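/- Setting. All spaces are real. Let $\tilde E$ and $E$ be separable Banach spaces and $H$ a separable Hilbert space. Let $A$ be the generator of a strongly continuous semigroup on $\tilde E$, and let $D(A)\subset E\subset\tilde E$ with continuous and dense embeddings, where $D(A)$ carries the graph norm. Let $F:E\to\tilde E$ be strongly measurable, let $G:E\to\mathscr L(H,\tilde E)$ be such that $x\mapsto G(x)h$ is strongly measurable for every $h\in H$, and let $F$ and $G$ be bounded on bounded subsets of $E$. Let $A^*$, with domain $D(A^*)\subset\tilde E^*$, be the adjoint of $A$. Let $\mathscr D$ be the set of all functions $f:E\to\mathbb R$ of the form $f(x)=\varphi(\langle x,x_1^*\rangle,\dots,\langle x,x_n^*\rangle)$ with $n\in\mathbb N$, $\varphi\in C^2(\mathbb R^n)$ and $x_1^*,\dots,x_n^*\in D(A^*)$. For such $f$, with all derivatives of $\varphi$ taken at $(\langle x,x_1^*\rangle,\dots,\langle x,x_n^*\rangle)$, put $$L_{[A,F,G]}f(x)=\sum_{k=1}^n\frac{\partial\varphi}{\partial u_k}\big[\langle x,A^*x_k^*\rangle+\langle F(x),x_k^*\rangle\big]+\frac12\sum_{k,l=1}^n\big[G(x)^*x_k^*,G(x)^*x_l^*\big]_H\,\frac{\partial^2\varphi}{\partial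 u_k\partial u_l}.$$ Let $\mathscr L_{[A,F,G]}$ be the operator $f\mapsto L_{[A,F,G]}f$ with domain $\mathscr D$. Let $C([0,\infty);E)$ carry the topology of uniform convergence on compact time intervals and its Borel $\sigma$-algebra $\mathscr B$. Write $\mathbf x(t)$ for the coordinate maps and $\mathscr B_t=\sigma(\mathbf x(s):s\le t)$. A probability measure $\mathbf P$ on $C([0,\infty);E)$ solves the local martingale problem for $\mathscr L_{[A,F,G]}$ if for every $f\in\mathscr D$ the process $$\mathbf M^f(t)=f(\mathbf x(t))-\int_0^tL_{[A,F,G]}f(\mathbf x(s))\,ds$$ is a local martingale under $\mathbf P$, that is, there are $(\mathscr B_t)$-stopping times $\tau_n\uparrow\infty$ $\mathbf P$-a.s. such that $\mathbf M^f(t\wedge\tau_n)-\mathbf M^f(0)$, $t\ge0$, is a martingale for every $n$. It solves the problem for $(\mathscr L_{[A,F,G]},\mu)$ if moreover $\mathbf x(0)$ has law $\mu$ under $\mathbf P$. The problem is well-posed if for every $x\in E$ there is exactly one solution $\mathbf P_x$ for $(\mathscr L_{[A,F,G]},\delta_x)$. It is completely well-posed if for every Borel probability measure $\mu$ on $E$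 there is exactly one solution for $(\mathscr L_{[A,F,G]},\mu)$, and $x\mapsto\mathbf P_x(B)$ is measurable for every $B\in\mathscr B$. A transition semigroup is a family $\mathbf T=(T(t))_{t\ge0}$ of operators $T(t)f(x)=\int_Ef(y)\,p_t(x,dy)$ on the bounded measurable functions $f:E\to\mathbb R$, where each $p_t$ is a Markovian kernel on $E$, such that $T(0)=I$ and $T(t+s)=T(t)T(s)$. A probability measure $\mathbf P$ on $C([0,\infty);E)$ is a strong Markov measure with transition semigroup $\mathbf T$ if for every bounded $(\mathscr B_t)$-stopping time $\tau$, every $s\ge0$ and every bounded measurable $f$, $\mathbf P$-a.s. $$\mathbb E[f(\mathbf x(\tau+s))\mid\mathscr B_\tau]=\mathbb E[f(\mathbf x(\tau+s))\mid\mathbf x(\tau)]=[T(s)f](\mathbf x(\tau)).$$ An $H$-cylindrical Wiener process with respect to a filtration $\mathbb F=(\mathscr F_t)_{t\ge0}$ on a probability space $(\Omega,\Sigma,\mathbb P)$ is a bounded linear map $W_H:L^2(0,\infty;H)\to L^2(\Omega)$ with the following properties: each $W_H(f)$ is centered Gaussian; $\mathbb E[W_H(f)W_H(g)]=[f,g]_{L^2(0,\infty;H)}$;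 and, with $W_H(t)h:=W_H(1_{(0,t]}\otimes h)$, the process $t\mapsto W_H(t)h$ is $\mathbb F$-adapted with $W_H(t)h-W_H(s)h$ independent of $\mathscr F_s$ for all $s\le t$ and $h\in H$. The integral $\int_0^t\Phi\,dW_H$ is the limit in probability of $\int_0^t\Phi_m\,dW_H$ for $H$-valued elementary processes $\Phi_m$ (finite sums of $1_{(a,b]}1_Bh$ with $B\in\mathscr F_a$, $h\in H$) with $\int_0^t\|\Phi_m-\Phi\|_H^2\,ds\to0$ in probability. A weak solution of equation $[A,F,G]$, that is, of $dX=(AX+F(X))\,dt+G(X)\,dW_H$, consists of a probability space with a filtration $\mathbb F$, an $H$-cylindrical Wiener process $W_H$ with respect to $\mathbb F$, and an $\mathbb F$-progressive $E$-valued process $X$ with continuous paths such that for all $x^*\in D(A^*)$ and $t\ge0$, almost surely, $$\langle X(t),x^*\rangle=\langle X(0),x^*\rangle+\int_0^t\langle X(s),A^*x^*\rangle\,ds+\int_0^t\langle F(X(s)),x^*\rangle\,ds+\int_0^tG(X(s))^*x^*\,dW_H(s).$$ Theorem. Suppose that the local martingale problem for $\mathscr L_{[A,F,G]}$ is well-posed.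 Then it is completely well-posed. Moreover, there is a transition semigroup $\mathbf T$ such that every solution of the local martingale problem for $\mathscr L_{[A,F,G]}$ is a strong Markov measure with transition semigroup $\mathbf T$, and the law on $C([0,\infty);E)$ of every weak solution of equation $[A,F,G]$ is a strong Markov measure with transition semigroup $\mathbf T$; that is, all weak solutions are strong Markov processes with the common transition semigroup $\mathbf T$. -/

import Mathlib

open MeasureTheory ProbabilityTheory Filter Topology
open scoped NNReal ENNReal

noncomputable section

namespace SVP

/-! ### Path space and its filtration -/

section PathSpace

/-- The path space `C([0,∞); E)` carries the Borel σ-algebra of the topology of uniform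
convergence on compact time intervals. -/
instance pathMeasurableSpace {E : Type*} [TopologicalSpace E] : MeasurableSpace C(ℝ≥0, E) :=
  borel _

instance pathBorelSpace {E : Type*} [TopologicalSpace E] : BorelSpace C(ℝ≥0, E) :=
  ⟨rfl⟩

/-- The filtration `𝓑_t = σ(x(s) : s ≤ t)` generated by the coordinate maps. -/
def pathFiltration (E : Type*) [TopologicalSpace E] [MeasurableSpace E] [BorelSpace E] :
    Filtration ℝ≥0 (pathMeasurableSpace (E := E)) where
  seq t := ⨆ s : Set.Iic t, MeasurableSpace.comap (fun x : C(ℝ≥0, E) => x s) inferInstance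
  mono' _ u htu := iSup_le fun s =>
    le_iSup (fun r : Set.Iic u =>
      MeasurableSpace.comap (fun x : C(ℝ≥0, E) => x r) inferInstance) ⟨s, s.2.trans htu⟩
  le' _ := iSup_le fun s =>
    (continuous_eval_const (F := C(ℝ≥0, E)) (s : ℝ≥0)).measurable.comap_le

end PathSpace

/-! ### Local martingale problems

An operator `𝓛` on functions on `E` is given by its graph, the set of all pairs `(f, 𝓛 f)`. -/

section MartingaleProblem

variable {E : Type*} [TopologicalSpace E] [MeasurableSpace E] [BorelSpace E]

/-- `M` is a local martingale: for some stopping times `τ_n ↑ ∞` (almost surely) all processes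
`M(t ∧ τ_n) - M(0)` are martingales. -/
def IsLocalMartingale {Ω : Type*} {mΩ : MeasurableSpace Ω} (M : ℝ≥0 → Ω → ℝ)
    (𝔽 : Filtration ℝ≥0 mΩ) (P : Measure Ω) : Prop :=
  ∃ τ : ℕ → Ω → WithTop ℝ≥0, IsLocalizingSequence 𝔽 τ P ∧
    ∀ n, Martingale (fun t ω => stoppedProcess M (τ n) t ω - M 0 ω) 𝔽 P

/-- For `g = 𝓛 f`, the process `M^f(t) = f(x(t)) - ∫₀ᵗ (𝓛 f)(x(s)) ds` on path space. -/
def martingaleProcess (f g : E → ℝ) (t : ℝ≥0) (x : C(ℝ≥0, E)) : ℝ :=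
  f (x t) - ∫ s in (0 : ℝ)..t, g (x s.toNNReal)

/-- The probability measure `P` on path space solves the local martingale problem for `𝓛`. -/
def SolvesLMP (L : Set ((E → ℝ) × (E → ℝ))) (P : Measure C(ℝ≥0, E)) : Prop :=
  IsProbabilityMeasure P ∧
    ∀ p ∈ L, IsLocalMartingale (martingaleProcess p.1 p.2) (pathFiltration E) P

/-- `P` solves the local martingale problem for `(𝓛, μ)`. -/
def SolvesLMPFrom (L : Set ((E → ℝ) × (E → ℝ))) (μ : Measure E) (P : Measure C(ℝ≥0, E)) :
    Prop :=
  SolvesLMP L P ∧ P.map (fun x => x 0) = μ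

/-- Well-posedness: a unique solution for every degenerate initial distribution. -/
def WellPosed (L : Set ((E → ℝ) × (E → ℝ))) : Prop :=
  ∀ x : E, ∃! P : Measure C(ℝ≥0, E), SolvesLMPFrom L (Measure.dirac x) P

/-- Complete well-posedness: a unique solution for every initial distribution, and the solution
`P_x` started in `δ_x` is a measurable function of `x`. -/
def CompletelyWellPosed (L : Set ((E → ℝ) × (E → ℝ))) : Prop :=
  (∀ μ : Measure E, IsProbabilityMeasure μ →
    ∃! P : Measure C(ℝ≥0, E), SolvesLMPFrom L μ P) ∧
  ∃ Q : E → Measure C(ℝ≥0, E), (∀ x, SolvesLMPFrom L (Measure.dirac x) (Q x)) ∧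
    ∀ B : Set C(ℝ≥0, E), MeasurableSet B → Measurable fun x => Q x B

end MartingaleProblem

/-! ### Transition semigroups and strong Markov measures -/

section Markov

/-- A transition semigroup: Markovian kernels `p_t` such that the operators
`T(t) f(x) = ∫ f(y) p_t(x, dy)` on bounded measurable functions satisfy `T(0) = I` and
`T(t + s) = T(t) T(s)`. -/
structure TransitionSemigroup (E : Type*) [MeasurableSpace E] where
  kernel : ℝ≥0 → Kernel E E
  markov : ∀ t, IsMarkovKernel (kernel t)
  zero : ∀ f : E → ℝ, Measurable f → (∃ C, ∀ x, |f x| ≤ C) →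
    ∀ x, ∫ y, f y ∂(kernel 0 x) = f x
  add : ∀ f : E → ℝ, Measurable f → (∃ C, ∀ x, |f x| ≤ C) →
    ∀ t s x, ∫ y, f y ∂(kernel (t + s) x) = ∫ z, (∫ y, f y ∂(kernel s z)) ∂(kernel t x)

/-- The operator `T(t)`. -/
def TransitionSemigroup.op {E : Type*} [MeasurableSpace E] (T : TransitionSemigroup E)
    (t : ℝ≥0) (f : E → ℝ) (x : E) : ℝ :=
  ∫ y, f y ∂(T.kernel t x)

variable {E : Type*} [TopologicalSpace E] [MeasurableSpace E] [BorelSpace E]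

/-- `P` is a strong Markov measure with transition semigroup `T`: for all bounded stopping times
`τ` of the coordinate filtration, `s ≥ 0` and bounded measurable `f`, almost surely
`E[f(x(τ+s)) | 𝓑_τ] = E[f(x(τ+s)) | x(τ)] = (T(s) f)(x(τ))`. -/
def IsStrongMarkovMeasure (T : TransitionSemigroup E) (P : Measure C(ℝ≥0, E)) : Prop :=
  IsProbabilityMeasure P ∧
  ∀ (τ : C(ℝ≥0, E) → ℝ≥0)
    (hτ : IsStoppingTime (pathFiltration E) fun x => (τ x : WithTop ℝ≥0)),
    (∃ N : ℝ≥0, ∀ x, τ x ≤ N) →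
    ∀ (s : ℝ≥0) (f : E → ℝ), Measurable f → (∃ C, ∀ y, |f y| ≤ C) →
      P[fun x => f (x (τ x + s)) | hτ.measurableSpace] =ᵐ[P]
        P[fun x => f (x (τ x + s)) | MeasurableSpace.comap (fun x => x (τ x)) inferInstance] ∧
      P[fun x => f (x (τ x + s)) | hτ.measurableSpace] =ᵐ[P]
        fun x => T.op s f (x (τ x))

end Markov

/-! ### The coefficients -/

section Coefficients

/-- A strongly continuous semigroup of bounded linear operators. -/
structure IsC0Semigroup {V : Type*} [NormedAddCommGroup V] [NormedSpace ℝ V]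
    (S : ℝ≥0 → V →L[ℝ] V) : Prop where
  zero : S 0 = ContinuousLinearMap.id ℝ V
  add : ∀ s t, S (s + t) = (S s).comp (S t)
  continuous : ∀ v, Continuous fun t => S t v

/-- `A`, with its domain, is the generator of `S`. -/
def IsGenerator {V : Type*} [NormedAddCommGroup V] [NormedSpace ℝ V]
    (S : ℝ≥0 → V →L[ℝ] V) (A : V →ₗ.[ℝ] V) : Prop :=
  ∀ v w : V, (v, w) ∈ A.graph ↔
    Tendsto (fun t : ℝ≥0 => (t : ℝ)⁻¹ • (S t v - v)) (𝓝[>] 0) (𝓝 w)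

/-- `v' ∈ D(A*)` and `A* v' = w'` (for densely defined `A` there is at most one such `w'`). -/
def IsAdjointValue {V : Type*} [NormedAddCommGroup V] [NormedSpace ℝ V]
    (A : V →ₗ.[ℝ] V) (v' w' : V →L[ℝ] ℝ) : Prop :=
  ∀ v : A.domain, v' (A v) = w' v

variable {E V H : Type*}
  [NormedAddCommGroup E] [NormedSpace ℝ E]
  [NormedAddCommGroup V] [NormedSpace ℝ V]
  [NormedAddCommGroup H] [InnerProductSpace ℝ H]

/-- The standing assumptions: `A` generates a strongly continuous semigroup on `V`, the embeddings
`D(A) ⊆ E ⊆ V` (the second one is `j`, and `D(A)` has the graph norm) are continuous and dense, `F`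
is strongly measurable, `G` is `H`-strongly measurable, and both are bounded on bounded sets. -/
structure StandingAssumptions [MeasurableSpace E] (j : E →L[ℝ] V) (A : V →ₗ.[ℝ] V) (F : E → V)
    (G : E → H →L[ℝ] V) : Prop where
  generator : ∃ S : ℝ≥0 → V →L[ℝ] V, IsC0Semigroup S ∧ IsGenerator S A
  embedding_injective : Function.Injective j
  embedding_dense : DenseRange j
  domain_subset : ∀ v ∈ A.domain, ∃ x : E, j x = v
  domain_continuous : ∃ C : ℝ, ∀ (x : E) (hx : j x ∈ A.domain),
    ‖x‖ ≤ C * (‖j x‖ + ‖A ⟨j x, hx⟩‖)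
  domain_dense : Dense {x : E | j x ∈ A.domain}
  F_measurable : StronglyMeasurable F
  F_bounded : ∀ r : ℝ, ∃ C : ℝ, ∀ x, ‖x‖ ≤ r → ‖F x‖ ≤ C
  G_measurable : ∀ h : H, StronglyMeasurable fun x => G x h
  G_bounded : ∀ r : ℝ, ∃ C : ℝ, ∀ x, ‖x‖ ≤ r → ‖G x‖ ≤ C

/-- The vector `B* v' ∈ H` for `B : H → V` and `v' ∈ V*`, where `H* = H` by Riesz. -/
def hilbertAdjoint [CompleteSpace H] (B : H →L[ℝ] V) (v' : V →L[ℝ] ℝ) : H :=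
  (InnerProductSpace.toDual ℝ H).symm (v'.comp B)

/-- `L_{[A,F,G]} f (x)` for `f = φ(⟨·, v'_1⟩, …, ⟨·, v'_n⟩)`, where `w'_k = A* v'_k`. -/
def generatorValue [CompleteSpace H] (j : E →L[ℝ] V) (F : E → V) (G : E → H →L[ℝ] V) {n : ℕ}
    (φ : (Fin n → ℝ) → ℝ) (v' w' : Fin n → V →L[ℝ] ℝ) (x : E) : ℝ :=
  (∑ k, fderiv ℝ φ (fun i => v' i (j x)) (Pi.single k 1) * (w' k (j x) + v' k (F x))) +
  (1 / 2) * ∑ k, ∑ l,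
    inner ℝ (hilbertAdjoint (G x) (v' k)) (hilbertAdjoint (G x) (v' l)) *
      fderiv ℝ (fderiv ℝ φ) (fun i => v' i (j x)) (Pi.single k 1) (Pi.single l 1)

/-- The graph of the operator `𝓛_{[A,F,G]}`: all pairs `(f, L_{[A,F,G]} f)` with
`f = φ(⟨·, v'_1⟩, …, ⟨·, v'_n⟩)`, `φ ∈ C²(ℝⁿ)` and `v'_1, …, v'_n ∈ D(A*)`. -/
def operatorGraph [CompleteSpace H] (j : E →L[ℝ] V) (A : V →ₗ.[ℝ] V) (F : E → V)
    (G : E → H →L[ℝ] V) : Set ((E → ℝ) × (E → ℝ)) :=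
  {p | ∃ (n : ℕ) (φ : (Fin n → ℝ) → ℝ) (v' w' : Fin n → V →L[ℝ] ℝ),
    ContDiff ℝ 2 φ ∧ (∀ k, IsAdjointValue A (v' k) (w' k)) ∧
    p = (fun x => φ fun i => v' i (j x), generatorValue j F G φ v' w')}

end Coefficients

/-! ### Cylindrical Wiener processes and stochastic integrals -/

section StochasticIntegral

variable {H : Type*} [NormedAddCommGroup H] [InnerProductSpace ℝ H]
variable {Ω : Type*} {mΩ : MeasurableSpace Ω} {P : Measure Ω}

/-- The space `L²(0, ∞; H)`. -/
abbrev TimeL2 (H : Type*) [NormedAddCommGroup H] [InnerProductSpace ℝ H] : Type _ :=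
  Lp H 2 ((volume : Measure ℝ).restrict (Set.Ioi 0))

/-- The function `1_{(0,t]} ⊗ h` in `L²(0, ∞; H)`. -/
def timeIndicator (t : ℝ≥0) (h : H) : TimeL2 H :=
  indicatorConstLp 2 (μ := (volume : Measure ℝ).restrict (Set.Ioi 0))
    (s := Set.Ioc (0 : ℝ) t) measurableSet_Ioc
    (((Measure.restrict_apply_le _ _).trans_lt measure_Ioc_lt_top).ne) h

/-- `W_H(t) h = W_H(1_{(0,t]} ⊗ h)`. -/
def wienerAt (W : TimeL2 H →L[ℝ] Lp ℝ 2 P) (t : ℝ≥0) (h : H) : Lp ℝ 2 P :=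
  W (timeIndicator t h)

/-- `W` is an `H`-cylindrical Wiener process with respect to the filtration `𝔽`. -/
structure IsCylindricalWiener (𝔽 : Filtration ℝ≥0 mΩ) (W : TimeL2 H →L[ℝ] Lp ℝ 2 P) : Prop where
  gaussian : ∀ f, P.map (W f) = gaussianReal 0 (‖f‖₊ ^ 2)
  covariance : ∀ f g, ∫ ω, W f ω * W g ω ∂P = inner ℝ f g
  adapted : ∀ t h, AEStronglyMeasurable[𝔽 t] (wienerAt W t h) P
  independent : ∀ (s t : ℝ≥0) (h : H), s ≤ t →
    Indep (𝔽 s)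
      (MeasurableSpace.comap (fun ω => wienerAt W t h ω - wienerAt W s h ω) inferInstance) P

/-- An `H`-valued elementary process `∑ᵢ 1_{(aᵢ, bᵢ]} 1_{Aᵢ} hᵢ` with `Aᵢ ∈ 𝓕_{aᵢ}`. -/
structure ElementaryProcess (H : Type*) (𝔽 : Filtration ℝ≥0 mΩ) where
  n : ℕ
  a : Fin n → ℝ≥0
  b : Fin n → ℝ≥0
  le : ∀ i, a i ≤ b i
  A : Fin n → Set Ω
  measurable : ∀ i, MeasurableSet[𝔽 (a i)] (A i)
  h : Fin n → H

/-- The value of an elementary process at time `s`. -/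
def ElementaryProcess.val {𝔽 : Filtration ℝ≥0 mΩ} (Φ : ElementaryProcess H 𝔽) (s : ℝ≥0) (ω : Ω) :
    H :=
  ∑ i, (Set.Ioc (Φ.a i) (Φ.b i)).indicator
    (fun _ => (Φ.A i).indicator (fun _ => Φ.h i) ω) s

/-- The stochastic integral `∫₀ᵗ Φ dW_H` of an elementary process. -/
def ElementaryProcess.integral {𝔽 : Filtration ℝ≥0 mΩ} (Φ : ElementaryProcess H 𝔽)
    (W : TimeL2 H →L[ℝ] Lp ℝ 2 P) (t : ℝ≥0) (ω : Ω) : ℝ :=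
  ∑ i, (Φ.A i).indicator
    (fun ω => wienerAt W (min (Φ.b i) t) (Φ.h i) ω - wienerAt W (min (Φ.a i) t) (Φ.h i) ω) ω

/-- `ξ` is (a version of) the stochastic integral `∫₀ᵗ Φ dW_H`: there are elementary processes `Φ_m`
with `∫₀ᵗ ‖Φ_m - Φ‖² ds → 0` and `∫₀ᵗ Φ_m dW_H → ξ` in probability. -/
def IsStochasticIntegral (𝔽 : Filtration ℝ≥0 mΩ) (W : TimeL2 H →L[ℝ] Lp ℝ 2 P)
    (Φ : ℝ≥0 → Ω → H) (t : ℝ≥0) (ξ : Ω → ℝ) : Prop :=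
  ∃ Φs : ℕ → ElementaryProcess H 𝔽,
    (∀ ε : ℝ≥0∞, 0 < ε → Tendsto (fun m => P {ω | ε ≤
      ∫⁻ s in Set.Ioc (0 : ℝ) t, ‖(Φs m).val s.toNNReal ω - Φ s.toNNReal ω‖ₑ ^ 2})
      atTop (𝓝 0)) ∧
    TendstoInMeasure P (fun m => (Φs m).integral W t) atTop ξ

variable {E V : Type*} [NormedAddCommGroup E] [NormedSpace ℝ E]
  [NormedAddCommGroup V] [NormedSpace ℝ V]

/-- `(Ω, P, 𝔽, W, X)` is a weak solution of `dX = (A X + F(X)) dt + G(X) dW_H`: the process `X` has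
continuous paths in `E`, is `𝔽`-progressive, and for all `v' ∈ D(A*)` and `t ≥ 0`, almost surely,
`⟨X(t), v'⟩ = ⟨X(0), v'⟩ + ∫₀ᵗ ⟨X(s), A* v'⟩ ds + ∫₀ᵗ ⟨F(X(s)), v'⟩ ds + ∫₀ᵗ G(X(s))* v' dW_H(s)`. -/
structure IsWeakSolution [CompleteSpace H] (j : E →L[ℝ] V) (A : V →ₗ.[ℝ] V) (F : E → V)
    (G : E → H →L[ℝ] V) (P : Measure Ω) (𝔽 : Filtration ℝ≥0 mΩ)
    (W : TimeL2 H →L[ℝ] Lp ℝ 2 P) (X : Ω → C(ℝ≥0, E)) : Prop where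
  probability : IsProbabilityMeasure P
  wiener : IsCylindricalWiener 𝔽 W
  progressive : IsStronglyProgressive 𝔽 fun t ω => X ω t
  equation : ∀ v' w' : V →L[ℝ] ℝ, IsAdjointValue A v' w' → ∀ t : ℝ≥0,
    ∃ I : Ω → ℝ,
      IsStochasticIntegral 𝔽 W (fun s ω => hilbertAdjoint (G (X ω s)) v') t I ∧
      ∀ᵐ ω ∂P, v' (j (X ω t)) = v' (j (X ω 0))
        + (∫ s in (0 : ℝ)..t, w' (j (X ω s.toNNReal)))
        + (∫ s in (0 : ℝ)..t, v' (F (X ω s.toNNReal)))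
        + I ω

end StochasticIntegral

end SVP

end

open MeasureTheory ProbabilityTheory Filter Topology
open scoped NNReal ENNReal

set_option linter.unusedSectionVars false

noncomputable section

namespace SVP


/-! ### Stopped and shifted paths -/

section Paths

variable {E : Type*} [TopologicalSpace E]

/-! The argument follows Stroock and Varadhan. Let `P` solve the martingale problem and let `τ` be a
bounded stopping time. Under the regular conditional law of the shifted path given the past of `τ`,
the martingale conditions still hold and the path starts at x(τ). Well-posedness therefore
identifies this conditional law with the solution started at x(τ). This is `condExp_shift`. For
general `τ` it is the strong Markov property; for constant times it gives the semigroup law; at time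
0 it gives uniqueness for every initial law μ. Existence for μ is obtained by mixing the solutions Q
x with weight μ, because the conditions are linear in `P`.

Two difficulties remain. The first is that the conditional law is defined only up to null sets, so
the martingale problem must be equivalent to countably many equations ∫ ξ dP = 0 with bounded ξ
(`exists_countable_tests`). Countably many times and events suffice by continuity and a monotone
class argument. Countably many functions f are harder. By Itô's formula in mean (`ito_formula`,
`solvesLMP_of_quadraticVariation`), the functionals ⟨x, x*⟩ and their squares already imply the
conditions for all of 𝒟. The graph of A* has a countable subset that is sequentially weak-star dense
in bounded parts, and linear conditions pass to such limits. Squares do not pass directly, since ‖G*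
x*‖² is not weak-star continuous. If the square conditions are also imposed on differences of
members of the countable set, however, then G* is forced to converge in mean square along the
sequence (`tendsto_cov_sub`).

With countably many equations, the graph of x ↦ Q x is Borel once probability measures are coded by
their distribution functions at rational points. It projects injectively onto `E`, so Q is
measurable by the Lusin–Souslin theorem (`measurable_of_unique`).

The second difficulty is to show that the law of a weak solution solves the martingale problem
(`IsWeakSolution.solvesLMP_map`). The martingale part of ⟨X, x*⟩ is, at each fixed time, a limit in
probability of elementary integrals. Truncation of the energy and Lenglart's inequality turn this
into mean-square convergence up to the exit from a ball. This yields the first two conditional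
moments of the stopped increments (`stopped_integral_isometry`), which is all that the mean Itô
formula requires. -/

/-- The path stopped at time `t`. -/
def stopAt (t : ℝ≥0) (x : C(ℝ≥0, E)) : C(ℝ≥0, E) :=
  x.comp ⟨fun s => min s t, by fun_prop⟩

/-- The path seen from time `t` on. -/
def shift (t : ℝ≥0) (x : C(ℝ≥0, E)) : C(ℝ≥0, E) :=
  x.comp ⟨fun s => t + s, by fun_prop⟩

@[simp] lemma stopAt_apply (t s : ℝ≥0) (x : C(ℝ≥0, E)) : stopAt t x s = x (min s t) := rfl

@[simp] lemma shift_apply (t s : ℝ≥0) (x : C(ℝ≥0, E)) : shift t x s = x (t + s) := rfl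

lemma stopAt_stopAt (t s : ℝ≥0) (x : C(ℝ≥0, E)) : stopAt s (stopAt t x) = stopAt (min s t) x := by
  ext u; simp [min_assoc]

lemma shift_zero (x : C(ℝ≥0, E)) : shift 0 x = x := by ext; simp

lemma continuous_path_eval : Continuous fun p : ℝ≥0 × C(ℝ≥0, E) => p.2 p.1 := by fun_prop

lemma continuous_shift : Continuous fun p : ℝ≥0 × C(ℝ≥0, E) => shift p.1 p.2 := by
  refine ContinuousMap.continuous_of_continuous_uncurry _ ?_
  have : Continuous fun q : (ℝ≥0 × C(ℝ≥0, E)) × ℝ≥0 => q.1.2 (q.1.1 + q.2) := by fun_prop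
  exact this

end Paths

/-! ### The Borel σ-algebra of path space -/

section PathMeasurability

variable {E : Type*} [NormedAddCommGroup E] [CompleteSpace E]
  [TopologicalSpace.SeparableSpace E] [MeasurableSpace E] [BorelSpace E]

lemma path_ext_dense {x y : C(ℝ≥0, E)} (h : ∀ n, x (TopologicalSpace.denseSeq ℝ≥0 n) =
    y (TopologicalSpace.denseSeq ℝ≥0 n)) : x = y :=
  DFunLike.coe_injective ((TopologicalSpace.denseRange_denseSeq ℝ≥0).equalizer
    x.continuous y.continuous (funext h))

/-- Path space is Polish, and a continuous injection of a Polish space is a measurable embedding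
(Lusin–Souslin). Hence the Borel σ-algebra is generated by the coordinates at countably many times.
-/
lemma measurableEmbedding_denseEval :
    MeasurableEmbedding fun (x : C(ℝ≥0, E)) (n : ℕ) => x (TopologicalSpace.denseSeq ℝ≥0 n) := by
  have : PolishSpace E := inferInstance
  refine Continuous.measurableEmbedding (by fun_prop) ?_
  intro x y h
  exact path_ext_dense fun q => congrFun h q

lemma measurable_path_iff {Ω : Type*} {mΩ : MeasurableSpace Ω} {X : Ω → C(ℝ≥0, E)} :
    Measurable X ↔ ∀ t, Measurable fun ω => X ω t := by
  refine ⟨fun h t => (continuous_eval_const t).measurable.comp h, fun h => ?_⟩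
  rw [← measurableEmbedding_denseEval.measurable_comp_iff]
  exact measurable_pi_lambda _ fun q => h _

lemma measurable_path_eval : Measurable fun p : ℝ≥0 × C(ℝ≥0, E) => p.2 p.1 :=
  continuous_path_eval.measurable

lemma measurable_shift : Measurable fun p : ℝ≥0 × C(ℝ≥0, E) => shift p.1 p.2 :=
  continuous_shift.measurable

lemma measurable_eval_pathFiltration {s t : ℝ≥0} (h : s ≤ t) :
    Measurable[pathFiltration E t] fun x : C(ℝ≥0, E) => x s := by
  rw [measurable_iff_comap_le]
  exact le_iSup (fun r : Set.Iic t =>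
      MeasurableSpace.comap (fun x : C(ℝ≥0, E) => x r) inferInstance) ⟨s, h⟩

lemma measurable_stopAt_pathFiltration (t : ℝ≥0) :
    Measurable[pathFiltration E t] (stopAt t : C(ℝ≥0, E) → C(ℝ≥0, E)) := by
  refine (@measurable_path_iff E _ _ _ _ _ _ (pathFiltration E t) _).2 fun s => ?_
  exact measurable_eval_pathFiltration (min_le_right s t)

lemma pathFiltration_le_comap (t : ℝ≥0) :
    pathFiltration E t ≤ MeasurableSpace.comap (stopAt t) pathMeasurableSpace := by
  refine iSup_le fun s => ?_
  rintro _ ⟨B, hB, rfl⟩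
  refine ⟨(fun x : C(ℝ≥0, E) => x s) ⁻¹' B, (continuous_eval_const (s : ℝ≥0)).measurable hB, ?_⟩
  ext x
  have : min (s : ℝ≥0) t = s := min_eq_left s.2
  simp [this]

/-- This is Galmarino's principle. Adaptedness to 𝓑_t becomes invariance under `stopAt t`, and it is
checked in that form throughout. -/
lemma pathFiltration_eq_comap (t : ℝ≥0) :
    pathFiltration E t = MeasurableSpace.comap (stopAt t) pathMeasurableSpace :=
  le_antisymm (pathFiltration_le_comap t) (measurable_stopAt_pathFiltration t).comap_le

/-- A set belongs to `𝓑_t` iff it is Borel and depends on the path up to time `t` only. -/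
lemma measurableSet_pathFiltration_iff {t : ℝ≥0} {B : Set C(ℝ≥0, E)} :
    MeasurableSet[pathFiltration E t] B ↔
      MeasurableSet B ∧ ∀ x, stopAt t x ∈ B ↔ x ∈ B := by
  constructor
  · intro h
    refine ⟨(pathFiltration E).le t B h, fun x => ?_⟩
    obtain ⟨B', -, rfl⟩ := pathFiltration_le_comap t B h
    simp [stopAt_stopAt]
  · rintro ⟨h, hB⟩
    have : B = stopAt t ⁻¹' B := by ext x; exact (hB x).symm
    rw [this]
    exact measurable_stopAt_pathFiltration t h

lemma measurable_pathFiltration {β : Type*} [MeasurableSpace β] {t : ℝ≥0} {Z : C(ℝ≥0, E) → β}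
    (hZ : Measurable Z) (h : ∀ x, Z (stopAt t x) = Z x) : Measurable[pathFiltration E t] Z := by
  have : Z = Z ∘ stopAt t := funext fun x => (h x).symm
  rw [this]
  exact hZ.comp (measurable_stopAt_pathFiltration t)

end PathMeasurability

/-! ### Exit times from balls -/

section ExitTime

variable {E : Type*} [NormedAddCommGroup E]

/-- The maximum of `‖x s‖` over `s ≤ t`. -/
def runNorm (t : ℝ≥0) (x : C(ℝ≥0, E)) : ℝ :=
  -- Rescaling [0, t] to the unit interval turns the maximum into a sup norm on a fixed compact
  -- space, so it is jointly continuous in `t` and `x`.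
  ‖x.comp (⟨fun θ : unitInterval => t * Real.toNNReal θ, by fun_prop⟩ : C(unitInterval, ℝ≥0))‖

lemma runNorm_lt_iff {t : ℝ≥0} {x : C(ℝ≥0, E)} {r : ℝ} :
    runNorm t x < r ↔ ∀ u ≤ t, ‖x u‖ < r := by
  rw [runNorm, ContinuousMap.norm_lt_iff_of_nonempty]
  constructor
  · intro h u hu
    rcases eq_or_ne t 0 with rfl | ht
    · have := h 0
      simp at this
      rwa [nonpos_iff_eq_zero.1 hu]
    · have := h ⟨(u / t : ℝ≥0), by positivity, by
        exact_mod_cast div_le_one_of_le₀ hu (zero_le)⟩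
      simp only [ContinuousMap.comp_apply, ContinuousMap.coe_mk, Real.toNNReal_coe] at this
      rwa [mul_div_cancel₀ _ ht] at this
  · intro h θ
    refine h _ (mul_le_of_le_one_right (zero_le) ?_)
    simpa using θ.2.2

lemma continuous_runNorm : Continuous fun p : ℝ≥0 × C(ℝ≥0, E) => runNorm p.1 p.2 := by
  refine continuous_norm.comp (ContinuousMap.continuous_of_continuous_uncurry
    (fun p : ℝ≥0 × C(ℝ≥0, E) => p.2.comp
      (⟨fun θ : unitInterval => p.1 * Real.toNNReal θ, by fun_prop⟩ : C(unitInterval, ℝ≥0))) ?_)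
  have : Continuous fun q : (ℝ≥0 × C(ℝ≥0, E)) × unitInterval =>
      q.1.2 (q.1.1 * Real.toNNReal q.2) := by fun_prop
  exact this

lemma runNorm_congr {t : ℝ≥0} {x y : C(ℝ≥0, E)} (h : ∀ u ≤ t, x u = y u) :
    runNorm t x = runNorm t y := by
  refine le_antisymm (le_of_forall_gt fun r hr => ?_) (le_of_forall_gt fun r hr => ?_) <;>
  rw [runNorm_lt_iff] at hr ⊢ <;> intro u hu
  · rw [h u hu]; exact hr u hu
  · rw [← h u hu]; exact hr u hu

lemma runNorm_mono {s t : ℝ≥0} (h : s ≤ t) (x : C(ℝ≥0, E)) : runNorm s x ≤ runNorm t x := by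
  refine le_of_forall_gt fun r hr => ?_
  rw [runNorm_lt_iff] at hr ⊢
  exact fun u hu => hr u (hu.trans h)

/-- The minimum of `t` and of the first time at which `‖x‖` reaches `r`. -/
def exitMin (r : ℝ) (t : ℝ≥0) (x : C(ℝ≥0, E)) : ℝ≥0 :=
  -- Inserting `t` keeps this closed set nonempty, so the infimum is attained and the default value
  -- `sInf ∅ = 0` never enters.
  sInf (insert t {u | r ≤ ‖x u‖})

lemma exitMin_le (r : ℝ) (t : ℝ≥0) (x : C(ℝ≥0, E)) : exitMin r t x ≤ t :=
  csInf_le (OrderBot.bddBelow _) (Set.mem_insert _ _)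

lemma exitMin_mem (r : ℝ) (t : ℝ≥0) (x : C(ℝ≥0, E)) :
    exitMin r t x = t ∨ r ≤ ‖x (exitMin r t x)‖ := by
  have hc : IsClosed (insert t {u | r ≤ ‖x u‖}) :=
    isClosed_singleton.union
      (isClosed_le continuous_const (continuous_norm.comp x.continuous))
  exact hc.csInf_mem (Set.insert_nonempty _ _) (OrderBot.bddBelow _)

/-- The right-hand side involves the path up to `u` only. Measurability, adaptedness and all
comparisons of exit times rest on this equivalence. -/
lemma lt_exitMin_iff {r : ℝ} {t u : ℝ≥0} {x : C(ℝ≥0, E)} :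
    u < exitMin r t x ↔ u < t ∧ runNorm u x < r := by
  rw [runNorm_lt_iff]
  constructor
  · intro h
    refine ⟨h.trans_le (exitMin_le r t x), fun v hv => ?_⟩
    by_contra! hr
    exact absurd (csInf_le (OrderBot.bddBelow _) (Set.mem_insert_of_mem t hr))
      (not_le.2 (hv.trans_lt h))
  · rintro ⟨h1, h2⟩
    rcases exitMin_mem r t x with h | h
    · rwa [h]
    · by_contra! hle
      exact absurd (h2 _ hle) (not_lt.2 h)

lemma exitMin_eq_of_runNorm_lt {r : ℝ} {t : ℝ≥0} {x : C(ℝ≥0, E)} (h : runNorm t x < r) :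
    exitMin r t x = t := by
  refine le_antisymm (exitMin_le r t x) (le_of_forall_lt fun u hu => ?_)
  exact lt_exitMin_iff.2 ⟨hu, (runNorm_mono hu.le x).trans_lt h⟩

lemma exitMin_min (r : ℝ) (s t : ℝ≥0) (x : C(ℝ≥0, E)) :
    exitMin r (min s t) x = min s (exitMin r t x) := by
  refine eq_of_forall_lt_iff fun u => ?_
  simp only [lt_exitMin_iff, lt_min_iff, and_assoc]

lemma exitMin_of_le {r : ℝ} {s t : ℝ≥0} (h : s ≤ t) (x : C(ℝ≥0, E)) :
    exitMin r s x = min s (exitMin r t x) := by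
  rw [← exitMin_min, min_eq_left h]

lemma exitMin_mono {r : ℝ} {s t : ℝ≥0} (h : s ≤ t) (x : C(ℝ≥0, E)) :
    exitMin r s x ≤ exitMin r t x := by
  rw [exitMin_of_le h]; exact min_le_right _ _

lemma exitMin_congr {r : ℝ} {t : ℝ≥0} {x y : C(ℝ≥0, E)} (h : ∀ u ≤ t, x u = y u) :
    exitMin r t x = exitMin r t y := by
  refine eq_of_forall_lt_iff fun u => ?_
  rw [lt_exitMin_iff, lt_exitMin_iff]
  refine and_congr_right fun hu => ?_
  rw [runNorm_congr fun v hv => h v (hv.trans hu.le)]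

lemma exitMin_eq_zero {r : ℝ} (t : ℝ≥0) {x : C(ℝ≥0, E)} (h : r ≤ ‖x 0‖) :
    exitMin r t x = 0 :=
  nonpos_iff_eq_zero.1 (csInf_le (OrderBot.bddBelow _) (Set.mem_insert_of_mem t h))

/-- Strictly before the exit the norm is below `r`, and continuity extends the weak bound to the
exit time itself. The hypothesis at time 0 excludes paths that start outside, whose exit time is 0.
-/
lemma norm_le_of_le_exitMin {r : ℝ} {t u : ℝ≥0} {x : C(ℝ≥0, E)} (h0 : ‖x 0‖ < r)
    (hu : u ≤ exitMin r t x) : ‖x u‖ ≤ r := by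
  rcases eq_or_ne u 0 with rfl | hu0
  · exact h0.le
  have hcl : u ∈ closure (Set.Iio u) := by
    rw [closure_Iio' ⟨0, pos_iff_ne_zero.2 hu0⟩]; exact Set.mem_Iic.2 le_rfl
  have : closure (Set.Iio u) ⊆ {v | ‖x v‖ ≤ r} := by
    refine closure_minimal (fun v hv => ?_) (isClosed_le (by fun_prop) continuous_const)
    exact (runNorm_lt_iff.1 (lt_exitMin_iff.1 (lt_of_lt_of_le hv hu)).2 v le_rfl).le
  exact this hcl

lemma norm_exitMin_le {r : ℝ} {x : C(ℝ≥0, E)} (h0 : ‖x 0‖ < r) (t : ℝ≥0) :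
    ‖x (exitMin r t x)‖ ≤ r :=
  norm_le_of_le_exitMin h0 le_rfl

/-- As a function of `t` this is the minimum of `t` and a fixed time, hence 1-Lipschitz. -/
lemma continuous_exitMin (r : ℝ) (x : C(ℝ≥0, E)) : Continuous fun t => exitMin r t x := by
  have : LipschitzWith 1 fun t => exitMin r t x := by
    refine LipschitzWith.of_dist_le_mul fun s t => ?_
    rw [NNReal.coe_one, one_mul]
    wlog h : s ≤ t generalizing s t
    · rw [dist_comm, dist_comm s]; exact this t s (le_of_not_ge h)
    have h1 := exitMin_mono (r := r) h x
    have h2 : exitMin r t x ≤ exitMin r s x + (t - s) := by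
      rw [exitMin_of_le h x]
      rcases le_total s (exitMin r t x) with h' | h'
      · rw [min_eq_left h', add_tsub_cancel_of_le h]; exact exitMin_le r t x
      · rw [min_eq_right h']; exact le_self_add
    rw [dist_comm, dist_comm s, NNReal.dist_eq, NNReal.dist_eq, abs_of_nonneg, abs_of_nonneg]
    · have := NNReal.coe_le_coe.2 h2
      rw [NNReal.coe_add, NNReal.coe_sub h] at this
      linarith
    · exact sub_nonneg.2 (NNReal.coe_le_coe.2 h)
    · exact sub_nonneg.2 (NNReal.coe_le_coe.2 h1)
  exact this.continuous

variable [CompleteSpace E] [TopologicalSpace.SeparableSpace E] [MeasurableSpace E] [BorelSpace E]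

lemma measurable_exitMin (r : ℝ) :
    Measurable fun p : ℝ≥0 × C(ℝ≥0, E) => exitMin r p.1 p.2 := by
  refine measurable_of_Ioi fun u => ?_
  have : (fun p : ℝ≥0 × C(ℝ≥0, E) => exitMin r p.1 p.2) ⁻¹' Set.Ioi u =
      {p | u < p.1} ∩ {p | runNorm u p.2 < r} := by
    ext p; simp [lt_exitMin_iff]
  rw [this]
  refine (measurableSet_lt measurable_const measurable_fst).inter
    (measurableSet_lt ?_ measurable_const)
  exact (continuous_runNorm.comp (continuous_const.prodMk continuous_id)).measurable.comp
    measurable_snd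

end ExitTime


/-! ### Optional stopping for continuous martingales -/

section OptionalStopping

/-- The smallest multiple of `1/(n+1)` above `ρ`, truncated at `T`. -/
def gridCeil (T : ℝ≥0) (n : ℕ) (ρ : ℝ≥0) : ℝ≥0 :=
  min T (⌈ρ * (n + 1)⌉₊ / (n + 1))

lemma le_gridCeil {T ρ : ℝ≥0} (h : ρ ≤ T) (n : ℕ) : ρ ≤ gridCeil T n ρ := by
  refine le_min h ?_
  rw [le_div_iff₀ (by positivity)]
  exact Nat.le_ceil _

lemma gridCeil_le (T : ℝ≥0) (n : ℕ) (ρ : ℝ≥0) : gridCeil T n ρ ≤ T := min_le_left _ _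

lemma gridCeil_le_add (T : ℝ≥0) (n : ℕ) (ρ : ℝ≥0) : gridCeil T n ρ ≤ ρ + 1 / (n + 1) := by
  refine (min_le_right _ _).trans ?_
  rw [div_le_iff₀ (by positivity), add_mul, one_div, inv_mul_cancel₀ (by positivity)]
  exact (Nat.ceil_lt_add_one (zero_le)).le

lemma tendsto_gridCeil {T ρ : ℝ≥0} (h : ρ ≤ T) :
    Tendsto (fun n => gridCeil T n ρ) atTop (𝓝 ρ) := by
  refine tendsto_of_tendsto_of_tendsto_of_le_of_le tendsto_const_nhds ?_
    (fun n => le_gridCeil h n) (fun n => gridCeil_le_add T n ρ)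
  have : Tendsto (fun n : ℕ => ρ + 1 / ((n : ℝ≥0) + 1)) atTop (𝓝 (ρ + 0)) :=
    tendsto_const_nhds.add tendsto_one_div_add_atTop_nhds_zero_nat
  simpa using this

lemma gridCeil_le_iff {T : ℝ≥0} {n : ℕ} {ρ u : ℝ≥0} :
    gridCeil T n ρ ≤ u ↔ T ≤ u ∨ ρ ≤ (⌊u * (n + 1)⌋₊ : ℝ≥0) / (n + 1) := by
  rw [gridCeil, min_le_iff]
  refine or_congr_right ?_
  rw [div_le_iff₀ (by positivity), le_div_iff₀ (by positivity), ← Nat.ceil_le,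
    ← Nat.le_floor_iff (zero_le)]

variable {Ω : Type*} {mΩ : MeasurableSpace Ω} {P : Measure Ω} {𝔽 : Filtration ℝ≥0 mΩ}

/-- Whether the rounded time has occurred by `u` is decided by `ρ` at the last grid point not after
`u`; once `T ≤ u` nothing is left to decide. -/
lemma isStoppingTime_gridCeil {ρ : Ω → ℝ≥0} (hρ : IsStoppingTime 𝔽 fun ω => (ρ ω : WithTop ℝ≥0))
    (T : ℝ≥0) (n : ℕ) : IsStoppingTime 𝔽 fun ω => (gridCeil T n (ρ ω) : WithTop ℝ≥0) := by
  intro u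
  simp only [WithTop.coe_le_coe, gridCeil_le_iff]
  refine MeasurableSet.union (.const _) ?_
  have h := hρ ((⌊u * (n + 1)⌋₊ : ℝ≥0) / (n + 1))
  simp only [WithTop.coe_le_coe] at h
  refine 𝔽.mono ?_ _ h
  rw [div_le_iff₀ (by positivity)]
  exact Nat.floor_le (zero_le)

lemma countable_range_gridCeil (ρ : Ω → ℝ≥0) (T : ℝ≥0) (n : ℕ) :
    (Set.range fun ω => (gridCeil T n (ρ ω) : WithTop ℝ≥0)).Countable := by
  refine (Set.countable_range fun k : ℕ =>
    ((min T (k / (n + 1)) : ℝ≥0) : WithTop ℝ≥0)).mono ?_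
  rintro _ ⟨ω, rfl⟩
  exact ⟨⌈ρ ω * (n + 1)⌉₊, rfl⟩

/-- Optional stopping for a martingale with continuous paths and a bounded stopping time. -/
lemma setIntegral_stopped_eq [IsFiniteMeasure P] {N : ℝ≥0 → Ω → ℝ} (hN : Martingale N 𝔽 P)
    (hc : ∀ ω, Continuous fun t => N t ω) {ρ : Ω → ℝ≥0}
    (hρ : IsStoppingTime 𝔽 fun ω => (ρ ω : WithTop ℝ≥0)) {T : ℝ≥0} (hT : ∀ ω, ρ ω ≤ T)
    {C : Set Ω} (hC : MeasurableSet[hρ.measurableSpace] C) :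
    ∫ ω in C, N (ρ ω) ω ∂P = ∫ ω in C, N T ω ∂P := by
  have hst := isStoppingTime_gridCeil hρ T
  have hle : ∀ n, hρ.measurableSpace ≤ (hst n).measurableSpace := fun n =>
    IsStoppingTime.measurableSpace_mono hρ (hst n) fun ω =>
      WithTop.coe_le_coe.2 (le_gridCeil (hT ω) n)
  have hleΩ : ∀ n, (hst n).measurableSpace ≤ mΩ := fun n => (hst n).measurableSpace_le
  -- The rounded times approach `ρ` from above and take countably many values, so discrete optional
  -- sampling applies to each of them.
  have hce : ∀ n, (fun ω => N (gridCeil T n (ρ ω)) ω) =ᵐ[P] P[N T | (hst n).measurableSpace] := by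
    intro n
    have := hN.stoppedValue_ae_eq_condExp_of_le_const_of_countable_range (hst n)
      (fun ω => WithTop.coe_le_coe.2 (gridCeil_le T n (ρ ω))) (countable_range_gridCeil ρ T n)
    exact this
  -- Conditional expectations of a single integrable variable are uniformly integrable. With path
  -- continuity, Vitali's theorem then gives convergence in L¹.
  have hUI := (hN.integrable T).uniformIntegrable_condExp hleΩ
  have hUI' : UniformIntegrable (fun n ω => N (gridCeil T n (ρ ω)) ω) 1 P :=
    hUI.ae_eq fun n => (hce n).symm
  have hlim : ∀ᵐ ω ∂P, Tendsto (fun n => N (gridCeil T n (ρ ω)) ω) atTop (𝓝 (N (ρ ω) ω)) :=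
    ae_of_all _ fun ω => ((hc ω).tendsto _).comp (tendsto_gridCeil (hT ω))
  have hmem := hUI'.memLp_of_ae_tendsto hlim
  have hL1 := tendsto_Lp_finite_of_tendsto_ae le_rfl ENNReal.one_ne_top hUI'.1 hmem hUI'.2.1 hlim
  have h1 : Tendsto (fun n => ∫ ω in C, N (gridCeil T n (ρ ω)) ω ∂P) atTop
      (𝓝 (∫ ω in C, N (ρ ω) ω ∂P)) := by
    refine tendsto_setIntegral_of_L1 _ hmem.1
      (Eventually.of_forall fun n => memLp_one_iff_integrable.1 (hUI'.memLp n)) ?_ C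
    simpa [eLpNorm_one_eq_lintegral_enorm] using hL1
  have h2 : ∀ n, ∫ ω in C, N (gridCeil T n (ρ ω)) ω ∂P = ∫ ω in C, N T ω ∂P := by
    intro n
    rw [setIntegral_congr_ae (g := P[N T | (hst n).measurableSpace]) (hleΩ n C (hle n C hC))
      ((hce n).mono fun ω h _ => h)]
    exact setIntegral_condExp (hleΩ n) (hN.integrable T) (hle n C hC)
  simp only [h2] at h1
  exact tendsto_nhds_unique h1 tendsto_const_nhds

/-- For `u < s` the event does not meet {ρ ≤ u}, and for `u ≥ s` it is already known at time `u`. -/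
lemma measurableSet_of_le_stoppingTime {ρ : Ω → ℝ≥0}
    (hρ : IsStoppingTime 𝔽 fun ω => (ρ ω : WithTop ℝ≥0)) {s : ℝ≥0} {B : Set Ω}
    (hB : MeasurableSet[𝔽 s] B) (h : ∀ ω ∈ B, s ≤ ρ ω) : MeasurableSet[hρ.measurableSpace] B := by
  refine ⟨le_iSup (fun t => (𝔽 t : MeasurableSpace Ω)) s B hB, fun u => ?_⟩
  rcases le_or_gt s u with hsu | hus
  · exact (𝔽.mono hsu B hB).inter (hρ u)
  · have : B ∩ {ω | (ρ ω : WithTop ℝ≥0) ≤ u} = ∅ := by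
      ext ω
      simp only [Set.mem_inter_iff, Set.mem_ofPred_eq, WithTop.coe_le_coe, Set.mem_empty_iff_false,
        iff_false, not_and, not_le]
      exact fun hω => hus.trans_le (h ω hω)
    rw [this]; exact @MeasurableSet.empty _ (𝔽 u)

end OptionalStopping

/-! ### Local martingales on path space -/

section StoppedIncrements

variable {E : Type*} [NormedAddCommGroup E] [CompleteSpace E]
  [TopologicalSpace.SeparableSpace E] [MeasurableSpace E] [BorelSpace E]

/-- `f` is continuous, `g` is measurable, and both are bounded on bounded sets. -/
structure TamePair (f g : E → ℝ) : Prop where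
  continuous : Continuous f
  measurable : Measurable g
  bounded_left : ∀ r : ℝ, ∃ C, ∀ x, ‖x‖ ≤ r → |f x| ≤ C
  bounded_right : ∀ r : ℝ, ∃ C, ∀ x, ‖x‖ ≤ r → |g x| ≤ C

lemma exists_norm_le_on_Icc (x : C(ℝ≥0, E)) (t : ℝ≥0) : ∃ r, ∀ u ≤ t, ‖x u‖ ≤ r :=
  ⟨runNorm t x + 1, fun u hu => (runNorm_lt_iff.1 (lt_add_one (runNorm t x)) u hu).le⟩

lemma intervalIntegrable_of_bounded_on_bounded {g : E → ℝ} (hg : Measurable g)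
    (hb : ∀ r : ℝ, ∃ C, ∀ x, ‖x‖ ≤ r → |g x| ≤ C) (x : C(ℝ≥0, E)) (a b : ℝ) :
    IntervalIntegrable (fun s : ℝ => g (x s.toNNReal)) volume a b := by
  obtain ⟨r, hr⟩ := exists_norm_le_on_Icc x (max a b).toNNReal
  obtain ⟨C, hC⟩ := hb r
  have hmeas : Measurable fun s : ℝ => g (x s.toNNReal) :=
    hg.comp (x.continuous.measurable.comp measurable_real_toNNReal)
  refine (intervalIntegrable_const (c := C)).mono_fun hmeas.aestronglyMeasurable ?_
  refine (ae_restrict_iff' measurableSet_uIoc).2 (ae_of_all _ fun s hs => ?_)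
  have : |g (x s.toNNReal)| ≤ C := hC _ (hr _ (Real.toNNReal_le_toNNReal hs.2))
  exact this.trans (le_abs_self C)

lemma measurable_timeIntegral {Ω : Type*} {mΩ : MeasurableSpace Ω} {h : ℝ → Ω → ℝ}
    (hh : Measurable (Function.uncurry h)) (a b : ℝ) : Measurable fun ω => ∫ s in a..b, h s ω := by
  have h' : StronglyMeasurable (Function.uncurry fun ω s => h s ω) :=
    (hh.comp measurable_swap).stronglyMeasurable
  simp only [intervalIntegral]
  exact (h'.integral_prod_right (ν := volume.restrict (Set.Ioc a b))).measurable.sub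
    (h'.integral_prod_right (ν := volume.restrict (Set.Ioc b a))).measurable

lemma measurable_comp_path {β : Type*} [MeasurableSpace β] {g : E → β} (hg : Measurable g) :
    Measurable (Function.uncurry fun (s : ℝ) (x : C(ℝ≥0, E)) => g (x s.toNNReal)) :=
  hg.comp (measurable_path_eval.comp
    ((measurable_real_toNNReal.comp measurable_fst).prodMk measurable_snd))

namespace TamePair

variable {f g : E → ℝ} (h : TamePair f g)

include h

lemma continuous_process (x : C(ℝ≥0, E)) : Continuous fun t => martingaleProcess f g t x :=
  (h.continuous.comp x.continuous).sub
    ((intervalIntegral.continuous_primitive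
      (intervalIntegrable_of_bounded_on_bounded h.measurable h.bounded_right x) 0).comp
      NNReal.continuous_coe)

lemma measurable_process (t : ℝ≥0) : Measurable (martingaleProcess f g t) :=
  (h.continuous.measurable.comp (continuous_eval_const t).measurable).sub
    (measurable_timeIntegral (measurable_comp_path h.measurable) _ _)

lemma measurable_uncurry_process :
    Measurable (Function.uncurry (martingaleProcess f g)) :=
  measurable_uncurry_of_continuous_of_measurable h.continuous_process h.measurable_process

lemma process_sub (x : C(ℝ≥0, E)) (u v : ℝ≥0) :
    martingaleProcess f g v x - martingaleProcess f g u x =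
      f (x v) - f (x u) - ∫ s in (u : ℝ)..v, g (x s.toNNReal) := by
  have hi := intervalIntegrable_of_bounded_on_bounded h.measurable h.bounded_right x
  rw [← intervalIntegral.integral_interval_sub_left (hi 0 v) (hi 0 u)]
  simp only [martingaleProcess]; ring

omit h in
lemma process_congr {x y : C(ℝ≥0, E)} {t : ℝ≥0} (hxy : ∀ u ≤ t, x u = y u) :
    martingaleProcess f g t x = martingaleProcess f g t y := by
  rw [martingaleProcess, martingaleProcess, hxy t le_rfl]
  congr 1
  refine intervalIntegral.integral_congr fun s hs => ?_
  rw [Set.uIcc_of_le (NNReal.coe_nonneg t)] at hs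
  rw [hxy]
  exact Real.toNNReal_le_iff_le_coe.2 hs.2

/-- Increments of the process over time intervals in which the path stays in a ball. -/
lemma abs_process_sub_le (r : ℝ) (T : ℝ≥0) : ∃ C, ∀ (x : C(ℝ≥0, E)) (u v : ℝ≥0), u ≤ v → v ≤ T →
    (∀ w, u ≤ w → w ≤ v → ‖x w‖ ≤ r) →
    |(martingaleProcess f g v x) - martingaleProcess f g u x| ≤ C := by
  obtain ⟨C1, h1⟩ := h.bounded_left r
  obtain ⟨C2, h2⟩ := h.bounded_right r
  refine ⟨C1 + C1 + |C2| * T, fun x u v huv hvT hx => ?_⟩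
  rw [h.process_sub]
  have huv' : (u : ℝ) ≤ v := huv
  have hi : |∫ s in (u : ℝ)..v, g (x s.toNNReal)| ≤ |C2| * |(v : ℝ) - u| := by
    rw [← Real.norm_eq_abs]
    refine intervalIntegral.norm_integral_le_of_norm_le_const fun s hs => ?_
    rw [Set.uIoc_of_le huv'] at hs
    refine (h2 _ (hx _ ?_ ?_)).trans (le_abs_self _)
    · exact NNReal.le_toNNReal_of_coe_le hs.1.le
    · exact Real.toNNReal_le_iff_le_coe.2 hs.2
  rw [abs_of_nonneg (sub_nonneg.2 huv')] at hi
  have hvT' : (v : ℝ) ≤ T := hvT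
  have hu0 : (0 : ℝ) ≤ u := u.2
  have hi' : |∫ s in (u : ℝ)..v, g (x s.toNNReal)| ≤ |C2| * T :=
    hi.trans (mul_le_mul_of_nonneg_left (by linarith) (abs_nonneg _))
  have ha := h1 _ (hx v huv le_rfl)
  have hb := h1 _ (hx u le_rfl huv)
  rw [abs_le] at *
  constructor <;> linarith [hi'.1, hi'.2, ha.1, ha.2, hb.1, hb.2]

/-- A path starting in the open ball stays in the closed ball up to its exit; a path starting
outside has exit time 0 and no increments. The bound is uniform over all paths and is the source of
integrability throughout. -/
lemma abs_stopped_sub_le (r : ℝ) (T : ℝ≥0) : ∃ C, 0 ≤ C ∧ ∀ (x : C(ℝ≥0, E)) (u v : ℝ≥0),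
    u ≤ exitMin r T x → v ≤ exitMin r T x →
    |(martingaleProcess f g v x) - martingaleProcess f g u x| ≤ C := by
  obtain ⟨C, hC⟩ := h.abs_process_sub_le r T
  refine ⟨|C|, abs_nonneg _, fun x u v hu hv => ?_⟩
  wlog huv : u ≤ v generalizing u v
  · rw [abs_sub_comm]; exact this v u hv hu (le_of_not_ge huv)
  rcases lt_or_ge ‖x 0‖ r with h0 | h0
  · exact (hC x u v huv (hv.trans (exitMin_le _ _ _)) fun w _ hw =>
      norm_le_of_le_exitMin h0 (hw.trans hv)).trans (le_abs_self _)
  · rw [exitMin_eq_zero T h0, nonpos_iff_eq_zero] at hu hv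
    simp [hu, hv]

lemma measurable_stopped (r : ℝ) (t : ℝ≥0) :
    Measurable fun x => martingaleProcess f g (exitMin r t x) x :=
  h.measurable_uncurry_process.comp
    (((measurable_exitMin r).comp (measurable_const.prodMk measurable_id)).prodMk measurable_id)

lemma measurable_stopped_pathFiltration (r : ℝ) {s t : ℝ≥0} (hst : s ≤ t) :
    Measurable[pathFiltration E t] fun x => martingaleProcess f g (exitMin r s x) x := by
  refine measurable_pathFiltration (h.measurable_stopped r s) fun x => ?_
  have h1 : exitMin r s (stopAt t x) = exitMin r s x :=
    exitMin_congr fun u hu => by simp [min_eq_left (hu.trans hst)]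
  rw [h1]
  refine process_congr fun u hu => ?_
  simp [min_eq_left ((hu.trans (exitMin_le r s x)).trans hst)]

end TamePair

/-- The process `M^f`, stopped when the path leaves the ball of radius `r`, is a martingale. -/
def StoppedMartingale (f g : E → ℝ) (P : Measure C(ℝ≥0, E)) : Prop :=
  -- Only increments are integrated: they are bounded, whereas f(x(0)) need not be integrable under
  -- `P`.
  ∀ (r : ℕ) (s t : ℝ≥0), s ≤ t → ∀ B, MeasurableSet[pathFiltration E s] B →
    ∫ x in B, (martingaleProcess f g (exitMin r t x) x -
      martingaleProcess f g (exitMin r s x) x) ∂P = 0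

lemma StoppedMartingale.martingale {f g : E → ℝ} (h : TamePair f g) {P : Measure C(ℝ≥0, E)}
    [IsFiniteMeasure P] (hP : StoppedMartingale f g P) (r : ℕ) :
    Martingale (fun t x => martingaleProcess f g (exitMin r t x) x - martingaleProcess f g 0 x)
      (pathFiltration E) P := by
  have hmeas : ∀ t, Measurable[pathFiltration E t] fun x =>
      martingaleProcess f g (exitMin r t x) x - martingaleProcess f g 0 x := by
    intro t
    have h2 := h.measurable_stopped_pathFiltration r (zero_le (a := t))
    have h3 : ∀ x : C(ℝ≥0, E), exitMin r 0 x = 0 := fun x => nonpos_iff_eq_zero.1 (exitMin_le _ _ _)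
    simp only [h3] at h2
    exact (h.measurable_stopped_pathFiltration r le_rfl).sub h2
  have hint : ∀ t, Integrable (fun x =>
      martingaleProcess f g (exitMin r t x) x - martingaleProcess f g 0 x) P := by
    intro t
    obtain ⟨C, -, hC⟩ := h.abs_stopped_sub_le r t
    refine Integrable.of_bound ((hmeas t).mono ((pathFiltration E).le t) le_rfl).aestronglyMeasurable
      C (ae_of_all _ fun x => hC x _ _ zero_le le_rfl)
  refine ⟨fun t => (hmeas t).stronglyMeasurable, fun s t hst => ?_⟩
  symm
  refine ae_eq_condExp_of_forall_setIntegral_eq ((pathFiltration E).le s) (hint t)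
    (fun _ _ _ => (hint s).integrableOn) (fun B hB _ => ?_)
    (hmeas s).stronglyMeasurable.aestronglyMeasurable
  have h0 := hP r s t hst B hB
  have : ∀ x, martingaleProcess f g (exitMin r t x) x - martingaleProcess f g (exitMin r s x) x =
      (martingaleProcess f g (exitMin r t x) x - martingaleProcess f g 0 x) -
      (martingaleProcess f g (exitMin r s x) x - martingaleProcess f g 0 x) := fun x => by ring
  simp only [this] at h0
  rw [integral_sub (hint t).integrableOn (hint s).integrableOn] at h0
  linarith

/-- The exit time from the ball of radius `r`. -/
def exitTime (r : ℝ) (x : C(ℝ≥0, E)) : WithTop ℝ≥0 :=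
  open Classical in if ∃ u, r ≤ ‖x u‖ then (sInf {u | r ≤ ‖x u‖} : ℝ≥0) else ⊤

lemma coe_lt_exitTime {r : ℝ} {u : ℝ≥0} {x : C(ℝ≥0, E)} :
    (u : WithTop ℝ≥0) < exitTime r x ↔ runNorm u x < r := by
  rw [runNorm_lt_iff, exitTime]
  split_ifs with h
  · rw [WithTop.coe_lt_coe]
    constructor
    · intro hu v hv
      by_contra! hr
      have hle : sInf {u | r ≤ ‖x u‖} ≤ v := csInf_le (OrderBot.bddBelow _) hr
      exact absurd hle (not_le.2 (hv.trans_lt hu))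
    · intro hu
      have hc : IsClosed {u | r ≤ ‖x u‖} :=
        isClosed_le continuous_const (continuous_norm.comp x.continuous)
      have hm := hc.csInf_mem h (OrderBot.bddBelow _)
      by_contra! hle
      exact absurd (hu _ hle) (not_lt.2 hm)
  · push Not at h
    simp only [WithTop.coe_lt_top, true_iff]
    exact fun v _ => h v

lemma min_exitTime (r : ℝ) (t : ℝ≥0) (x : C(ℝ≥0, E)) :
    min (t : WithTop ℝ≥0) (exitTime r x) = exitMin r t x := by
  refine eq_of_forall_lt_iff fun u => ?_
  induction u with
  | top => exact iff_of_false not_top_lt not_top_lt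
  | coe u =>
    rw [lt_min_iff, coe_lt_exitTime, WithTop.coe_lt_coe, WithTop.coe_lt_coe, lt_exitMin_iff]

lemma measurableSet_runNorm_lt (r : ℝ) (t : ℝ≥0) :
    MeasurableSet[pathFiltration E t] {x : C(ℝ≥0, E) | runNorm t x < r} := by
  rw [measurableSet_pathFiltration_iff]
  refine ⟨measurableSet_lt (continuous_runNorm.comp
    (continuous_const.prodMk continuous_id)).measurable measurable_const, fun x => ?_⟩
  rw [Set.mem_ofPred_eq, Set.mem_ofPred_eq, runNorm_congr fun u hu => ?_]
  simp [min_eq_left hu]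

lemma isStoppingTime_exitTime (r : ℝ) :
    IsStoppingTime (pathFiltration E) (exitTime r : C(ℝ≥0, E) → WithTop ℝ≥0) := by
  intro t
  have : {x : C(ℝ≥0, E) | exitTime r x ≤ t} = {x | runNorm t x < r}ᶜ := by
    ext x
    rw [Set.mem_compl_iff, Set.mem_ofPred_eq, Set.mem_ofPred_eq, ← coe_lt_exitTime, not_lt]
  rw [this]
  exact (measurableSet_runNorm_lt r t).compl

lemma isStoppingTime_exitMin (r : ℝ) (t : ℝ≥0) :
    IsStoppingTime (pathFiltration E) fun x : C(ℝ≥0, E) => (exitMin r t x : WithTop ℝ≥0) := by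
  have := (isStoppingTime_const (pathFiltration E) t).min (isStoppingTime_exitTime r)
  simpa only [min_exitTime] using this

/-- The exit times from balls of integer radius localize, because a continuous path is bounded on
compact time intervals. -/
lemma isLocalMartingale_of_stoppedMartingale {f g : E → ℝ} (h : TamePair f g)
    {P : Measure C(ℝ≥0, E)} [IsFiniteMeasure P] (hP : StoppedMartingale f g P) :
    IsLocalMartingale (martingaleProcess f g) (pathFiltration E) P := by
  refine ⟨fun n => exitTime n, ⟨⟨fun n => isStoppingTime_exitTime _, ae_of_all _ fun x => ?_⟩,
    ae_of_all _ fun x => ?_⟩, fun n => ?_⟩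
  · rw [WithTop.tendsto_nhds_top_iff]
    intro u
    obtain ⟨N, hN⟩ := exists_nat_gt (runNorm u x)
    filter_upwards [eventually_ge_atTop N] with n hn
    exact coe_lt_exitTime.2 (hN.trans_le (by exact_mod_cast hn))
  · intro m n hmn
    refine le_of_forall_lt fun u hu => ?_
    induction u with
    | top => simp at hu
    | coe u =>
      rw [coe_lt_exitTime] at hu ⊢
      exact hu.trans_le (by exact_mod_cast hmn)
  · have := hP.martingale h n
    refine (congrArg (fun N => Martingale N (pathFiltration E) P) ?_).mp this
    ext t x
    rw [stoppedProcess, min_exitTime]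
    rfl

/-- The localizing sequence is arbitrary and is traded for exit times. Optional stopping at the exit
time is applied to each localized martingale, and bounded convergence removes the localization,
since increments before the exit are bounded independently of `n`. -/
lemma stoppedMartingale_of_isLocalMartingale {f g : E → ℝ} (h : TamePair f g)
    {P : Measure C(ℝ≥0, E)} [IsFiniteMeasure P]
    (hP : IsLocalMartingale (martingaleProcess f g) (pathFiltration E) P) :
    StoppedMartingale f g P := by
  intro r s t hst B hB
  obtain ⟨σ, hσ, hM⟩ := hP
  -- Off `B'` the path has left the ball by time `s` and the increment vanishes. On `B'` both
  -- stopped times are at least `s`, so `B'` belongs to the σ-algebras of both.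
  set B' := B ∩ {x | runNorm s x < r} with hB'
  have hB'm : MeasurableSet[pathFiltration E s] B' := hB.inter (measurableSet_runNorm_lt r s)
  have hB'm' := (pathFiltration E).le s _ hB'm
  have hred : ∀ Z : C(ℝ≥0, E) → ℝ, (∀ x, r ≤ runNorm s x → Z x = 0) →
      ∫ x in B, Z x ∂P = ∫ x in B', Z x ∂P := by
    intro Z hZ
    refine setIntegral_eq_of_subset_of_forall_sdiff_eq_zero ((pathFiltration E).le s B hB)
      Set.inter_subset_left fun x hx => hZ x ?_
    by_contra! hlt
    exact hx.2 ⟨hx.1, hlt⟩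
  have heq : ∀ x : C(ℝ≥0, E), r ≤ runNorm s x → exitMin r t x = exitMin r s x := by
    intro x hx
    rw [exitMin_of_le hst]
    symm
    refine min_eq_right (not_lt.1 fun hlt => ?_)
    exact absurd (lt_exitMin_iff.1 hlt).2 (not_lt.2 hx)
  have hsle : ∀ x ∈ B', s = exitMin r s x := fun x hx => (exitMin_eq_of_runNorm_lt hx.2).symm
  rw [hred _ fun x hx => by rw [heq x hx, sub_self]]
  obtain ⟨C, -, hC⟩ := h.abs_stopped_sub_le r t
  have hcoe : ∀ (n : ℕ) (u : ℝ≥0) (x : C(ℝ≥0, E)), ∃ v : ℝ≥0, v ≤ u ∧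
      min (u : WithTop ℝ≥0) (σ n x) = v ∧ ∀ y, stoppedProcess (martingaleProcess f g) (fun _ => σ n x) u y =
        martingaleProcess f g v y := by
    intro n u x
    have hne : min (u : WithTop ℝ≥0) (σ n x) ≠ ⊤ :=
      ((min_le_left _ _).trans_lt (WithTop.coe_lt_top u)).ne
    obtain ⟨v, hv⟩ := WithTop.ne_top_iff_exists.1 hne
    refine ⟨v, ?_, hv.symm, fun y => ?_⟩
    · rw [← WithTop.coe_le_coe, hv]; exact min_le_left _ _
    · rw [stoppedProcess, ← hv]; rfl
  choose v hvle hvmin hv using hcoe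
  have h_stop : ∀ n u x, stoppedProcess (martingaleProcess f g) (σ n) u x =
      martingaleProcess f g (v n u x) x := fun n u x => hv n u x x
  have hvcont : ∀ n x, Continuous fun u => v n u x := by
    intro n x
    rcases eq_or_ne (σ n x) ⊤ with htop | hne
    · have : ∀ u, v n u x = u := fun u => by
        have := hvmin n u x
        rw [htop, min_eq_left le_top] at this
        exact (WithTop.coe_injective this).symm
      simp only [this]; exact continuous_id
    · obtain ⟨w, hw⟩ := WithTop.ne_top_iff_exists.1 hne
      have : ∀ u, v n u x = min u w := fun u => by
        have := hvmin n u x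
        rw [← hw, ← WithTop.coe_min] at this
        exact (WithTop.coe_injective this).symm
      simp only [this]; fun_prop
  have hcont : ∀ n x, Continuous fun u =>
      stoppedProcess (martingaleProcess f g) (σ n) u x - martingaleProcess f g 0 x := by
    intro n x
    simp only [h_stop]
    exact ((h.continuous_process x).comp (hvcont n x)).sub continuous_const
  have key : ∀ n, ∫ x in B', (stoppedProcess (martingaleProcess f g) (σ n) (exitMin r t x) x -
      stoppedProcess (martingaleProcess f g) (σ n) (exitMin r s x) x) ∂P = 0 := by
    intro n
    have hmt := hM n
    have hBt := measurableSet_of_le_stoppingTime (isStoppingTime_exitMin r t) hB'm fun x hx => by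
      have := exitMin_mono (r := r) hst x
      rwa [← hsle x hx] at this
    have hBs := measurableSet_of_le_stoppingTime (isStoppingTime_exitMin r s) hB'm fun x hx =>
      (hsle x hx).le
    have e1 := setIntegral_stopped_eq hmt (hcont n) (isStoppingTime_exitMin r t)
      (fun x => exitMin_le r t x) hBt
    have e2 := setIntegral_stopped_eq hmt (hcont n) (isStoppingTime_exitMin r s)
      (fun x => (exitMin_le r s x).trans hst) hBs
    have hprog : ∀ u : ℝ≥0, Measurable fun x =>
        stoppedProcess (martingaleProcess f g) (σ n) (exitMin r u x) x -
          martingaleProcess f g 0 x := by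
      intro u
      have hj := measurable_uncurry_of_continuous_of_measurable (hcont n) fun u =>
        ((hmt.1 u).measurable.mono ((pathFiltration E).le u) le_rfl)
      exact hj.comp (((measurable_exitMin r).comp
        (measurable_const.prodMk measurable_id)).prodMk measurable_id)
    have hb : ∀ x, |(stoppedProcess (martingaleProcess f g) (σ n) (exitMin r t x) x) -
        stoppedProcess (martingaleProcess f g) (σ n) (exitMin r s x) x| ≤ C := by
      intro x
      rw [h_stop, h_stop]
      exact hC x _ _ ((hvle _ _ _).trans (exitMin_mono hst x)) (hvle _ _ _)
    have hb' : ∀ u ≤ t, ∀ x, |(stoppedProcess (martingaleProcess f g) (σ n) (exitMin r u x) x) -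
        martingaleProcess f g 0 x| ≤ C := by
      intro u hu x
      rw [h_stop]
      exact hC x _ _ zero_le ((hvle _ _ _).trans (exitMin_mono hu x))
    have hint : ∀ u ≤ t, Integrable (fun x =>
        stoppedProcess (martingaleProcess f g) (σ n) (exitMin r u x) x -
          martingaleProcess f g 0 x) P := fun u hu =>
      Integrable.of_bound (hprog u).aestronglyMeasurable C (ae_of_all _ (hb' u hu))
    have e3 := e1.trans e2.symm
    rw [← sub_eq_zero, ← integral_sub (hint t le_rfl).integrableOn (hint s hst).integrableOn] at e3
    rw [← e3]
    congr 1
    ext x; ring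
  have hlim : Tendsto (fun n => ∫ x in B',
      (stoppedProcess (martingaleProcess f g) (σ n) (exitMin r t x) x -
      stoppedProcess (martingaleProcess f g) (σ n) (exitMin r s x) x) ∂P) atTop
      (𝓝 (∫ x in B', (martingaleProcess f g (exitMin r t x) x -
        martingaleProcess f g (exitMin r s x) x) ∂P)) := by
    refine tendsto_integral_of_dominated_convergence (fun _ => C) (fun n => ?_)
      (integrable_const _) (fun n => ae_of_all _ fun x => ?_) ?_
    · have hj := measurable_uncurry_of_continuous_of_measurable (hcont n) fun u =>
        (((hM n).1 u).measurable.mono ((pathFiltration E).le u) le_rfl)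
      have hp : ∀ u : ℝ≥0, Measurable fun x : C(ℝ≥0, E) => (exitMin r u x, x) := fun u =>
        ((measurable_exitMin r).comp (measurable_const.prodMk measurable_id)).prodMk measurable_id
      have := ((hj.comp (hp t)).sub (hj.comp (hp s))).aestronglyMeasurable (μ := P.restrict B')
      refine this.congr (ae_of_all _ fun x => ?_)
      simp
    · rw [h_stop, h_stop]
      exact hC x _ _ ((hvle _ _ _).trans (exitMin_mono hst x)) (hvle _ _ _)
    -- Almost surely the localizing times eventually exceed `t`, and from then on the stopped
    -- increment equals its limit.
    · filter_upwards [ae_restrict_of_ae hσ.tendsto_top] with x hx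
      have hev := (WithTop.tendsto_nhds_top_iff _).1 hx t
      refine tendsto_const_nhds.congr' ?_
      filter_upwards [hev] with n hn
      have hvv : ∀ u ≤ t, v n u x = u := fun u hu => by
        have := hvmin n u x
        rw [min_eq_left ((WithTop.coe_le_coe.2 hu).trans hn.le)] at this
        exact (WithTop.coe_injective this).symm
      rw [h_stop, h_stop, hvv _ (exitMin_le r t x), hvv _ ((exitMin_le r s x).trans hst)]
  simp only [key] at hlim
  exact tendsto_nhds_unique hlim tendsto_const_nhds

end StoppedIncrements


/-! ### Second order Taylor expansion -/

section Taylor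

variable {n : ℕ} {φ : (Fin n → ℝ) → ℝ}

/-- The partial derivatives of `φ`. -/
def partialDeriv (φ : (Fin n → ℝ) → ℝ) (k : Fin n) (y : Fin n → ℝ) : ℝ :=
  fderiv ℝ φ y (Pi.single k 1)

/-- The second partial derivatives of `φ`. -/
def partialDeriv₂ (φ : (Fin n → ℝ) → ℝ) (k l : Fin n) (y : Fin n → ℝ) : ℝ :=
  fderiv ℝ (fderiv ℝ φ) y (Pi.single k 1) (Pi.single l 1)

lemma sum_smul_single (d : Fin n → ℝ) : ∑ k, d k • (Pi.single k (1 : ℝ) : Fin n → ℝ) = d := by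
  ext i
  simp [Finset.sum_apply, Pi.single_apply]

lemma fderiv_apply_eq_sum (y d : Fin n → ℝ) :
    fderiv ℝ φ y d = ∑ k, partialDeriv φ k y * d k := by
  conv_lhs => rw [← sum_smul_single d]
  simp [map_sum, partialDeriv, mul_comm]

lemma fderiv_fderiv_apply_eq_sum (y d : Fin n → ℝ) :
    fderiv ℝ (fderiv ℝ φ) y d d = ∑ k, ∑ l, partialDeriv₂ φ k l y * (d k * d l) := by
  conv_lhs => rw [← sum_smul_single d]
  simp only [map_sum, map_smul, _root_.sum_apply, _root_.smul_apply,
    smul_eq_mul, partialDeriv₂, Finset.mul_sum]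
  rw [Finset.sum_comm]
  refine Finset.sum_congr rfl fun k _ => Finset.sum_congr rfl fun l _ => ?_
  ring

lemma continuous_partialDeriv (hφ : ContDiff ℝ 2 φ) (k : Fin n) :
    Continuous (partialDeriv φ k) :=
  (hφ.continuous_fderiv (by norm_num)).clm_apply continuous_const

lemma contDiff_fderiv (hφ : ContDiff ℝ 2 φ) : ContDiff ℝ 1 (fderiv ℝ φ) :=
  hφ.fderiv_right (by norm_num)

lemma continuous_partialDeriv₂ (hφ : ContDiff ℝ 2 φ) (k l : Fin n) :
    Continuous (partialDeriv₂ φ k l) :=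
  (((contDiff_fderiv hφ).continuous_fderiv (by norm_num)).clm_apply continuous_const).clm_apply
    continuous_const

lemma sum_abs_mul_abs_le (d : Fin n → ℝ) :
    ∑ k, ∑ l, |d k * d l| ≤ n * ∑ k, d k ^ 2 := by
  have : ∑ k, ∑ l, |d k * d l| = (∑ k, |d k|) ^ 2 := by
    rw [sq, Finset.sum_mul_sum]; simp only [abs_mul]
  rw [this]
  simpa using sq_sum_le_card_mul_sum_sq (s := Finset.univ) (f := fun k => |d k|)

/-- Taylor's formula, with the remainder bounded by the oscillation of the second derivatives. -/
lemma abs_taylor_remainder_le (hφ : ContDiff ℝ 2 φ) {K η : ℝ} {y z : Fin n → ℝ}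
    (hy : ‖y‖ ≤ K) (hz : ‖z‖ ≤ K)
    (hη : ∀ x, ‖x‖ ≤ K → ‖x - y‖ ≤ ‖z - y‖ → ∀ k l,
      |partialDeriv₂ φ k l x - partialDeriv₂ φ k l y| ≤ η) :
    |φ z - φ y - ∑ k, partialDeriv φ k y * (z k - y k) -
      1 / 2 * ∑ k, ∑ l, partialDeriv₂ φ k l y * ((z k - y k) * (z l - y l))| ≤
      n * η * ∑ k, (z k - y k) ^ 2 := by
  -- The sign of `η` is read off from `hη`, which requires an index.
  rcases Nat.eq_zero_or_pos n with rfl | hn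
  · have : z = y := Subsingleton.elim _ _
    simp [this]
  have hη0 : 0 ≤ η := (abs_nonneg _).trans
    (hη y hy (by simp) ⟨0, hn⟩ ⟨0, hn⟩)
  set d : Fin n → ℝ := z - y with hd
  set c : ℝ := n * η * ∑ k, d k ^ 2 with hc
  have hseg : ∀ θ ∈ Set.Icc (0 : ℝ) 1, ‖y + θ • d‖ ≤ K ∧ ‖y + θ • d - y‖ ≤ ‖z - y‖ := by
    intro θ hθ
    constructor
    · have hconv := (convex_closedBall (0 : Fin n → ℝ) K).add_smul_sub_mem
        (mem_closedBall_zero_iff.2 hy) (mem_closedBall_zero_iff.2 hz) hθ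
      exact mem_closedBall_zero_iff.1 hconv
    · rw [add_sub_cancel_left, norm_smul, Real.norm_eq_abs, abs_of_nonneg hθ.1]
      exact mul_le_of_le_one_left (norm_nonneg _) hθ.2
  have hline : ∀ θ : ℝ, HasDerivAt (fun θ : ℝ => y + θ • d) d θ := fun θ => by
    simpa using ((hasDerivAt_id θ).smul_const d).const_add y
  have h1 : ∀ θ : ℝ, HasDerivAt (fun θ : ℝ => φ (y + θ • d)) (fderiv ℝ φ (y + θ • d) d) θ :=
    fun θ => ((hφ.differentiable (by norm_num)) _).hasFDerivAt.comp_hasDerivAt θ (hline θ)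
  have h2 : ∀ θ : ℝ, HasDerivAt (fun θ : ℝ => fderiv ℝ φ (y + θ • d) d)
      (fderiv ℝ (fderiv ℝ φ) (y + θ • d) d d) θ := fun θ => by
    have := (((contDiff_fderiv hφ).differentiable (by norm_num)) _).hasFDerivAt.comp_hasDerivAt θ
      (hline θ)
    exact this.clm_apply (hasDerivAt_const θ d) |>.congr_deriv (by simp)
  have hbound : ∀ θ ∈ Set.Icc (0 : ℝ) 1,
      |fderiv ℝ (fderiv ℝ φ) (y + θ • d) d d - fderiv ℝ (fderiv ℝ φ) y d d| ≤ c := by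
    intro θ hθ
    rw [fderiv_fderiv_apply_eq_sum, fderiv_fderiv_apply_eq_sum, ← Finset.sum_sub_distrib]
    simp only [← Finset.sum_sub_distrib, ← sub_mul]
    calc _ ≤ ∑ k, ∑ l, η * |d k * d l| := by
          refine (Finset.abs_sum_le_sum_abs _ _).trans (Finset.sum_le_sum fun k _ => ?_)
          refine (Finset.abs_sum_le_sum_abs _ _).trans (Finset.sum_le_sum fun l _ => ?_)
          rw [abs_mul]
          exact mul_le_mul_of_nonneg_right (hη _ (hseg θ hθ).1 (hseg θ hθ).2 k l) (abs_nonneg _)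
      _ = η * ∑ k, ∑ l, |d k * d l| := by simp only [Finset.mul_sum]
      _ ≤ η * (n * ∑ k, d k ^ 2) := mul_le_mul_of_nonneg_left (sum_abs_mul_abs_le d) hη0
      _ = c := by rw [hc]; ring
  have hc0 : 0 ≤ c := (abs_nonneg _).trans (hbound 0 (by simp))
  -- The mean value inequality is used twice along the segment, first for the derivative and then
  -- for the function. The factors θ and θ²/2 of an integral remainder are replaced by 1.
  have h3 : ∀ θ ∈ Set.Icc (0 : ℝ) 1,
      |fderiv ℝ φ (y + θ • d) d - fderiv ℝ φ y d - θ * fderiv ℝ (fderiv ℝ φ) y d d| ≤ c := by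
    intro θ hθ
    have := norm_image_sub_le_of_norm_deriv_le_segment' (a := (0 : ℝ)) (b := 1) (C := c)
      (f := fun θ : ℝ => fderiv ℝ φ (y + θ • d) d - θ * fderiv ℝ (fderiv ℝ φ) y d d)
      (f' := fun θ => fderiv ℝ (fderiv ℝ φ) (y + θ • d) d d - fderiv ℝ (fderiv ℝ φ) y d d)
      (fun x _ => by
        have := (h2 x).sub ((hasDerivAt_id x).mul_const (fderiv ℝ (fderiv ℝ φ) y d d))
        exact (this.congr_deriv (by simp)).hasDerivWithinAt)
      (fun x hx => hbound x ⟨hx.1, hx.2.le⟩) θ hθ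
    simp only [zero_smul, add_zero, zero_mul, sub_zero, Real.norm_eq_abs] at this
    refine le_trans (le_of_eq ?_) (this.trans (mul_le_of_le_one_right hc0 hθ.2))
    congr 1; ring
  have h4 := norm_image_sub_le_of_norm_deriv_le_segment_01' (C := c)
      (f := fun θ : ℝ => φ (y + θ • d) - θ * fderiv ℝ φ y d -
        1 / 2 * θ ^ 2 * fderiv ℝ (fderiv ℝ φ) y d d)
      (f' := fun θ => fderiv ℝ φ (y + θ • d) d - fderiv ℝ φ y d -
        θ * fderiv ℝ (fderiv ℝ φ) y d d)
      (fun x _ => by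
        have := ((h1 x).sub ((hasDerivAt_id x).mul_const (fderiv ℝ φ y d))).sub
          ((((hasDerivAt_id x).pow 2).const_mul (1 / 2)).mul_const
            (fderiv ℝ (fderiv ℝ φ) y d d))
        exact (this.congr_deriv (by simp)).hasDerivWithinAt)
      (fun x hx => h3 x ⟨hx.1, hx.2.le⟩)
  have hz' : y + d = z := by rw [hd]; abel
  simp only [one_smul, zero_smul, add_zero, Real.norm_eq_abs, hz', fderiv_apply_eq_sum,
    fderiv_fderiv_apply_eq_sum] at h4
  refine le_trans (le_of_eq ?_) h4
  congr 1
  simp only [hd, Pi.sub_apply]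
  ring

end Taylor

/-! ### Multipliers -/

section Multiplier

variable {Ω : Type*} {m mΩ : MeasurableSpace Ω} {P : Measure Ω}

/-- The hypothesis `h0` says that the conditional expectation of `X` vanishes, and a factor
measurable for the conditioning σ-algebra can be taken out. -/
lemma integral_mul_eq_zero_of_setIntegral [IsFiniteMeasure P] (hm : m ≤ mΩ) {X Z : Ω → ℝ}
    (hX : Integrable X P) (h0 : ∀ B, MeasurableSet[m] B → ∫ ω in B, X ω ∂P = 0)
    (hZ : Measurable[m] Z) (hZX : Integrable (fun ω => Z ω * X ω) P) :
    ∫ ω, Z ω * X ω ∂P = 0 := by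
  have h1 : P[X | m] =ᵐ[P] 0 := by
    symm
    refine ae_eq_condExp_of_forall_setIntegral_eq hm hX (fun _ _ _ => integrableOn_zero)
      (fun B hB _ => ?_) aestronglyMeasurable_zero
    simp [h0 B hB]
  have h2 := condExp_mul_of_stronglyMeasurable_left (μ := P) hZ.stronglyMeasurable hZX hX
  have h3 : ∫ ω, Z ω * X ω ∂P = ∫ ω, (P[fun ω => Z ω * X ω | m]) ω ∂P :=
    (integral_condExp hm).symm
  rw [h3]
  refine integral_eq_zero_of_ae (h2.trans ?_)
  filter_upwards [h1] with ω hω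
  simp [hω]

end Multiplier


/-! ### Itô's formula for bounded continuous semimartingales, in mean -/

section Ito

variable {Ω : Type*} {mΩ : MeasurableSpace Ω} {n : ℕ}

/-- A bounded continuous adapted process `Y` with drift density `b` and covariation density `a`:
the increments of `Y - ∫ b` and the main parts `m` of `ΔY ΔY - ∫ a` have conditional mean zero. -/
structure BoundedSemimartingale (𝔽 : Filtration ℝ≥0 mΩ) (P : Measure Ω) (Y : ℝ≥0 → Ω → Fin n → ℝ)
    (b : Fin n → ℝ → Ω → ℝ) (a : Fin n → Fin n → ℝ → Ω → ℝ)
    (m : Fin n → Fin n → ℝ≥0 → ℝ≥0 → Ω → ℝ) (K C : ℝ) : Prop where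
  continuous : ∀ ω, Continuous fun u => Y u ω
  adapted : ∀ u, Measurable[𝔽 u] (Y u)
  norm_le : ∀ u ω, ‖Y u ω‖ ≤ K
  drift_measurable : ∀ k, Measurable (Function.uncurry (b k))
  drift_le : ∀ k w ω, |b k w ω| ≤ C
  cov_measurable : ∀ k l, Measurable (Function.uncurry (a k l))
  cov_le : ∀ k l w ω, |a k l w ω| ≤ C
  main_measurable : ∀ k l u v, Measurable (m k l u v)
  drift_mean : ∀ k u v, u ≤ v → ∀ B, MeasurableSet[𝔽 u] B →
    ∫ ω in B, (Y v ω k - Y u ω k - ∫ w in (u : ℝ)..v, b k w ω) ∂P = 0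
  main_mean : ∀ k l u v, u ≤ v → ∀ B, MeasurableSet[𝔽 u] B → ∫ ω in B, m k l u v ω ∂P = 0
  -- The error is small compared with v - u when the oscillation δ is small, so its sum over a fine
  -- partition vanishes. This slack allows `m` to come either from the martingale of a square or
  -- from a stochastic integral.
  error_le : ∀ k l u v ω δ, u ≤ v → (∀ w, u ≤ w → w ≤ v → ‖Y w ω - Y u ω‖ ≤ δ) →
    |(Y v ω k - Y u ω k) * (Y v ω l - Y u ω l) - (∫ w in (u : ℝ)..v, a k l w ω) - m k l u v ω| ≤
      C * ((v : ℝ) - u) * (δ + ((v : ℝ) - u))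

/-- The generator of the semimartingale, applied to `φ`. -/
def itoGenerator (φ : (Fin n → ℝ) → ℝ) (Y : ℝ≥0 → Ω → Fin n → ℝ)
    (b : Fin n → ℝ → Ω → ℝ) (a : Fin n → Fin n → ℝ → Ω → ℝ) (w : ℝ) (ω : Ω) : ℝ :=
  (∑ k, partialDeriv φ k (Y w.toNNReal ω) * b k w ω) +
    (1 / 2) * ∑ k, ∑ l, a k l w ω * partialDeriv₂ φ k l (Y w.toNNReal ω)

/-- The squared length of an increment. -/
def incrSq (Y : ℝ≥0 → Ω → Fin n → ℝ) (u v : ℝ≥0) (ω : Ω) : ℝ := ∑ k, (Y v ω k - Y u ω k) ^ 2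

lemma incrSq_nonneg (Y : ℝ≥0 → Ω → Fin n → ℝ) (u v : ℝ≥0) (ω : Ω) : 0 ≤ incrSq Y u v ω :=
  Finset.sum_nonneg fun _ _ => sq_nonneg _

/-- The increment of `φ(Y) - ∫ L φ`, without its first and second order martingale parts. -/
def itoRemainder (φ : (Fin n → ℝ) → ℝ) (Y : ℝ≥0 → Ω → Fin n → ℝ)
    (b : Fin n → ℝ → Ω → ℝ) (a : Fin n → Fin n → ℝ → Ω → ℝ)
    (m : Fin n → Fin n → ℝ≥0 → ℝ≥0 → Ω → ℝ) (u v : ℝ≥0) (ω : Ω) : ℝ :=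
  φ (Y v ω) - φ (Y u ω) - (∫ w in (u : ℝ)..v, itoGenerator φ Y b a w ω) -
    (∑ k, partialDeriv φ k (Y u ω) * (Y v ω k - Y u ω k - ∫ w in (u : ℝ)..v, b k w ω)) -
    (1 / 2) * ∑ k, ∑ l, partialDeriv₂ φ k l (Y u ω) * m k l u v ω

lemma exists_abs_le_of_continuous {d : ℕ} {ψ : (Fin d → ℝ) → ℝ} (hψ : Continuous ψ) (K : ℝ) :
    ∃ L, 0 ≤ L ∧ ∀ y, ‖y‖ ≤ K → |ψ y| ≤ L := by
  obtain ⟨L, hL⟩ := (isCompact_closedBall (0 : Fin d → ℝ) K).exists_bound_of_continuousOn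
    hψ.continuousOn
  exact ⟨|L|, abs_nonneg _, fun y hy => (hL y (mem_closedBall_zero_iff.2 hy)).trans (le_abs_self L)⟩

lemma abs_interval_integral_le {g : ℝ → ℝ} {C u v : ℝ} (huv : u ≤ v) (h : ∀ w, u < w → w ≤ v → |g w| ≤ C) :
    |∫ w in u..v, g w| ≤ C * (v - u) := by
  have := intervalIntegral.norm_integral_le_of_norm_le_const (a := u) (b := v) (f := g) (C := C)
    fun w hw => by
      rw [Set.uIoc_of_le huv] at hw
      exact h w hw.1 hw.2
  rwa [Real.norm_eq_abs, abs_of_nonneg (sub_nonneg.2 huv)] at this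

lemma intervalIntegrable_of_measurable_bounded {g : ℝ → ℝ} (hg : Measurable g) {C : ℝ}
    (hC : ∀ w, |g w| ≤ C) (u v : ℝ) : IntervalIntegrable g volume u v :=
  (intervalIntegrable_const (c := C)).mono_fun hg.aestronglyMeasurable
    (ae_of_all _ fun w => (hC w).trans (le_abs_self C))

lemma intervalIntegrable_sum {F : Fin n → ℝ → ℝ} {u v : ℝ}
    (hF : ∀ k, IntervalIntegrable (F k) volume u v) :
    IntervalIntegrable (fun w => ∑ k, F k w) volume u v :=
  (IntervalIntegrable.sum Finset.univ fun k _ => hF k).congr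
    fun w _ => by simp [Finset.sum_apply]

namespace BoundedSemimartingale

variable {𝔽 : Filtration ℝ≥0 mΩ} {P : Measure Ω} {Y : ℝ≥0 → Ω → Fin n → ℝ}
  {b : Fin n → ℝ → Ω → ℝ} {a : Fin n → Fin n → ℝ → Ω → ℝ}
  {m : Fin n → Fin n → ℝ≥0 → ℝ≥0 → Ω → ℝ} {K C : ℝ}
  (h : BoundedSemimartingale 𝔽 P Y b a m K C)

include h

lemma measurable_value (u : ℝ≥0) : Measurable (Y u) := (h.adapted u).mono (𝔽.le u) le_rfl

lemma measurable_coord (u : ℝ≥0) (k : Fin n) : Measurable fun ω => Y u ω k :=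
  (measurable_pi_apply k).comp (h.measurable_value u)

lemma norm_sub_le (u v : ℝ≥0) (ω : Ω) : ‖Y v ω - Y u ω‖ ≤ 2 * K := by
  refine (_root_.norm_sub_le _ _).trans ?_
  linarith [h.norm_le u ω, h.norm_le v ω]

lemma abs_coord_sub_le (u v : ℝ≥0) (ω : Ω) (k : Fin n) : |Y v ω k - Y u ω k| ≤ 2 * K :=
  (norm_le_pi_norm (Y v ω - Y u ω) k).trans (h.norm_sub_le u v ω)

lemma measurable_incrSq (u v : ℝ≥0) : Measurable (incrSq Y u v) :=
  Finset.measurable_sum _ fun k _ => ((h.measurable_coord v k).sub (h.measurable_coord u k)).pow_const 2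

lemma incrSq_adapted {u v t : ℝ≥0} (hu : u ≤ t) (hv : v ≤ t) : Measurable[𝔽 t] (incrSq Y u v) := by
  have h1 : ∀ w ≤ t, ∀ k, Measurable[𝔽 t] fun ω => Y w ω k := fun w hw k =>
    (measurable_pi_apply k).comp ((h.adapted w).mono (𝔽.mono hw) le_rfl)
  exact Finset.measurable_sum _ fun k _ => ((h1 v hv k).sub (h1 u hu k)).pow_const 2

lemma incrSq_le (u v : ℝ≥0) (ω : Ω) : incrSq Y u v ω ≤ n * (2 * K) ^ 2 := by
  have : incrSq Y u v ω ≤ ∑ _k : Fin n, (2 * K) ^ 2 :=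
    Finset.sum_le_sum fun k _ => sq_le_sq' (by linarith [(abs_le.1 (h.abs_coord_sub_le u v ω k)).1])
      (abs_le.1 (h.abs_coord_sub_le u v ω k)).2
  simpa using this

lemma intervalIntegrable_drift (k : Fin n) (ω : Ω) (u v : ℝ) :
    IntervalIntegrable (fun w => b k w ω) volume u v :=
  intervalIntegrable_of_measurable_bounded ((h.drift_measurable k).of_uncurry_right)
    (fun w => h.drift_le k w ω) u v

lemma intervalIntegrable_cov (k l : Fin n) (ω : Ω) (u v : ℝ) :
    IntervalIntegrable (fun w => a k l w ω) volume u v :=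
  intervalIntegrable_of_measurable_bounded ((h.cov_measurable k l).of_uncurry_right)
    (fun w => h.cov_le k l w ω) u v

lemma measurable_uncurry_value :
    Measurable (Function.uncurry fun (w : ℝ) ω => Y w.toNNReal ω) :=
  (measurable_uncurry_of_continuous_of_measurable h.continuous h.measurable_value).comp
    ((measurable_real_toNNReal.comp measurable_fst).prodMk measurable_snd)

lemma measurable_generator {φ : (Fin n → ℝ) → ℝ} (hφ : ContDiff ℝ 2 φ) :
    Measurable (Function.uncurry (itoGenerator φ Y b a)) := by
  have hY := h.measurable_uncurry_value
  refine (Finset.measurable_sum _ fun k _ => ?_).add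
    ((Finset.measurable_sum _ fun k _ => Finset.measurable_sum _ fun l _ => ?_).const_mul _)
  · exact ((continuous_partialDeriv hφ k).measurable.comp hY).mul (h.drift_measurable k)
  · exact (h.cov_measurable k l).mul ((continuous_partialDeriv₂ hφ k l).measurable.comp hY)

lemma exists_abs_generator_le {φ : (Fin n → ℝ) → ℝ} (hφ : ContDiff ℝ 2 φ) :
    ∃ M, 0 ≤ M ∧ ∀ w ω, |itoGenerator φ Y b a w ω| ≤ M := by
  choose L1 h10 h1 using fun k => exists_abs_le_of_continuous (continuous_partialDeriv hφ k) K
  choose L2 h20 h2 using fun k l => exists_abs_le_of_continuous (continuous_partialDeriv₂ hφ k l) K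
  refine ⟨∑ k, L1 k * |C| + 1 / 2 * ∑ k, ∑ l, |C| * L2 k l, ?_, fun w ω => ?_⟩
  · have := fun k => h10 k
    have := fun k l => h20 k l
    refine add_nonneg (Finset.sum_nonneg fun k _ => mul_nonneg (h10 k) (abs_nonneg _))
      (mul_nonneg (by norm_num) (Finset.sum_nonneg fun k _ => Finset.sum_nonneg fun l _ =>
        mul_nonneg (abs_nonneg _) (h20 k l)))
  · refine (abs_add_le _ _).trans (add_le_add ?_ ?_)
    · refine (Finset.abs_sum_le_sum_abs _ _).trans (Finset.sum_le_sum fun k _ => ?_)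
      rw [abs_mul]
      exact mul_le_mul (h1 k _ (h.norm_le _ _)) ((h.drift_le k w ω).trans (le_abs_self C))
        (abs_nonneg _) (h10 k)
    · rw [abs_mul, abs_of_nonneg (by norm_num : (0 : ℝ) ≤ 1 / 2)]
      refine mul_le_mul_of_nonneg_left ?_ (by norm_num)
      refine (Finset.abs_sum_le_sum_abs _ _).trans (Finset.sum_le_sum fun k _ => ?_)
      refine (Finset.abs_sum_le_sum_abs _ _).trans (Finset.sum_le_sum fun l _ => ?_)
      rw [abs_mul]
      exact mul_le_mul ((h.cov_le k l w ω).trans (le_abs_self C)) (h2 k l _ (h.norm_le _ _))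
        (abs_nonneg _) (abs_nonneg _)

lemma intervalIntegrable_generator {φ : (Fin n → ℝ) → ℝ} (hφ : ContDiff ℝ 2 φ) (ω : Ω) (u v : ℝ) :
    IntervalIntegrable (fun w => itoGenerator φ Y b a w ω) volume u v := by
  obtain ⟨M, -, hM⟩ := h.exists_abs_generator_le hφ
  exact intervalIntegrable_of_measurable_bounded ((h.measurable_generator hφ).of_uncurry_right)
    (fun w => hM w ω) u v

/-- The one-step estimate, in terms of moduli of continuity. -/
lemma abs_itoRemainder_le {φ : (Fin n → ℝ) → ℝ} (hφ : ContDiff ℝ 2 φ) {η δ L : ℝ} (hη : 0 ≤ η)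
    (hL : 0 ≤ L) (hC : 0 ≤ C)
    (h1 : ∀ k y z, ‖y‖ ≤ K → ‖z‖ ≤ K → ‖y - z‖ ≤ δ →
      |partialDeriv φ k y - partialDeriv φ k z| ≤ η)
    (h2 : ∀ k l y z, ‖y‖ ≤ K → ‖z‖ ≤ K → ‖y - z‖ ≤ δ →
      |partialDeriv₂ φ k l y - partialDeriv₂ φ k l z| ≤ η)
    (h2L : ∀ k l y, ‖y‖ ≤ K → |partialDeriv₂ φ k l y| ≤ L) {u v : ℝ≥0} (huv : u ≤ v) {ω : Ω}
    (hosc : ∀ w, u ≤ w → w ≤ v → ‖Y w ω - Y u ω‖ ≤ δ) :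
    |itoRemainder φ Y b a m u v ω| ≤ n * η * incrSq Y u v ω +
      ((v : ℝ) - u) * (n * n * L * C * (δ + ((v : ℝ) - u)) + η * C * (n + n * n)) := by
  have huv' : (u : ℝ) ≤ v := huv
  have hT := abs_taylor_remainder_le hφ (h.norm_le u ω) (h.norm_le v ω) (η := η)
    fun x hx hxd k l => h2 k l x _ hx (h.norm_le u ω) (hxd.trans (hosc v huv le_rfl))
  -- Three errors are separated: the Taylor remainder `T`, the deviation `e` of products of
  -- increments from their compensator and main part, and the error `D` from freezing the
  -- derivatives of φ at the left end point.
  set T := φ (Y v ω) - φ (Y u ω) - ∑ k, partialDeriv φ k (Y u ω) * (Y v ω k - Y u ω k) -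
      1 / 2 * ∑ k, ∑ l, partialDeriv₂ φ k l (Y u ω) *
        ((Y v ω k - Y u ω k) * (Y v ω l - Y u ω l)) with hTdef
  set e : Fin n → Fin n → ℝ := fun k l => (Y v ω k - Y u ω k) * (Y v ω l - Y u ω l) -
    (∫ w in (u : ℝ)..v, a k l w ω) - m k l u v ω with he
  set D : ℝ → ℝ := fun w => (∑ k, (partialDeriv φ k (Y u ω) -
      partialDeriv φ k (Y w.toNNReal ω)) * b k w ω) +
    1 / 2 * ∑ k, ∑ l, a k l w ω * (partialDeriv₂ φ k l (Y u ω) -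
      partialDeriv₂ φ k l (Y w.toNNReal ω)) with hD
  have hDint : ∫ w in (u : ℝ)..v, D w = (∑ k, partialDeriv φ k (Y u ω) *
      ∫ w in (u : ℝ)..v, b k w ω) + 1 / 2 * (∑ k, ∑ l, partialDeriv₂ φ k l (Y u ω) *
      ∫ w in (u : ℝ)..v, a k l w ω) - ∫ w in (u : ℝ)..v, itoGenerator φ Y b a w ω := by
    have e1 : ∀ w, D w = ((∑ k, partialDeriv φ k (Y u ω) * b k w ω) +
        1 / 2 * ∑ k, ∑ l, partialDeriv₂ φ k l (Y u ω) * a k l w ω) -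
        itoGenerator φ Y b a w ω := by
      intro w
      simp only [hD, itoGenerator, sub_mul, mul_sub, Finset.sum_sub_distrib]
      have : ∀ k l, a k l w ω * partialDeriv₂ φ k l (Y u ω) =
        partialDeriv₂ φ k l (Y u ω) * a k l w ω := fun k l => mul_comm _ _
      simp only [this]
      ring
    have ib := fun k => h.intervalIntegrable_drift k ω u v
    have ia := fun k l => h.intervalIntegrable_cov k l ω u v
    have i1 : IntervalIntegrable (fun w => ∑ k, partialDeriv φ k (Y u ω) * b k w ω) volume u v :=
      intervalIntegrable_sum fun k => (ib k).const_mul _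
    have i3 : ∀ k, IntervalIntegrable (fun w => ∑ l, partialDeriv₂ φ k l (Y u ω) * a k l w ω)
        volume u v := fun k => intervalIntegrable_sum fun l => (ia k l).const_mul _
    have i2 : IntervalIntegrable (fun w => ∑ k, ∑ l, partialDeriv₂ φ k l (Y u ω) * a k l w ω)
        volume u v := intervalIntegrable_sum i3
    simp only [e1]
    rw [intervalIntegral.integral_sub (i1.add (i2.const_mul _))
      (h.intervalIntegrable_generator hφ ω u v),
      intervalIntegral.integral_add i1 (i2.const_mul _), intervalIntegral.integral_const_mul,
      intervalIntegral.integral_finsetSum fun k _ => (ib k).const_mul _,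
      intervalIntegral.integral_finsetSum fun k _ => i3 k]
    simp only [intervalIntegral.integral_finsetSum fun l _ => (ia _ l).const_mul _,
      intervalIntegral.integral_const_mul]
  have hsplit : itoRemainder φ Y b a m u v ω = T +
      1 / 2 * (∑ k, ∑ l, partialDeriv₂ φ k l (Y u ω) * e k l) + ∫ w in (u : ℝ)..v, D w := by
    rw [hDint, hTdef, itoRemainder]
    simp only [he, mul_sub, Finset.sum_sub_distrib]
    ring
  have hδ : 0 ≤ δ := (norm_nonneg _).trans (hosc u le_rfl huv)
  have hvu : 0 ≤ (v : ℝ) - u := sub_nonneg.2 huv'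
  have he_le : |1 / 2 * (∑ k, ∑ l, partialDeriv₂ φ k l (Y u ω) * e k l)| ≤
      ((v : ℝ) - u) * (n * n * L * C * (δ + ((v : ℝ) - u))) := by
    have h3 : |∑ k, ∑ l, partialDeriv₂ φ k l (Y u ω) * e k l| ≤
        ∑ _k : Fin n, ∑ _l : Fin n, L * (C * ((v : ℝ) - u) * (δ + ((v : ℝ) - u))) := by
      refine (Finset.abs_sum_le_sum_abs _ _).trans (Finset.sum_le_sum fun k _ => ?_)
      refine (Finset.abs_sum_le_sum_abs _ _).trans (Finset.sum_le_sum fun l _ => ?_)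
      rw [abs_mul]
      exact mul_le_mul (h2L k l _ (h.norm_le u ω)) (h.error_le k l u v ω δ huv hosc)
        (abs_nonneg _) hL
    rw [abs_mul, abs_of_nonneg (by norm_num : (0 : ℝ) ≤ 1 / 2)]
    simp only [Finset.sum_const, Finset.card_univ, Fintype.card_fin, nsmul_eq_mul] at h3
    have h4 : (0 : ℝ) ≤ n * (n * (L * (C * ((v : ℝ) - u) * (δ + ((v : ℝ) - u))))) := by positivity
    calc _ ≤ 1 / 2 * (n * (n * (L * (C * ((v : ℝ) - u) * (δ + ((v : ℝ) - u)))))) := by linarith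
      _ ≤ n * (n * (L * (C * ((v : ℝ) - u) * (δ + ((v : ℝ) - u))))) := by linarith
      _ = _ := by ring
  have hD_le : |∫ w in (u : ℝ)..v, D w| ≤ (η * C * (n + n * n)) * ((v : ℝ) - u) := by
    refine abs_interval_integral_le huv' fun w hw1 hw2 => ?_
    have hw1' : u ≤ w.toNNReal := NNReal.le_toNNReal_of_coe_le hw1.le
    have hw2' : w.toNNReal ≤ v := Real.toNNReal_le_iff_le_coe.2 hw2
    have hY := hosc _ hw1' hw2'
    rw [norm_sub_rev] at hY
    have h3 : |∑ k, (partialDeriv φ k (Y u ω) - partialDeriv φ k (Y w.toNNReal ω)) * b k w ω| ≤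
        ∑ _k : Fin n, η * C := by
      refine (Finset.abs_sum_le_sum_abs _ _).trans (Finset.sum_le_sum fun k _ => ?_)
      rw [abs_mul]
      exact mul_le_mul (h1 k _ _ (h.norm_le _ _) (h.norm_le _ _) hY) (h.drift_le k w ω)
        (abs_nonneg _) hη
    have h4 : |∑ k, ∑ l, a k l w ω * (partialDeriv₂ φ k l (Y u ω) -
        partialDeriv₂ φ k l (Y w.toNNReal ω))| ≤ ∑ _k : Fin n, ∑ _l : Fin n, C * η := by
      refine (Finset.abs_sum_le_sum_abs _ _).trans (Finset.sum_le_sum fun k _ => ?_)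
      refine (Finset.abs_sum_le_sum_abs _ _).trans (Finset.sum_le_sum fun l _ => ?_)
      rw [abs_mul]
      exact mul_le_mul (h.cov_le k l w ω) (h2 k l _ _ (h.norm_le _ _) (h.norm_le _ _) hY)
        (abs_nonneg _) hC
    simp only [Finset.sum_const, Finset.card_univ, Fintype.card_fin, nsmul_eq_mul] at h3 h4
    refine (abs_add_le _ _).trans ?_
    rw [abs_mul, abs_of_nonneg (by norm_num : (0 : ℝ) ≤ 1 / 2)]
    have h5 : (0 : ℝ) ≤ n * (n * (C * η)) := by positivity
    calc _ ≤ n * (η * C) + 1 / 2 * (n * (n * (C * η))) := by linarith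
      _ ≤ n * (η * C) + n * (n * (C * η)) := by linarith
      _ = _ := by ring
  rw [hsplit]
  refine (abs_add_three _ _ _).trans ?_
  have : |T| ≤ n * η * incrSq Y u v ω := hT
  linarith

end BoundedSemimartingale

end Ito


/-! ### Moments of increments over a grid. -/

section ItoFormula

variable {Ω : Type*} {mΩ : MeasurableSpace Ω} {n : ℕ}

lemma integrable_of_abs_le {P : Measure Ω} [IsFiniteMeasure P] {X : Ω → ℝ} (hX : Measurable X)
    {M : ℝ} (hM : ∀ ω, |X ω| ≤ M) : Integrable X P :=
  Integrable.of_bound hX.aestronglyMeasurable M (ae_of_all _ hM)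

lemma exists_modulus {d : ℕ} {ι : Type*} [Finite ι] {ψ : ι → (Fin d → ℝ) → ℝ}
    (hψ : ∀ i, Continuous (ψ i)) (K : ℝ) {η : ℝ} (hη : 0 < η) :
    ∀ᶠ δ in 𝓝[>] (0 : ℝ), ∀ i y z, ‖y‖ ≤ K → ‖z‖ ≤ K → ‖y - z‖ ≤ δ → |ψ i y - ψ i z| ≤ η := by
  rw [eventually_all]
  intro i
  have := (isCompact_closedBall (0 : Fin d → ℝ) K).uniformContinuousOn_of_continuous
    (hψ i).continuousOn
  obtain ⟨δ, hδ, hδ'⟩ := Metric.uniformContinuousOn_iff.1 this η hη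
  filter_upwards [Ioo_mem_nhdsGT hδ] with δ' hδ1 y z hy hz hyz
  have := hδ' y (mem_closedBall_zero_iff.2 hy) z (mem_closedBall_zero_iff.2 hz)
    (by rw [dist_eq_norm]; exact hyz.trans_lt hδ1.2)
  exact this.le

/-- The `i`-th point of the grid with mesh `h` starting at `s`. -/
def gridPt (s h : ℝ≥0) (i : ℕ) : ℝ≥0 := s + i * h

lemma gridPt_zero (s h : ℝ≥0) : gridPt s h 0 = s := by simp [gridPt]

lemma gridPt_succ (s h : ℝ≥0) (i : ℕ) : gridPt s h (i + 1) = gridPt s h i + h := by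
  simp [gridPt]; ring

lemma gridPt_le_succ (s h : ℝ≥0) (i : ℕ) : gridPt s h i ≤ gridPt s h (i + 1) := by
  rw [gridPt_succ]; exact le_self_add

lemma gridPt_mono (s h : ℝ≥0) : Monotone (gridPt s h) := monotone_nat_of_le_succ (gridPt_le_succ s h)

lemma le_gridPt (s h : ℝ≥0) (i : ℕ) : s ≤ gridPt s h i := le_self_add

lemma gridPt_succ_sub (s h : ℝ≥0) (i : ℕ) :
    (gridPt s h (i + 1) : ℝ) - gridPt s h i = h := by
  rw [gridPt_succ]; simp

lemma gridPt_last {s t : ℝ≥0} (hst : s ≤ t) {N : ℕ} (hN : N ≠ 0) :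
    gridPt s ((t - s) / N) N = t := by
  rw [gridPt, mul_div_cancel₀ _ (by exact_mod_cast hN), add_tsub_cancel_of_le hst]

namespace BoundedSemimartingale

variable {𝔽 : Filtration ℝ≥0 mΩ} {P : Measure Ω} {Y : ℝ≥0 → Ω → Fin n → ℝ}
  {b : Fin n → ℝ → Ω → ℝ} {a : Fin n → Fin n → ℝ → Ω → ℝ}
  {m : Fin n → Fin n → ℝ≥0 → ℝ≥0 → Ω → ℝ} {K C : ℝ}
  (h : BoundedSemimartingale 𝔽 P Y b a m K C)

include h

lemma abs_main_le {u v : ℝ≥0} (huv : u ≤ v) (k l : Fin n) (ω : Ω) :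
    |m k l u v ω| ≤ (2 * K) ^ 2 + C * ((v : ℝ) - u) +
      C * ((v : ℝ) - u) * (2 * K + ((v : ℝ) - u)) := by
  have h1 := h.error_le k l u v ω (2 * K) huv fun w _ _ => h.norm_sub_le u w ω
  have h2 : |∫ w in (u : ℝ)..v, a k l w ω| ≤ C * ((v : ℝ) - u) :=
    abs_interval_integral_le huv fun w _ _ => h.cov_le k l w ω
  have h3 : |(Y v ω k - Y u ω k) * (Y v ω l - Y u ω l)| ≤ (2 * K) ^ 2 := by
    rw [abs_mul, sq]
    exact mul_le_mul (h.abs_coord_sub_le u v ω k) (h.abs_coord_sub_le u v ω l) (abs_nonneg _)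
      ((abs_nonneg _).trans (h.abs_coord_sub_le u v ω k))
  rw [abs_le] at *
  constructor <;> linarith [h1.1, h1.2, h2.1, h2.2, h3.1, h3.2]

lemma integral_mul_main [IsFiniteMeasure P] {u v : ℝ≥0} (huv : u ≤ v) (k l : Fin n) {Z : Ω → ℝ}
    (hZ : Measurable[𝔽 u] Z) {M : ℝ} (hM : ∀ ω, |Z ω| ≤ M) :
    Integrable (fun ω => Z ω * m k l u v ω) P ∧ ∫ ω, Z ω * m k l u v ω ∂P = 0 := by
  have hi := integrable_of_abs_le (P := P) (h.main_measurable k l u v) fun ω => h.abs_main_le huv k l ω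
  have hZi : Integrable (fun ω => Z ω * m k l u v ω) P :=
    hi.bdd_mul (hZ.mono (𝔽.le u) le_rfl).aestronglyMeasurable (ae_of_all _ hM)
  exact ⟨hZi, integral_mul_eq_zero_of_setIntegral (𝔽.le u) hi (h.main_mean k l u v huv) hZ hZi⟩

lemma measurable_drift_integral (k : Fin n) (u v : ℝ) :
    Measurable fun ω => ∫ w in u..v, b k w ω :=
  measurable_timeIntegral (h.drift_measurable k) _ _

lemma integral_mul_drift [IsFiniteMeasure P] {u v : ℝ≥0} (huv : u ≤ v) (k : Fin n) {Z : Ω → ℝ}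
    (hZ : Measurable[𝔽 u] Z) {M : ℝ} (hM : ∀ ω, |Z ω| ≤ M) :
    Integrable (fun ω => Z ω * (Y v ω k - Y u ω k - ∫ w in (u : ℝ)..v, b k w ω)) P ∧
    ∫ ω, Z ω * (Y v ω k - Y u ω k - ∫ w in (u : ℝ)..v, b k w ω) ∂P = 0 := by
  have hi : Integrable (fun ω => Y v ω k - Y u ω k - ∫ w in (u : ℝ)..v, b k w ω) P := by
    refine integrable_of_abs_le (((h.measurable_coord v k).sub (h.measurable_coord u k)).sub
      (h.measurable_drift_integral k u v)) (M := 2 * K + C * ((v : ℝ) - u)) fun ω => ?_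
    exact (abs_sub _ _).trans (add_le_add (h.abs_coord_sub_le u v ω k)
      (abs_interval_integral_le huv fun w _ _ => h.drift_le k w ω))
  have hZi := hi.bdd_mul (hZ.mono (𝔽.le u) le_rfl).aestronglyMeasurable (ae_of_all _ hM)
  exact ⟨hZi, integral_mul_eq_zero_of_setIntegral (𝔽.le u) hi (h.drift_mean k u v huv) hZ hZi⟩

lemma integrable_incrSq [IsFiniteMeasure P] (u v : ℝ≥0) : Integrable (incrSq Y u v) P :=
  integrable_of_abs_le (h.measurable_incrSq u v) fun ω => by
    rw [abs_of_nonneg (incrSq_nonneg _ _ _ _)]; exact h.incrSq_le u v ω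

/-- By `error_le` with k = l and the trivial oscillation bound 2K, a squared increment is at most a
multiple of v - u plus a term of conditional mean zero. The latter disappears against the weight
`Z`. -/
lemma integral_mul_incrSq_le [IsFiniteMeasure P] (hC : 0 ≤ C) {u v : ℝ≥0} (huv : u ≤ v) {D : ℝ}
    (hD : (v : ℝ) - u ≤ D) {Z : Ω → ℝ} (hZ : Measurable[𝔽 u] Z) (hZ0 : ∀ ω, 0 ≤ Z ω) {M : ℝ}
    (hM : ∀ ω, Z ω ≤ M) :
    ∫ ω, Z ω * incrSq Y u v ω ∂P ≤
      n * (C + C * (2 * K + D)) * ((v : ℝ) - u) * ∫ ω, Z ω ∂P := by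
  have hM' : ∀ ω, |Z ω| ≤ M := fun ω => by rw [abs_of_nonneg (hZ0 ω)]; exact hM ω
  have hZm := hZ.mono (𝔽.le u) le_rfl
  have hZi : Integrable Z P := integrable_of_abs_le hZm hM'
  have hvu : 0 ≤ (v : ℝ) - u := sub_nonneg.2 huv
  set c := n * (C + C * (2 * K + D)) * ((v : ℝ) - u) with hc
  have hpt : ∀ ω, incrSq Y u v ω ≤ c + ∑ k, m k k u v ω := by
    intro ω
    have h1 : ∀ k, (Y v ω k - Y u ω k) ^ 2 ≤
        (C + C * (2 * K + D)) * ((v : ℝ) - u) + m k k u v ω := by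
      intro k
      have h1 := (abs_le.1 (h.error_le k k u v ω (2 * K) huv fun w _ _ => h.norm_sub_le u w ω)).2
      have h2 : |∫ w in (u : ℝ)..v, a k k w ω| ≤ C * ((v : ℝ) - u) :=
        abs_interval_integral_le huv fun w _ _ => h.cov_le k k w ω
      have h3 := (abs_le.1 h2).2
      have h4 : C * ((v : ℝ) - u) * (2 * K + ((v : ℝ) - u)) ≤ C * ((v : ℝ) - u) * (2 * K + D) :=
        mul_le_mul_of_nonneg_left (by linarith) (mul_nonneg hC hvu)
      rw [sq]; nlinarith
    refine (Finset.sum_le_sum fun k _ => h1 k).trans (le_of_eq ?_)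
    rw [Finset.sum_add_distrib]
    simp [hc]; ring
  have hmi := fun k => h.integral_mul_main (P := P) huv k k hZ hM'
  calc ∫ ω, Z ω * incrSq Y u v ω ∂P ≤ ∫ ω, (Z ω * c + ∑ k, Z ω * m k k u v ω) ∂P := by
        refine integral_mono ((h.integrable_incrSq u v).bdd_mul hZm.aestronglyMeasurable
          (ae_of_all _ hM')) ((hZi.mul_const c).add (integrable_finsetSum _ fun k _ => (hmi k).1))
          fun ω => ?_
        simp only
        rw [← Finset.mul_sum, ← mul_add]
        exact mul_le_mul_of_nonneg_left (hpt ω) (hZ0 ω)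
    _ = c * ∫ ω, Z ω ∂P := by
        rw [integral_add (hZi.mul_const c) (integrable_finsetSum _ fun k _ => (hmi k).1),
          integral_finsetSum _ fun k _ => (hmi k).1, Finset.sum_eq_zero fun k _ => (hmi k).2,
          integral_mul_const, add_zero, mul_comm]

/-- Moments of the discrete quadratic variation. -/
lemma integral_sum_incrSq_le [IsFiniteMeasure P] (hC : 0 ≤ C) (hK : 0 ≤ K) (s : ℝ≥0) {D : ℝ}
    {η : ℝ≥0} {N : ℕ} (hD : N * (η : ℝ) ≤ D) (hη : (η : ℝ) ≤ D) (c : ℝ)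
    (hc : c = n * (C + C * (2 * K + D))) :
    (∀ j ≤ N, ∫ ω, ∑ i ∈ Finset.range j, incrSq Y (gridPt s η i) (gridPt s η (i + 1)) ω ∂P ≤
      j * (c * η * P.real Set.univ)) ∧
    ∀ j ≤ N, ∫ ω, (∑ i ∈ Finset.range j, incrSq Y (gridPt s η i) (gridPt s η (i + 1)) ω) ^ 2 ∂P ≤
      j * (η * (2 * c * (D * c * P.real Set.univ) +
        n * (2 * K) ^ 2 * c * P.real Set.univ)) := by
  set S : ℕ → Ω → ℝ := fun j ω =>
    ∑ i ∈ Finset.range j, incrSq Y (gridPt s η i) (gridPt s η (i + 1)) ω with hS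
  have hD0 : 0 ≤ D := le_trans (by positivity) hη
  have hc0 : 0 ≤ c := by rw [hc]; positivity
  have hSm : ∀ j, Measurable[𝔽 (gridPt s η j)] (S j) := fun j =>
    Finset.measurable_sum _ fun i hi =>
      h.incrSq_adapted (gridPt_mono s η (Finset.mem_range.1 hi).le)
        (gridPt_mono s η (Finset.mem_range.1 hi))
  have hS0 : ∀ j ω, 0 ≤ S j ω := fun j ω => Finset.sum_nonneg fun _ _ => incrSq_nonneg _ _ _ _
  have hSM : ∀ j ω, S j ω ≤ j * (n * (2 * K) ^ 2) := fun j ω => by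
    refine (Finset.sum_le_sum fun i _ => h.incrSq_le _ _ ω).trans (le_of_eq ?_)
    simp
  have hSabs : ∀ j ω, |S j ω| ≤ j * (n * (2 * K) ^ 2) := fun j ω => by
    rw [abs_of_nonneg (hS0 j ω)]; exact hSM j ω
  have hSm' : ∀ j, Measurable (S j) := fun j => (hSm j).mono (𝔽.le _) le_rfl
  have hSi : ∀ j, Integrable (S j) P := fun j => integrable_of_abs_le (hSm' j) (hSabs j)
  have hp0 : 0 ≤ P.real Set.univ := measureReal_nonneg
  have step : ∀ j (Z : Ω → ℝ) (M : ℝ), Measurable[𝔽 (gridPt s η j)] Z → (∀ ω, 0 ≤ Z ω) →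
      (∀ ω, Z ω ≤ M) → ∫ ω, Z ω * incrSq Y (gridPt s η j) (gridPt s η (j + 1)) ω ∂P ≤
        c * η * ∫ ω, Z ω ∂P := by
    intro j Z M hZ hZ0 hZM
    have := h.integral_mul_incrSq_le (P := P) hC (gridPt_le_succ s η j) (D := D)
      (by rwa [gridPt_succ_sub]) hZ hZ0 hZM
    rwa [gridPt_succ_sub, ← hc] at this
  have hone : ∀ j, ∫ ω, incrSq Y (gridPt s η j) (gridPt s η (j + 1)) ω ∂P ≤
      c * η * P.real Set.univ := fun j => by
    have := step j (fun _ => 1) 1 measurable_const (fun _ => zero_le_one) fun _ => le_rfl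
    simpa using this
  have hfirst : ∀ j ≤ N, ∫ ω, S j ω ∂P ≤ j * (c * η * P.real Set.univ) := by
    intro j _
    induction j with
    | zero => simp [hS]
    | succ j ih =>
      have e : ∀ ω, S (j + 1) ω = S j ω + incrSq Y (gridPt s η j) (gridPt s η (j + 1)) ω :=
        fun ω => Finset.sum_range_succ _ _
      simp only [e]
      rw [integral_add (hSi j) (h.integrable_incrSq _ _)]
      have := ih (by omega)
      push_cast
      linarith [hone j]
  refine ⟨hfirst, fun j hj => ?_⟩
  change ∫ ω, S j ω ^ 2 ∂P ≤ _
  induction j with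
  | zero => simp [hS]
  | succ j ih =>
    set d := incrSq Y (gridPt s η j) (gridPt s η (j + 1)) with hd
    have hdi : Integrable d P := h.integrable_incrSq _ _
    have hd0 : ∀ ω, 0 ≤ d ω := fun ω => incrSq_nonneg _ _ _ _
    have hdM : ∀ ω, d ω ≤ n * (2 * K) ^ 2 := fun ω => h.incrSq_le _ _ ω
    -- In (S + d)² = S² + 2Sd + d² the last square is at most the uniform bound of `d` times `d`.
    -- The cross term is estimated by `step` with the weight `S j`, so the second moment stays
    -- bounded as the mesh shrinks.
    have e : ∀ ω, S (j + 1) ω ^ 2 ≤ S j ω ^ 2 + (2 * (S j ω * d ω) + n * (2 * K) ^ 2 * d ω) := by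
      intro ω
      have : S (j + 1) ω = S j ω + d ω := Finset.sum_range_succ _ _
      rw [this]
      nlinarith [hd0 ω, hdM ω, mul_nonneg (hd0 ω) (sub_nonneg.2 (hdM ω))]
    have i1 : ∀ j, Integrable (fun ω => S j ω ^ 2) P := fun j =>
      integrable_of_abs_le ((hSm' j).pow_const 2) (M := (j * (n * (2 * K) ^ 2)) ^ 2) fun ω => by
        rw [abs_pow]; exact pow_le_pow_left₀ (abs_nonneg _) (hSabs j ω) 2
    have i2 : Integrable (fun ω => S j ω * d ω) P :=
      hdi.bdd_mul (hSm' j).aestronglyMeasurable (ae_of_all _ (hSabs j))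
    have i3 : Integrable (fun ω => 2 * (S j ω * d ω)) P := i2.const_mul 2
    have i4 : Integrable (fun ω => n * (2 * K) ^ 2 * d ω) P := hdi.const_mul _
    have i5 : Integrable (fun ω => 2 * (S j ω * d ω) + n * (2 * K) ^ 2 * d ω) P := i3.add i4
    have h1 := step j (S j) _ (hSm j) (hS0 j) (hSM j)
    have hj' : (j : ℝ) * η ≤ D := by
      refine le_trans (mul_le_mul_of_nonneg_right ?_ η.2) hD
      exact_mod_cast (by omega : j ≤ N)
    have h2 : c * η * ∫ ω, S j ω ∂P ≤ c * η * (D * c * P.real Set.univ) := by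
      refine mul_le_mul_of_nonneg_left ((hfirst j (by omega)).trans ?_) (by positivity)
      calc (j : ℝ) * (c * η * P.real Set.univ) = (j * η) * (c * P.real Set.univ) := by ring
        _ ≤ D * (c * P.real Set.univ) := mul_le_mul_of_nonneg_right hj' (by positivity)
        _ = _ := by ring
    calc ∫ ω, S (j + 1) ω ^ 2 ∂P
        ≤ ∫ ω, (S j ω ^ 2 + (2 * (S j ω * d ω) + n * (2 * K) ^ 2 * d ω)) ∂P :=
          integral_mono (i1 (j + 1)) ((i1 j).add i5) e
      _ = ∫ ω, S j ω ^ 2 ∂P + (2 * ∫ ω, S j ω * d ω ∂P + n * (2 * K) ^ 2 * ∫ ω, d ω ∂P) := by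
          rw [integral_add (i1 j) i5, integral_add i3 i4, integral_const_mul, integral_const_mul]
      _ ≤ j * (η * (2 * c * (D * c * P.real Set.univ) + n * (2 * K) ^ 2 * c * P.real Set.univ)) +
          (2 * (c * η * (D * c * P.real Set.univ)) +
            n * (2 * K) ^ 2 * (c * η * P.real Set.univ)) := by
          refine add_le_add (ih (by omega)) (add_le_add ?_ ?_)
          · linarith
          · exact mul_le_mul_of_nonneg_left (hone j) (by positivity)
      _ = _ := by push_cast; ring

/-- The terms subtracted in `itoRemainder` are bounded variables known at time `u` times variables
of conditional mean zero, so they do not contribute on an event known at time `s ≤ u`. -/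
lemma setIntegral_remainder [IsFiniteMeasure P] {φ : (Fin n → ℝ) → ℝ} (hφ : ContDiff ℝ 2 φ)
    {s u v : ℝ≥0} (hsu : s ≤ u) (huv : u ≤ v) {B : Set Ω} (hB : MeasurableSet[𝔽 s] B) :
    Integrable (fun ω => φ (Y v ω) - φ (Y u ω) - ∫ w in (u : ℝ)..v, itoGenerator φ Y b a w ω) P ∧
    Integrable (itoRemainder φ Y b a m u v) P ∧
    ∫ ω in B, (φ (Y v ω) - φ (Y u ω) - ∫ w in (u : ℝ)..v, itoGenerator φ Y b a w ω) ∂P =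
      ∫ ω in B, itoRemainder φ Y b a m u v ω ∂P := by
  obtain ⟨L, -, hL⟩ := exists_abs_le_of_continuous hφ.continuous K
  obtain ⟨M, -, hM⟩ := h.exists_abs_generator_le hφ
  choose L1 h10 h1 using fun k => exists_abs_le_of_continuous (continuous_partialDeriv hφ k) K
  choose L2 h20 h2 using fun k l => exists_abs_le_of_continuous (continuous_partialDeriv₂ hφ k l) K
  have hY := h.measurable_value
  have hBu := 𝔽.mono hsu B hB
  have hi0 : Integrable (fun ω => φ (Y v ω) - φ (Y u ω) -
      ∫ w in (u : ℝ)..v, itoGenerator φ Y b a w ω) P := by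
    refine integrable_of_abs_le (((hφ.continuous.measurable.comp (hY v)).sub
      (hφ.continuous.measurable.comp (hY u))).sub
      (measurable_timeIntegral (h.measurable_generator hφ) u v))
      (M := L + L + M * ((v : ℝ) - u)) fun ω => ?_
    refine (abs_sub _ _).trans (add_le_add ((abs_sub _ _).trans
      (add_le_add (hL _ (h.norm_le _ _)) (hL _ (h.norm_le _ _)))) ?_)
    exact abs_interval_integral_le huv fun w _ _ => hM w ω
  have hYu : Measurable[𝔽 u] (Y u) := h.adapted u
  have hA : ∀ k, Integrable (fun ω => partialDeriv φ k (Y u ω) *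
      (Y v ω k - Y u ω k - ∫ w in (u : ℝ)..v, b k w ω)) P := fun k =>
    (h.integral_mul_drift (P := P) huv k
      ((continuous_partialDeriv hφ k).measurable.comp hYu) (fun ω => h1 k _ (h.norm_le u ω))).1
  have hA2 : ∀ k l, Integrable (fun ω => partialDeriv₂ φ k l (Y u ω) * m k l u v ω) P :=
    fun k l => (h.integral_mul_main (P := P) huv k l
      ((continuous_partialDeriv₂ hφ k l).measurable.comp hYu)
      (fun ω => h2 k l _ (h.norm_le u ω))).1
  have hind : ∀ {ψ : (Fin n → ℝ) → ℝ} {L : ℝ}, Continuous ψ → (∀ y, ‖y‖ ≤ K → |ψ y| ≤ L) →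
      Measurable[𝔽 u] (B.indicator fun ω => ψ (Y u ω)) ∧
        ∀ ω, |B.indicator (fun ω => ψ (Y u ω)) ω| ≤ |L| := by
    intro ψ L hψ hψL
    refine ⟨(hψ.measurable.comp hYu).indicator hBu, fun ω => ?_⟩
    by_cases hω : ω ∈ B
    · rw [Set.indicator_of_mem hω]
      exact (hψL _ (h.norm_le u ω)).trans (le_abs_self L)
    · rw [Set.indicator_of_notMem hω]; simp
  have hmulind : ∀ (ψ X : Ω → ℝ), ∫ ω in B, ψ ω * X ω ∂P = ∫ ω, B.indicator ψ ω * X ω ∂P := by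
    intro ψ X
    rw [← integral_indicator (𝔽.le u B hBu)]
    congr 1; ext ω
    by_cases hω : ω ∈ B <;> simp [hω]
  have hB1 : ∀ k, ∫ ω in B, partialDeriv φ k (Y u ω) *
      (Y v ω k - Y u ω k - ∫ w in (u : ℝ)..v, b k w ω) ∂P = 0 := by
    intro k
    obtain ⟨hm, hb⟩ := hind (continuous_partialDeriv hφ k) (h1 k)
    rw [hmulind]
    exact (h.integral_mul_drift (P := P) huv k hm hb).2
  have hB2 : ∀ k l, ∫ ω in B, partialDeriv₂ φ k l (Y u ω) * m k l u v ω ∂P = 0 := by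
    intro k l
    obtain ⟨hm, hb⟩ := hind (continuous_partialDeriv₂ hφ k l) (h2 k l)
    rw [hmulind]
    exact (h.integral_mul_main (P := P) huv k l hm hb).2
  have hi1 : Integrable (fun ω => ∑ k, partialDeriv φ k (Y u ω) *
      (Y v ω k - Y u ω k - ∫ w in (u : ℝ)..v, b k w ω)) P :=
    integrable_finsetSum _ fun k _ => hA k
  have hi2' : ∀ k, Integrable (fun ω => ∑ l, partialDeriv₂ φ k l (Y u ω) * m k l u v ω) P :=
    fun k => integrable_finsetSum _ fun l _ => hA2 k l
  have hi2 : Integrable (fun ω => 1 / 2 * ∑ k, ∑ l, partialDeriv₂ φ k l (Y u ω) * m k l u v ω) P :=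
    (integrable_finsetSum _ fun k _ => hi2' k).const_mul _
  refine ⟨hi0, (hi0.sub hi1).sub hi2, ?_⟩
  have hi01 : Integrable (fun ω => (φ (Y v ω) - φ (Y u ω) -
      ∫ w in (u : ℝ)..v, itoGenerator φ Y b a w ω) - ∑ k, partialDeriv φ k (Y u ω) *
      (Y v ω k - Y u ω k - ∫ w in (u : ℝ)..v, b k w ω)) P := hi0.sub hi1
  have e : ∫ ω in B, itoRemainder φ Y b a m u v ω ∂P =
      ∫ ω in B, (φ (Y v ω) - φ (Y u ω) - ∫ w in (u : ℝ)..v, itoGenerator φ Y b a w ω) ∂P -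
      ∫ ω in B, (∑ k, partialDeriv φ k (Y u ω) *
        (Y v ω k - Y u ω k - ∫ w in (u : ℝ)..v, b k w ω)) ∂P -
      ∫ ω in B, (1 / 2 * ∑ k, ∑ l, partialDeriv₂ φ k l (Y u ω) * m k l u v ω) ∂P := by
    rw [← integral_sub hi0.integrableOn hi1.integrableOn,
      ← integral_sub hi01.integrableOn hi2.integrableOn]
    rfl
  rw [e, integral_finsetSum _ fun k _ => (hA k).integrableOn,
    Finset.sum_eq_zero fun k _ => hB1 k, integral_const_mul,
    integral_finsetSum _ fun k _ => (hi2' k).integrableOn]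
  rw [Finset.sum_eq_zero fun k _ => ?_]
  · simp
  · rw [integral_finsetSum _ fun l _ => (hA2 k l).integrableOn,
      Finset.sum_eq_zero fun l _ => hB2 k l]

end BoundedSemimartingale

end ItoFormula


/-! ### Oscillation over grid cells and the limit of vanishing mesh. -/

section ItoFormula

variable {Ω : Type*} {mΩ : MeasurableSpace Ω} {n : ℕ}

/-- The paths that oscillate by more than `δ` in one of the first `N` cells of the grid. -/
def oscSet (Y : ℝ≥0 → Ω → Fin n → ℝ) (s h : ℝ≥0) (N : ℕ) (δ : ℝ) : Set Ω :=
  -- Clamping a dense sequence of times into the cell gives a countable, hence measurable, union. By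
  -- continuity no oscillation is missed.
  ⋃ i : Fin N, ⋃ j : ℕ, {ω | δ < ‖Y (max (gridPt s h i)
    (min (TopologicalSpace.denseSeq ℝ≥0 j) (gridPt s h (i + 1)))) ω - Y (gridPt s h i) ω‖}

lemma norm_sub_le_of_notMem_oscSet {Y : ℝ≥0 → Ω → Fin n → ℝ} {ω : Ω}
    (hY : Continuous fun u => Y u ω) {s h : ℝ≥0} {N : ℕ} {δ : ℝ} (hω : ω ∉ oscSet Y s h N δ)
    {i : ℕ} (hi : i < N) {w : ℝ≥0} (h1 : gridPt s h i ≤ w) (h2 : w ≤ gridPt s h (i + 1)) :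
    ‖Y w ω - Y (gridPt s h i) ω‖ ≤ δ := by
  have hcl : IsClosed {w : ℝ≥0 | ‖Y (max (gridPt s h i) (min w (gridPt s h (i + 1)))) ω -
      Y (gridPt s h i) ω‖ ≤ δ} := by
    refine isClosed_le ?_ continuous_const
    have : Continuous fun w : ℝ≥0 => Y (max (gridPt s h i) (min w (gridPt s h (i + 1)))) ω :=
      hY.comp (by fun_prop)
    fun_prop
  have hsub : Set.range (TopologicalSpace.denseSeq ℝ≥0) ⊆ {w : ℝ≥0 |
      ‖Y (max (gridPt s h i) (min w (gridPt s h (i + 1)))) ω - Y (gridPt s h i) ω‖ ≤ δ} := by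
    rintro _ ⟨j, rfl⟩
    by_contra hj
    refine hω (Set.mem_iUnion.2 ⟨⟨i, hi⟩, Set.mem_iUnion.2 ⟨j, ?_⟩⟩)
    rw [Set.mem_ofPred_eq] at hj ⊢
    exact not_le.1 hj
  have := closure_minimal hsub hcl
  rw [(TopologicalSpace.denseRange_denseSeq ℝ≥0).closure_range] at this
  have hw := this (Set.mem_univ w)
  simpa [min_eq_left h2, max_eq_right h1] using hw

/-- This is uniform continuity of the path on [s, t]. -/
lemma eventually_notMem_oscSet {Y : ℝ≥0 → Ω → Fin n → ℝ} {ω : Ω}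
    (hY : Continuous fun u => Y u ω) {s t : ℝ≥0} (hst : s ≤ t) {δ : ℝ} (hδ : 0 < δ) :
    ∀ᶠ N : ℕ in atTop, ω ∉ oscSet Y s ((t - s) / N) N δ := by
  have huc := (isCompact_Icc (a := s) (b := t)).uniformContinuousOn_of_continuous hY.continuousOn
  obtain ⟨ρ, hρ, hρ'⟩ := Metric.uniformContinuousOn_iff.1 huc δ hδ
  have hlim : Tendsto (fun N : ℕ => (t - s) / (N : ℝ≥0)) atTop (𝓝 0) :=
    tendsto_const_div_atTop_nhds_zero_nat _
  have hev : ∀ᶠ N : ℕ in atTop, (((t - s) / (N : ℝ≥0) : ℝ≥0) : ℝ) < ρ := by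
    have := (NNReal.continuous_coe.tendsto 0).comp hlim
    exact this.eventually (gt_mem_nhds hρ)
  filter_upwards [hev, eventually_ne_atTop 0] with N hN hN0 hmem
  obtain ⟨i, hi⟩ := Set.mem_iUnion.1 hmem
  obtain ⟨j, hj⟩ := Set.mem_iUnion.1 hi
  set h := (t - s) / (N : ℝ≥0) with hh
  set w := max (gridPt s h i) (min (TopologicalSpace.denseSeq ℝ≥0 j) (gridPt s h (i + 1))) with hw
  have hlast : gridPt s h N = t := gridPt_last hst hN0
  have hw1 : gridPt s h i ≤ w := le_max_left _ _
  have hw2 : w ≤ gridPt s h (i + 1) := max_le (gridPt_le_succ s h i) (min_le_right _ _)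
  have hit : gridPt s h (i + 1) ≤ t := by rw [← hlast]; exact gridPt_mono s h i.2
  have hd : dist w (gridPt s h i) < ρ := by
    rw [NNReal.dist_eq, abs_of_nonneg (sub_nonneg.2 (NNReal.coe_le_coe.2 hw1))]
    have := NNReal.coe_le_coe.2 hw2
    have h3 := gridPt_succ_sub s h i
    linarith
  have := hρ' w ⟨(le_gridPt s h i).trans hw1, hw2.trans hit⟩ (gridPt s h i)
    ⟨le_gridPt s h i, (gridPt_le_succ s h i).trans hit⟩ hd
  rw [dist_eq_norm] at this
  exact absurd hj (not_lt.2 this.le)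

namespace BoundedSemimartingale

variable {𝔽 : Filtration ℝ≥0 mΩ} {P : Measure Ω} {Y : ℝ≥0 → Ω → Fin n → ℝ}
  {b : Fin n → ℝ → Ω → ℝ} {a : Fin n → Fin n → ℝ → Ω → ℝ}
  {m : Fin n → Fin n → ℝ≥0 → ℝ≥0 → Ω → ℝ} {K C : ℝ}
  (h : BoundedSemimartingale 𝔽 P Y b a m K C)

include h

lemma measurableSet_oscSet (s ρ : ℝ≥0) (N : ℕ) (δ : ℝ) : MeasurableSet (oscSet Y s ρ N δ) :=
  MeasurableSet.iUnion fun _ => MeasurableSet.iUnion fun _ =>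
    measurableSet_lt measurable_const ((h.measurable_value _).sub (h.measurable_value _)).norm

set_option maxHeartbeats 2000000 in
/-- Itô's formula in mean. -/
theorem ito_formula [IsFiniteMeasure P] (hC : 0 ≤ C) (hK : 0 ≤ K) {φ : (Fin n → ℝ) → ℝ}
    (hφ : ContDiff ℝ 2 φ) {s t : ℝ≥0} (hst : s ≤ t) {B : Set Ω} (hB : MeasurableSet[𝔽 s] B) :
    ∫ ω in B, (φ (Y t ω) - φ (Y s ω) - ∫ w in (s : ℝ)..t, itoGenerator φ Y b a w ω) ∂P = 0 := by
  choose L1 h10 h1 using fun k => exists_abs_le_of_continuous (continuous_partialDeriv hφ k) K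
  choose L2 h20 h2 using fun k l => exists_abs_le_of_continuous (continuous_partialDeriv₂ hφ k l) K
  set L : ℝ := (∑ k, L1 k) + ∑ k, ∑ l, L2 k l with hLdef
  have hs1 : 0 ≤ ∑ k, L1 k := Finset.sum_nonneg fun k _ => h10 k
  have hs2 : 0 ≤ ∑ k, ∑ l, L2 k l :=
    Finset.sum_nonneg fun k _ => Finset.sum_nonneg fun l _ => h20 k l
  have hL0 : 0 ≤ L := add_nonneg hs1 hs2
  have hL1 : ∀ k y, ‖y‖ ≤ K → |partialDeriv φ k y| ≤ L := fun k y hy =>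
    (h1 k y hy).trans ((Finset.single_le_sum (fun k _ => h10 k) (Finset.mem_univ k)).trans
      (le_add_of_nonneg_right hs2))
  have hL2 : ∀ k l y, ‖y‖ ≤ K → |partialDeriv₂ φ k l y| ≤ L := fun k l y hy =>
    (h2 k l y hy).trans (((Finset.single_le_sum (fun l _ => h20 k l) (Finset.mem_univ l)).trans
      (Finset.single_le_sum (f := fun k => ∑ l, L2 k l)
        (fun k _ => Finset.sum_nonneg fun l _ => h20 k l) (Finset.mem_univ k))).trans
      (le_add_of_nonneg_left hs1))
  set D : ℝ := (t : ℝ) - s with hD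
  have hD0 : 0 ≤ D := sub_nonneg.2 hst
  set p : ℝ := P.real Set.univ with hp
  have hp0 : 0 ≤ p := measureReal_nonneg
  set c : ℝ := n * (C + C * (2 * K + D)) with hc
  have hc0 : 0 ≤ c := by positivity
  set c2 : ℝ := D * (2 * c * (D * c * p) + n * (2 * K) ^ 2 * c * p) with hc2
  set c3 : ℝ := 2 * (n * n * L * C) + C * (n + n * n) with hc3
  have hc30 : 0 ≤ c3 := by positivity
  set c4 : ℝ := n * (2 * L) + n * n * L * C * (2 * K + 1) + 2 * L * C * (n + n * n) with hc4
  have hc40 : 0 ≤ c4 := by positivity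
  set I := ∫ ω in B, (φ (Y t ω) - φ (Y s ω) -
    ∫ w in (s : ℝ)..t, itoGenerator φ Y b a w ω) ∂P with hI
  -- All constants are independent of η. For fixed η the mesh tends to 0 first, which removes the
  -- exceptional set; then η tends to 0.
  have main : ∀ η : ℝ, 0 < η → η ≤ 1 →
      |I| ≤ η * (n * (D * c * p) + D * c3 * p + c4 * (c2 + D ^ 2 * p)) := by
    intro η hη hη1
    have hIoo : ∀ᶠ δ in 𝓝[>] (0 : ℝ), δ ∈ Set.Ioo 0 η := Ioo_mem_nhdsGT hη
    obtain ⟨δ, ⟨hδ1, hδ2⟩, hδη⟩ := (((exists_modulus (continuous_partialDeriv hφ) K hη).and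
      (exists_modulus (ψ := fun q : Fin n × Fin n => partialDeriv₂ φ q.1 q.2)
        (fun q => continuous_partialDeriv₂ hφ q.1 q.2) K hη)).and
      hIoo).exists
    have hδ0 : 0 < δ := hδη.1
    have hbound : ∀ N : ℕ, N ≠ 0 → (((t - s) / (N : ℝ≥0) : ℝ≥0) : ℝ) ≤ η →
        |I| ≤ η * (n * (D * c * p) + D * c3 * p + c4 * (c2 + D ^ 2 * p)) + c4 / (2 * η) *
          ∫ ω, (oscSet Y s ((t - s) / N) N δ).indicator 1 ω ∂P := by
      intro N hN hNη
      set ρ : ℝ≥0 := (t - s) / N with hρ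
      have hNρ : N * (ρ : ℝ) = D := by
        rw [hρ, NNReal.coe_div, NNReal.coe_sub hst, NNReal.coe_natCast,
          mul_div_cancel₀ _ (by exact_mod_cast hN)]
      have hρD : (ρ : ℝ) ≤ D := by
        rw [← hNρ]
        refine le_mul_of_one_le_left ρ.2 ?_
        exact_mod_cast Nat.one_le_iff_ne_zero.2 hN
      have hlast : gridPt s ρ N = t := gridPt_last hst hN
      set A := oscSet Y s ρ N δ with hA
      have hAm : MeasurableSet A := h.measurableSet_oscSet s ρ N δ
      set Q : ℕ → Ω → ℝ := fun i => itoRemainder φ Y b a m (gridPt s ρ i) (gridPt s ρ (i + 1))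
      set d : ℕ → Ω → ℝ := fun i => incrSq Y (gridPt s ρ i) (gridPt s ρ (i + 1)) with hd
      set S : Ω → ℝ := fun ω => ∑ i ∈ Finset.range N, d i ω with hS
      have hd0 : ∀ i ω, 0 ≤ d i ω := fun i ω => incrSq_nonneg _ _ _ _
      have hS0 : ∀ ω, 0 ≤ S ω := fun ω => Finset.sum_nonneg fun i _ => hd0 i ω
      have hrem := fun i => h.setIntegral_remainder (P := P) hφ (le_gridPt s ρ i)
        (gridPt_le_succ s ρ i) hB
      -- The increments and the integrals telescope over the grid, and on each cell only the Itô
      -- remainder has a nonzero mean.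
      have hIsum : I = ∫ ω in B, ∑ i ∈ Finset.range N, Q i ω ∂P := by
        rw [integral_finsetSum _ fun i _ => (hrem i).2.1.integrableOn,
          ← Finset.sum_congr rfl fun i _ => (hrem i).2.2,
          ← integral_finsetSum _ fun i _ => (hrem i).1.integrableOn, hI]
        congr 1
        ext ω
        have e1 := Finset.sum_range_sub (fun i => φ (Y (gridPt s ρ i) ω)) N
        have e2 := intervalIntegral.sum_integral_adjacent_intervals (n := N)
          (a := fun i => ((gridPt s ρ i : ℝ≥0) : ℝ)) (μ := volume)
          fun k _ => h.intervalIntegrable_generator hφ ω (gridPt s ρ k) (gridPt s ρ (k + 1))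
        simp only [hlast, gridPt_zero] at e1 e2
        rw [Finset.sum_sub_distrib, e1, e2]
      have hgood : ∀ ω ∉ A, ∀ i < N, |Q i ω| ≤ η * (n * d i ω + ρ * c3) := by
        intro ω hω i hi
        have := h.abs_itoRemainder_le hφ hη.le hL0 hC hδ1 (fun k l => hδ2 (k, l)) hL2
          (gridPt_le_succ s ρ i) (fun w h1 h2 =>
            norm_sub_le_of_notMem_oscSet (h.continuous ω) hω hi h1 h2)
        rw [gridPt_succ_sub] at this
        refine this.trans ?_
        have h3 : n * n * L * C * (δ + ρ) ≤ n * n * L * C * (η + η) :=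
          mul_le_mul_of_nonneg_left (add_le_add hδη.2.le hNη) (by positivity)
        have h4 : (ρ : ℝ) * (n * n * L * C * (δ + ρ) + η * C * (n + n * n)) ≤
            ρ * (n * n * L * C * (η + η) + η * C * (n + n * n)) :=
          mul_le_mul_of_nonneg_left (by linarith) ρ.2
        have h5 : n * η * d i ω + ρ * (n * n * L * C * (η + η) + η * C * (n + n * n)) =
          η * (n * d i ω + ρ * c3) := by rw [hc3]; ring
        rw [← h5]
        exact add_le_add le_rfl h4
      -- Without control of the oscillation the trivial moduli 2L and 2K are used; ρ ≤ η ≤ 1 allows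
      -- a constant independent of the mesh.
      have hall : ∀ ω, ∀ i < N, |Q i ω| ≤ c4 * (d i ω + ρ) := by
        intro ω i _
        have := h.abs_itoRemainder_le hφ (η := 2 * L) (δ := 2 * K) (by positivity) hL0 hC
          (fun k y z hy hz _ => (abs_sub _ _).trans (by linarith [hL1 k y hy, hL1 k z hz]))
          (fun k l y z hy hz _ => (abs_sub _ _).trans (by linarith [hL2 k l y hy, hL2 k l z hz]))
          hL2 (gridPt_le_succ s ρ i) (fun w _ _ => h.norm_sub_le _ w ω)
        rw [gridPt_succ_sub] at this
        refine this.trans ?_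
        have h3 : n * n * L * C * (2 * K + ρ) ≤ n * n * L * C * (2 * K + 1) :=
          mul_le_mul_of_nonneg_left (by linarith) (by positivity)
        have h4 : (ρ : ℝ) * (n * n * L * C * (2 * K + ρ) + 2 * L * C * (n + n * n)) ≤ ρ * c4 := by
          refine mul_le_mul_of_nonneg_left ?_ ρ.2
          have : 0 ≤ n * (2 * L) := by positivity
          linarith
        have h5 : n * (2 * L) * d i ω ≤ c4 * d i ω := by
          refine mul_le_mul_of_nonneg_right ?_ (hd0 i ω)
          have h6 : 0 ≤ n * n * L * C * (2 * K + 1) := by positivity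
          have h7 : 0 ≤ 2 * L * C * (n + n * n) := by positivity
          linarith
        calc _ ≤ c4 * d i ω + ρ * c4 := add_le_add h5 h4
          _ = _ := by ring
      have hpt : ∀ ω, |∑ i ∈ Finset.range N, Q i ω| ≤ η * (n * S ω + D * c3) +
          c4 * (η * (S ω ^ 2 + D ^ 2) + A.indicator 1 ω / (2 * η)) := by
        intro ω
        by_cases hω : ω ∈ A
        · have h3 : |∑ i ∈ Finset.range N, Q i ω| ≤ c4 * (S ω + D) := by
            refine (Finset.abs_sum_le_sum_abs _ _).trans ((Finset.sum_le_sum fun i hi =>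
              hall ω i (Finset.mem_range.1 hi)).trans (le_of_eq ?_))
            rw [← Finset.mul_sum, Finset.sum_add_distrib, Finset.sum_const, Finset.card_range,
              nsmul_eq_mul, hNρ]
          -- Young's inequality x ≤ (η/2) x² + 1/(2η) trades the crude bound on the exceptional set
          -- for the second moment, which is bounded in N, and for the probability of that set.
          have h4 : S ω + D ≤ η * (S ω ^ 2 + D ^ 2) + A.indicator 1 ω / (2 * η) := by
            rw [Set.indicator_of_mem hω, Pi.one_apply]
            have h6 : S ω + D ≤ η / 2 * (S ω + D) ^ 2 + 1 / (2 * η) := by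
              have h7 : η / 2 * (S ω + D) ^ 2 + 1 / (2 * η) - (S ω + D) =
                (η * (S ω + D) - 1) ^ 2 / (2 * η) := by field_simp; ring
              have : 0 ≤ (η * (S ω + D) - 1) ^ 2 / (2 * η) := by positivity
              linarith
            have h8 : η * (S ω ^ 2 + D ^ 2) - η / 2 * (S ω + D) ^ 2 = η / 2 * (S ω - D) ^ 2 := by
              ring
            have h9 : 0 ≤ η / 2 * (S ω - D) ^ 2 := by positivity
            linarith
          refine h3.trans ((mul_le_mul_of_nonneg_left h4 hc40).trans
            (le_add_of_nonneg_left ?_))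
          have := hS0 ω
          positivity
        · have h3 : |∑ i ∈ Finset.range N, Q i ω| ≤ η * (n * S ω + D * c3) := by
            refine (Finset.abs_sum_le_sum_abs _ _).trans ((Finset.sum_le_sum fun i hi =>
              hgood ω hω i (Finset.mem_range.1 hi)).trans (le_of_eq ?_))
            rw [← Finset.mul_sum, Finset.sum_add_distrib, Finset.sum_const, Finset.card_range,
              nsmul_eq_mul, ← mul_assoc, hNρ, ← Finset.mul_sum]
          refine h3.trans (le_add_of_nonneg_right ?_)
          rw [Set.indicator_of_notMem hω]
          positivity
      obtain ⟨hm1, hm2⟩ := h.integral_sum_incrSq_le (P := P) hC hK s (D := D) (η := ρ) (N := N)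
        hNρ.le hρD c hc
      have hE1 : ∫ ω, S ω ∂P ≤ D * c * p := by
        refine (hm1 N le_rfl).trans (le_of_eq ?_)
        rw [← hNρ]; ring
      have hE2 : ∫ ω, S ω ^ 2 ∂P ≤ c2 := by
        refine (hm2 N le_rfl).trans (le_of_eq ?_)
        rw [← mul_assoc, hNρ]
      have hSm : Measurable S := Finset.measurable_sum _ fun i _ => h.measurable_incrSq _ _
      have hSM : ∀ ω, |S ω| ≤ N * (n * (2 * K) ^ 2) := fun ω => by
        rw [abs_of_nonneg (hS0 ω)]
        refine (Finset.sum_le_sum fun i _ => h.incrSq_le _ _ ω).trans (le_of_eq ?_)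
        simp
      have hSi : Integrable S P := integrable_of_abs_le hSm hSM
      have hS2i : Integrable (fun ω => S ω ^ 2) P :=
        integrable_of_abs_le (hSm.pow_const 2) (M := (N * (n * (2 * K) ^ 2)) ^ 2) fun ω => by
          rw [abs_pow]; exact pow_le_pow_left₀ (abs_nonneg _) (hSM ω) 2
      have hAi : Integrable (fun ω => A.indicator (1 : Ω → ℝ) ω) P :=
        (integrable_const (1 : ℝ)).indicator hAm
      have hsumi : Integrable (fun ω => ∑ i ∈ Finset.range N, Q i ω) P :=
        integrable_finsetSum _ fun i _ => (hrem i).2.1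
      have i1 : Integrable (fun ω => η * (n * S ω + D * c3)) P :=
        ((hSi.const_mul _).add (integrable_const _)).const_mul _
      have i2 : Integrable (fun ω => η * (S ω ^ 2 + D ^ 2)) P :=
        (hS2i.add (integrable_const _)).const_mul _
      have i3 : Integrable (fun ω => A.indicator (1 : Ω → ℝ) ω / (2 * η)) P := hAi.div_const _
      have i4 : Integrable (fun ω => c4 * (η * (S ω ^ 2 + D ^ 2) + A.indicator 1 ω / (2 * η))) P :=
        (i2.add i3).const_mul _
      have e1 : ∫ ω, η * (n * S ω + D * c3) ∂P = η * (n * ∫ ω, S ω ∂P + D * c3 * p) := by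
        rw [integral_const_mul, integral_add (hSi.const_mul _) (integrable_const _),
          integral_const_mul, integral_const, smul_eq_mul, mul_comm p]
      have e2 : ∫ ω, η * (S ω ^ 2 + D ^ 2) ∂P = η * (∫ ω, S ω ^ 2 ∂P + D ^ 2 * p) := by
        rw [integral_const_mul, integral_add hS2i (integrable_const _), integral_const,
          smul_eq_mul, mul_comm p]
      calc |I| ≤ ∫ ω in B, |∑ i ∈ Finset.range N, Q i ω| ∂P := by
            rw [hIsum]; exact abs_integral_le_integral_abs
        _ ≤ ∫ ω, |∑ i ∈ Finset.range N, Q i ω| ∂P :=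
            setIntegral_le_integral hsumi.abs (ae_of_all _ fun _ => abs_nonneg _)
        _ ≤ ∫ ω, (η * (n * S ω + D * c3) +
              c4 * (η * (S ω ^ 2 + D ^ 2) + A.indicator 1 ω / (2 * η))) ∂P :=
            integral_mono hsumi.abs (i1.add i4) hpt
        _ = η * (n * ∫ ω, S ω ∂P + D * c3 * p) + c4 * (η * (∫ ω, S ω ^ 2 ∂P + D ^ 2 * p) +
              (∫ ω, A.indicator 1 ω ∂P) / (2 * η)) := by
            rw [integral_add i1 i4, e1, integral_const_mul, integral_add i2 i3, e2,
              integral_div]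
        _ ≤ η * (n * (D * c * p) + D * c3 * p) + c4 * (η * (c2 + D ^ 2 * p) +
              (∫ ω, A.indicator 1 ω ∂P) / (2 * η)) := by
            gcongr
        _ = _ := by ring
    have hlim : Tendsto (fun N : ℕ => ∫ ω, (oscSet Y s ((t - s) / N) N δ).indicator
        (1 : Ω → ℝ) ω ∂P) atTop (𝓝 0) := by
      have : Tendsto (fun N : ℕ => ∫ ω, (oscSet Y s ((t - s) / N) N δ).indicator
          (1 : Ω → ℝ) ω ∂P) atTop (𝓝 (∫ _ω : Ω, (0 : ℝ) ∂P)) := by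
        refine tendsto_integral_of_dominated_convergence (fun _ => 1)
          (fun N => ((measurable_const.indicator
            (h.measurableSet_oscSet s _ N δ)).aestronglyMeasurable)) (integrable_const _)
          (fun N => ae_of_all _ fun ω => ?_) (ae_of_all _ fun ω => ?_)
        · by_cases hω : ω ∈ oscSet Y s ((t - s) / N) N δ <;> simp [hω]
        · refine tendsto_const_nhds.congr' ?_
          filter_upwards [eventually_notMem_oscSet (h.continuous ω) hst hδ0] with N hN
          rw [Set.indicator_of_notMem hN]
      simpa using this
    have hρlim : ∀ᶠ N : ℕ in atTop, (((t - s) / (N : ℝ≥0) : ℝ≥0) : ℝ) ≤ η := by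
      have h3 : Tendsto (fun N : ℕ => (t - s) / (N : ℝ≥0)) atTop (𝓝 0) :=
        tendsto_const_div_atTop_nhds_zero_nat _
      have := (NNReal.continuous_coe.tendsto 0).comp h3
      exact (this.eventually (gt_mem_nhds hη)).mono fun N hN => le_of_lt hN
    have hlim2 := (hlim.const_mul (c4 / (2 * η))).const_add
      (η * (n * (D * c * p) + D * c3 * p + c4 * (c2 + D ^ 2 * p)))
    rw [mul_zero, add_zero] at hlim2
    refine ge_of_tendsto hlim2 ?_
    filter_upwards [hρlim, eventually_ne_atTop 0] with N hN hN0
    exact hbound N hN0 hN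
  set c5 := n * (D * c * p) + D * c3 * p + c4 * (c2 + D ^ 2 * p) with hc5
  have hlim : Tendsto (fun η : ℝ => η * c5) (𝓝[>] 0) (𝓝 0) := by
    have : Tendsto (fun η : ℝ => η * c5) (𝓝 0) (𝓝 (0 * c5)) :=
      (continuous_id.mul continuous_const).tendsto 0
    rw [zero_mul] at this
    exact this.mono_left nhdsWithin_le_nhds
  have : |I| ≤ 0 := by
    refine ge_of_tendsto hlim ?_
    filter_upwards [Ioo_mem_nhdsGT (zero_lt_one : (0 : ℝ) < 1)] with η hη
    exact main η hη.1 hη.2.le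
  exact abs_nonpos_iff.1 this

end BoundedSemimartingale

end ItoFormula


/-! ### Measurability of Hilbert space valued maps -/

section WeakMeasurability

variable {H : Type*} [NormedAddCommGroup H] [InnerProductSpace ℝ H]
  [TopologicalSpace.SeparableSpace H]

/-- The inequality is closed in the test vector, so it extends from the dense sequence to all
vectors. The vector `y` itself is then the decisive test. -/
lemma norm_le_iff_forall_denseSeq {y : H} {c : ℝ} (hc : 0 ≤ c) :
    ‖y‖ ≤ c ↔ ∀ n, inner ℝ (TopologicalSpace.denseSeq H n) y ≤
      c * ‖TopologicalSpace.denseSeq H n‖ := by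
  constructor
  · intro h n
    refine (real_inner_le_norm _ _).trans ?_
    rw [mul_comm]
    exact mul_le_mul_of_nonneg_right h (norm_nonneg _)
  · intro h
    have hcl : IsClosed {z : H | inner ℝ z y ≤ c * ‖z‖} :=
      isClosed_le (by fun_prop) (by fun_prop)
    have := closure_minimal (s := Set.range (TopologicalSpace.denseSeq H))
      (by rintro _ ⟨n, rfl⟩; exact h n) hcl
    rw [(TopologicalSpace.denseRange_denseSeq H).closure_range] at this
    have hy : inner ℝ y y ≤ c * ‖y‖ := this (Set.mem_univ y)
    rw [real_inner_self_eq_norm_mul_norm] at hy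
    rcases eq_or_ne ‖y‖ 0 with h0 | h0
    · rw [h0]; exact hc
    · exact le_of_mul_le_mul_right hy (lt_of_le_of_ne (norm_nonneg y) h0.symm)

/-- Weakly measurable maps into a separable Hilbert space are strongly measurable. -/
lemma stronglyMeasurable_of_inner {α : Type*} [MeasurableSpace α] {Φ : α → H}
    (h : ∀ z, Measurable fun x => inner ℝ z (Φ x)) : StronglyMeasurable Φ := by
  borelize H
  have hball : ∀ (c : H) (r : ℝ), MeasurableSet {x | ‖Φ x - c‖ ≤ r} := by
    intro c r
    rcases lt_or_ge r 0 with hr | hr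
    · have : {x | ‖Φ x - c‖ ≤ r} = ∅ := by
        ext x
        simp only [Set.mem_ofPred_eq, Set.mem_empty_iff_false, iff_false, not_le]
        exact hr.trans_le (norm_nonneg _)
      rw [this]; exact MeasurableSet.empty
    · simp only [norm_le_iff_forall_denseSeq hr, Set.ofPred_forall, inner_sub_right]
      exact MeasurableSet.iInter fun n =>
        measurableSet_le ((h _).sub measurable_const) measurable_const
  refine Measurable.stronglyMeasurable (measurable_of_isOpen fun U hU => ?_)
  have : Φ ⁻¹' U = ⋃ n : ℕ, ⋃ q : ℚ, ⋃ _ : Metric.closedBall (TopologicalSpace.denseSeq H n) q ⊆ U,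
      {x | ‖Φ x - TopologicalSpace.denseSeq H n‖ ≤ q} := by
    ext x
    simp only [Set.mem_preimage, Set.mem_iUnion, Set.mem_ofPred_eq, exists_prop]
    constructor
    · intro hx
      obtain ⟨ε, hε, hεU⟩ := Metric.isOpen_iff.1 hU _ hx
      obtain ⟨q, hq0, hq⟩ := exists_rat_btwn (half_pos hε)
      obtain ⟨n, hn⟩ := (TopologicalSpace.denseRange_denseSeq H).exists_dist_lt (Φ x) hq0
      refine ⟨n, q, fun z hz => hεU ?_, by rw [← dist_eq_norm]; exact hn.le⟩
      rw [Metric.mem_closedBall] at hz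
      rw [Metric.mem_ball]
      have := dist_triangle_right z (Φ x) (TopologicalSpace.denseSeq H n)
      linarith
    · rintro ⟨n, q, hsub, hx⟩
      exact hsub (by rw [Metric.mem_closedBall, dist_eq_norm]; exact hx)
  rw [this]
  exact MeasurableSet.iUnion fun n => MeasurableSet.iUnion fun q => MeasurableSet.iUnion fun _ =>
    hball _ _

end WeakMeasurability

/-! ### The coefficients of the martingale problem -/

section Coefficients

variable {E V H : Type*}
  [NormedAddCommGroup E] [NormedSpace ℝ E] [CompleteSpace E]
  [TopologicalSpace.SeparableSpace E] [MeasurableSpace E] [BorelSpace E]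
  [NormedAddCommGroup V] [NormedSpace ℝ V]
  [NormedAddCommGroup H] [InnerProductSpace ℝ H] [CompleteSpace H]
  [TopologicalSpace.SeparableSpace H]
  {j : E →L[ℝ] V} {A : V →ₗ.[ℝ] V} {F : E → V} {G : E → H →L[ℝ] V}

lemma inner_hilbertAdjoint (B : H →L[ℝ] V) (v' : V →L[ℝ] ℝ) (z : H) :
    inner ℝ (hilbertAdjoint B v') z = v' (B z) := by
  simp [hilbertAdjoint, InnerProductSpace.toDual_symm_apply]

lemma hilbertAdjoint_add (B : H →L[ℝ] V) (v' u' : V →L[ℝ] ℝ) :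
    hilbertAdjoint B (v' + u') = hilbertAdjoint B v' + hilbertAdjoint B u' := by
  refine ext_inner_right ℝ fun z => ?_
  rw [inner_add_left]
  simp [inner_hilbertAdjoint]

lemma norm_hilbertAdjoint_le (B : H →L[ℝ] V) (v' : V →L[ℝ] ℝ) :
    ‖hilbertAdjoint B v'‖ ≤ ‖v'‖ * ‖B‖ := by
  rw [hilbertAdjoint, LinearIsometryEquiv.norm_map]
  exact v'.opNorm_comp_le B

variable (j F G) in
/-- The drift of `⟨x, v'⟩`, where `w' = A* v'`. -/
def driftFun (v' w' : V →L[ℝ] ℝ) (x : E) : ℝ := w' (j x) + v' (F x)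

variable (G) in
/-- The diffusion coefficient of the pair `⟨x, v'⟩`, `⟨x, u'⟩`. -/
def covFun (v' u' : V →L[ℝ] ℝ) (x : E) : ℝ :=
  inner ℝ (hilbertAdjoint (G x) v') (hilbertAdjoint (G x) u')

lemma covFun_self (v' : V →L[ℝ] ℝ) (x : E) : covFun G v' v' x = ‖hilbertAdjoint (G x) v'‖ ^ 2 :=
  real_inner_self_eq_norm_sq _

/-- Since D(A*) is closed under sums, covariations of pairs need not be treated separately from
quadratic variations of single functionals. -/
lemma covFun_polarization (v' u' : V →L[ℝ] ℝ) (x : E) :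
    covFun G v' u' x =
      1 / 2 * (covFun G (v' + u') (v' + u') x - covFun G v' v' x - covFun G u' u' x) := by
  rw [covFun_self, covFun_self, covFun_self, hilbertAdjoint_add, norm_add_sq_real, covFun]
  ring

lemma abs_lin_le (v' : V →L[ℝ] ℝ) {r : ℝ} {x : E} (hx : ‖x‖ ≤ r) :
    |v' (j x)| ≤ ‖v'‖ * (‖j‖ * r) :=
  (v'.le_opNorm _).trans (mul_le_mul_of_nonneg_left
    ((j.le_opNorm x).trans (mul_le_mul_of_nonneg_left hx (norm_nonneg _))) (norm_nonneg _))

variable (j F G) in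
/-- The generator applied to `⟨x, v'⟩²`. -/
def sqGenerator (v' w' : V →L[ℝ] ℝ) (x : E) : ℝ :=
  2 * v' (j x) * driftFun j F v' w' x + covFun G v' v' x

lemma generatorValue_eq {n : ℕ} (φ : (Fin n → ℝ) → ℝ) (v' w' : Fin n → V →L[ℝ] ℝ)
    (x : E) : generatorValue j F G φ v' w' x =
      (∑ k, partialDeriv φ k (fun i => v' i (j x)) * driftFun j F (v' k) (w' k) x) +
      (1 / 2) * ∑ k, ∑ l, covFun G (v' k) (v' l) x *
        partialDeriv₂ φ k l (fun i => v' i (j x)) := rfl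

namespace StandingAssumptions

variable (hyp : StandingAssumptions j A F G)

include hyp

lemma stronglyMeasurable_hilbertAdjoint (v' : V →L[ℝ] ℝ) :
    StronglyMeasurable fun x => hilbertAdjoint (G x) v' := by
  refine stronglyMeasurable_of_inner fun z => ?_
  have h : ∀ x, inner ℝ z (hilbertAdjoint (G x) v') = v' (G x z) := fun x => by
    rw [real_inner_comm, inner_hilbertAdjoint]
  simp only [h]
  exact (v'.continuous.comp_stronglyMeasurable (hyp.G_measurable z)).measurable

lemma measurable_drift (v' w' : V →L[ℝ] ℝ) : Measurable (driftFun j F v' w') :=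
  (w'.continuous.comp j.continuous).measurable.add
    (v'.continuous.comp_stronglyMeasurable hyp.F_measurable).measurable

lemma measurable_cov (v' u' : V →L[ℝ] ℝ) : Measurable (covFun G v' u') :=
  ((hyp.stronglyMeasurable_hilbertAdjoint v').inner
    (hyp.stronglyMeasurable_hilbertAdjoint u')).measurable

/-- Bounds for the coefficients on balls, uniform over bounded sets of functionals. -/
lemma exists_bound (r R : ℝ) : ∃ C, 0 ≤ C ∧ ∀ v' w' u' : V →L[ℝ] ℝ, ‖v'‖ ≤ R → ‖w'‖ ≤ R →
    ‖u'‖ ≤ R → ∀ x, ‖x‖ ≤ r →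
    |v' (j x)| ≤ C ∧ |driftFun j F v' w' x| ≤ C ∧ |covFun G v' u' x| ≤ C := by
  obtain ⟨C1, h1⟩ := hyp.F_bounded r
  obtain ⟨C2, h2⟩ := hyp.G_bounded r
  refine ⟨|R| * (‖j‖ * |r|) + |R| * |C1| + |R| * |C2| * (|R| * |C2|), by positivity,
    fun v' w' u' hv hw hu x hx => ?_⟩
  have hv' := hv.trans (le_abs_self R)
  have hw' := hw.trans (le_abs_self R)
  have hu' := hu.trans (le_abs_self R)
  have a1 : ∀ z' : V →L[ℝ] ℝ, ‖z'‖ ≤ |R| → |z' (j x)| ≤ |R| * (‖j‖ * |r|) := fun z' hz =>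
    (abs_lin_le z' (hx.trans (le_abs_self r))).trans
      (mul_le_mul_of_nonneg_right hz (by positivity))
  have a2 : |v' (F x)| ≤ |R| * |C1| := (v'.le_opNorm _).trans
    (mul_le_mul hv' ((h1 x hx).trans (le_abs_self _)) (norm_nonneg _) (abs_nonneg _))
  have a3 : ∀ z' : V →L[ℝ] ℝ, ‖z'‖ ≤ |R| → ‖hilbertAdjoint (G x) z'‖ ≤ |R| * |C2| := fun z' hz =>
    (norm_hilbertAdjoint_le _ _).trans
      (mul_le_mul hz ((h2 x hx).trans (le_abs_self _)) (norm_nonneg _) (abs_nonneg _))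
  have a4 : |covFun G v' u' x| ≤ |R| * |C2| * (|R| * |C2|) := (abs_real_inner_le_norm _ _).trans
    (mul_le_mul (a3 v' hv') (a3 u' hu') (norm_nonneg _) (by positivity))
  have b1 : 0 ≤ |R| * (‖j‖ * |r|) := by positivity
  have b2 : 0 ≤ |R| * |C1| := by positivity
  have b3 : 0 ≤ |R| * |C2| * (|R| * |C2|) := by positivity
  refine ⟨by linarith [a1 v' hv'], ?_, by linarith⟩
  refine (abs_add_le _ _).trans ?_
  linarith [a1 w' hw']

lemma exists_bound_self (r : ℝ) (v' w' u' : V →L[ℝ] ℝ) : ∃ C, 0 ≤ C ∧ ∀ x, ‖x‖ ≤ r →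
    |v' (j x)| ≤ C ∧ |driftFun j F v' w' x| ≤ C ∧ |covFun G v' u' x| ≤ C := by
  obtain ⟨C, hC, h⟩ := hyp.exists_bound r (max ‖v'‖ (max ‖w'‖ ‖u'‖))
  exact ⟨C, hC, fun x hx => h v' w' u' (le_max_left _ _)
    ((le_max_left _ _).trans (le_max_right _ _)) ((le_max_right _ _).trans (le_max_right _ _)) x hx⟩

lemma tamePair_lin (v' w' : V →L[ℝ] ℝ) :
    TamePair (fun x => v' (j x)) (driftFun j F v' w') where
  continuous := v'.continuous.comp j.continuous
  measurable := hyp.measurable_drift v' w'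
  bounded_left r := by
    obtain ⟨C, -, h⟩ := hyp.exists_bound_self r v' w' v'
    exact ⟨C, fun x hx => (h x hx).1⟩
  bounded_right r := by
    obtain ⟨C, -, h⟩ := hyp.exists_bound_self r v' w' v'
    exact ⟨C, fun x hx => (h x hx).2.1⟩

lemma tamePair_sq (v' w' : V →L[ℝ] ℝ) :
    TamePair (fun x => v' (j x) ^ 2) (sqGenerator j F G v' w') where
  continuous := (v'.continuous.comp j.continuous).pow 2
  measurable := (((v'.continuous.comp j.continuous).measurable.const_mul 2).mul
    (hyp.measurable_drift v' w')).add (hyp.measurable_cov v' v')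
  bounded_left r := by
    obtain ⟨C, -, h⟩ := hyp.exists_bound_self r v' w' v'
    refine ⟨C ^ 2, fun x hx => ?_⟩
    rw [abs_pow]
    exact pow_le_pow_left₀ (abs_nonneg _) (h x hx).1 2
  bounded_right r := by
    obtain ⟨C, hC, h⟩ := hyp.exists_bound_self r v' w' v'
    refine ⟨2 * C * C + C, fun x hx => ?_⟩
    obtain ⟨h1, h2, h3⟩ := h x hx
    refine (abs_add_le _ _).trans (add_le_add ?_ h3)
    rw [abs_mul, abs_mul, abs_two]
    exact mul_le_mul (mul_le_mul_of_nonneg_left h1 zero_le_two) h2 (abs_nonneg _) (by positivity)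

/-- Balls of `E` are mapped into bounded sets of ℝⁿ, where φ and its derivatives are bounded, while
the coefficients are bounded on balls by the standing assumptions. -/
lemma tamePair_generator {n : ℕ} {φ : (Fin n → ℝ) → ℝ} (hφ : ContDiff ℝ 2 φ)
    (v' w' : Fin n → V →L[ℝ] ℝ) :
    TamePair (fun x => φ fun i => v' i (j x)) (generatorValue j F G φ v' w') := by
  have hlin : Continuous fun x : E => (fun i => v' i (j x)) :=
    continuous_pi fun i => (v' i).continuous.comp j.continuous
  have hK : ∀ r : ℝ, ∃ K, ∀ x : E, ‖x‖ ≤ r → ‖fun i => v' i (j x)‖ ≤ K := by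
    intro r
    choose C hC h using fun i => hyp.exists_bound_self r (v' i) (w' i) (v' i)
    refine ⟨∑ i, C i, fun x hx => (pi_norm_le_iff_of_nonneg
      (Finset.sum_nonneg fun i _ => hC i)).2 fun i => ?_⟩
    exact ((h i x hx).1).trans (Finset.single_le_sum (fun i _ => hC i) (Finset.mem_univ i))
  refine ⟨hφ.continuous.comp hlin, ?_, fun r => ?_, fun r => ?_⟩
  · simp only [funext (generatorValue_eq φ v' w')]
    refine (Finset.measurable_sum _ fun k _ => ?_).add
      ((Finset.measurable_sum _ fun k _ => Finset.measurable_sum _ fun l _ => ?_).const_mul _)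
    · exact ((continuous_partialDeriv hφ k).comp hlin).measurable.mul (hyp.measurable_drift _ _)
    · exact (hyp.measurable_cov _ _).mul ((continuous_partialDeriv₂ hφ k l).comp hlin).measurable
  · obtain ⟨K, hK⟩ := hK r
    obtain ⟨L, -, hL⟩ := exists_abs_le_of_continuous hφ.continuous K
    exact ⟨L, fun x hx => hL _ (hK x hx)⟩
  · obtain ⟨K, hK⟩ := hK r
    choose L1 h10 h1 using fun k => exists_abs_le_of_continuous (continuous_partialDeriv hφ k) K
    choose L2 h20 h2 using
      fun k l => exists_abs_le_of_continuous (continuous_partialDeriv₂ hφ k l) K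
    choose C hC h using fun q : Fin n × Fin n => hyp.exists_bound_self r (v' q.1) (w' q.1) (v' q.2)
    refine ⟨(∑ k, L1 k * C (k, k)) + 1 / 2 * ∑ k, ∑ l, C (k, l) * L2 k l, fun x hx => ?_⟩
    rw [generatorValue_eq]
    refine (abs_add_le _ _).trans (add_le_add ?_ ?_)
    · refine (Finset.abs_sum_le_sum_abs _ _).trans (Finset.sum_le_sum fun k _ => ?_)
      rw [abs_mul]
      exact mul_le_mul (h1 k _ (hK x hx)) (h (k, k) x hx).2.1 (abs_nonneg _) (h10 k)
    · rw [abs_mul, abs_of_nonneg (by norm_num : (0 : ℝ) ≤ 1 / 2)]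
      refine mul_le_mul_of_nonneg_left ?_ (by norm_num)
      refine (Finset.abs_sum_le_sum_abs _ _).trans (Finset.sum_le_sum fun k _ => ?_)
      refine (Finset.abs_sum_le_sum_abs _ _).trans (Finset.sum_le_sum fun l _ => ?_)
      rw [abs_mul]
      exact mul_le_mul (h (k, l) x hx).2.2 (h2 k l _ (hK x hx)) (abs_nonneg _) (hC _)

end StandingAssumptions

lemma lin_mem_operatorGraph {v' w' : V →L[ℝ] ℝ} (h : IsAdjointValue A v' w') :
    ((fun x => v' (j x)), driftFun j F v' w') ∈ operatorGraph j A F G := by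
  refine ⟨1, fun u => u 0, fun _ => v', fun _ => w', by fun_prop, fun _ => h, ?_⟩
  have hd : fderiv ℝ (fun u : Fin 1 → ℝ => u 0) =
      fun _ => ContinuousLinearMap.proj (R := ℝ) (φ := fun _ : Fin 1 => ℝ) 0 := by
    ext1 y
    exact (ContinuousLinearMap.proj (R := ℝ) (φ := fun _ : Fin 1 => ℝ) 0).fderiv
  refine Prod.ext rfl ?_
  ext x
  simp [generatorValue, driftFun, hd]

lemma sq_mem_operatorGraph {v' w' : V →L[ℝ] ℝ} (h : IsAdjointValue A v' w') :
    ((fun x => v' (j x) ^ 2), sqGenerator j F G v' w') ∈ operatorGraph j A F G := by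
  refine ⟨1, fun u => u 0 ^ 2, fun _ => v', fun _ => w', by fun_prop, fun _ => h, ?_⟩
  set p := ContinuousLinearMap.proj (R := ℝ) (φ := fun _ : Fin 1 => ℝ) 0 with hp
  have hp1 : p (Pi.single 0 1) = 1 := by simp [hp]
  have hd : fderiv ℝ (fun u : Fin 1 → ℝ => u 0 ^ 2) = fun y => (2 * y 0) • p := by
    ext1 y
    have := (p.hasFDerivAt (x := y)).pow 2
    refine this.fderiv.trans ?_
    simp [hp]
  have hd2 : fderiv ℝ (fun y : Fin 1 → ℝ => (2 * y 0) • p) =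
      fun _ => ((2 : ℝ) • p).smulRight p := by
    ext1 y
    exact (((2 : ℝ) • p).smulRight p).fderiv
  refine Prod.ext rfl ?_
  ext x
  simp [generatorValue, sqGenerator, driftFun, covFun, hd, hd2, hp1]
  ring

end Coefficients


/-! ### Stopped increments in integrated form -/

section Killed

variable {E : Type*} [NormedAddCommGroup E] [CompleteSpace E]
  [TopologicalSpace.SeparableSpace E] [MeasurableSpace E] [BorelSpace E]

open Classical in
/-- The process `f(x)`, stopped at the exit from the ball of radius `r` (and `0` for paths that
start outside). -/
def stoppedFun (r : ℝ) (f : E → ℝ) (u : ℝ≥0) (x : C(ℝ≥0, E)) : ℝ :=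
  if ‖x 0‖ < r then f (x (exitMin r u x)) else 0

open Classical in
/-- The process `g(x)`, set to `0` from the exit from the ball of radius `r` on. -/
def killedFun (r : ℝ) (g : E → ℝ) (w : ℝ) (x : C(ℝ≥0, E)) : ℝ :=
  if runNorm w.toNNReal x < r then g (x w.toNNReal) else 0

lemma norm_zero_lt_of_runNorm_lt {r : ℝ} {w : ℝ≥0} {x : C(ℝ≥0, E)} (h : runNorm w x < r) :
    ‖x 0‖ < r := runNorm_lt_iff.1 h 0 zero_le

lemma continuous_stoppedFun (r : ℝ) {f : E → ℝ} (hf : Continuous f) (x : C(ℝ≥0, E)) :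
    Continuous fun u => stoppedFun r f u x := by
  simp only [stoppedFun]
  split_ifs
  · exact hf.comp (x.continuous.comp (continuous_exitMin r x))
  · exact continuous_const

lemma measurable_stoppedFun (r : ℝ) {f : E → ℝ} (hf : Measurable f) (u : ℝ≥0) :
    Measurable[pathFiltration E u] (stoppedFun r f u) := by
  refine measurable_pathFiltration ?_ fun x => ?_
  · refine Measurable.ite (measurableSet_lt (continuous_eval_const (0 : ℝ≥0)).norm.measurable
      measurable_const) ?_ measurable_const
    exact hf.comp (measurable_path_eval.comp (((measurable_exitMin r).comp
      (measurable_const.prodMk measurable_id)).prodMk measurable_id))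
  · have h1 : exitMin r u (stopAt u x) = exitMin r u x :=
      exitMin_congr fun v hv => by simp [min_eq_left hv]
    simp [stoppedFun, h1, min_eq_left (exitMin_le r u x)]

lemma abs_stoppedFun_le {r C : ℝ} (hC : 0 ≤ C) {f : E → ℝ} (hf : ∀ x, ‖x‖ ≤ r → |f x| ≤ C)
    (u : ℝ≥0) (x : C(ℝ≥0, E)) : |stoppedFun r f u x| ≤ C := by
  rw [stoppedFun]
  split_ifs with h
  · exact hf _ (norm_exitMin_le h u)
  · simpa using hC

lemma measurable_killedFun (r : ℝ) {g : E → ℝ} (hg : Measurable g) :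
    Measurable (Function.uncurry (killedFun r g)) := by
  have hrun : Measurable fun p : ℝ≥0 × C(ℝ≥0, E) => runNorm p.1 p.2 := continuous_runNorm.measurable
  have hpair : Measurable fun p : ℝ × C(ℝ≥0, E) => (p.1.toNNReal, p.2) :=
    (measurable_real_toNNReal.comp measurable_fst).prodMk measurable_snd
  have hcomp : Measurable fun p : ℝ × C(ℝ≥0, E) => runNorm p.1.toNNReal p.2 := by
    have h := hrun.comp hpair
    rw [Function.comp_def] at h
    exact h
  have hset : MeasurableSet {p : ℝ × C(ℝ≥0, E) | runNorm p.1.toNNReal p.2 < r} :=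
    measurableSet_lt hcomp measurable_const
  have hfun : Measurable fun p : ℝ × C(ℝ≥0, E) => g (p.2 p.1.toNNReal) := measurable_comp_path hg
  have heq : Function.uncurry (killedFun r g) =
      {p : ℝ × C(ℝ≥0, E) | runNorm p.1.toNNReal p.2 < r}.indicator
        (fun p => g (p.2 p.1.toNNReal)) := by
    ext ⟨w, x⟩
    by_cases h : runNorm w.toNNReal x < r
    · rw [Set.indicator_of_mem (by exact h), Function.uncurry_apply_pair, killedFun, if_pos h]
    · rw [Set.indicator_of_notMem (by exact h), Function.uncurry_apply_pair, killedFun, if_neg h]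
  rw [heq]
  exact hfun.indicator hset

lemma abs_killedFun_le {r C : ℝ} (hC : 0 ≤ C) {g : E → ℝ} (hg : ∀ x, ‖x‖ ≤ r → |g x| ≤ C)
    (w : ℝ) (x : C(ℝ≥0, E)) : |killedFun r g w x| ≤ C := by
  rw [killedFun]
  split_ifs with h
  · exact hg _ (runNorm_lt_iff.1 h _ le_rfl).le
  · simpa using hC

lemma stoppedFun_eq_of_runNorm_lt {r : ℝ} {f : E → ℝ} {w : ℝ≥0} {x : C(ℝ≥0, E)}
    (h : runNorm w x < r) : stoppedFun r f w x = f (x w) := by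
  rw [stoppedFun, if_pos (norm_zero_lt_of_runNorm_lt h), exitMin_eq_of_runNorm_lt h]

lemma le_exitMin_of_runNorm_lt {r : ℝ} {w v : ℝ≥0} {x : C(ℝ≥0, E)} (h : runNorm w x < r)
    (hwv : w ≤ v) : w ≤ exitMin r v x := by
  rw [← exitMin_eq_of_runNorm_lt h]; exact exitMin_mono hwv x

/-- After the exit the killed integrand is 0. Before it the two integrands agree, with the exit time
itself a null set. Random limits of integration are thus replaced by deterministic ones. -/
lemma integral_killedFun {g : E → ℝ} {r : ℝ} {u v : ℝ≥0} (huv : u ≤ v) (x : C(ℝ≥0, E))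
    (hg : Measurable g) (hb : ∀ r : ℝ, ∃ C, ∀ x, ‖x‖ ≤ r → |g x| ≤ C) :
    ∫ w in (u : ℝ)..v, killedFun r g w x =
      ∫ w in (exitMin r u x : ℝ)..exitMin r v x, g (x w.toNNReal) := by
  have hzero : ∀ a b : ℝ≥0, b ≤ v → exitMin r v x ≤ a → a ≤ b →
      ∫ w in (a : ℝ)..b, killedFun r g w x = 0 := by
    intro a b hbv ha hab
    refine intervalIntegral.integral_zero_ae (ae_of_all _ fun w hw => ?_)
    rw [Set.uIoc_of_le (NNReal.coe_le_coe.2 hab)] at hw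
    rw [killedFun, if_neg]
    intro hlt
    have h1 := le_exitMin_of_runNorm_lt hlt ((Real.toNNReal_le_iff_le_coe.2 hw.2).trans hbv)
    have h2 : a < w.toNNReal := Real.lt_toNNReal_iff_coe_lt.2 hw.1
    exact absurd (h1.trans ha) (not_le.2 h2)
  rcases le_total (exitMin r v x) u with h | h
  · rw [hzero u v le_rfl h huv, exitMin_of_le huv, min_eq_right h, intervalIntegral.integral_same]
  · obtain ⟨C, hC⟩ := hb r
    have hki : ∀ a b : ℝ, IntervalIntegrable (fun w => killedFun r g w x) volume a b :=
      fun a b => intervalIntegrable_of_measurable_bounded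
        ((measurable_killedFun r hg).of_uncurry_right)
        (fun w => abs_killedFun_le (abs_nonneg C) (fun y hy => (hC y hy).trans (le_abs_self C)) w x)
        a b
    rw [exitMin_of_le huv, min_eq_left h,
      ← intervalIntegral.integral_add_adjacent_intervals (hki u (exitMin r v x)) (hki _ v),
      hzero _ v le_rfl le_rfl (exitMin_le r v x), add_zero]
    refine intervalIntegral.integral_congr_ae ?_
    have hne : ∀ᵐ w : ℝ, w ≠ exitMin r v x := by simp [ae_iff]
    filter_upwards [hne] with w hw hmem
    rw [Set.uIoc_of_le (NNReal.coe_le_coe.2 h)] at hmem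
    have hlt : w.toNNReal < exitMin r v x := by
      rw [← NNReal.coe_lt_coe, Real.coe_toNNReal _ ((NNReal.coe_nonneg u).trans hmem.1.le)]
      exact lt_of_le_of_ne hmem.2 hw
    rw [killedFun, if_pos (lt_exitMin_iff.1 hlt).2]

/-- This is the form required by `BoundedSemimartingale`: a bounded process and a bounded density
over a deterministic interval. For paths starting outside the ball both sides vanish. -/
lemma TamePair.stopped_sub {f g : E → ℝ} (h : TamePair f g) {r : ℝ} {u v : ℝ≥0} (huv : u ≤ v)
    (x : C(ℝ≥0, E)) :
    martingaleProcess f g (exitMin r v x) x - martingaleProcess f g (exitMin r u x) x =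
      stoppedFun r f v x - stoppedFun r f u x - ∫ w in (u : ℝ)..v, killedFun r g w x := by
  rw [h.process_sub, integral_killedFun huv x h.measurable h.bounded_right]
  simp only [stoppedFun]
  split_ifs with h0
  · rfl
  · simp [exitMin_eq_zero _ (not_lt.1 h0)]

end Killed

/-! ### Reduction to linear functionals and their covariations -/

section Reduction

variable {E V H : Type*}
  [NormedAddCommGroup E] [NormedSpace ℝ E] [CompleteSpace E]
  [TopologicalSpace.SeparableSpace E] [MeasurableSpace E] [BorelSpace E]
  [NormedAddCommGroup V] [NormedSpace ℝ V]
  [NormedAddCommGroup H] [InnerProductSpace ℝ H] [CompleteSpace H]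
  [TopologicalSpace.SeparableSpace H]
  {j : E →L[ℝ] V} {A : V →ₗ.[ℝ] V} {F : E → V} {G : E → H →L[ℝ] V}

variable (j G) in
/-- The stopped process `⟨x, v'⟩` has quadratic variation `∫ ‖G* v'‖²`, up to small errors. -/
def HasQuadraticVariation (P : Measure C(ℝ≥0, E)) (r : ℝ) (v' : V →L[ℝ] ℝ)
    (m : ℝ≥0 → ℝ≥0 → C(ℝ≥0, E) → ℝ) (C : ℝ) : Prop :=
  (∀ u v, Measurable (m u v)) ∧
  (∀ u v, u ≤ v → ∀ B, MeasurableSet[pathFiltration E u] B → ∫ x in B, m u v x ∂P = 0) ∧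
  (∀ u v, u ≤ v → Integrable (m u v) P) ∧
  ∀ u v x δ, u ≤ v → (∀ w, u ≤ w → w ≤ v →
    |stoppedFun r (fun y => v' (j y)) w x - stoppedFun r (fun y => v' (j y)) u x| ≤ δ) →
    |(stoppedFun r (fun y => v' (j y)) v x - stoppedFun r (fun y => v' (j y)) u x) ^ 2 -
      (∫ w in (u : ℝ)..v, killedFun r (covFun G v' v') w x) - m u v x| ≤
      C * ((v : ℝ) - u) * (δ + ((v : ℝ) - u))

lemma stoppedFun_add (r : ℝ) (v' u' : V →L[ℝ] ℝ) (u : ℝ≥0) (x : C(ℝ≥0, E)) :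
    stoppedFun r (fun y => (v' + u') (j y)) u x =
      stoppedFun r (fun y => v' (j y)) u x + stoppedFun r (fun y => u' (j y)) u x := by
  simp only [stoppedFun]; split_ifs <;> simp

lemma IsAdjointValue.add {v' w' u' z' : V →L[ℝ] ℝ} (h1 : IsAdjointValue A v' w')
    (h2 : IsAdjointValue A u' z') : IsAdjointValue A (v' + u') (w' + z') := fun v => by
  simp [h1 v, h2 v]

lemma IsAdjointValue.sub {v' w' u' z' : V →L[ℝ] ℝ} (h1 : IsAdjointValue A v' w')
    (h2 : IsAdjointValue A u' z') : IsAdjointValue A (v' - u') (w' - z') := fun v => by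
  simp [h1 v, h2 v]

lemma StandingAssumptions.intervalIntegrable_killed_cov (hyp : StandingAssumptions j A F G)
    (r : ℝ) (v' u' : V →L[ℝ] ℝ) (x : C(ℝ≥0, E)) (a b : ℝ) :
    IntervalIntegrable (fun w => killedFun r (covFun G v' u') w x) volume a b := by
  obtain ⟨C, hC0, hC⟩ := hyp.exists_bound_self r v' 0 u'
  exact intervalIntegrable_of_measurable_bounded
    ((measurable_killedFun r (hyp.measurable_cov v' u')).of_uncurry_right)
    (fun w => abs_killedFun_le hC0 (fun y hy => (hC y hy).2.2) w x) a b

/-- If all functionals `⟨x, v'⟩` have the drift and the quadratic variation prescribed by the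
coefficients, then `P` solves the local martingale problem. -/
theorem solvesLMP_of_quadraticVariation (hyp : StandingAssumptions j A F G)
    {P : Measure C(ℝ≥0, E)} [hP : IsProbabilityMeasure P]
    (hlin : ∀ v' w', IsAdjointValue A v' w' →
      StoppedMartingale (fun x => v' (j x)) (driftFun j F v' w') P)
    (hqv : ∀ v' w', IsAdjointValue A v' w' → ∀ r : ℕ, ∃ m C, 0 ≤ C ∧
      HasQuadraticVariation j G P r v' m C) :
    SolvesLMP (operatorGraph j A F G) P := by
  refine ⟨hP, ?_⟩
  rintro _ ⟨n, φ, v', w', hφ, hadj, rfl⟩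
  have htame := hyp.tamePair_generator hφ v' w'
  refine isLocalMartingale_of_stoppedMartingale htame fun r s t hst B hB => ?_
  set Y : ℝ≥0 → C(ℝ≥0, E) → Fin n → ℝ :=
    fun u x k => stoppedFun r (fun y => v' k (j y)) u x with hY
  set b : Fin n → ℝ → C(ℝ≥0, E) → ℝ := fun k => killedFun r (driftFun j F (v' k) (w' k)) with hb
  set a : Fin n → Fin n → ℝ → C(ℝ≥0, E) → ℝ :=
    fun k l => killedFun r (covFun G (v' k) (v' l)) with ha
  choose m1 C1 hC1 hm1 using fun k => hqv (v' k) (w' k) (hadj k) r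
  choose m2 C2 hC2 hm2 using fun k l =>
    hqv (v' k + v' l) (w' k + w' l) ((hadj k).add (hadj l)) r
  choose C3 hC3 hb3 using fun q : Fin n × Fin n =>
    hyp.exists_bound_self r (v' q.1) (w' q.1) (v' q.2)
  set C : ℝ := ∑ q : Fin n × Fin n, (C1 q.1 + C1 q.2 + C2 q.1 q.2 + C3 q) with hCdef
  have hterm : ∀ q : Fin n × Fin n, 0 ≤ C1 q.1 + C1 q.2 + C2 q.1 q.2 + C3 q := fun q => by
    linarith [hC1 q.1, hC1 q.2, hC2 q.1 q.2, hC3 q]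
  have hC : 0 ≤ C := Finset.sum_nonneg fun q _ => hterm q
  have hCle : ∀ k l, C1 k + C1 l + C2 k l + C3 (k, l) ≤ C := fun k l =>
    Finset.single_le_sum (f := fun q : Fin n × Fin n => C1 q.1 + C1 q.2 + C2 q.1 q.2 + C3 q)
      (fun q _ => hterm q) (Finset.mem_univ (k, l))
  have hC3le : ∀ k l, C3 (k, l) ≤ C := fun k l =>
    le_trans (by linarith [hC1 k, hC1 l, hC2 k l]) (hCle k l)
  -- The main part of a mixed product comes by polarization from the functionals v'_k, v'_l and v'_k
  -- + v'_l.
  have hsm : BoundedSemimartingale (pathFiltration E) P Y b a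
      (fun k l u v x => 1 / 2 * (m2 k l u v x - m1 k u v x - m1 l u v x)) C C := by
    refine ⟨fun x => ?_, fun u => ?_, fun u x => ?_, fun k => ?_, fun k w x => ?_, fun k l => ?_,
      fun k l w x => ?_, fun k l u v => ?_, fun k u v huv B hB => ?_, fun k l u v huv B hB => ?_,
      fun k l u v x δ huv hδ => ?_⟩
    · exact continuous_pi fun k =>
        continuous_stoppedFun r ((v' k).continuous.comp j.continuous) x
    · refine @measurable_pi_lambda _ _ _ (pathFiltration E u) _ _ fun k =>
        measurable_stoppedFun r ((v' k).continuous.comp j.continuous).measurable u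
    · refine (pi_norm_le_iff_of_nonneg hC).2 fun k => ?_
      exact (abs_stoppedFun_le (hC3 (k, k)) (fun y hy => (hb3 (k, k) y hy).1) u x).trans (hC3le k k)
    · exact measurable_killedFun r (hyp.measurable_drift _ _)
    · exact (abs_killedFun_le (hC3 (k, k)) (fun y hy => (hb3 (k, k) y hy).2.1) w x).trans
        (hC3le k k)
    · exact measurable_killedFun r (hyp.measurable_cov _ _)
    · exact (abs_killedFun_le (hC3 (k, l)) (fun y hy => (hb3 (k, l) y hy).2.2) w x).trans
        (hC3le k l)
    · exact (((hm2 k l).1 u v).sub ((hm1 k).1 u v) |>.sub ((hm1 l).1 u v)).const_mul _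
    · rw [← hlin (v' k) (w' k) (hadj k) r u v huv B hB]
      congr 1; ext x
      rw [(hyp.tamePair_lin (v' k) (w' k)).stopped_sub huv]
    · have i2 := ((hm2 k l).2.2.1 u v huv).integrableOn (s := B)
      have ik := ((hm1 k).2.2.1 u v huv).integrableOn (s := B)
      have il := ((hm1 l).2.2.1 u v huv).integrableOn (s := B)
      have i2k : IntegrableOn (fun x => m2 k l u v x - m1 k u v x) B P := i2.sub ik
      rw [integral_const_mul, integral_sub i2k il, integral_sub i2 ik, (hm2 k l).2.1 u v huv B hB,
        (hm1 k).2.1 u v huv B hB, (hm1 l).2.1 u v huv B hB]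
      simp
    · have hkδ : ∀ k, ∀ w, u ≤ w → w ≤ v → |Y w x k - Y u x k| ≤ δ := fun k w h1 h2 =>
        (norm_le_pi_norm (Y w x - Y u x) k).trans (hδ w h1 h2)
      have e1 := (hm1 k).2.2.2 u v x δ huv (hkδ k)
      have e2 := (hm1 l).2.2.2 u v x δ huv (hkδ l)
      -- The sum of two coordinates may oscillate by twice as much; the factor is absorbed in `hq`.
      have e3 := (hm2 k l).2.2.2 u v x (2 * δ) huv fun w h1 h2 => by
        rw [stoppedFun_add, stoppedFun_add]
        have h3 := hkδ k w h1 h2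
        have h4 := hkδ l w h1 h2
        rw [abs_le] at *
        constructor <;> linarith [h3.1, h3.2, h4.1, h4.2]
      rw [stoppedFun_add, stoppedFun_add] at e3
      have hint : ∫ w in (u : ℝ)..v, a k l w x = 1 / 2 *
          ((∫ w in (u : ℝ)..v, killedFun r (covFun G (v' k + v' l) (v' k + v' l)) w x) -
            (∫ w in (u : ℝ)..v, killedFun r (covFun G (v' k) (v' k)) w x) -
            ∫ w in (u : ℝ)..v, killedFun r (covFun G (v' l) (v' l)) w x) := by
        have hi := hyp.intervalIntegrable_killed_cov (r := r) (x := x) (a := u) (b := v)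
        rw [← intervalIntegral.integral_sub (hi _ _) (hi _ _),
          ← intervalIntegral.integral_sub ((hi _ _).sub (hi _ _)) (hi _ _),
          ← intervalIntegral.integral_const_mul]
        refine intervalIntegral.integral_congr fun w _ => ?_
        simp only [ha, killedFun]
        split_ifs
        · exact covFun_polarization _ _ _
        · simp
      have hvu : 0 ≤ (v : ℝ) - u := sub_nonneg.2 (NNReal.coe_le_coe.2 huv)
      have hδ0 : 0 ≤ δ := (norm_nonneg _).trans (hδ u le_rfl huv)
      have hq : C2 k l * ((v : ℝ) - u) * (2 * δ + ((v : ℝ) - u)) ≤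
          2 * (C2 k l * ((v : ℝ) - u) * (δ + ((v : ℝ) - u))) := by
        have : 0 ≤ C2 k l * ((v : ℝ) - u) * ((v : ℝ) - u) :=
          mul_nonneg (mul_nonneg (hC2 k l) hvu) hvu
        nlinarith
      have hfin : (C1 k + C1 l + C2 k l + C3 (k, l)) * (((v : ℝ) - u) * (δ + ((v : ℝ) - u))) ≤
          C * (((v : ℝ) - u) * (δ + ((v : ℝ) - u))) :=
        mul_le_mul_of_nonneg_right (hCle k l) (by positivity)
      have hpos : ∀ c, 0 ≤ c → 0 ≤ c * (((v : ℝ) - u) * (δ + ((v : ℝ) - u))) := fun c hc => by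
        positivity
      have p1 := hpos _ (hC1 k)
      have p2 := hpos _ (hC1 l)
      have p3 := hpos _ (hC2 k l)
      have p4 := hpos _ (hC3 (k, l))
      have hval : (Y v x k - Y u x k) * (Y v x l - Y u x l) =
          1 / 2 * ((Y v x k + Y v x l - (Y u x k + Y u x l)) ^ 2 - (Y v x k - Y u x k) ^ 2 -
            (Y v x l - Y u x l) ^ 2) := by ring
      rw [hint, hval]
      simp only [hY] at e1 e2 e3 ⊢
      rw [abs_le] at *
      constructor <;> linarith [e1.1, e1.2, e2.1, e2.2, e3.1, e3.2]
  have hito := hsm.ito_formula hC hC hφ hst hB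
  rw [← hito]
  congr 1; ext x
  rw [htame.stopped_sub hst]
  have hgen : ∀ w : ℝ, killedFun r (generatorValue j F G φ v' w') w x = itoGenerator φ Y b a w x := by
    intro w
    simp only [killedFun, itoGenerator, hb, ha]
    split_ifs with h
    · rw [generatorValue_eq]
      have : Y w.toNNReal x = fun i => v' i (j (x w.toNNReal)) := by
        ext i
        exact stoppedFun_eq_of_runNorm_lt (f := fun y => v' i (j y)) h
      rw [this]
    · simp
  simp only [hgen]
  congr 1
  -- For paths starting outside the ball φ(Y) is the constant φ(0) and not 0, so only the increments
  -- agree.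
  simp only [hY, stoppedFun]
  split_ifs
  · rfl
  · simp

/-- Conversely, quadratic variations can be read off from the martingale problem for `⟨x, v'⟩`
and `⟨x, v'⟩²`. -/
lemma StandingAssumptions.hasQuadraticVariation_of_sq (hyp : StandingAssumptions j A F G)
    {P : Measure C(ℝ≥0, E)} [IsFiniteMeasure P] {v' w' : V →L[ℝ] ℝ}
    (hlin : StoppedMartingale (fun x => v' (j x)) (driftFun j F v' w') P)
    (hsq : StoppedMartingale (fun x => v' (j x) ^ 2) (sqGenerator j F G v' w') P) (r : ℕ) :
    ∃ m C, 0 ≤ C ∧ HasQuadraticVariation j G P r v' m C := by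
  obtain ⟨C, hC0, hC⟩ := hyp.exists_bound_self r v' w' v'
  have t1 := hyp.tamePair_lin v' w'
  have t2 := hyp.tamePair_sq v' w'
  set f : E → ℝ := fun x => v' (j x) with hf
  have hfm : Measurable f := (v'.continuous.comp j.continuous).measurable
  have hm1 := fun u v => (t1.measurable_stopped r v).sub (t1.measurable_stopped r u)
  have hm2 := fun u v => (t2.measurable_stopped r v).sub (t2.measurable_stopped r u)
  have hYm : ∀ u, Measurable (stoppedFun r f u) := fun u =>
    (measurable_stoppedFun r hfm u).mono ((pathFiltration E).le u) le_rfl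
  have i1 : ∀ u v, u ≤ v → Integrable (fun x => martingaleProcess f (driftFun j F v' w')
      (exitMin r v x) x - martingaleProcess f (driftFun j F v' w') (exitMin r u x) x) P := by
    intro u v huv
    obtain ⟨c, -, hc⟩ := t1.abs_stopped_sub_le r v
    exact integrable_of_abs_le (hm1 u v) fun x => hc x _ _ (exitMin_mono huv x) le_rfl
  have i2 : ∀ u v, u ≤ v → Integrable (fun x => martingaleProcess (fun x => f x ^ 2)
      (sqGenerator j F G v' w') (exitMin r v x) x - martingaleProcess (fun x => f x ^ 2)
      (sqGenerator j F G v' w') (exitMin r u x) x) P := by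
    intro u v huv
    obtain ⟨c, -, hc⟩ := t2.abs_stopped_sub_le r v
    exact integrable_of_abs_le (hm2 u v) fun x => hc x _ _ (exitMin_mono huv x) le_rfl
  have hYb : ∀ u x, |stoppedFun r f u x| ≤ C := fun u x =>
    abs_stoppedFun_le hC0 (fun y hy => (hC y hy).1) u x
  have i3 : ∀ u v, u ≤ v → Integrable (fun x => stoppedFun r f u x *
      (martingaleProcess f (driftFun j F v' w') (exitMin r v x) x -
        martingaleProcess f (driftFun j F v' w') (exitMin r u x) x)) P := fun u v huv =>
    (i1 u v huv).bdd_mul (hYm u).aestronglyMeasurable (ae_of_all _ (hYb u))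
  -- With f = ⟨·, v'⟩, the witness comes from (Δf)² = Δ(f²) - 2 f(u) Δf: martingale increments of f²
  -- minus 2 f(u) times those of f.
  refine ⟨fun u v x => (martingaleProcess (fun x => f x ^ 2) (sqGenerator j F G v' w')
      (exitMin r v x) x - martingaleProcess (fun x => f x ^ 2) (sqGenerator j F G v' w')
      (exitMin r u x) x) - 2 * (stoppedFun r f u x *
      (martingaleProcess f (driftFun j F v' w') (exitMin r v x) x -
        martingaleProcess f (driftFun j F v' w') (exitMin r u x) x)), 2 * C, by positivity,
    fun u v => (hm2 u v).sub (((hYm u).mul (hm1 u v)).const_mul 2), fun u v huv B hB => ?_,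
    fun u v huv => (i2 u v huv).sub ((i3 u v huv).const_mul 2), fun u v x δ huv hδ => ?_⟩
  · rw [integral_sub (i2 u v huv).integrableOn ((i3 u v huv).const_mul 2).integrableOn,
      integral_const_mul, hsq r u v huv B hB]
    have hBm := (pathFiltration E).le u B hB
    have e : ∫ x in B, stoppedFun r f u x * (martingaleProcess f (driftFun j F v' w')
        (exitMin r v x) x - martingaleProcess f (driftFun j F v' w') (exitMin r u x) x) ∂P =
        ∫ x, B.indicator (stoppedFun r f u) x * (martingaleProcess f (driftFun j F v' w')
        (exitMin r v x) x - martingaleProcess f (driftFun j F v' w') (exitMin r u x) x) ∂P := by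
      rw [← integral_indicator hBm]
      congr 1; ext x
      by_cases hx : x ∈ B <;> simp [hx]
    rw [e, integral_mul_eq_zero_of_setIntegral ((pathFiltration E).le u) (i1 u v huv)
      (hlin r u v huv) ((measurable_stoppedFun r hfm u).indicator hB)]
    · simp
    · refine (i1 u v huv).bdd_mul ((hYm u).indicator hBm).aestronglyMeasurable
        (ae_of_all _ fun x => ?_) (c := C)
      by_cases hx : x ∈ B
      · simpa [hx] using hYb u x
      · simpa [hx] using hC0
  · simp only
    have hδ0 : 0 ≤ δ := (abs_nonneg _).trans (hδ u le_rfl huv)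
    have huv' : (u : ℝ) ≤ v := huv
    rw [t1.stopped_sub huv, t2.stopped_sub huv]
    have hsqv : ∀ w, stoppedFun r (fun x => f x ^ 2) w x = stoppedFun r f w x ^ 2 := fun w => by
      simp only [stoppedFun]; split_ifs <;> simp
    rw [hsqv, hsqv]
    have id' : IntervalIntegrable (fun w => killedFun r (driftFun j F v' w') w x) volume u v :=
      intervalIntegrable_of_measurable_bounded
        ((measurable_killedFun r (hyp.measurable_drift v' w')).of_uncurry_right)
        (fun w => abs_killedFun_le hC0 (fun y hy => (hC y hy).2.1) w x) _ _
    have ic := hyp.intervalIntegrable_killed_cov r v' v' x u v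
    have is : IntervalIntegrable (fun w => killedFun r (sqGenerator j F G v' w') w x) volume u v := by
      obtain ⟨c, hc⟩ := t2.bounded_right r
      exact intervalIntegrable_of_measurable_bounded
        ((measurable_killedFun r t2.measurable).of_uncurry_right)
        (fun w => abs_killedFun_le (abs_nonneg c) (fun y hy => (hc y hy).trans (le_abs_self c)) w x)
        _ _
    -- The drift 2 f b of f² and the subtracted drift 2 f(u) b combine to 2 (f - f(u)) b, which is
    -- small by the oscillation bound.
    have key : (∫ w in (u : ℝ)..v, killedFun r (sqGenerator j F G v' w') w x) -
        (∫ w in (u : ℝ)..v, killedFun r (covFun G v' v') w x) -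
        2 * (stoppedFun r f u x * ∫ w in (u : ℝ)..v, killedFun r (driftFun j F v' w') w x) =
        ∫ w in (u : ℝ)..v, 2 * (stoppedFun r f w.toNNReal x - stoppedFun r f u x) *
          killedFun r (driftFun j F v' w') w x := by
      rw [← intervalIntegral.integral_const_mul, ← intervalIntegral.integral_const_mul,
        ← intervalIntegral.integral_sub is ic,
        ← intervalIntegral.integral_sub (is.sub ic) ((id'.const_mul _).const_mul _)]
      refine intervalIntegral.integral_congr fun w _ => ?_
      simp only [killedFun]
      split_ifs with hlt
      · rw [stoppedFun_eq_of_runNorm_lt hlt, sqGenerator]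
        ring
      · simp
    have hle : |∫ w in (u : ℝ)..v, 2 * (stoppedFun r f w.toNNReal x - stoppedFun r f u x) *
          killedFun r (driftFun j F v' w') w x| ≤ 2 * δ * C * ((v : ℝ) - u) := by
      refine abs_interval_integral_le huv' fun w h1 h2 => ?_
      rw [abs_mul, abs_mul, abs_two]
      refine mul_le_mul (mul_le_mul_of_nonneg_left (hδ _ ?_ ?_) zero_le_two)
        (abs_killedFun_le hC0 (fun y hy => (hC y hy).2.1) w x) (abs_nonneg _) (by positivity)
      · exact NNReal.le_toNNReal_of_coe_le h1.le
      · exact Real.toNNReal_le_iff_le_coe.2 h2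
    rw [← key] at hle
    have hvu : 0 ≤ (v : ℝ) - u := sub_nonneg.2 huv'
    have hfin : 2 * δ * C * ((v : ℝ) - u) ≤ 2 * C * ((v : ℝ) - u) * (δ + ((v : ℝ) - u)) := by
      have : 0 ≤ 2 * C * ((v : ℝ) - u) * ((v : ℝ) - u) := by positivity
      nlinarith
    refine le_trans (le_of_eq ?_) (hle.trans hfin)
    congr 1
    ring

end Reduction


/-! ### Countable weak-star dense subsets -/

section CountableDense

variable {V : Type*} [NormedAddCommGroup V] [NormedSpace ℝ V]
  [TopologicalSpace.SeparableSpace V]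

/-- The common norm bound makes the functionals equicontinuous, so convergence on a dense set
extends to all vectors. -/
lemma tendsto_apply_of_denseRange {ι : Type*} {u : ι → V} (hu : DenseRange u)
    {f : ℕ → V →L[ℝ] ℝ} {g : V →L[ℝ] ℝ} {R : ℝ} (hf : ∀ n, ‖f n‖ ≤ R)
    (h : ∀ i, Tendsto (fun n => f n (u i)) atTop (𝓝 (g (u i)))) (v : V) :
    Tendsto (fun n => f n v) atTop (𝓝 (g v)) := by
  have hR : 0 ≤ R := (norm_nonneg _).trans (hf 0)
  rw [Metric.tendsto_atTop]
  intro ε hε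
  obtain ⟨i, hi⟩ := hu.exists_dist_lt v (ε := ε / 3 / (R + ‖g‖ + 1)) (by positivity)
  rw [dist_eq_norm, lt_div_iff₀ (by positivity)] at hi
  obtain ⟨N, hN⟩ := Metric.tendsto_atTop.1 (h i) (ε / 3) (by positivity)
  refine ⟨N, fun n hn => ?_⟩
  have h1 := hN n hn
  rw [Real.dist_eq] at h1 ⊢
  have h2 : |f n (v - u i)| ≤ R * ‖v - u i‖ :=
    ((f n).le_opNorm _).trans (mul_le_mul_of_nonneg_right (hf n) (norm_nonneg _))
  have h3 : |g (v - u i)| ≤ ‖g‖ * ‖v - u i‖ := g.le_opNorm _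
  have h4 : f n v - g v = f n (v - u i) + (f n (u i) - g (u i)) - g (v - u i) := by
    simp
  have h5 := norm_nonneg (v - u i)
  have h6 := norm_nonneg g
  rw [h4]
  rw [abs_le] at h2 h3
  rw [abs_lt] at h1 ⊢
  constructor <;> nlinarith [h1.1, h1.2, h2.1, h2.2, h3.1, h3.2]

/-- Every set of pairs of functionals has a countable subset which is sequentially weak-star dense
in bounded parts. -/
lemma exists_countable_weakStar_dense (𝒢 : Set ((V →L[ℝ] ℝ) × (V →L[ℝ] ℝ))) :
    ∃ S ⊆ 𝒢, S.Countable ∧ ∀ p ∈ 𝒢, ∃ (q : ℕ → (V →L[ℝ] ℝ) × (V →L[ℝ] ℝ)) (R : ℝ),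
      (∀ n, q n ∈ S) ∧ (∀ n, ‖(q n).1‖ ≤ R) ∧ (∀ n, ‖(q n).2‖ ≤ R) ∧
      ‖p.1‖ ≤ R ∧ ‖p.2‖ ≤ R ∧
      (∀ v, Tendsto (fun n => (q n).1 v) atTop (𝓝 (p.1 v))) ∧
      ∀ v, Tendsto (fun n => (q n).2 v) atTop (𝓝 (p.2 v)) := by
  set u := TopologicalSpace.denseSeq V with hu
  -- Evaluation along a dense sequence maps into a separable metrizable space, in which every subset
  -- is separable. On norm-bounded sets convergence there is weak-star convergence, which is why the
  -- norm levels R are treated one at a time.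
  set e : (V →L[ℝ] ℝ) × (V →L[ℝ] ℝ) → ℕ → ℝ × ℝ := fun p i => (p.1 (u i), p.2 (u i)) with he
  set 𝒢R : ℕ → Set ((V →L[ℝ] ℝ) × (V →L[ℝ] ℝ)) :=
    fun R => {p ∈ 𝒢 | ‖p.1‖ ≤ R ∧ ‖p.2‖ ≤ R} with h𝒢R
  have hex : ∀ R, ∃ S ⊆ 𝒢R R, S.Countable ∧ e '' 𝒢R R ⊆ closure (e '' S) := by
    intro R
    obtain ⟨t, ht, htc, hcl⟩ :=
      (TopologicalSpace.IsSeparable.of_separableSpace (e '' 𝒢R R)).exists_countable_dense_subset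
    obtain ⟨S, hS, hSt⟩ := Set.SurjOn.exists_bijOn_subset (f := e) (s := 𝒢R R) (t := t)
      (fun y hy => ht hy)
    refine ⟨S, hS, ?_, ?_⟩
    · exact Set.countable_of_injective_of_countable_image hSt.injOn (hSt.image_eq ▸ htc)
    · rw [hSt.image_eq]; exact hcl
  choose S hS hSc hcl using hex
  refine ⟨⋃ R, S R, Set.iUnion_subset fun R p hp => (hS R hp).1, Set.countable_iUnion hSc, ?_⟩
  intro p hp
  obtain ⟨R, hR⟩ := exists_nat_ge (max ‖p.1‖ ‖p.2‖)
  have hp1 := (le_max_left _ _).trans hR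
  have hp2 := (le_max_right _ _).trans hR
  obtain ⟨y, hy, hlim⟩ := mem_closure_iff_seq_limit.1 (hcl R ⟨p, ⟨hp, hp1, hp2⟩, rfl⟩)
  choose q hq hqy using hy
  have hlim' : ∀ i, Tendsto (fun n => e (q n) i) atTop (𝓝 (e p i)) := fun i => by
    simpa only [hqy] using (tendsto_pi_nhds.1 hlim i)
  refine ⟨q, R, fun n => Set.mem_iUnion.2 ⟨R, hq n⟩, fun n => (hS R (hq n)).2.1,
    fun n => (hS R (hq n)).2.2, hp1, hp2, ?_, ?_⟩
  · exact tendsto_apply_of_denseRange (TopologicalSpace.denseRange_denseSeq V)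
      (fun n => (hS R (hq n)).2.1) fun i => (continuous_fst.tendsto _).comp (hlim' i)
  · exact tendsto_apply_of_denseRange (TopologicalSpace.denseRange_denseSeq V)
      (fun n => (hS R (hq n)).2.2) fun i => (continuous_snd.tendsto _).comp (hlim' i)

end CountableDense

/-! ### Occupation measures -/

section Occupation

variable {E : Type*} [NormedAddCommGroup E] [CompleteSpace E]
  [TopologicalSpace.SeparableSpace E] [MeasurableSpace E] [BorelSpace E]

/-- The occupation measure of the path during `(s, t]`, up to the exit from the ball of radius `r`
and on the event `B`. -/
def occupation (P : Measure C(ℝ≥0, E)) (r : ℝ) (s t : ℝ≥0) (B : Set C(ℝ≥0, E)) : Measure E :=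
  -- Expected time integrals of g(x) become integrals of `g` against a finite measure concentrated
  -- on a ball of `E`, so limits and positivity can be used there.
  (((volume : Measure ℝ).prod P).restrict
    ((Set.Ioc (s : ℝ) t ×ˢ B) ∩ {p | runNorm p.1.toNNReal p.2 < r})).map
    fun p => p.2 p.1.toNNReal

lemma measurable_runNorm_toNNReal :
    Measurable fun p : ℝ × C(ℝ≥0, E) => runNorm p.1.toNNReal p.2 := by
  have hrun : Measurable fun p : ℝ≥0 × C(ℝ≥0, E) => runNorm p.1 p.2 := continuous_runNorm.measurable
  have hpair : Measurable fun p : ℝ × C(ℝ≥0, E) => (p.1.toNNReal, p.2) :=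
    (measurable_real_toNNReal.comp measurable_fst).prodMk measurable_snd
  have h := hrun.comp hpair
  rw [Function.comp_def] at h
  exact h

lemma measurable_eval_toNNReal : Measurable fun p : ℝ × C(ℝ≥0, E) => p.2 p.1.toNNReal :=
  measurable_comp_path measurable_id

lemma measurableSet_runNorm_toNNReal (r : ℝ) :
    MeasurableSet {p : ℝ × C(ℝ≥0, E) | runNorm p.1.toNNReal p.2 < r} :=
  measurableSet_lt measurable_runNorm_toNNReal measurable_const

variable {P : Measure C(ℝ≥0, E)} [IsFiniteMeasure P] {r : ℝ} {s t : ℝ≥0} {B : Set C(ℝ≥0, E)}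

instance : IsFiniteMeasure (occupation P r s t B) := by
  refine ⟨?_⟩
  rw [occupation, Measure.map_apply measurable_eval_toNNReal MeasurableSet.univ, Set.preimage_univ,
    Measure.restrict_apply_univ]
  refine (measure_mono Set.inter_subset_left).trans_lt ?_
  rw [Measure.prod_prod]
  exact ENNReal.mul_lt_top measure_Ioc_lt_top (measure_lt_top _ _)

lemma ae_norm_le_occupation (hB : MeasurableSet B) : ∀ᵐ y ∂occupation P r s t B, ‖y‖ ≤ r := by
  rw [occupation, ae_map_iff measurable_eval_toNNReal.aemeasurable
    (measurableSet_le measurable_norm measurable_const)]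
  filter_upwards [ae_restrict_mem ((measurableSet_Ioc.prod hB).inter
    (measurableSet_runNorm_toNNReal r))] with p hp
  exact (runNorm_lt_iff.1 hp.2 _ le_rfl).le

lemma occupation_mono {s' t' : ℝ≥0} {B' : Set C(ℝ≥0, E)} (hs : s' ≤ s) (ht : t ≤ t')
    (hB : B ⊆ B') : occupation P r s t B ≤ occupation P r s' t' B' := by
  refine Measure.map_mono (Measure.restrict_mono ?_ le_rfl) measurable_eval_toNNReal
  exact Set.inter_subset_inter_left _ (Set.prod_mono
    (Set.Ioc_subset_Ioc (NNReal.coe_le_coe.2 hs) (NNReal.coe_le_coe.2 ht)) hB)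

lemma integrable_occupation {g : E → ℝ} (hB : MeasurableSet B) (hg : Measurable g)
    (hb : ∀ r : ℝ, ∃ C, ∀ x, ‖x‖ ≤ r → |g x| ≤ C) : Integrable g (occupation P r s t B) := by
  obtain ⟨C, hC⟩ := hb r
  refine Integrable.of_bound hg.aestronglyMeasurable C ?_
  filter_upwards [ae_norm_le_occupation hB] with y hy using hC y hy

lemma integral_occupation {g : E → ℝ} (hst : s ≤ t) (hg : Measurable g)
    (hb : ∀ r : ℝ, ∃ C, ∀ x, ‖x‖ ≤ r → |g x| ≤ C) :
    ∫ x in B, (∫ w in (s : ℝ)..t, killedFun r g w x) ∂P = ∫ y, g y ∂occupation P r s t B := by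
  obtain ⟨C, hC⟩ := hb r
  have hk : ∀ p : ℝ × C(ℝ≥0, E), killedFun r g p.1 p.2 =
      {p : ℝ × C(ℝ≥0, E) | runNorm p.1.toNNReal p.2 < r}.indicator
        (fun p => g (p.2 p.1.toNNReal)) p := by
    intro p
    by_cases h : runNorm p.1.toNNReal p.2 < r
    · rw [Set.indicator_of_mem (by exact h), killedFun, if_pos h]
    · rw [Set.indicator_of_notMem (by exact h), killedFun, if_neg h]
  have hkm : Measurable fun p : ℝ × C(ℝ≥0, E) => killedFun r g p.1 p.2 := measurable_killedFun r hg
  rw [occupation, integral_map measurable_eval_toNNReal.aemeasurable hg.aestronglyMeasurable,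
    ← setIntegral_indicator (measurableSet_runNorm_toNNReal r)]
  simp only [← hk]
  rw [← Measure.prod_restrict, integral_prod_symm]
  · refine integral_congr_ae (ae_of_all _ fun x => ?_)
    simp only
    rw [intervalIntegral.integral_of_le (NNReal.coe_le_coe.2 hst)]
  · refine Integrable.of_bound hkm.aestronglyMeasurable |C| (ae_of_all _ fun p => ?_)
    exact abs_killedFun_le (abs_nonneg C) (fun y hy => (hC y hy).trans (le_abs_self C)) _ _

lemma TamePair.integrable_stoppedFun {f g : E → ℝ} (h : TamePair f g) (r : ℝ) (u : ℝ≥0) :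
    Integrable (stoppedFun r f u) P := by
  obtain ⟨C, hC⟩ := h.bounded_left r
  exact integrable_of_abs_le ((measurable_stoppedFun r h.continuous.measurable u).mono
    ((pathFiltration E).le u) le_rfl) fun x =>
      abs_stoppedFun_le (abs_nonneg C) (fun y hy => (hC y hy).trans (le_abs_self C)) u x

/-- The stopped martingale property in terms of occupation measures. -/
lemma TamePair.setIntegral_stopped {f g : E → ℝ} (h : TamePair f g) (hst : s ≤ t) :
    ∫ x in B, (martingaleProcess f g (exitMin r t x) x -
      martingaleProcess f g (exitMin r s x) x) ∂P =
    (∫ x in B, stoppedFun r f t x ∂P) - (∫ x in B, stoppedFun r f s x ∂P) -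
      ∫ y, g y ∂occupation P r s t B := by
  obtain ⟨C, hC⟩ := h.bounded_right r
  have hI : Integrable (fun x => ∫ w in (s : ℝ)..t, killedFun r g w x) (P.restrict B) := by
    refine integrable_of_abs_le (M := |C| * ((t : ℝ) - s))
      (measurable_timeIntegral (measurable_killedFun r h.measurable) _ _) fun x => ?_
    exact abs_interval_integral_le (NNReal.coe_le_coe.2 hst) fun w _ _ =>
      abs_killedFun_le (abs_nonneg C) (fun y hy => (hC y hy).trans (le_abs_self C)) _ _
  simp only [h.stopped_sub hst]
  have h1 := (h.integrable_stoppedFun (P := P) r t).integrableOn (s := B)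
  have h2 := (h.integrable_stoppedFun (P := P) r s).integrableOn (s := B)
  have h3 : Integrable (fun x => stoppedFun r f t x - stoppedFun r f s x) (P.restrict B) := h1.sub h2
  rw [integral_sub h3 hI, integral_sub h1 h2, integral_occupation hst h.measurable
    h.bounded_right]

lemma tendsto_integral_stoppedFun {f : ℕ → E → ℝ} {f' : E → ℝ} {C : ℝ}
    (hf : ∀ n, Continuous (f n)) (hC : ∀ n x, ‖x‖ ≤ r → |f n x| ≤ C)
    (hlim : ∀ x, Tendsto (fun n => f n x) atTop (𝓝 (f' x))) (u : ℝ≥0) :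
    Tendsto (fun n => ∫ x in B, stoppedFun r (f n) u x ∂P) atTop
      (𝓝 (∫ x in B, stoppedFun r f' u x ∂P)) := by
  refine tendsto_integral_of_dominated_convergence (fun _ => |C|)
    (fun n => ((measurable_stoppedFun r (hf n).measurable u).mono
    ((pathFiltration E).le u) le_rfl).aestronglyMeasurable) (integrable_const _)
    (fun n => ae_of_all _ fun x => abs_stoppedFun_le (abs_nonneg C)
      (fun y hy => (hC n y hy).trans (le_abs_self C)) u x) (ae_of_all _ fun x => ?_)
  simp only [stoppedFun]
  split_ifs
  · exact hlim _
  · exact tendsto_const_nhds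

lemma tendsto_integral_occupation {g : ℕ → E → ℝ} {g' : E → ℝ} {C : ℝ} (hB : MeasurableSet B)
    (hg : ∀ n, Measurable (g n)) (hC : ∀ n x, ‖x‖ ≤ r → |g n x| ≤ C)
    (hlim : ∀ x, Tendsto (fun n => g n x) atTop (𝓝 (g' x))) :
    Tendsto (fun n => ∫ y, g n y ∂occupation P r s t B) atTop
      (𝓝 (∫ y, g' y ∂occupation P r s t B)) := by
  refine tendsto_integral_of_dominated_convergence (fun _ => C)
    (fun n => (hg n).aestronglyMeasurable) (integrable_const _)
    (fun n => ?_) (ae_of_all _ hlim)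
  filter_upwards [ae_norm_le_occupation hB] with y hy using hC n y hy

end Occupation


/-! ### Reduction to countably many functionals -/

section Reduction

variable {E V H : Type*}
  [NormedAddCommGroup E] [NormedSpace ℝ E] [CompleteSpace E]
  [TopologicalSpace.SeparableSpace E] [MeasurableSpace E] [BorelSpace E]
  [NormedAddCommGroup V] [NormedSpace ℝ V] [TopologicalSpace.SeparableSpace V]
  [NormedAddCommGroup H] [InnerProductSpace ℝ H] [CompleteSpace H]
  [TopologicalSpace.SeparableSpace H]
  {j : E →L[ℝ] V} {A : V →ₗ.[ℝ] V} {F : E → V} {G : E → H →L[ℝ] V}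

/-- With one argument fixed, the inner product is the value of the other functional at a fixed
vector, hence weak-star continuous. In both arguments at once continuity fails in general. -/
lemma tendsto_covFun {q : ℕ → V →L[ℝ] ℝ} {v' : V →L[ℝ] ℝ}
    (h : ∀ v, Tendsto (fun n => q n v) atTop (𝓝 (v' v))) (u' : V →L[ℝ] ℝ) (x : E) :
    Tendsto (fun n => covFun G u' (q n) x) atTop (𝓝 (covFun G u' v' x)) := by
  simp only [covFun]
  have e : ∀ z' : V →L[ℝ] ℝ, inner ℝ (hilbertAdjoint (G x) u') (hilbertAdjoint (G x) z') =
      z' (G x (hilbertAdjoint (G x) u')) := fun z' => by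
    rw [real_inner_comm, inner_hilbertAdjoint]
  simpa only [e] using h _

lemma tendsto_driftFun {q z : ℕ → V →L[ℝ] ℝ} {v' w' : V →L[ℝ] ℝ}
    (h : ∀ v, Tendsto (fun n => q n v) atTop (𝓝 (v' v)))
    (h' : ∀ v, Tendsto (fun n => z n v) atTop (𝓝 (w' v))) (x : E) :
    Tendsto (fun n => driftFun j F (q n) (z n) x) atTop (𝓝 (driftFun j F v' w' x)) :=
  (h' _).add (h _)

lemma covFun_sub_self (v' u' : V →L[ℝ] ℝ) (x : E) :
    covFun G u' u' x =
      covFun G v' v' x + 2 * covFun G v' (u' - v') x + covFun G (u' - v') (u' - v') x := by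
  have : hilbertAdjoint (G x) u' = hilbertAdjoint (G x) v' + hilbertAdjoint (G x) (u' - v') := by
    rw [← hilbertAdjoint_add, add_sub_cancel]
  rw [covFun, this, real_inner_add_add_self]
  rfl

lemma two_mul_covFun_le (v' u' : V →L[ℝ] ℝ) (x : E) :
    2 * covFun G v' u' x ≤ covFun G v' v' x + covFun G u' u' x := by
  rw [covFun_self, covFun_self, covFun]
  nlinarith [real_inner_le_norm (hilbertAdjoint (G x) v') (hilbertAdjoint (G x) u'),
    sq_nonneg (‖hilbertAdjoint (G x) v'‖ - ‖hilbertAdjoint (G x) u'‖)]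

namespace StandingAssumptions

variable (hyp : StandingAssumptions j A F G) {P : Measure C(ℝ≥0, E)} [IsProbabilityMeasure P]

include hyp

variable {q z : ℕ → V →L[ℝ] ℝ} {v' w' : V →L[ℝ] ℝ} {R : ℝ}

/-- The linear conditions are stable under bounded weak-star limits. -/
lemma stoppedMartingale_lin_of_tendsto (hq : ∀ n, ‖q n‖ ≤ R) (hz : ∀ n, ‖z n‖ ≤ R)
    (h : ∀ v, Tendsto (fun n => q n v) atTop (𝓝 (v' v)))
    (h' : ∀ v, Tendsto (fun n => z n v) atTop (𝓝 (w' v)))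
    (hP : ∀ n, StoppedMartingale (fun x => q n (j x)) (driftFun j F (q n) (z n)) P) :
    StoppedMartingale (fun x => v' (j x)) (driftFun j F v' w') P := by
  intro r s t hst B hB
  have hBm := (pathFiltration E).le s B hB
  obtain ⟨C, hC0, hC⟩ := hyp.exists_bound r R
  have hb := fun n => hC (q n) (z n) (q n) (hq n) (hz n) (hq n)
  have h1 := fun u => tendsto_integral_stoppedFun (P := P) (B := B)
    (f := fun n x => q n (j x)) (f' := fun x => v' (j x))
    (fun n => (q n).continuous.comp j.continuous) (fun n x hx => (hb n x hx).1) (fun x => h _) u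
  have h2 := tendsto_integral_occupation (P := P) (B := B) (s := s) (t := t) hBm
    (fun n => hyp.measurable_drift (q n) (z n)) (fun n x hx => (hb n x hx).2.1)
    (tendsto_driftFun h h')
  have h3 := ((h1 t).sub (h1 s)).sub h2
  rw [(hyp.tamePair_lin v' w').setIntegral_stopped hst]
  refine tendsto_nhds_unique h3 ?_
  have : ∀ n, (∫ x in B, stoppedFun r (fun x => q n (j x)) t x ∂P) -
      (∫ x in B, stoppedFun r (fun x => q n (j x)) s x ∂P) -
      ∫ y, driftFun j F (q n) (z n) y ∂occupation P r s t B = 0 := fun n => by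
    rw [← (hyp.tamePair_lin (q n) (z n)).setIntegral_stopped hst, hP n r s t hst B hB]
  simp only [this]
  exact tendsto_const_nhds

lemma integrable_cov_occupation (u' z' : V →L[ℝ] ℝ) (r : ℝ) (s t : ℝ≥0) {B : Set C(ℝ≥0, E)}
    (hB : MeasurableSet B) : Integrable (covFun G u' z') (occupation P r s t B) :=
  integrable_occupation hB (hyp.measurable_cov _ _) fun r => by
    obtain ⟨C, -, hC⟩ := hyp.exists_bound_self r u' 0 z'
    exact ⟨C, fun x hx => (hC x hx).2.2⟩

lemma sq_identity {u' z' : V →L[ℝ] ℝ} {r : ℝ} {s t : ℝ≥0} {B : Set C(ℝ≥0, E)}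
    (hst : s ≤ t) (hB : MeasurableSet B) :
    ∫ x in B, (martingaleProcess (fun x => u' (j x) ^ 2) (sqGenerator j F G u' z')
      (exitMin r t x) x - martingaleProcess (fun x => u' (j x) ^ 2) (sqGenerator j F G u' z')
      (exitMin r s x) x) ∂P =
    (∫ x in B, stoppedFun r (fun x => u' (j x) ^ 2) t x ∂P) -
      (∫ x in B, stoppedFun r (fun x => u' (j x) ^ 2) s x ∂P) -
      (∫ y, 2 * u' (j y) * driftFun j F u' z' y ∂occupation P r s t B) -
      ∫ y, covFun G u' u' y ∂occupation P r s t B := by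
  rw [(hyp.tamePair_sq u' z').setIntegral_stopped hst, sub_sub _ _ (∫ y, covFun G u' u' y ∂_)]
  congr 1
  rw [← integral_add _ (hyp.integrable_cov_occupation _ _ _ _ _ hB)]
  · rfl
  refine integrable_occupation hB
    (((u'.continuous.comp j.continuous).measurable.const_mul 2).mul
    (hyp.measurable_drift u' z')) fun r => ?_
  obtain ⟨C, hC0, hC⟩ := hyp.exists_bound_self r u' z' u'
  refine ⟨2 * C * C, fun x hx => ?_⟩
  rw [abs_mul, abs_mul, abs_two]
  exact mul_le_mul (mul_le_mul_of_nonneg_left (hC x hx).1 zero_le_two) (hC x hx).2.1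
    (abs_nonneg _) (by positivity)

/-- The part of the square condition that is continuous under bounded weak-star limits. -/
lemma tendsto_sq_part (hq : ∀ n, ‖q n‖ ≤ R) (hz : ∀ n, ‖z n‖ ≤ R)
    (h : ∀ v, Tendsto (fun n => q n v) atTop (𝓝 (v' v)))
    (h' : ∀ v, Tendsto (fun n => z n v) atTop (𝓝 (w' v))) (r : ℝ) (s t : ℝ≥0)
    {B : Set C(ℝ≥0, E)} (hB : MeasurableSet B) :
    Tendsto (fun n => (∫ x in B, stoppedFun r (fun x => q n (j x) ^ 2) t x ∂P) -
      (∫ x in B, stoppedFun r (fun x => q n (j x) ^ 2) s x ∂P) -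
      ∫ y, 2 * q n (j y) * driftFun j F (q n) (z n) y ∂occupation P r s t B) atTop
      (𝓝 ((∫ x in B, stoppedFun r (fun x => v' (j x) ^ 2) t x ∂P) -
      (∫ x in B, stoppedFun r (fun x => v' (j x) ^ 2) s x ∂P) -
      ∫ y, 2 * v' (j y) * driftFun j F v' w' y ∂occupation P r s t B)) := by
  obtain ⟨C, hC0, hC⟩ := hyp.exists_bound r R
  have hb := fun n => hC (q n) (z n) (q n) (hq n) (hz n) (hq n)
  have h1 := fun u => tendsto_integral_stoppedFun (P := P) (B := B) (r := r) (C := C ^ 2)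
    (f := fun n x => q n (j x) ^ 2) (f' := fun x => v' (j x) ^ 2)
    (fun n => ((q n).continuous.comp j.continuous).pow 2) (fun n x hx => by
      rw [abs_pow]; exact pow_le_pow_left₀ (abs_nonneg _) (hb n x hx).1 2)
    (fun x => (h _).pow 2) u
  refine ((h1 t).sub (h1 s)).sub ?_
  refine tendsto_integral_occupation (C := 2 * C * C) hB
    (fun n => ((((q n).continuous.comp j.continuous).measurable.const_mul 2).mul
      (hyp.measurable_drift (q n) (z n)))) (fun n x hx => ?_)
    (fun x => ((h _).const_mul 2).mul (tendsto_driftFun h h' x))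
  rw [abs_mul, abs_mul, abs_two]
  exact mul_le_mul (mul_le_mul_of_nonneg_left (hb n x hx).1 zero_le_two) (hb n x hx).2.1
    (abs_nonneg _) (by positivity)

/-- If the square condition holds for the differences of a bounded weak-star convergent sequence,
then the covariances converge in mean. -/
lemma tendsto_cov_sub (hq : ∀ n, ‖q n‖ ≤ R) (hz : ∀ n, ‖z n‖ ≤ R)
    (hv : ‖v'‖ ≤ R) (hw : ‖w'‖ ≤ R)
    (h : ∀ v, Tendsto (fun n => q n v) atTop (𝓝 (v' v)))
    (h' : ∀ v, Tendsto (fun n => z n v) atTop (𝓝 (w' v)))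
    (hP : ∀ n m, StoppedMartingale (fun x => (q n - q m) (j x) ^ 2)
      (sqGenerator j F G (q n - q m) (z n - z m)) P) (r : ℕ) (t : ℝ≥0) :
    Tendsto (fun n => ∫ y, covFun G (q n - v') (q n - v') y ∂occupation P r 0 t Set.univ) atTop
      (𝓝 0) := by
  set ν := occupation P r 0 t Set.univ with hν
  set part : (V →L[ℝ] ℝ) → (V →L[ℝ] ℝ) → ℝ := fun u' z' =>
    (∫ x in Set.univ, stoppedFun r (fun x => u' (j x) ^ 2) t x ∂P) -
      (∫ x in Set.univ, stoppedFun r (fun x => u' (j x) ^ 2) 0 x ∂P) -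
      ∫ y, 2 * u' (j y) * driftFun j F u' z' y ∂ν with hpart
  have hRR : ∀ a b : V →L[ℝ] ℝ, ‖a‖ ≤ R → ‖b‖ ≤ R → ‖a - b‖ ≤ 2 * R := fun a b ha hb => by
    linarith [norm_sub_le a b]
  -- The square condition for the differences expresses their mean covariance through terms that are
  -- weak-star continuous.
  have hbm : ∀ n m, ∫ y, covFun G (q n - q m) (q n - q m) y ∂ν = part (q n - q m) (z n - z m) := by
    intro n m
    have h1 := hP n m r 0 t zero_le Set.univ MeasurableSet.univ
    rw [hyp.sq_identity zero_le MeasurableSet.univ] at h1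
    simp only [hpart]
    linarith
  have hlim1 : ∀ n, Tendsto (fun m => part (q n - q m) (z n - z m)) atTop
      (𝓝 (part (q n - v') (z n - w'))) := fun n =>
    hyp.tendsto_sq_part (R := 2 * R) (fun m => hRR _ _ (hq n) (hq m)) (fun m => hRR _ _ (hz n) (hz m))
      (fun v => (tendsto_const_nhds).sub (h v)) (fun v => (tendsto_const_nhds).sub (h' v)) r 0 t
      MeasurableSet.univ
  have hlim2 : Tendsto (fun n => part (q n - v') (z n - w')) atTop (𝓝 (part 0 0)) :=
    hyp.tendsto_sq_part (R := 2 * R) (fun m => hRR _ _ (hq m) hv) (fun m => hRR _ _ (hz m) hw)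
      (fun v => by simpa using (h v).sub_const (v' v)) (fun v => by simpa using (h' v).sub_const (w' v))
      r 0 t MeasurableSet.univ
  have hpart0 : part 0 0 = 0 := by
    simp [hpart, stoppedFun]
  rw [hpart0] at hlim2
  refine squeeze_zero (fun n => integral_nonneg fun y => ?_) (fun n => ?_) hlim2
  · rw [covFun_self]; positivity
  · have hi := hyp.integrable_cov_occupation (P := P) (r := r) (s := 0) (t := t)
      (B := Set.univ) (hB := MeasurableSet.univ)
    -- This is weak lower semicontinuity of the norm. As m tends to infinity the left side becomes
    -- twice the mean covariance of q_n - v', one copy of which cancels against the right side.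
    have hle : ∀ m, 2 * ∫ y, covFun G (q n - v') (q n - q m) y ∂ν ≤
        (∫ y, covFun G (q n - v') (q n - v') y ∂ν) + part (q n - q m) (z n - z m) := by
      intro m
      rw [← hbm, ← integral_const_mul, ← integral_add (hi _ _) (hi _ _)]
      exact integral_mono ((hi _ _).const_mul 2) ((hi _ _).add (hi _ _)) fun y =>
        two_mul_covFun_le _ _ y
    obtain ⟨C, hC0, hC⟩ := hyp.exists_bound r (2 * R)
    have hconv : Tendsto (fun m => ∫ y, covFun G (q n - v') (q n - q m) y ∂ν) atTop
        (𝓝 (∫ y, covFun G (q n - v') (q n - v') y ∂ν)) :=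
      tendsto_integral_occupation (C := C) MeasurableSet.univ
        (fun m => hyp.measurable_cov _ _)
        (fun m x hx => (hC (q n - v') 0 (q n - q m) (hRR _ _ (hq n) hv)
          (by rw [norm_zero]; linarith [norm_nonneg v']) (hRR _ _ (hq n) (hq m)) x hx).2.2)
        (tendsto_covFun (fun v => tendsto_const_nhds.sub (h v)) _)
    have := le_of_tendsto_of_tendsto' (hconv.const_mul 2) ((hlim1 n).const_add _) hle
    linarith

/-- The square conditions are stable under bounded weak-star limits. -/
lemma stoppedMartingale_sq_of_tendsto (hq : ∀ n, ‖q n‖ ≤ R) (hz : ∀ n, ‖z n‖ ≤ R)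
    (hv : ‖v'‖ ≤ R) (hw : ‖w'‖ ≤ R)
    (h : ∀ v, Tendsto (fun n => q n v) atTop (𝓝 (v' v)))
    (h' : ∀ v, Tendsto (fun n => z n v) atTop (𝓝 (w' v)))
    (hP : ∀ n, StoppedMartingale (fun x => q n (j x) ^ 2) (sqGenerator j F G (q n) (z n)) P)
    (hP' : ∀ n m, StoppedMartingale (fun x => (q n - q m) (j x) ^ 2)
      (sqGenerator j F G (q n - q m) (z n - z m)) P) :
    StoppedMartingale (fun x => v' (j x) ^ 2) (sqGenerator j F G v' w') P := by
  intro r s t hst B hB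
  have hBm := (pathFiltration E).le s B hB
  rw [hyp.sq_identity hst hBm]
  set ν := occupation P r s t B with hν
  have hi := hyp.integrable_cov_occupation (P := P) (r := r) (s := s) (t := t) (hB := hBm)
  have h1 := hyp.tendsto_sq_part (P := P) hq hz h h' r s t hBm
  have h2 : Tendsto (fun n => ∫ y, covFun G v' (q n - v') y ∂ν) atTop (𝓝 (∫ y, covFun G v' 0 y ∂ν)) := by
    obtain ⟨C, hC0, hC⟩ := hyp.exists_bound r (2 * R)
    have hR0 : 0 ≤ R := (norm_nonneg _).trans hv
    exact tendsto_integral_occupation (C := C) hBm (fun m => hyp.measurable_cov _ _)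
        (fun m x hx => (hC v' 0 (q m - v') (by linarith)
          (by rw [norm_zero]; linarith) (by linarith [norm_sub_le (q m) v', hq m]) x hx).2.2)
        (tendsto_covFun (fun v => by simpa using (h v).sub_const (v' v)) _)
  -- By positivity it suffices to integrate over all paths and the whole time interval (0, t].
  have h3 : Tendsto (fun n => ∫ y, covFun G (q n - v') (q n - v') y ∂ν) atTop (𝓝 0) := by
    refine squeeze_zero (fun n => integral_nonneg fun y => ?_) (fun n => ?_)
      (hyp.tendsto_cov_sub hq hz hv hw h h' hP' r t)
    · rw [covFun_self]; positivity
    · exact integral_mono_measure (occupation_mono zero_le le_rfl (Set.subset_univ B))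
        (ae_of_all _ fun y => by rw [covFun_self]; exact sq_nonneg _)
        (hyp.integrable_cov_occupation _ _ _ _ _ MeasurableSet.univ)
  have h0 : ∫ y, covFun G v' 0 y ∂ν = 0 := by simp [covFun, hilbertAdjoint]
  rw [h0] at h2
  -- Expanding the covariance of q_n around v' leaves a cross term, which vanishes by weak-star
  -- convergence, and the term controlled by `tendsto_cov_sub`.
  have h4 := (((h1.sub_const (∫ y, covFun G v' v' y ∂ν)).sub (h2.const_mul 2)).sub h3)
  rw [mul_zero, sub_zero, sub_zero] at h4
  refine tendsto_nhds_unique h4 ?_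
  have : ∀ n, (∫ x in B, stoppedFun r (fun x => q n (j x) ^ 2) t x ∂P) -
      (∫ x in B, stoppedFun r (fun x => q n (j x) ^ 2) s x ∂P) -
      (∫ y, 2 * q n (j y) * driftFun j F (q n) (z n) y ∂ν) - (∫ y, covFun G v' v' y ∂ν) -
      2 * (∫ y, covFun G v' (q n - v') y ∂ν) -
      ∫ y, covFun G (q n - v') (q n - v') y ∂ν = 0 := by
    intro n
    have e := hP n r s t hst B hB
    rw [hyp.sq_identity hst hBm] at e
    have e2 : ∫ y, covFun G (q n) (q n) y ∂ν = (∫ y, covFun G v' v' y ∂ν) +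
      2 * (∫ y, covFun G v' (q n - v') y ∂ν) +
      ∫ y, covFun G (q n - v') (q n - v') y ∂ν := by
      have i2 : Integrable (fun y => 2 * covFun G v' (q n - v') y) ν := (hi _ _).const_mul 2
      have i3 : Integrable (fun y => covFun G v' v' y + 2 * covFun G v' (q n - v') y) ν :=
        (hi _ _).add i2
      rw [← integral_const_mul, ← integral_add (hi _ _) i2, ← integral_add i3 (hi _ _)]
      exact integral_congr_ae (ae_of_all _ fun y => covFun_sub_self _ _ y)
    linarith
  exact tendsto_const_nhds.congr fun n => (this n).symm

/-- The local martingale problem only involves the functionals from a suitable countable set and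
their squares. -/
theorem exists_countable_solvesLMP_iff :
    ∃ D : Set ((V →L[ℝ] ℝ) × (V →L[ℝ] ℝ)), D.Countable ∧ (∀ p ∈ D, IsAdjointValue A p.1 p.2) ∧
      ∀ P : Measure C(ℝ≥0, E), IsProbabilityMeasure P →
        (SolvesLMP (operatorGraph j A F G) P ↔ ∀ p ∈ D,
          StoppedMartingale (fun x => p.1 (j x)) (driftFun j F p.1 p.2) P ∧
          StoppedMartingale (fun x => p.1 (j x) ^ 2) (sqGenerator j F G p.1 p.2) P) := by
  obtain ⟨S, hS, hSc, hdense⟩ := exists_countable_weakStar_dense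
    {p : (V →L[ℝ] ℝ) × (V →L[ℝ] ℝ) | IsAdjointValue A p.1 p.2}
  -- Differences are included because `tendsto_cov_sub` needs the square conditions for them.
  refine ⟨S ∪ Set.image2 (fun p q => p - q) S S, hSc.union (hSc.image2 hSc _), ?_, ?_⟩
  · rintro p (hp | ⟨a, ha, b, hb, rfl⟩)
    · exact hS hp
    · exact IsAdjointValue.sub (hS ha) (hS hb)
  intro P hPp
  constructor
  · intro hP p hp
    have hadj : IsAdjointValue A p.1 p.2 := by
      rcases hp with hp | ⟨a, ha, b, hb, rfl⟩
      · exact hS hp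
      · exact IsAdjointValue.sub (hS ha) (hS hb)
    exact ⟨stoppedMartingale_of_isLocalMartingale (hyp.tamePair_lin _ _)
        (hP.2 _ (lin_mem_operatorGraph hadj)),
      stoppedMartingale_of_isLocalMartingale (hyp.tamePair_sq _ _)
        (hP.2 _ (sq_mem_operatorGraph hadj))⟩
  · intro hD
    have hall : ∀ v' w', IsAdjointValue A v' w' →
        StoppedMartingale (fun x => v' (j x)) (driftFun j F v' w') P ∧
        StoppedMartingale (fun x => v' (j x) ^ 2) (sqGenerator j F G v' w') P := by
      intro v' w' hadj
      obtain ⟨q, R, hqS, hq1, hq2, hv, hw, h, h'⟩ := hdense (v', w') hadj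
      exact ⟨hyp.stoppedMartingale_lin_of_tendsto hq1 hq2 h h' fun n => (hD _ (Or.inl (hqS n))).1,
        hyp.stoppedMartingale_sq_of_tendsto hq1 hq2 hv hw h h'
          (fun n => (hD _ (Or.inl (hqS n))).2)
          fun n m => (hD _ (Or.inr ⟨q n, hqS n, q m, hqS m, rfl⟩)).2⟩
    exact solvesLMP_of_quadraticVariation hyp (fun v' w' hadj => (hall v' w' hadj).1)
      fun v' w' hadj r => hyp.hasQuadraticVariation_of_sq (hall v' w' hadj).1 (hall v' w' hadj).2 r

end StandingAssumptions

end Reduction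


/-! ### A countable family of test functions -/

/-- Finite intersections of members of a countable base serve; the empty intersection supplies the
whole space. -/
lemma exists_countable_piSystem (α : Type*) [TopologicalSpace α] [SecondCountableTopology α] :
    ∃ 𝒮 : Set (Set α), 𝒮.Countable ∧ IsPiSystem 𝒮 ∧ Set.univ ∈ 𝒮 ∧
      borel α = MeasurableSpace.generateFrom 𝒮 := by
  set b := TopologicalSpace.countableBasis α
  have hb := TopologicalSpace.isBasis_countableBasis α
  refine ⟨Set.sInter '' {F : Set (Set α) | F.Finite ∧ F ⊆ b},
    (Set.countable_ofPred_finite_subset (TopologicalSpace.countable_countableBasis α)).image _,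
    ?_, ⟨∅, ⟨Set.finite_empty, Set.empty_subset _⟩, Set.sInter_empty⟩, ?_⟩
  · rintro _ ⟨F, hF, rfl⟩ _ ⟨F', hF', rfl⟩ -
    exact ⟨F ∪ F', ⟨hF.1.union hF'.1, Set.union_subset hF.2 hF'.2⟩, Set.sInter_union _ _⟩
  · rw [hb.borel_eq_generateFrom]
    refine le_antisymm (MeasurableSpace.generateFrom_mono fun s hs =>
      ⟨{s}, ⟨Set.finite_singleton s, Set.singleton_subset_iff.2 hs⟩, Set.sInter_singleton s⟩) ?_
    refine MeasurableSpace.generateFrom_le ?_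
    rintro _ ⟨F, hF, rfl⟩
    exact MeasurableSet.sInter hF.1.countable fun s hs =>
      MeasurableSpace.measurableSet_generateFrom (hF.2 hs)

section TestFunctions

variable {E : Type*} [NormedAddCommGroup E] [CompleteSpace E]
  [TopologicalSpace.SeparableSpace E] [MeasurableSpace E] [BorelSpace E]

/-- The increment of the martingale of `(f, g)`, stopped at the exit from a ball, between `s` and
`t` on the event `B`. -/
def testFun (f g : E → ℝ) (r : ℝ) (s t : ℝ≥0) (B : Set C(ℝ≥0, E)) : C(ℝ≥0, E) → ℝ :=
  B.indicator fun x => martingaleProcess f g (exitMin r t x) x -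
    martingaleProcess f g (exitMin r s x) x

variable {f g : E → ℝ}

lemma TamePair.measurable_testFun (h : TamePair f g) (r : ℝ) (s t : ℝ≥0) {B : Set C(ℝ≥0, E)}
    (hB : MeasurableSet B) : Measurable (testFun f g r s t B) :=
  ((h.measurable_stopped r t).sub (h.measurable_stopped r s)).indicator hB

lemma TamePair.abs_testFun_le (h : TamePair f g) (r : ℝ) {s t : ℝ≥0} (hst : s ≤ t)
    (B : Set C(ℝ≥0, E)) : ∃ C, ∀ x, |testFun f g r s t B x| ≤ C := by
  obtain ⟨C, hC0, hC⟩ := h.abs_stopped_sub_le r t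
  refine ⟨C, fun x => ?_⟩
  by_cases hx : x ∈ B
  · rw [testFun, Set.indicator_of_mem hx]
    exact hC x _ _ (exitMin_mono hst x) le_rfl
  · rw [testFun, Set.indicator_of_notMem hx]
    simpa using hC0

lemma integral_testFun {P : Measure C(ℝ≥0, E)} (f g : E → ℝ) (r : ℝ) (s t : ℝ≥0)
    {B : Set C(ℝ≥0, E)} (hB : MeasurableSet B) :
    ∫ x, testFun f g r s t B x ∂P = ∫ x in B, (martingaleProcess f g (exitMin r t x) x -
      martingaleProcess f g (exitMin r s x) x) ∂P :=
  integral_indicator hB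

lemma measurableSet_stopAt_preimage (s : ℝ≥0) {B : Set C(ℝ≥0, E)} (hB : MeasurableSet B) :
    MeasurableSet[pathFiltration E s] (stopAt s ⁻¹' B) := by
  rw [pathFiltration_eq_comap]; exact ⟨B, hB, rfl⟩

/-- For times in `D` the events are reached by a monotone class argument. General times are
approached from the right, because an event of 𝓑_s belongs to 𝓑_u only for u ≥ s; the stopped
process is continuous and its increments are bounded. -/
lemma stoppedMartingale_of_countable (h : TamePair f g) {P : Measure C(ℝ≥0, E)}
    [IsProbabilityMeasure P] {D : Set ℝ≥0} (hD : Dense D) {S : Set (Set C(ℝ≥0, E))}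
    (hS : IsPiSystem S) (huniv : Set.univ ∈ S)
    (hgen : borel C(ℝ≥0, E) = MeasurableSpace.generateFrom S)
    (hP : ∀ (r : ℕ), ∀ s ∈ D, ∀ t ∈ D, s ≤ t → ∀ B ∈ S,
      ∫ x, testFun f g r s t (stopAt s ⁻¹' B) x ∂P = 0) :
    StoppedMartingale f g P := by
  have hint : ∀ (r : ℕ) (s t : ℝ≥0), s ≤ t → Integrable (fun x =>
      martingaleProcess f g (exitMin r t x) x - martingaleProcess f g (exitMin r s x) x) P := by
    intro r s t hst
    obtain ⟨c, -, hc⟩ := h.abs_stopped_sub_le r t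
    exact integrable_of_abs_le ((h.measurable_stopped r t).sub (h.measurable_stopped r s))
      fun x => hc x _ _ (exitMin_mono hst x) le_rfl
  have hmeas : ∀ (s : ℝ≥0) {B : Set C(ℝ≥0, E)}, MeasurableSet B → MeasurableSet (stopAt s ⁻¹' B) :=
    fun s B hB => (pathFiltration E).le s _ (measurableSet_stopAt_preimage s hB)
  have h1 : ∀ (r : ℕ), ∀ s ∈ D, ∀ t ∈ D, s ≤ t → ∀ B : Set C(ℝ≥0, E), MeasurableSet B →
      ∫ x in stopAt s ⁻¹' B, (martingaleProcess f g (exitMin r t x) x -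
        martingaleProcess f g (exitMin r s x) x) ∂P = 0 := by
    intro r s hs t ht hst
    have hbase : ∀ B ∈ S, ∫ x in stopAt s ⁻¹' B, (martingaleProcess f g (exitMin r t x) x -
        martingaleProcess f g (exitMin r s x) x) ∂P = 0 := by
      intro B hB
      rw [← integral_testFun _ _ _ _ _ (hmeas s ?_), hP r s hs t ht hst B hB]
      show MeasurableSet[borel _] B
      rw [hgen]; exact MeasurableSpace.measurableSet_generateFrom hB
    refine MeasurableSpace.induction_on_inter hgen hS ?_ hbase ?_ ?_
    · simp
    · intro B hB hB0
      have hBm := hmeas s (B := B) hB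
      have e := integral_add_compl hBm (hint r s t hst)
      have e2 := hbase _ huniv
      rw [Set.preimage_univ, setIntegral_univ] at e2
      rw [hB0, e2, zero_add] at e
      exact e
    · intro B hdisj hB h0
      rw [Set.preimage_iUnion, integral_iUnion (fun n => hmeas s (hB n))
        (fun m n hmn => (hdisj hmn).preimage _) (hint r s t hst).integrableOn]
      simp [h0]
  intro r s t hst B hB
  rcases hst.eq_or_lt with rfl | hlt
  · simp
  obtain ⟨sn, -, hsn, hslim⟩ := hD.exists_seq_strictAnti_tendsto s
  obtain ⟨tn, -, htn, htlim⟩ := hD.exists_seq_strictAnti_tendsto t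
  obtain ⟨T, hT⟩ := htlim.bddAbove_range
  have hTle : ∀ n, tn n ≤ T := fun n => hT ⟨n, rfl⟩
  obtain ⟨c, -, hc⟩ := h.abs_stopped_sub_le r (max T t)
  have hcont : ∀ x, Continuous fun u => martingaleProcess f g (exitMin r u x) x := fun x =>
    (h.continuous_process x).comp (continuous_exitMin r x)
  have hev : ∀ᶠ n in atTop, sn n ≤ t := (hslim.eventually (gt_mem_nhds hlt)).mono fun n hn => hn.le
  have hlim : Tendsto (fun n => ∫ x in B, (martingaleProcess f g (exitMin r (tn n) x) x -
      martingaleProcess f g (exitMin r (sn n) x) x) ∂P) atTop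
      (𝓝 (∫ x in B, (martingaleProcess f g (exitMin r t x) x -
      martingaleProcess f g (exitMin r s x) x) ∂P)) := by
    refine tendsto_integral_filter_of_dominated_convergence (fun _ => c)
      (Eventually.of_forall fun n => ((h.measurable_stopped r (tn n)).sub
        (h.measurable_stopped r (sn n))).aestronglyMeasurable) ?_ (integrable_const _)
      (ae_of_all _ fun x => ?_)
    · filter_upwards [hev] with n hn
      exact ae_of_all _ fun x => hc x _ _ (exitMin_mono (hn.trans (le_max_right _ _)) x)
        (exitMin_mono ((hTle n).trans (le_max_left _ _)) x)
    · exact (((hcont x).tendsto t).comp htlim).sub (((hcont x).tendsto s).comp hslim)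
  refine tendsto_nhds_unique hlim (tendsto_const_nhds.congr' ?_)
  filter_upwards [hev] with n hn
  have hB' : MeasurableSet[pathFiltration E (sn n)] B := (pathFiltration E).mono (hsn n).1.le B hB
  rw [pathFiltration_eq_comap] at hB'
  obtain ⟨B', hB'm, rfl⟩ := hB'
  exact (h1 r (sn n) (hsn n).2 (tn n) (htn n).2 (hn.trans (htn n).1.le) B' hB'm).symm

end TestFunctions

/-! ### Countably many equations for the martingale problem. -/

section Tests

variable {E V H : Type*}
  [NormedAddCommGroup E] [NormedSpace ℝ E] [CompleteSpace E]
  [TopologicalSpace.SeparableSpace E] [MeasurableSpace E] [BorelSpace E]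
  [NormedAddCommGroup V] [NormedSpace ℝ V] [TopologicalSpace.SeparableSpace V]
  [NormedAddCommGroup H] [InnerProductSpace ℝ H] [CompleteSpace H]
  [TopologicalSpace.SeparableSpace H]
  {j : E →L[ℝ] V} {A : V →ₗ.[ℝ] V} {F : E → V} {G : E → H →L[ℝ] V}

/-- The local martingale problem is described by countably many test functions. -/
theorem StandingAssumptions.exists_countable_tests (hyp : StandingAssumptions j A F G) :
    ∃ Ξ : Set (C(ℝ≥0, E) → ℝ), Ξ.Countable ∧
      (∀ ξ ∈ Ξ, ∃ (f g : E → ℝ) (r : ℕ) (s t : ℝ≥0) (B : Set C(ℝ≥0, E)),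
        (f, g) ∈ operatorGraph j A F G ∧ TamePair f g ∧ s ≤ t ∧
        MeasurableSet[pathFiltration E s] B ∧ ξ = testFun f g r s t B) ∧
      ∀ P : Measure C(ℝ≥0, E), IsProbabilityMeasure P →
        (SolvesLMP (operatorGraph j A F G) P ↔ ∀ ξ ∈ Ξ, ∫ x, ξ x ∂P = 0) := by
  obtain ⟨𝒟, h𝒟c, h𝒟, hiff⟩ := hyp.exists_countable_solvesLMP_iff
  obtain ⟨S, hSc, hS, huniv, hgen⟩ := exists_countable_piSystem C(ℝ≥0, E)
  obtain ⟨D, hDc, hD⟩ := TopologicalSpace.exists_countable_dense ℝ≥0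
  have hSm : ∀ B ∈ S, MeasurableSet B := fun B hB => by
    show MeasurableSet[borel _] B
    rw [hgen]; exact MeasurableSpace.measurableSet_generateFrom hB
  set tests : (E → ℝ) × (E → ℝ) → Set (C(ℝ≥0, E) → ℝ) := fun p =>
    {ξ | ∃ r : ℕ, ∃ s ∈ D, ∃ t ∈ D, ∃ B ∈ S, s ≤ t ∧
      ξ = testFun p.1 p.2 r s t (stopAt s ⁻¹' B)} with htests
  have htc : ∀ p, (tests p).Countable := by
    intro p
    refine (((Set.countable_univ (α := ℕ)).prod (hDc.prod (hDc.prod hSc))).image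
      fun q : ℕ × ℝ≥0 × ℝ≥0 × Set C(ℝ≥0, E) =>
        testFun p.1 p.2 q.1 q.2.1 q.2.2.1 (stopAt q.2.1 ⁻¹' q.2.2.2)).mono ?_
    rintro ξ ⟨r, s, hs, t, ht, B, hB, -, rfl⟩
    exact ⟨(r, s, t, B), ⟨Set.mem_univ _, hs, ht, hB⟩, rfl⟩
  set lin : (V →L[ℝ] ℝ) × (V →L[ℝ] ℝ) → (E → ℝ) × (E → ℝ) :=
    fun p => (fun x => p.1 (j x), driftFun j F p.1 p.2) with hlin
  set sq : (V →L[ℝ] ℝ) × (V →L[ℝ] ℝ) → (E → ℝ) × (E → ℝ) :=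
    fun p => (fun x => p.1 (j x) ^ 2, sqGenerator j F G p.1 p.2) with hsq
  have hpair : ∀ P : Measure C(ℝ≥0, E), IsProbabilityMeasure P → ∀ p : (E → ℝ) × (E → ℝ),
      TamePair p.1 p.2 → (StoppedMartingale p.1 p.2 P ↔ ∀ ξ ∈ tests p, ∫ x, ξ x ∂P = 0) := by
    intro P hP p hp
    constructor
    · rintro h ξ ⟨r, s, hs, t, ht, B, hB, hst, rfl⟩
      have hm := measurableSet_stopAt_preimage s (hSm B hB)
      rw [integral_testFun _ _ _ _ _ ((pathFiltration E).le s _ hm)]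
      exact h r s t hst _ hm
    · intro h
      exact stoppedMartingale_of_countable hp hD hS huniv hgen fun r s hs t ht hst B hB =>
        h _ ⟨r, s, hs, t, ht, B, hB, hst, rfl⟩
  refine ⟨⋃ p ∈ 𝒟, (tests (lin p) ∪ tests (sq p)), h𝒟c.biUnion fun p _ => (htc _).union (htc _),
    ?_, ?_⟩
  · intro ξ hξ
    simp only [Set.mem_iUnion] at hξ
    obtain ⟨p, hp, hξ⟩ := hξ
    rcases hξ with ⟨r, s, hs, t, ht, B, hB, hst, rfl⟩ | ⟨r, s, hs, t, ht, B, hB, hst, rfl⟩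
    · exact ⟨_, _, r, s, t, _, lin_mem_operatorGraph (h𝒟 p hp), hyp.tamePair_lin _ _, hst,
        measurableSet_stopAt_preimage s (hSm B hB), rfl⟩
    · exact ⟨_, _, r, s, t, _, sq_mem_operatorGraph (h𝒟 p hp), hyp.tamePair_sq _ _, hst,
        measurableSet_stopAt_preimage s (hSm B hB), rfl⟩
  · intro P hP
    rw [hiff P hP]
    simp only [Set.mem_iUnion]
    constructor
    · rintro h ξ ⟨p, hp, hξ | hξ⟩
      · exact (hpair P hP (lin p) (hyp.tamePair_lin _ _)).1 (h p hp).1 ξ hξ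
      · exact (hpair P hP (sq p) (hyp.tamePair_sq _ _)).1 (h p hp).2 ξ hξ
    · intro h p hp
      exact ⟨(hpair P hP (lin p) (hyp.tamePair_lin _ _)).2 fun ξ hξ => h ξ ⟨p, hp, Or.inl hξ⟩,
        (hpair P hP (sq p) (hyp.tamePair_sq _ _)).2 fun ξ hξ => h ξ ⟨p, hp, Or.inr hξ⟩⟩

end Tests


/-! ### Measurable selection of uniquely determined measures -/

section Selection

variable {Ω : Type*} [MeasurableSpace Ω] [StandardBorelSpace Ω]

/-- The distribution function, at rational points, of a measure on a standard Borel space that is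
transported to the real line. -/
def ratCDF (μ : Measure Ω) (q : ℚ) : ℝ := (μ (embeddingReal Ω ⁻¹' Set.Iic (q : ℝ))).toReal

lemma measurable_ratCDF : Measurable (ratCDF (Ω := Ω)) :=
  measurable_pi_lambda _ fun _ => (Measure.measurable_coe
    ((measurableEmbedding_embeddingReal Ω).measurable measurableSet_Iic)).ennreal_toReal

variable (Ω) in
/-- The measure with a given distribution function. -/
def ofRatCDF (F : ℚ → ℝ) : Measure Ω :=
  (stieltjesOfMeasurableRat (id : (ℚ → ℝ) → ℚ → ℝ) measurable_id F).measure.comap (embeddingReal Ω)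

lemma ofRatCDF_apply (F : ℚ → ℝ) (B : Set Ω) :
    ofRatCDF Ω F B = (stieltjesOfMeasurableRat (id : (ℚ → ℝ) → ℚ → ℝ) measurable_id F).measure
      (embeddingReal Ω '' B) :=
  (measurableEmbedding_embeddingReal Ω).comap_apply _ _

lemma measurable_ofRatCDF : Measurable (ofRatCDF Ω) := by
  refine Measure.measurable_of_measurable_coe _ fun B hB => ?_
  simp only [ofRatCDF_apply]
  exact (Measure.measurable_coe ((measurableEmbedding_embeddingReal Ω).measurableSet_image.2 hB)).comp
    (measurable_measure_stieltjesOfMeasurableRat measurable_id)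

lemma ofRatCDF_univ_le (F : ℚ → ℝ) : ofRatCDF Ω F Set.univ ≤ 1 := by
  rw [ofRatCDF_apply]
  refine (measure_mono (Set.subset_univ _)).trans ?_
  rw [measure_stieltjesOfMeasurableRat_univ]

/-- A distribution function is recovered from its rational values by right continuity. Probability
measures on `Ω` are thereby coded by points of the standard Borel space ℚ → ℝ. -/
lemma ofRatCDF_ratCDF (μ : Measure Ω) [IsProbabilityMeasure μ] : ofRatCDF Ω (ratCDF μ) = μ := by
  have he := measurableEmbedding_embeddingReal Ω
  set ν := μ.map (embeddingReal Ω) with hν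
  have : IsProbabilityMeasure ν := Measure.isProbabilityMeasure_map he.measurable.aemeasurable
  have hF : ∀ q : ℚ, ratCDF μ q = cdf ν q := fun q => by
    rw [cdf_eq_real, hν, map_measureReal_apply he.measurable measurableSet_Iic]; rfl
  have hcast : Tendsto ((↑) : ℚ → ℝ) atTop atTop := tendsto_ratCast_atTop_iff.2 tendsto_id
  have hpt : IsRatStieltjesPoint (id : (ℚ → ℝ) → ℚ → ℝ) (ratCDF μ) := by
    refine ⟨fun p q hpq => ?_, ?_, ?_, fun t => ?_⟩
    · simp only [id, hF]
      exact monotone_cdf ν (by exact_mod_cast hpq)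
    · simp only [id, funext hF]
      exact (tendsto_cdf_atTop ν).comp hcast
    · simp only [id, funext hF]
      exact (tendsto_cdf_atBot ν).comp (tendsto_ratCast_atBot_iff.2 tendsto_id)
    · simp only [id, hF]
      rw [← (cdf ν).iInf_rat_gt_eq t]
      exact Equiv.iInf_congr (Equiv.subtypeEquivRight fun q => by simp) fun q => rfl
  have hst : stieltjesOfMeasurableRat (id : (ℚ → ℝ) → ℚ → ℝ) measurable_id (ratCDF μ) = cdf ν := by
    ext x
    rw [← StieltjesFunction.iInf_rat_gt_eq, ← (cdf ν).iInf_rat_gt_eq x]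
    congr 1; ext q
    rw [stieltjesOfMeasurableRat_eq, toRatCDF_of_isRatStieltjesPoint hpt, id, hF]
  rw [ofRatCDF, hst, measure_cdf, hν, he.comap_map]

variable {X : Type*} [MeasurableSpace X] [StandardBorelSpace X] [MeasurableEq X]

/-- Probability measures that are determined by countably many equations and their initial point
depend measurably on that point. -/
theorem measurable_of_unique {Ξ : Set (Ω → ℝ)} (hΞ : Ξ.Countable) (hm : ∀ ξ ∈ Ξ, Measurable ξ)
    {e : Ω → X} (he : Measurable e) {Q : X → Measure Ω} (hQ : ∀ x, IsProbabilityMeasure (Q x))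
    (hQΞ : ∀ x, ∀ ξ ∈ Ξ, ∫ ω, ξ ω ∂Q x = 0) (hQe : ∀ x, (Q x).map e = Measure.dirac x)
    (huniq : ∀ x (P : Measure Ω), IsProbabilityMeasure P → (∀ ξ ∈ Ξ, ∫ ω, ξ ω ∂P = 0) →
      P.map e = Measure.dirac x → P = Q x) : Measurable Q := by
  let κ : Kernel (ℚ → ℝ) Ω := ⟨ofRatCDF Ω, measurable_ofRatCDF⟩
  have hκ : IsFiniteKernel κ := ⟨1, ENNReal.one_lt_top, ofRatCDF_univ_le⟩
  -- This is the graph of x ↦ `ratCDF (Q x)`, described without reference to Q. The first condition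
  -- selects the canonical code of a measure, and the last one says that the initial point is x.
  set Γ : Set (X × (ℚ → ℝ)) := {p | ratCDF (κ p.2) = p.2 ∧ κ p.2 Set.univ = 1 ∧
    (∀ ξ ∈ Ξ, ∫ ω, ξ ω ∂κ p.2 = 0) ∧ κ p.2 {ω | e ω = p.1} = 1} with hΓ
  have hΓm : MeasurableSet Γ := by
    have h1 : MeasurableSet {p : X × (ℚ → ℝ) | ratCDF (κ p.2) = p.2} :=
      measurableSet_eq_fun (measurable_ratCDF.comp (κ.measurable.comp measurable_snd)) measurable_snd
    have h2 : MeasurableSet {p : X × (ℚ → ℝ) | κ p.2 Set.univ = 1} :=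
      measurableSet_eq_fun ((κ.measurable_coe MeasurableSet.univ).comp measurable_snd)
        measurable_const
    have h3 : MeasurableSet {p : X × (ℚ → ℝ) | ∀ ξ ∈ Ξ, ∫ ω, ξ ω ∂κ p.2 = 0} := by
      have : {p : X × (ℚ → ℝ) | ∀ ξ ∈ Ξ, ∫ ω, ξ ω ∂κ p.2 = 0} =
          ⋂ ξ ∈ Ξ, {p : X × (ℚ → ℝ) | ∫ ω, ξ ω ∂κ p.2 = 0} := by ext; simp
      rw [this]
      refine MeasurableSet.biInter hΞ fun ξ hξ => ?_
      exact measurableSet_eq_fun (((hm ξ hξ).stronglyMeasurable.integral_kernel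
        (κ := κ)).measurable.comp measurable_snd) measurable_const
    have h4 : MeasurableSet {p : X × (ℚ → ℝ) | κ p.2 {ω | e ω = p.1} = 1} := by
      have hset : MeasurableSet {z : (X × (ℚ → ℝ)) × Ω | e z.2 = z.1.1} :=
        measurableSet_eq_fun (he.comp measurable_snd) (measurable_fst.comp measurable_fst)
      exact measurableSet_eq_fun (Kernel.measurable_kernel_prodMk_left
        (κ := κ.comap Prod.snd measurable_snd) hset) measurable_const
    exact h1.inter (h2.inter (h3.inter h4))
  have hmem : ∀ x, (x, ratCDF (Q x)) ∈ Γ := by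
    intro x
    have hk : κ (ratCDF (Q x)) = Q x := ofRatCDF_ratCDF (Q x)
    refine ⟨?_, ?_, ?_, ?_⟩
    · simp only [hk]
    · simp only [hk, measure_univ]
    · simpa only [hk] using hQΞ x
    · simp only [hk]
      have := Measure.map_apply (μ := Q x) he (measurableSet_singleton x)
      rw [hQe, Measure.dirac_apply' _ (measurableSet_singleton x)] at this
      have hx : (Q x) {ω | e ω = x} = (Q x) (e ⁻¹' {x}) := rfl
      rw [hx, ← this]
      simp
  have huniq' : ∀ p ∈ Γ, p.2 = ratCDF (Q p.1) := by
    rintro ⟨x, F⟩ ⟨h1, h2, h3, h4⟩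
    have hP : IsProbabilityMeasure (κ F) := ⟨h2⟩
    have hae : e =ᵐ[κ F] fun _ => x := by
      have : ∀ᵐ ω ∂κ F, ω ∈ {ω | e ω = x} :=
        (prob_compl_eq_zero_iff (measurableSet_eq_fun he measurable_const)).2 h4
      exact this
    have := huniq x (κ F) hP h3 (by rw [Measure.map_congr hae, Measure.map_const]; simp)
    rw [← this]
    exact h1.symm
  have hc : Measurable fun x => ratCDF (Q x) := by
    intro D hD
    -- A preimage is a projection of a Borel part of the graph. The projection is injective there by
    -- uniqueness, so Lusin–Souslin gives a Borel set and not merely an analytic one.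
    have : (fun x => ratCDF (Q x)) ⁻¹' D = Prod.fst '' (Γ ∩ Prod.snd ⁻¹' D) := by
      ext x
      constructor
      · exact fun hx => ⟨(x, ratCDF (Q x)), ⟨hmem x, hx⟩, rfl⟩
      · rintro ⟨p, ⟨hp, hpD⟩, rfl⟩
        have := huniq' p hp
        simpa [this] using hpD
    rw [this]
    refine (hΓm.inter (measurable_snd hD)).image_of_measurable_injOn measurable_fst ?_
    rintro ⟨x, F⟩ hp ⟨y, F'⟩ hp' (rfl : x = y)
    exact Prod.ext rfl ((huniq' _ hp.1).trans (huniq' _ hp'.1).symm)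
  have : Q = fun x => ofRatCDF Ω (ratCDF (Q x)) := by
    ext1 x; exact (ofRatCDF_ratCDF (Q x)).symm
  rw [this]
  exact measurable_ofRatCDF.comp hc

end Selection


/-! ### Stopping times on path space and shifts -/

section Shift

variable {E : Type*} [NormedAddCommGroup E] [CompleteSpace E]
  [TopologicalSpace.SeparableSpace E] [MeasurableSpace E] [BorelSpace E]

lemma isStoppingTime_of_stopAt {ρ : C(ℝ≥0, E) → ℝ≥0} (hm : Measurable ρ)
    (h : ∀ u x, ρ (stopAt u x) ≤ u ↔ ρ x ≤ u) :
    IsStoppingTime (pathFiltration E) fun x => (ρ x : WithTop ℝ≥0) := by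
  intro u
  simp only [WithTop.coe_le_coe]
  exact measurableSet_pathFiltration_iff.2 ⟨measurableSet_le hm measurable_const, h u⟩

variable {ρ : C(ℝ≥0, E) → ℝ≥0}

lemma measurableSet_stoppingTime_of_stopAt
    (hρ : IsStoppingTime (pathFiltration E) fun x => (ρ x : WithTop ℝ≥0))
    {T : ℝ≥0} (hT : ∀ x, ρ x ≤ T) {D : Set C(ℝ≥0, E)} (hD : MeasurableSet D)
    (h : ∀ u x, ρ (stopAt u x) ≤ u → ρ x ≤ u → (stopAt u x ∈ D ↔ x ∈ D)) :
    MeasurableSet[hρ.measurableSpace] D := by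
  have key : ∀ u, MeasurableSet[pathFiltration E u]
      (D ∩ {x | (ρ x : WithTop ℝ≥0) ≤ u}) := by
    intro u
    have h1 := measurableSet_pathFiltration_iff.1 (hρ u)
    refine measurableSet_pathFiltration_iff.2 ⟨hD.inter h1.1, fun x => ?_⟩
    have h2 := h1.2 x
    simp only [Set.mem_inter_iff, Set.mem_ofPred_eq, WithTop.coe_le_coe] at h2 ⊢
    constructor
    · rintro ⟨h3, h4⟩; exact ⟨(h u x h4 (h2.1 h4)).1 h3, h2.1 h4⟩
    · rintro ⟨h3, h4⟩; exact ⟨(h u x (h2.2 h4) h4).2 h3, h2.2 h4⟩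
  refine ⟨?_, key⟩
  have : D = D ∩ {x | (ρ x : WithTop ℝ≥0) ≤ T} := by
    refine (Set.inter_eq_left.2 fun x _ => ?_).symm
    exact WithTop.coe_le_coe.2 (hT x)
  rw [this]
  exact le_iSup (fun t => (pathFiltration E t : MeasurableSpace C(ℝ≥0, E))) T _ (key T)

variable (hρ : IsStoppingTime (pathFiltration E) fun x => (ρ x : WithTop ℝ≥0))

include hρ

lemma measurable_of_isStoppingTime : Measurable ρ := by
  refine measurable_of_Iic fun u => ?_
  have := (measurableSet_pathFiltration_iff.1 (hρ u)).1
  simp only [WithTop.coe_le_coe] at this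
  exact this

lemma stopAt_le_iff {u t : ℝ≥0} (hut : u ≤ t) (x : C(ℝ≥0, E)) :
    ρ (stopAt t x) ≤ u ↔ ρ x ≤ u := by
  have h := (measurableSet_pathFiltration_iff.1 (hρ u)).2
  simp only [Set.mem_ofPred_eq, WithTop.coe_le_coe] at h
  rw [← h (stopAt t x), stopAt_stopAt, min_eq_left hut, h]

/-- A stopping time that has occurred by `t` depends on the path up to `t` only. -/
lemma stopAt_eq_of_le {t : ℝ≥0} {x : C(ℝ≥0, E)} (h : ρ x ≤ t) : ρ (stopAt t x) = ρ x := by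
  have h1 := (stopAt_le_iff hρ h x).2 le_rfl
  exact le_antisymm h1 ((stopAt_le_iff hρ (h1.trans h) x).1 le_rfl)

lemma stopAt_mem_iff {C : Set C(ℝ≥0, E)} (hC : MeasurableSet[hρ.measurableSpace] C) {t : ℝ≥0}
    {x : C(ℝ≥0, E)} (h : ρ x ≤ t) : stopAt t x ∈ C ↔ x ∈ C := by
  have h1 := (measurableSet_pathFiltration_iff.1 (hC.2 t)).2 x
  simp only [Set.mem_inter_iff, Set.mem_ofPred_eq, WithTop.coe_le_coe, h, stopAt_eq_of_le hρ h,
    and_true] at h1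
  exact h1

/-- Stopping and shifting commute up to the remaining time t - ρ, so invariance under stopping can
be tested on the shifted path. -/
lemma shift_stopAt {t : ℝ≥0} {x : C(ℝ≥0, E)} (h : ρ x ≤ t) :
    shift (ρ (stopAt t x)) (stopAt t x) = stopAt (t - ρ x) (shift (ρ x) x) := by
  ext u
  rw [stopAt_eq_of_le hρ h, shift_apply, stopAt_apply, stopAt_apply, shift_apply]
  congr 1
  rw [← min_add_add_left, add_tsub_cancel_of_le h]

lemma measurable_shift_stoppingTime : Measurable fun x => shift (ρ x) x :=
  measurable_shift.comp ((measurable_of_isStoppingTime hρ).prodMk measurable_id)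

end Shift

/-! ### Martingale conditions for the shifted path. -/

section ShiftedMartingale

variable {E : Type*} [NormedAddCommGroup E] [CompleteSpace E]
  [TopologicalSpace.SeparableSpace E] [MeasurableSpace E] [BorelSpace E]

lemma TamePair.process_shift {f g : E → ℝ} (h : TamePair f g) (a u v : ℝ≥0) (x : C(ℝ≥0, E)) :
    martingaleProcess f g v (shift a x) - martingaleProcess f g u (shift a x) =
      martingaleProcess f g (a + v) x - martingaleProcess f g (a + u) x := by
  rw [h.process_sub, h.process_sub, shift_apply, shift_apply]
  congr 1
  have e : ∫ s in (u : ℝ)..v, g (shift a x s.toNNReal) =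
      ∫ s in (u : ℝ)..v, g (x ((a : ℝ) + s).toNNReal) := by
    refine intervalIntegral.integral_congr fun s hs => ?_
    have hs0 : 0 ≤ s := le_trans (le_min u.2 v.2) hs.1
    simp only [shift_apply]
    rw [Real.toNNReal_add a.coe_nonneg hs0, Real.toNNReal_coe]
  rw [e, intervalIntegral.integral_comp_add_left (fun s => g (x s.toNNReal))]
  simp

lemma exitMin_le_iff_stopAt (r : ℝ) (t c : ℝ≥0) (x : C(ℝ≥0, E)) :
    exitMin r t (stopAt c x) ≤ c ↔ exitMin r t x ≤ c := by
  rw [← not_lt, ← not_lt, lt_exitMin_iff, lt_exitMin_iff,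
    runNorm_congr (x := stopAt c x) (y := x) fun u hu => by simp [min_eq_left hu]]

/-- After a bounded stopping time, the shifted path still satisfies the martingale conditions. -/
theorem StoppedMartingale.setIntegral_testFun_shift {f g : E → ℝ} (h : TamePair f g)
    {P : Measure C(ℝ≥0, E)} [IsFiniteMeasure P] (hP : StoppedMartingale f g P)
    {ρ : C(ℝ≥0, E) → ℝ≥0} (hρ : IsStoppingTime (pathFiltration E) fun x => (ρ x : WithTop ℝ≥0))
    {N : ℝ≥0} (hN : ∀ x, ρ x ≤ N) (r : ℝ) {s t : ℝ≥0} (hst : s ≤ t) {B C : Set C(ℝ≥0, E)}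
    (hB : MeasurableSet[pathFiltration E s] B) (hC : MeasurableSet[hρ.measurableSpace] C) :
    ∫ x in C, testFun f g r s t B (shift (ρ x) x) ∂P = 0 := by
  have hρm := measurable_of_isStoppingTime hρ
  have hθ := measurable_shift_stoppingTime hρ
  set θ : C(ℝ≥0, E) → C(ℝ≥0, E) := fun x => shift (ρ x) x with hθdef
  have hCm := hρ.measurableSpace_le C hC
  obtain ⟨hBm, hBi⟩ := measurableSet_pathFiltration_iff.1 hB
  set T := N + t with hT
  -- On the event that matters, the stopped increment of the shifted path is an increment of the
  -- original process between the stopping times `a` and `b`. Taking the maximum with `s` ensures `a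
  -- ≤ b` everywhere.
  set a : C(ℝ≥0, E) → ℝ≥0 := fun x => ρ x + s with ha
  set b : C(ℝ≥0, E) → ℝ≥0 := fun x => ρ x + max s (exitMin r t (θ x)) with hb
  have hex : Measurable fun x => exitMin r t (θ x) :=
    (measurable_exitMin r).comp (measurable_const.prodMk hθ)
  have ham : Measurable a := hρm.add_const s
  have hbm : Measurable b := hρm.add (measurable_const.max hex)
  have hab : ∀ x, a x ≤ b x := fun x => add_le_add le_rfl (le_max_left _ _)
  have hbT : ∀ x, b x ≤ T := fun x =>
    add_le_add (hN x) (max_le hst (exitMin_le _ _ _))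
  have haT : ∀ x, a x ≤ T := fun x => (hab x).trans (hbT x)
  have hρle : ∀ {u x}, a x ≤ u → ρ x ≤ u := fun h => le_trans le_self_add h
  have ha_st : IsStoppingTime (pathFiltration E) fun x => (a x : WithTop ℝ≥0) := by
    refine isStoppingTime_of_stopAt ham fun u x => ⟨fun hu => ?_, fun hu => ?_⟩
    · have h1 : ρ x ≤ u := (stopAt_le_iff hρ le_rfl x).1 (hρle hu)
      simpa only [ha, stopAt_eq_of_le hρ h1] using hu
    · have h1 : ρ x ≤ u := hρle hu
      simpa only [ha, stopAt_eq_of_le hρ h1] using hu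
  have hb_st : IsStoppingTime (pathFiltration E) fun x => (b x : WithTop ℝ≥0) := by
    refine isStoppingTime_of_stopAt hbm fun u x => ?_
    have key : ρ x ≤ u → (b (stopAt u x) ≤ u ↔ b x ≤ u) := by
      intro h1
      have e1 : θ (stopAt u x) = stopAt (u - ρ x) (θ x) := shift_stopAt hρ h1
      have e2 : ∀ c, ρ x + c ≤ u ↔ c ≤ u - ρ x := fun c => (le_tsub_iff_left h1).symm
      simp only [hb, stopAt_eq_of_le hρ h1, e1, e2, max_le_iff, exitMin_le_iff_stopAt]
    constructor
    · intro hu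
      exact (key ((stopAt_le_iff hρ le_rfl x).1 (hρle ((hab _).trans hu)))).1 hu
    · intro hu
      exact (key (hρle ((hab _).trans hu))).2 hu
  -- Off `D` the test function vanishes: the shifted path either misses `B` or has left the ball by
  -- time `s`. Membership in `D` is decided at time `a`.
  set D : Set C(ℝ≥0, E) := C ∩ (θ ⁻¹' (B ∩ {y | runNorm s y < r})) with hD
  obtain ⟨hRm, hRi⟩ := measurableSet_pathFiltration_iff.1 (measurableSet_runNorm_lt (E := E) r s)
  have hDm : MeasurableSet D := hCm.inter (hθ (hBm.inter hRm))
  have hDi : ∀ u x, a x ≤ u → (stopAt u x ∈ D ↔ x ∈ D) := by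
    intro u x hu
    have h1 := hρle hu
    have e1 : θ (stopAt u x) = stopAt (u - ρ x) (θ x) := shift_stopAt hρ h1
    have hs : s ≤ u - ρ x := (le_tsub_iff_left h1).2 hu
    have e2 : stopAt s (θ (stopAt u x)) = stopAt s (θ x) := by
      rw [e1, stopAt_stopAt, min_eq_left hs]
    simp only [hD, Set.mem_inter_iff, Set.mem_preimage, stopAt_mem_iff hρ hC h1]
    rw [← hBi (θ (stopAt u x)), ← hRi (θ (stopAt u x)), e2, hBi, hRi]
  have hDa : MeasurableSet[ha_st.measurableSpace] D :=
    measurableSet_stoppingTime_of_stopAt ha_st haT hDm fun u x _ hu => hDi u x hu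
  have hDb : MeasurableSet[hb_st.measurableSpace] D :=
    measurableSet_stoppingTime_of_stopAt hb_st hbT hDm fun u x _ hu => hDi u x ((hab x).trans hu)
  have hinc : ∀ x ∈ D, testFun f g r s t B (θ x) =
      martingaleProcess f g (b x) x - martingaleProcess f g (a x) x := by
    intro x hx
    have h1 : runNorm s (θ x) < r := hx.2.2
    have h2 : exitMin r s (θ x) = s := exitMin_eq_of_runNorm_lt h1
    have h3 : s ≤ exitMin r t (θ x) := le_exitMin_of_runNorm_lt h1 hst
    rw [testFun, Set.indicator_of_mem hx.2.1, h2, h.process_shift, hb, ha]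
    simp only [max_eq_right h3]
  have hzero : ∀ x ∈ C \ D, testFun f g r s t B (θ x) = 0 := by
    rintro x ⟨hxC, hxD⟩
    by_cases hxB : θ x ∈ B
    · have h1 : ¬ runNorm s (θ x) < r := fun h1 => hxD ⟨hxC, hxB, h1⟩
      have h2 : exitMin r t (θ x) ≤ s := not_lt.1 fun h2 => h1 (lt_exitMin_iff.1 h2).2
      rw [testFun, Set.indicator_of_mem hxB, exitMin_of_le hst, min_eq_right h2, sub_self]
    · rw [testFun, Set.indicator_of_notMem hxB]
  rw [setIntegral_eq_of_subset_of_forall_sdiff_eq_zero hCm Set.inter_subset_left hzero,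
    setIntegral_congr_fun hDm hinc]
  -- optional stopping for the martingale stopped at a large radius
  have hstopm : ∀ (R : ℕ) {c : C(ℝ≥0, E) → ℝ≥0}, Measurable c →
      Measurable fun x => martingaleProcess f g (exitMin R (c x) x) x := fun R c hc =>
    h.measurable_uncurry_process.comp
      (((measurable_exitMin (R : ℝ)).comp (hc.prodMk measurable_id)).prodMk measurable_id)
  have hR : ∀ R : ℕ, ∫ x in D, (martingaleProcess f g (exitMin R (b x) x) x -
      martingaleProcess f g (exitMin R (a x) x) x) ∂P = 0 := by
    intro R
    have hm := hP.martingale h R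
    have hcont : ∀ x, Continuous fun u => martingaleProcess f g (exitMin R u x) x -
        martingaleProcess f g 0 x := fun x =>
      ((h.continuous_process x).comp (continuous_exitMin R x)).sub continuous_const
    have e1 := setIntegral_stopped_eq hm hcont ha_st haT hDa
    have e2 := setIntegral_stopped_eq hm hcont hb_st hbT hDb
    obtain ⟨K, -, hK⟩ := h.abs_stopped_sub_le R T
    have hi : ∀ {c : C(ℝ≥0, E) → ℝ≥0}, Measurable c → (∀ x, c x ≤ T) →
        Integrable (fun x => martingaleProcess f g (exitMin R (c x) x) x -
          martingaleProcess f g 0 x) (P.restrict D) := fun hc hcT =>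
      integrable_of_abs_le ((hstopm R hc).sub (h.measurable_process 0))
        fun x => hK x _ _ zero_le (exitMin_mono (hcT x) x)
    have e3 := integral_sub (hi hbm hbT) (hi ham haT)
    rw [e1, e2, sub_self] at e3
    rw [← e3]
    congr 1; ext x; ring
  -- The large radius was needed because the original path may leave the ball of radius `r` before
  -- `ρ`. Between `a` and `b` it stays in that ball, so the increments are bounded independently of
  -- `R`.
  obtain ⟨K, hK⟩ := h.abs_process_sub_le r T
  have hlim : Tendsto (fun R : ℕ => ∫ x in D, (martingaleProcess f g (exitMin R (b x) x) x -
      martingaleProcess f g (exitMin R (a x) x) x) ∂P) atTop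
      (𝓝 (∫ x in D, (martingaleProcess f g (b x) x - martingaleProcess f g (a x) x) ∂P)) := by
    refine tendsto_integral_of_dominated_convergence (fun _ => |K|)
      (fun R => ((hstopm R hbm).sub (hstopm R ham)).aestronglyMeasurable) (integrable_const _)
      (fun R => ?_) (ae_of_all _ fun x => ?_)
    · filter_upwards [ae_restrict_mem hDm] with x hx
      rcases le_total (a x) (exitMin R (b x) x) with h1 | h1
      · rw [exitMin_of_le (hab x), min_eq_left h1]
        refine (hK x _ _ h1 ((exitMin_le _ _ _).trans (hbT x)) fun w hw1 hw2 => ?_).trans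
          (le_abs_self K)
        have hρw : ρ x ≤ w := hρle hw1
        have h0 : ‖θ x 0‖ < r := norm_zero_lt_of_runNorm_lt hx.2.2
        have h2 : w - ρ x ≤ exitMin r t (θ x) := by
          rw [tsub_le_iff_left]
          have h3 : s ≤ exitMin r t (θ x) := le_exitMin_of_runNorm_lt hx.2.2 hst
          have h4 := hw2.trans (exitMin_le _ _ _)
          simpa only [hb, max_eq_right h3] using h4
        have h5 := norm_le_of_le_exitMin h0 h2
        simpa only [hθdef, shift_apply, add_tsub_cancel_of_le hρw] using h5
      · rw [exitMin_of_le (hab x), min_eq_right h1]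
        simp
    · refine tendsto_const_nhds.congr' ?_
      obtain ⟨R0, hR0⟩ := exists_nat_gt (runNorm T x)
      filter_upwards [eventually_ge_atTop R0] with R hRR
      have hlt : runNorm T x < R := hR0.trans_le (by exact_mod_cast hRR)
      rw [exitMin_eq_of_runNorm_lt ((runNorm_mono (hbT x) x).trans_lt hlt),
        exitMin_eq_of_runNorm_lt ((runNorm_mono (haT x) x).trans_lt hlt)]
  simp only [hR] at hlim
  exact tendsto_nhds_unique hlim tendsto_const_nhds

end ShiftedMartingale


/-! ### The strong Markov property -/

section StrongMarkov

variable {E : Type*} [NormedAddCommGroup E] [CompleteSpace E]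
  [TopologicalSpace.SeparableSpace E] [MeasurableSpace E] [BorelSpace E]

/-- The local martingale problem for `L` is equivalent to the countably many equations
`∫ ξ dP = 0`, `ξ ∈ Ξ`. -/
structure IsTestFamily (L : Set ((E → ℝ) × (E → ℝ))) (Ξ : Set (C(ℝ≥0, E) → ℝ)) : Prop where
  countable : Ξ.Countable
  form : ∀ ξ ∈ Ξ, ∃ (f g : E → ℝ) (r : ℕ) (s t : ℝ≥0) (B : Set C(ℝ≥0, E)),
    (f, g) ∈ L ∧ TamePair f g ∧ s ≤ t ∧ MeasurableSet[pathFiltration E s] B ∧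
      ξ = testFun f g r s t B
  solves_iff : ∀ P : Measure C(ℝ≥0, E), IsProbabilityMeasure P →
    (SolvesLMP L P ↔ ∀ ξ ∈ Ξ, ∫ x, ξ x ∂P = 0)

namespace IsTestFamily

variable {L : Set ((E → ℝ) × (E → ℝ))} {Ξ : Set (C(ℝ≥0, E) → ℝ)} (hΞ : IsTestFamily L Ξ)

include hΞ

lemma measurable {ξ : C(ℝ≥0, E) → ℝ} (hξ : ξ ∈ Ξ) : Measurable ξ := by
  obtain ⟨f, g, r, s, t, B, -, h, -, hB, rfl⟩ := hΞ.form ξ hξ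
  exact h.measurable_testFun r s t ((pathFiltration E).le s B hB)

lemma bounded {ξ : C(ℝ≥0, E) → ℝ} (hξ : ξ ∈ Ξ) : ∃ C, ∀ x, |ξ x| ≤ C := by
  obtain ⟨f, g, r, s, t, B, -, h, hst, hB, rfl⟩ := hΞ.form ξ hξ
  exact h.abs_testFun_le r hst B

lemma setIntegral_shift {P : Measure C(ℝ≥0, E)} (hP : SolvesLMP L P)
    {ρ : C(ℝ≥0, E) → ℝ≥0} (hρ : IsStoppingTime (pathFiltration E) fun x => (ρ x : WithTop ℝ≥0))
    {N : ℝ≥0} (hN : ∀ x, ρ x ≤ N) {C : Set C(ℝ≥0, E)} (hC : MeasurableSet[hρ.measurableSpace] C)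
    {ξ : C(ℝ≥0, E) → ℝ} (hξ : ξ ∈ Ξ) : ∫ x in C, ξ (shift (ρ x) x) ∂P = 0 := by
  have := hP.1
  obtain ⟨f, g, r, s, t, B, hfg, h, hst, hB, rfl⟩ := hΞ.form ξ hξ
  exact (stoppedMartingale_of_isLocalMartingale h (hP.2 _ hfg)).setIntegral_testFun_shift h hρ hN
    r hst hB hC

end IsTestFamily

/-- Stopping the path at a time not before `ρ` changes neither `ρ` nor the value there. -/
lemma measurable_eval_stoppingTime {ρ : C(ℝ≥0, E) → ℝ≥0}
    (hρ : IsStoppingTime (pathFiltration E) fun x => (ρ x : WithTop ℝ≥0))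
    {N : ℝ≥0} (hN : ∀ x, ρ x ≤ N) : Measurable[hρ.measurableSpace] fun x => x (ρ x) := by
  intro S hS
  have hm : Measurable fun x : C(ℝ≥0, E) => x (ρ x) :=
    measurable_path_eval.comp ((measurable_of_isStoppingTime hρ).prodMk measurable_id)
  refine measurableSet_stoppingTime_of_stopAt hρ hN (hm hS) fun u x _ hu => ?_
  simp only [Set.mem_preimage, stopAt_eq_of_le hρ hu, stopAt_apply, min_eq_left hu]

/-- A solution of a well-posed problem, restarted at a bounded stopping time `ρ`, has the
conditional law `Q (x(ρ))`. -/
theorem condExp_shift {L : Set ((E → ℝ) × (E → ℝ))} {Ξ : Set (C(ℝ≥0, E) → ℝ)}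
    (hΞ : IsTestFamily L Ξ) {Q : E → Measure C(ℝ≥0, E)}
    (hQ : ∀ x P, SolvesLMPFrom L (Measure.dirac x) P → P = Q x)
    {P : Measure C(ℝ≥0, E)} (hP : SolvesLMP L P) {ρ : C(ℝ≥0, E) → ℝ≥0}
    (hρ : IsStoppingTime (pathFiltration E) fun x => (ρ x : WithTop ℝ≥0))
    {N : ℝ≥0} (hN : ∀ x, ρ x ≤ N) {Z : C(ℝ≥0, E) → ℝ} (hZ : Measurable Z)
    {K : ℝ} (hK : ∀ x, |Z x| ≤ K) :
    P[fun x => Z (shift (ρ x) x) | hρ.measurableSpace] =ᵐ[P]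
      fun x => ∫ y, Z y ∂Q (x (ρ x)) := by
  have := hP.1
  have hmle : hρ.measurableSpace ≤ pathMeasurableSpace := hρ.measurableSpace_le
  have hθ := measurable_shift_stoppingTime hρ
  set θ : C(ℝ≥0, E) → C(ℝ≥0, E) := fun x => shift (ρ x) x with hθdef
  have hφ := measurable_eval_stoppingTime hρ hN
  have hint : ∀ {ξ : C(ℝ≥0, E) → ℝ}, Measurable ξ → (∃ c, ∀ x, |ξ x| ≤ c) →
      Integrable (fun x => ξ (θ x)) P := fun hξ ⟨c, hc⟩ =>
    integrable_of_abs_le (hξ.comp hθ) fun x => hc _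
  have hce : ∀ {ξ : C(ℝ≥0, E) → ℝ}, Measurable ξ → (∃ c, ∀ x, |ξ x| ≤ c) →
      P[fun x => ξ (θ x) | hρ.measurableSpace] =ᵐ[P] fun x => ∫ y, ξ y ∂(condExpKernel P hρ.measurableSpace x).map θ := by
    intro ξ hξ hb
    refine (condExp_ae_eq_integral_condExpKernel hmle (hint hξ hb)).trans (ae_of_all _ fun x => ?_)
    exact (integral_map hθ.aemeasurable hξ.aestronglyMeasurable).symm
  -- the martingale conditions
  have h1 : ∀ᵐ x ∂P, ∀ ξ ∈ Ξ, ∫ y, ξ y ∂(condExpKernel P hρ.measurableSpace x).map θ = 0 := by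
    refine (ae_ball_iff hΞ.countable).2 fun ξ hξ => ?_
    have hz : (fun _ => (0 : ℝ)) =ᵐ[P] P[fun x => ξ (θ x) | hρ.measurableSpace] := by
      refine ae_eq_condExp_of_forall_setIntegral_eq hmle (hint (hΞ.measurable hξ) (hΞ.bounded hξ))
        (fun _ _ _ => (integrable_zero _ _ _).integrableOn) (fun C hC _ => ?_)
        stronglyMeasurable_const.aestronglyMeasurable
      rw [hΞ.setIntegral_shift hP hρ hN hC hξ]
      simp
    filter_upwards [hz, hce (hΞ.measurable hξ) (hΞ.bounded hξ)] with x hx1 hx2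
    rw [← hx2, ← hx1]
  -- the initial condition
  have h2 : ∀ᵐ x ∂P, ((condExpKernel P hρ.measurableSpace x).map θ).map (fun y => y 0) =
      Measure.dirac (x (ρ x)) := by
    obtain ⟨S, hSc, hS, huniv, hgen⟩ := exists_countable_piSystem E
    have hSm : ∀ B ∈ S, MeasurableSet B := fun B hB => by
      rw [BorelSpace.measurable_eq (α := E), hgen]
      exact MeasurableSpace.measurableSet_generateFrom hB
    have hae : ∀ᵐ x ∂P, ∀ B ∈ S,
        ∫ y, (B.indicator (fun _ => (1 : ℝ)) (y 0)) ∂(condExpKernel P hρ.measurableSpace x).map θ =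
          B.indicator (fun _ => (1 : ℝ)) (x (ρ x)) := by
      refine (ae_ball_iff hSc).2 fun B hB => ?_
      have hI : Measurable (B.indicator fun _ => (1 : ℝ)) := measurable_const.indicator (hSm B hB)
      have hI' : Measurable fun y : C(ℝ≥0, E) => B.indicator (fun _ => (1 : ℝ)) (y 0) :=
        hI.comp (continuous_eval_const (0 : ℝ≥0)).measurable
      have hb : ∃ c, ∀ y : C(ℝ≥0, E), |B.indicator (fun _ => (1 : ℝ)) (y 0)| ≤ c :=
        ⟨1, fun y => by by_cases h : y 0 ∈ B <;> simp [h]⟩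
      have hself : P[fun x => B.indicator (fun _ => (1 : ℝ)) (θ x 0) | hρ.measurableSpace] =
          fun x => B.indicator (fun _ => (1 : ℝ)) (θ x 0) := by
        refine condExp_of_stronglyMeasurable hmle ?_ (hint hI' hb)
        simp only [hθdef, shift_apply, add_zero]
        exact (hI.comp hφ).stronglyMeasurable
      filter_upwards [hce hI' hb] with x hx
      rw [← hx, hself]
      simp [hθdef]
    filter_upwards [hae] with x hx
    have hp : IsProbabilityMeasure ((condExpKernel P hρ.measurableSpace x).map θ) :=
      Measure.isProbabilityMeasure_map hθ.aemeasurable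
    have h0 : Measurable fun y : C(ℝ≥0, E) => y 0 := (continuous_eval_const (0 : ℝ≥0)).measurable
    have hp' : IsProbabilityMeasure (((condExpKernel P hρ.measurableSpace x).map θ).map fun y => y 0) :=
      Measure.isProbabilityMeasure_map h0.aemeasurable
    refine ext_of_generate_finite S (by rw [BorelSpace.measurable_eq (α := E), hgen]) hS
      (fun B hB => ?_) (by rw [measure_univ, measure_univ])
    have h3 := hx B hB
    have h4 : ∫ y, (B.indicator (fun _ => (1 : ℝ)) (y 0)) ∂(condExpKernel P hρ.measurableSpace x).map θ =
        (((condExpKernel P hρ.measurableSpace x).map θ).map fun y => y 0).real B := by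
      rw [← integral_indicator_one (hSm B hB), integral_map h0.aemeasurable]
      · rfl
      · exact (measurable_const.indicator (hSm B hB)).aestronglyMeasurable
    have h5 : B.indicator (fun _ => (1 : ℝ)) (x (ρ x)) = (Measure.dirac (x (ρ x))).real B := by
      rw [measureReal_def, Measure.dirac_apply' _ (hSm B hB)]
      by_cases h : x (ρ x) ∈ B <;> simp [h]
    rw [h4, h5] at h3
    exact (measureReal_eq_measureReal_iff).1 h3
  -- For almost every `x` the conditional law now solves the problem started at x(ρ), and uniqueness
  -- identifies it.
  filter_upwards [hce hZ ⟨K, hK⟩, h1, h2] with x hx hx1 hx2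
  have hp : IsProbabilityMeasure ((condExpKernel P hρ.measurableSpace x).map θ) :=
    Measure.isProbabilityMeasure_map hθ.aemeasurable
  rw [hx, ← hQ _ _ ⟨(hΞ.solves_iff _ hp).2 hx1, hx2⟩]

end StrongMarkov


/-! ### Consequences of well-posedness -/

section WellPosed

variable {E : Type*} [NormedAddCommGroup E] [CompleteSpace E]
  [TopologicalSpace.SeparableSpace E] [MeasurableSpace E] [BorelSpace E]

lemma measurable_eval_zero : Measurable fun y : C(ℝ≥0, E) => y 0 :=
  (continuous_eval_const (0 : ℝ≥0)).measurable

variable {L : Set ((E → ℝ) × (E → ℝ))} {Ξ : Set (C(ℝ≥0, E) → ℝ)}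

variable (hΞ : IsTestFamily L Ξ) {Q : E → Measure C(ℝ≥0, E)}
  (hQ : ∀ x, SolvesLMPFrom L (Measure.dirac x) (Q x))
  (hQu : ∀ x P, SolvesLMPFrom L (Measure.dirac x) P → P = Q x)

include hΞ hQ hQu

/-- The solutions started at points depend measurably on the point. -/
theorem measurable_solution : Measurable Q :=
  measurable_of_unique hΞ.countable (fun _ hξ => hΞ.measurable hξ) measurable_eval_zero
    (fun x => (hQ x).1.1) (fun x => (hΞ.solves_iff _ (hQ x).1.1).1 (hQ x).1) (fun x => (hQ x).2)
    fun x P hP h1 h2 => hQu x P ⟨(hΞ.solves_iff P hP).2 h1, h2⟩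

/-- The expectation of `condExp_shift` at a constant time. At time 0 it yields uniqueness for
general initial laws, at other times the semigroup property. -/
lemma integral_shift_eq {P : Measure C(ℝ≥0, E)} (hP : SolvesLMP L P) (t : ℝ≥0)
    {Z : C(ℝ≥0, E) → ℝ} (hZ : Measurable Z) {K : ℝ} (hK : ∀ x, |Z x| ≤ K) :
    ∫ x, Z (shift t x) ∂P = ∫ x, ∫ y, Z y ∂Q (x t) ∂P := by
  have := hP.1
  have h := condExp_shift hΞ hQu hP (isStoppingTime_const (pathFiltration E) t) (N := t)
    (fun _ => le_rfl) hZ hK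
  rw [← integral_condExp ((isStoppingTime_const (pathFiltration E) t).measurableSpace_le)]
  exact integral_congr_ae h

/-- For every initial distribution there is exactly one solution. -/
theorem existsUnique_solution (μ : Measure E) [IsProbabilityMeasure μ] :
    ∃! P : Measure C(ℝ≥0, E), SolvesLMPFrom L μ P := by
  have hm := measurable_solution hΞ hQ hQu
  let κ : Kernel E C(ℝ≥0, E) := ⟨Q, hm⟩
  have hκ : IsMarkovKernel κ := ⟨fun x => (hQ x).1.1⟩
  have hbind : ∀ {Z : C(ℝ≥0, E) → ℝ}, Measurable Z → (∃ K, ∀ x, |Z x| ≤ K) →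
      ∫ x, Z x ∂(μ.bind κ) = ∫ x, ∫ y, Z y ∂Q x ∂μ := by
    rintro Z hZ ⟨K, hK⟩
    rw [Measure.comp_eq_comp_const_apply, Kernel.integral_comp (integrable_of_abs_le hZ hK),
      Kernel.const_apply]
    rfl
  -- The mixture of the solutions Q x inherits the equations, which are linear in the measure.
  refine ⟨μ.bind κ, ⟨?_, ?_⟩, ?_⟩
  · have hp : IsProbabilityMeasure (μ.bind κ) := inferInstance
    refine (hΞ.solves_iff _ hp).2 fun ξ hξ => ?_
    rw [hbind (hΞ.measurable hξ) (hΞ.bounded hξ)]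
    have : ∀ x, ∫ y, ξ y ∂Q x = 0 := fun x => (hΞ.solves_iff _ (hQ x).1.1).1 (hQ x).1 ξ hξ
    simp [this]
  · ext B hB
    rw [Measure.map_apply measurable_eval_zero hB,
      Measure.bind_apply (measurable_eval_zero hB) κ.measurable.aemeasurable]
    have : ∀ x, κ x ((fun y : C(ℝ≥0, E) => y 0) ⁻¹' B) = B.indicator 1 x := fun x => by
      rw [← Measure.map_apply measurable_eval_zero hB]
      show ((Q x).map _) B = _
      rw [(hQ x).2, Measure.dirac_apply' _ hB]
    simp only [this]
    rw [lintegral_indicator_one hB]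
  · rintro P ⟨hP, hPμ⟩
    have := hP.1
    ext B hB
    have hI : Measurable (B.indicator fun _ => (1 : ℝ)) := measurable_const.indicator hB
    have hb : ∀ x, |B.indicator (fun _ => (1 : ℝ)) x| ≤ 1 := fun x => by
      by_cases h : x ∈ B <;> simp [h]
    -- Restarting at time 0 writes any solution as the same mixture.
    have h1 := integral_shift_eq hΞ hQ hQu hP 0 hI hb
    have h2 : ∫ x : C(ℝ≥0, E), ∫ y, B.indicator (fun _ => (1 : ℝ)) y ∂Q (x 0) ∂P =
        ∫ x, ∫ y, B.indicator (fun _ => (1 : ℝ)) y ∂Q x ∂μ := by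
      rw [← hPμ, integral_map measurable_eval_zero.aemeasurable]
      exact (hI.stronglyMeasurable.integral_kernel (κ := κ)).aestronglyMeasurable
    rw [h2, ← hbind hI ⟨1, hb⟩] at h1
    simp only [shift_zero] at h1
    have h3 : ∀ P' : Measure C(ℝ≥0, E), ∫ x, B.indicator (fun _ => (1 : ℝ)) x ∂P' = P'.real B :=
      fun R => integral_indicator_one hB
    rw [h3, h3] at h1
    exact (measureReal_eq_measureReal_iff).1 h1

theorem completelyWellPosed_of_testFamily : CompletelyWellPosed L :=
  ⟨fun μ _ => existsUnique_solution hΞ hQ hQu μ, Q, hQ, fun _ hB =>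
    (Measure.measurable_coe hB).comp (measurable_solution hΞ hQ hQu)⟩

/-- The transition semigroup of the solutions. -/
theorem exists_transitionSemigroup : ∃ T : TransitionSemigroup E,
    ∀ (s : ℝ≥0) (f : E → ℝ), Measurable f → ∀ x, T.op s f x = ∫ y, f (y s) ∂Q x := by
  have hm := measurable_solution hΞ hQ hQu
  let κ : Kernel E C(ℝ≥0, E) := ⟨Q, hm⟩
  have hκ : IsMarkovKernel κ := ⟨fun x => (hQ x).1.1⟩
  have hev : ∀ t : ℝ≥0, Measurable fun y : C(ℝ≥0, E) => y t := fun t =>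
    (continuous_eval_const t).measurable
  have hop : ∀ (s : ℝ≥0) (f : E → ℝ), Measurable f → ∀ x,
      ∫ y, f y ∂(κ.map (fun y => y s)) x = ∫ y, f (y s) ∂Q x := by
    intro s f hf x
    rw [Kernel.map_apply _ (hev s), integral_map (hev s).aemeasurable hf.aestronglyMeasurable]
    rfl
  refine ⟨⟨fun t => κ.map fun y => y t, fun t => Kernel.IsMarkovKernel.map κ (hev t), ?_, ?_⟩,
    fun s f hf x => hop s f hf x⟩
  · intro f hf _ x
    rw [Kernel.map_apply _ (hev 0)]
    have : (κ x).map (fun y => y 0) = Measure.dirac x := (hQ x).2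
    rw [this, integral_dirac' _ _ hf.stronglyMeasurable]
  · rintro f hf ⟨K, hK⟩ t s x
    rw [hop (t + s) f hf, hop t _ ?_]
    · simp only [hop s f hf]
      exact integral_shift_eq hΞ hQ hQu (hQ x).1 t (Z := fun y => f (y s)) (hf.comp (hev s))
        (fun y => hK _)
    · exact (hf.stronglyMeasurable.integral_kernel (κ := κ.map fun y => y s)).measurable

/-- All solutions are strong Markov measures. -/
theorem isStrongMarkovMeasure_of_solves {T : TransitionSemigroup E}
    (hT : ∀ (s : ℝ≥0) (f : E → ℝ), Measurable f → ∀ x, T.op s f x = ∫ y, f (y s) ∂Q x)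
    {P : Measure C(ℝ≥0, E)} (hP : SolvesLMP L P) : IsStrongMarkovMeasure T P := by
  have := hP.1
  refine ⟨hP.1, ?_⟩
  rintro τ hτ ⟨N, hN⟩ s f hf ⟨K, hK⟩
  have hev : Measurable fun y : C(ℝ≥0, E) => f (y s) :=
    hf.comp (continuous_eval_const s).measurable
  have h := condExp_shift hΞ hQu hP hτ hN hev (K := K) (fun y => hK _)
  have h1 : P[fun x => f (x (τ x + s)) | hτ.measurableSpace] =ᵐ[P]
      fun x => T.op s f (x (τ x)) := by
    refine h.trans (ae_of_all _ fun x => ?_)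
    exact (hT s f hf _).symm
  refine ⟨?_, h1⟩
  have hφ := measurable_eval_stoppingTime hτ hN
  have hle : MeasurableSpace.comap (fun x : C(ℝ≥0, E) => x (τ x)) inferInstance ≤
      hτ.measurableSpace := hφ.comap_le
  have hTm : Measurable (T.op s f) := by
    have := T.markov s
    exact (hf.stronglyMeasurable.integral_kernel (κ := T.kernel s)).measurable
  have hTb : ∀ x, |T.op s f x| ≤ K := fun x => by
    have := T.markov s
    have h2 := norm_integral_le_of_norm_le_const (μ := T.kernel s x) (f := f) (C := K)
      (ae_of_all _ fun y => hK y)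
    rw [TransitionSemigroup.op]
    simpa using h2
  have h3 := condExp_condExp_of_le (μ := P) (f := fun x => f (x (τ x + s))) hle
    hτ.measurableSpace_le
  -- The value (T(s) f)(x(τ)) is a function of x(τ), so conditioning on x(τ) leaves it unchanged;
  -- the first equality of the strong Markov property is then the tower property.
  have h4 : P[fun x => T.op s f (x (τ x)) | MeasurableSpace.comap
      (fun x : C(ℝ≥0, E) => x (τ x)) inferInstance] = fun x => T.op s f (x (τ x)) := by
    refine condExp_of_stronglyMeasurable (hle.trans hτ.measurableSpace_le) ?_ ?_
    · exact (hTm.comp (comap_measurable _)).stronglyMeasurable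
    · exact integrable_of_abs_le (hTm.comp (hφ.mono hτ.measurableSpace_le le_rfl)) fun x => hTb _
  have h5 := condExp_congr_ae (m := MeasurableSpace.comap
      (fun x : C(ℝ≥0, E) => x (τ x)) inferInstance) h1
  rw [h4] at h5
  exact h1.trans (h5.symm.trans h3)

end WellPosed


/-! ### Adapted versions of cylindrical Wiener processes -/

lemma setIntegral_eq_of_indep {Ω : Type*} {𝓖 mΩ : MeasurableSpace Ω} {P : Measure[mΩ] Ω}
    [IsProbabilityMeasure P] (h𝓖 : 𝓖 ≤ mΩ)
    {Y : Ω → ℝ} (hY : Measurable Y) {φ : ℝ → ℝ} (hφ : Measurable φ)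
    (hind : Indep 𝓖 (MeasurableSpace.comap Y inferInstance) P) {C : Set Ω}
    (hC : MeasurableSet[𝓖] C) :
    ∫ ω in C, φ (Y ω) ∂P = P.real C * ∫ ω, φ (Y ω) ∂P := by
  have hCm : MeasurableSet[mΩ] C := h𝓖 C hC
  have h1 : IndepFun (C.indicator fun _ => (1 : ℝ)) (fun ω => φ (Y ω)) P := by
    refine indep_of_indep_of_le_left (indep_of_indep_of_le_right hind ?_) ?_
    · exact (hφ.comp (comap_measurable Y)).comap_le
    · exact Measurable.comap_le
        (Measurable.indicator (@measurable_const ℝ Ω _ 𝓖 1) hC)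
  have h2 := h1.integral_mul_eq_mul_integral
    (measurable_const.indicator hCm).aestronglyMeasurable (hφ.comp hY).aestronglyMeasurable
  have h3 : ∫ ω, C.indicator (fun _ => (1 : ℝ)) ω ∂P = P.real C := integral_indicator_one hCm
  rw [h3] at h2
  rw [← h2, ← integral_indicator hCm]
  congr 1; ext ω
  by_cases hω : ω ∈ C <;> simp [hω]

section Wiener

variable {H : Type*} [NormedAddCommGroup H] [InnerProductSpace ℝ H]
variable {Ω : Type*} {mΩ : MeasurableSpace Ω} {P : Measure Ω}

lemma timeIndicator_coeFn (t : ℝ≥0) (h : H) :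
    timeIndicator t h =ᵐ[(volume : Measure ℝ).restrict (Set.Ioi 0)]
      (Set.Ioc (0 : ℝ) t).indicator fun _ => h :=
  indicatorConstLp_coeFn

lemma timeIndicator_add (t : ℝ≥0) (h h' : H) :
    timeIndicator t (h + h') = timeIndicator t h + timeIndicator t h' := by
  refine Lp.ext ?_
  filter_upwards [timeIndicator_coeFn t (h + h'), timeIndicator_coeFn t h,
    timeIndicator_coeFn t h', Lp.coeFn_add (timeIndicator t h) (timeIndicator t h')]
    with x h1 h2 h3 h4
  rw [h1, h4, Pi.add_apply, h2, h3]
  by_cases hx : x ∈ Set.Ioc (0 : ℝ) t <;> simp [hx]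

lemma norm_timeIndicator_sub_sq {s t : ℝ≥0} (hst : s ≤ t) (h : H) :
    ‖timeIndicator t h - timeIndicator s h‖ ^ 2 = ((t : ℝ) - s) * ‖h‖ ^ 2 := by
  have hst' : (s : ℝ) ≤ t := hst
  have hne : ((volume : Measure ℝ).restrict (Set.Ioi 0)) (Set.Ioc (s : ℝ) t) ≠ ∞ :=
    ((Measure.restrict_apply_le _ _).trans_lt measure_Ioc_lt_top).ne
  have e : timeIndicator t h - timeIndicator s h =
      indicatorConstLp 2 measurableSet_Ioc hne h := by
    refine Lp.ext ?_
    filter_upwards [timeIndicator_coeFn t h, timeIndicator_coeFn s h,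
      Lp.coeFn_sub (timeIndicator t h) (timeIndicator s h),
      indicatorConstLp_coeFn (p := 2) (hs := measurableSet_Ioc) (hμs := hne) (c := h),
      ae_restrict_mem measurableSet_Ioi] with x h1 h2 h3 h4 h5
    rw [h3, h4, Pi.sub_apply, h1, h2]
    have h5' : 0 < x := h5
    by_cases hxs : x ≤ s
    · simp [h5', hxs, hxs.trans hst', not_lt.2 hxs]
    · by_cases hxt : x ≤ t <;> simp [h5', hxs, hxt, not_le.1 hxs]
  have hm : ((volume : Measure ℝ).restrict (Set.Ioi 0)).real (Set.Ioc (s : ℝ) t) = (t : ℝ) - s := by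
    rw [measureReal_def, Measure.restrict_apply measurableSet_Ioc, Set.inter_eq_left.2,
      Real.volume_Ioc, ENNReal.toReal_ofReal (sub_nonneg.2 hst')]
    exact fun x hx => lt_of_le_of_lt s.2 hx.1
  rw [e, norm_indicatorConstLp two_ne_zero ENNReal.ofNat_ne_top, hm, mul_pow, mul_comm]
  congr 1
  rw [← Real.rpow_natCast, ← Real.rpow_mul (sub_nonneg.2 hst')]
  simp

/-- Adapted versions `w t h` of the random variables `W_H(t) h`. -/
structure IsWienerVersion (𝔽 : Filtration ℝ≥0 mΩ) (P : Measure Ω) (w : ℝ≥0 → H → Ω → ℝ) :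
    Prop where
  measurable : ∀ t h, Measurable[𝔽 t] (w t h)
  memLp : ∀ t h, MemLp (w t h) 2 P
  centered : ∀ (s t : ℝ≥0) (h : H), s ≤ t → ∀ C, MeasurableSet[𝔽 s] C →
    ∫ ω in C, (w t h ω - w s h ω) ∂P = 0
  covariance : ∀ (s t : ℝ≥0) (h h' : H), s ≤ t → ∀ C, MeasurableSet[𝔽 s] C →
    ∫ ω in C, (w t h ω - w s h ω) * (w t h' ω - w s h' ω) ∂P =
      P.real C * (((t : ℝ) - s) * inner ℝ h h')

/-- W_H(t)h is an almost-everywhere class and `𝔽` need not be complete, so representatives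
measurable for 𝓕_t are chosen. Independence is given for one `h` at a time; covariances on events of
the past follow from variances by polarization in `h`. -/
theorem IsCylindricalWiener.exists_version [hP : IsProbabilityMeasure P] {𝔽 : Filtration ℝ≥0 mΩ}
    {W : TimeL2 H →L[ℝ] Lp ℝ 2 P} (hW : IsCylindricalWiener 𝔽 W) :
    ∃ w : ℝ≥0 → H → Ω → ℝ, IsWienerVersion 𝔽 P w ∧ ∀ t h, w t h =ᵐ[P] wienerAt W t h := by
  have hmeas : ∀ t h, Measurable (wienerAt W t h) := fun t h =>
    (Lp.stronglyMeasurable (wienerAt W t h)).measurable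
  have hlp : ∀ t h, MemLp (wienerAt W t h) 2 P := fun t h => Lp.memLp _
  have hsub : ∀ s t h, (fun ω => wienerAt W t h ω - wienerAt W s h ω) =ᵐ[P]
      W (timeIndicator t h - timeIndicator s h) := fun s t h => by
    rw [map_sub]
    filter_upwards [Lp.coeFn_sub (W (timeIndicator t h)) (W (timeIndicator s h))] with ω hω
    rw [hω]; rfl
  have hcent : ∀ (s t : ℝ≥0) (h : H), s ≤ t → ∀ C, MeasurableSet[𝔽 s] C →
      ∫ ω in C, (wienerAt W t h ω - wienerAt W s h ω) ∂P = 0 := by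
    intro s t h hst C hC
    have h1 := setIntegral_eq_of_indep (𝔽.le s) ((hmeas t h).sub (hmeas s h)) measurable_id
      (hW.independent s t h hst) hC
    have h2 : ∫ ω, (wienerAt W t h ω - wienerAt W s h ω) ∂P = 0 := by
      rw [integral_congr_ae (hsub s t h)]
      have h3 := integral_map (μ := P) (φ := W (timeIndicator t h - timeIndicator s h))
        (Lp.stronglyMeasurable _).measurable.aemeasurable (f := fun y : ℝ => y)
        measurable_id.aestronglyMeasurable
      rw [← h3, hW.gaussian]
      exact integral_id_gaussianReal
    refine h1.trans ?_
    simp only [id, Pi.sub_apply]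
    rw [h2, mul_zero]
  have hvar : ∀ (s t : ℝ≥0) (h : H), s ≤ t → ∀ C, MeasurableSet[𝔽 s] C →
      ∫ ω in C, (wienerAt W t h ω - wienerAt W s h ω) ^ 2 ∂P =
        P.real C * (((t : ℝ) - s) * ‖h‖ ^ 2) := by
    intro s t h hst C hC
    have h1 := setIntegral_eq_of_indep (𝔽.le s) ((hmeas t h).sub (hmeas s h))
      (measurable_id.pow_const 2) (hW.independent s t h hst) hC
    refine h1.trans ?_
    congr 1
    rw [← norm_timeIndicator_sub_sq hst h, ← real_inner_self_eq_norm_sq, ← hW.covariance]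
    refine integral_congr_ae ?_
    filter_upwards [hsub s t h] with ω hω
    simp only [id, Pi.sub_apply]
    rw [hω, sq]
  have hadd : ∀ s t h h', (fun ω => wienerAt W t (h + h') ω - wienerAt W s (h + h') ω) =ᵐ[P]
      fun ω => (wienerAt W t h ω - wienerAt W s h ω) + (wienerAt W t h' ω - wienerAt W s h' ω) := by
    intro s t h h'
    simp only [wienerAt, timeIndicator_add, map_add]
    filter_upwards [Lp.coeFn_add (W (timeIndicator t h)) (W (timeIndicator t h')),
      Lp.coeFn_add (W (timeIndicator s h)) (W (timeIndicator s h'))] with ω h1 h2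
    rw [h1, h2, Pi.add_apply, Pi.add_apply]
    ring
  have hint : ∀ s t h s' t' h' (C : Set Ω), Integrable (fun ω =>
      (wienerAt W t h ω - wienerAt W s h ω) * (wienerAt W t' h' ω - wienerAt W s' h' ω))
      (P.restrict C) := fun s t h s' t' h' C =>
    (((hlp t h).sub (hlp s h)).integrable_mul ((hlp t' h').sub (hlp s' h'))).integrableOn
  have hcov : ∀ (s t : ℝ≥0) (h h' : H), s ≤ t → ∀ C, MeasurableSet[𝔽 s] C →
      ∫ ω in C, (wienerAt W t h ω - wienerAt W s h ω) * (wienerAt W t h' ω - wienerAt W s h' ω) ∂P =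
        P.real C * (((t : ℝ) - s) * inner ℝ h h') := by
    intro s t h h' hst C hC
    have h1 := hvar s t (h + h') hst C hC
    have h2 := hvar s t h hst C hC
    have h3 := hvar s t h' hst C hC
    have h4 : ∫ ω in C, (wienerAt W t (h + h') ω - wienerAt W s (h + h') ω) ^ 2 ∂P =
        (∫ ω in C, (wienerAt W t h ω - wienerAt W s h ω) ^ 2 ∂P) +
        2 * (∫ ω in C, (wienerAt W t h ω - wienerAt W s h ω) *
          (wienerAt W t h' ω - wienerAt W s h' ω) ∂P) +
        ∫ ω in C, (wienerAt W t h' ω - wienerAt W s h' ω) ^ 2 ∂P := by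
      have i1 : Integrable (fun ω => (wienerAt W t h ω - wienerAt W s h ω) ^ 2) (P.restrict C) := by
        simpa only [sq] using hint s t h s t h C
      have i3 : Integrable (fun ω => (wienerAt W t h' ω - wienerAt W s h' ω) ^ 2)
          (P.restrict C) := by
        simpa only [sq] using hint s t h' s t h' C
      have i2 : Integrable (fun ω => 2 * ((wienerAt W t h ω - wienerAt W s h ω) *
          (wienerAt W t h' ω - wienerAt W s h' ω))) (P.restrict C) :=
        (hint s t h s t h' C).const_mul 2
      have i12 : Integrable (fun ω => (wienerAt W t h ω - wienerAt W s h ω) ^ 2 +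
          2 * ((wienerAt W t h ω - wienerAt W s h ω) *
          (wienerAt W t h' ω - wienerAt W s h' ω))) (P.restrict C) := i1.add i2
      rw [← integral_const_mul, ← integral_add i1 i2, ← integral_add i12 i3]
      refine integral_congr_ae ?_
      filter_upwards [ae_restrict_of_ae (hadd s t h h')] with ω hω
      rw [hω]; ring
    rw [norm_add_sq_real] at h1
    linarith
  set w : ℝ≥0 → H → Ω → ℝ := fun t h => (hW.adapted t h).mk with hw
  have hae : ∀ t h, w t h =ᵐ[P] wienerAt W t h := fun t h => (hW.adapted t h).ae_eq_mk.symm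
  refine ⟨w, ⟨fun t h => (hW.adapted t h).stronglyMeasurable_mk.measurable,
    fun t h => (hlp t h).ae_eq (hae t h).symm, fun s t h hst C hC => ?_,
    fun s t h h' hst C hC => ?_⟩, hae⟩
  · rw [← hcent s t h hst C hC]
    refine integral_congr_ae ?_
    filter_upwards [ae_restrict_of_ae (hae t h), ae_restrict_of_ae (hae s h)] with ω h1 h2
    rw [h1, h2]
  · rw [← hcov s t h h' hst C hC]
    refine integral_congr_ae ?_
    filter_upwards [ae_restrict_of_ae (hae t h), ae_restrict_of_ae (hae s h),
      ae_restrict_of_ae (hae t h'), ae_restrict_of_ae (hae s h')] with ω h1 h2 h3 h4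
    rw [h1, h2, h3, h4]

end Wiener


/-! ### Elementary integrands and their integrals -/

section Elementary

variable {H : Type*} [NormedAddCommGroup H] [InnerProductSpace ℝ H]
variable {Ω : Type*} {mΩ : MeasurableSpace Ω} {P : Measure Ω}

/-- `J` is the stochastic integral process of the elementary process `ψ`, formed with the
versions `w t h` of the Wiener process. -/
inductive IsElementary (𝔽 : Filtration ℝ≥0 mΩ) (w : ℝ≥0 → H → Ω → ℝ) :
    (ℝ≥0 → Ω → H) → (ℝ≥0 → Ω → ℝ) → Prop
  -- The scalar `c` is kept apart from `h` because the chosen versions need not depend linearly on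
  -- `h`.
  | piece (c : ℝ) (a b : ℝ≥0) (hab : a ≤ b) (A : Set Ω) (hA : MeasurableSet[𝔽 a] A) (h : H) :
      IsElementary 𝔽 w
        (fun s ω => (Set.Ioc a b).indicator (fun _ => A.indicator (fun _ => c • h) ω) s)
        (fun t ω => A.indicator (fun ω => c * (w (min b t) h ω - w (min a t) h ω)) ω)
  | add {ψ ψ' : ℝ≥0 → Ω → H} {J J' : ℝ≥0 → Ω → ℝ} :
      IsElementary 𝔽 w ψ J → IsElementary 𝔽 w ψ' J' →
      IsElementary 𝔽 w (fun s ω => ψ s ω + ψ' s ω) (fun t ω => J t ω + J' t ω)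

namespace IsElementary

variable {𝔽 : Filtration ℝ≥0 mΩ} {w : ℝ≥0 → H → Ω → ℝ} {ψ ψ' : ℝ≥0 → Ω → H}
  {J J' : ℝ≥0 → Ω → ℝ}

lemma congr (h : IsElementary 𝔽 w ψ J) (hψ : ∀ s ω, ψ' s ω = ψ s ω) (hJ : ∀ t ω, J' t ω = J t ω) :
    IsElementary 𝔽 w ψ' J' := by
  have e1 : ψ' = ψ := by ext s ω; exact hψ s ω
  have e2 : J' = J := by ext s ω; exact hJ s ω
  rw [e1, e2]; exact h

lemma zero : IsElementary 𝔽 w (fun _ _ => 0) (fun _ _ => 0) :=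
  (piece 0 0 0 le_rfl ∅ (@MeasurableSet.empty _ (𝔽 0)) 0).congr (by simp) (by simp)

lemma smul (h : IsElementary 𝔽 w ψ J) (c : ℝ) :
    IsElementary 𝔽 w (fun s ω => c • ψ s ω) (fun t ω => c * J t ω) := by
  induction h with
  | piece c' a b hab A hA h =>
    refine (piece (c * c') a b hab A hA h).congr (fun s ω => ?_) (fun t ω => ?_)
    · by_cases h1 : s ∈ Set.Ioc a b <;> by_cases h2 : ω ∈ A <;> simp [h1, h2, mul_smul]
    · by_cases h2 : ω ∈ A <;> simp [h2, mul_assoc]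
  | add _ _ h1 h2 =>
    exact (h1.add h2).congr (fun s ω => smul_add _ _ _) (fun t ω => mul_add _ _ _)

lemma sub (h : IsElementary 𝔽 w ψ J) (h' : IsElementary 𝔽 w ψ' J') :
    IsElementary 𝔽 w (fun s ω => ψ s ω - ψ' s ω) (fun t ω => J t ω - J' t ω) :=
  (h.add (h'.smul (-1))).congr (fun s ω => by rw [neg_one_smul, sub_eq_add_neg])
    (fun t ω => by ring)

lemma sum {ι : Type*} (S : Finset ι) {ψ : ι → ℝ≥0 → Ω → H} {J : ι → ℝ≥0 → Ω → ℝ}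
    (h : ∀ i ∈ S, IsElementary 𝔽 w (ψ i) (J i)) :
    IsElementary 𝔽 w (fun s ω => ∑ i ∈ S, ψ i s ω) (fun t ω => ∑ i ∈ S, J i t ω) := by
  classical
  induction S using Finset.induction_on with
  | empty => simpa using zero
  | insert i S hi ih =>
    simp only [Finset.sum_insert hi]
    exact (h i (Finset.mem_insert_self i S)).add
      (ih fun k hk => h k (Finset.mem_insert_of_mem hk))

/-- Restriction to `(c, d] × B` with `B ∈ 𝓕_c`. -/
lemma restrict (h : IsElementary 𝔽 w ψ J) {c d : ℝ≥0} (hcd : c ≤ d) {B : Set Ω}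
    (hB : MeasurableSet[𝔽 c] B) :
    IsElementary 𝔽 w
      (fun s ω => (Set.Ioc c d).indicator (fun _ => B.indicator (fun _ => ψ s ω) ω) s)
      (fun t ω => B.indicator (fun ω => J (min d t) ω - J (min c t) ω) ω) := by
  induction h with
  | piece k a b hab A hA h =>
    -- The intersection of the two intervals is again a half-open interval; the outer maximum makes
    -- it degenerate when the intersection is empty.
    refine (piece k (max a c) (max (max a c) (min b d)) (le_max_left _ _) (A ∩ B)
      ((𝔽.mono (le_max_left a c) A hA).inter (𝔽.mono (le_max_right a c) B hB)) h).congr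
      (fun s ω => ?_) (fun t ω => ?_)
    · have e : s ∈ Set.Ioc (max a c) (max (max a c) (min b d)) ↔
          s ∈ Set.Ioc a b ∧ s ∈ Set.Ioc c d := by
        simp only [Set.mem_Ioc, max_lt_iff, le_max_iff, le_min_iff]
        constructor
        · rintro ⟨⟨h1, h2⟩, (h3 | h3) | h3⟩
          · exact absurd h3 (not_le.2 h1)
          · exact absurd h3 (not_le.2 h2)
          · exact ⟨⟨h1, h3.1⟩, h2, h3.2⟩
        · rintro ⟨⟨h1, h2⟩, h3, h4⟩
          exact ⟨⟨h1, h3⟩, Or.inr ⟨h2, h4⟩⟩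
      by_cases h1 : s ∈ Set.Ioc a b <;> by_cases h2 : s ∈ Set.Ioc c d <;>
        by_cases h3 : ω ∈ A <;> by_cases h4 : ω ∈ B <;>
        simp [Set.indicator, e, h1, h2, h3, h4]
    · by_cases h3 : ω ∈ A <;> by_cases h4 : ω ∈ B <;> simp [h3, h4]
      have key : w (min (max (max a c) (min b d)) t) h ω - w (min (max a c) t) h ω =
          (w (min b (min d t)) h ω - w (min a (min d t)) h ω) -
          (w (min b (min c t)) h ω - w (min a (min c t)) h ω) := by
        rcases le_total b c with hbc | hcb
        · have e1 : max (max a c) (min b d) = c := by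
            rw [max_eq_right (hab.trans hbc), min_eq_left (hbc.trans hcd), max_eq_left hbc]
          rw [e1, max_eq_right (hab.trans hbc), ← min_assoc, ← min_assoc, ← min_assoc, ← min_assoc,
            min_eq_left (hbc.trans hcd), min_eq_left (hab.trans (hbc.trans hcd)),
            min_eq_left hbc, min_eq_left (hab.trans hbc)]
          ring
        · rcases le_total d a with hda | had
          · have e1 : max (max a c) (min b d) = a := by
              rw [max_eq_left (hcd.trans hda), max_eq_left ((min_le_right _ _).trans hda)]
            rw [e1, max_eq_left (hcd.trans hda), ← min_assoc, ← min_assoc, ← min_assoc, ← min_assoc,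
              min_eq_right (hda.trans hab), min_eq_right hda, min_eq_right (hcd.trans hda),
              min_eq_right hcb]
            ring
          · have e1 : max (max a c) (min b d) = min b d :=
              max_eq_right (max_le (le_min hab had) (le_min hcb hcd))
            rw [e1, ← min_assoc, ← min_assoc, ← min_assoc, ← min_assoc, min_eq_left had,
              min_eq_right hcb]
            rcases le_total a c with hac | hca
            · rw [max_eq_right hac, min_eq_left hac]; ring
            · rw [max_eq_left hca, min_eq_right hca]; ring
      rw [key]; ring
  | add _ _ h1 h2 =>
    refine (h1.add h2).congr (fun s ω => ?_) (fun t ω => ?_)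
    · by_cases h1 : s ∈ Set.Ioc c d <;> by_cases h2 : ω ∈ B <;> simp [h1, h2]
    · by_cases h2 : ω ∈ B <;> simp [h2]
      ring

lemma exists_bound (h : IsElementary 𝔽 w ψ J) : ∃ M : ℝ, ∀ s ω, ‖ψ s ω‖ ≤ M := by
  induction h with
  | piece c a b hab A hA h =>
    refine ⟨‖c • h‖, fun s ω => ?_⟩
    by_cases h1 : s ∈ Set.Ioc a b <;> by_cases h2 : ω ∈ A <;> simp [h1, h2]
  | add _ _ h1 h2 =>
    obtain ⟨M1, h1⟩ := h1
    obtain ⟨M2, h2⟩ := h2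
    exact ⟨M1 + M2, fun s ω => (norm_add_le _ _).trans (add_le_add (h1 s ω) (h2 s ω))⟩

lemma stronglyMeasurable (h : IsElementary 𝔽 w ψ J) :
    StronglyMeasurable fun p : ℝ≥0 × Ω => ψ p.1 p.2 := by
  induction h with
  | piece c a b hab A hA h =>
    have e : (fun p : ℝ≥0 × Ω => (Set.Ioc a b).indicator
        (fun _ => A.indicator (fun _ => c • h) p.2) p.1) =
        (Set.Ioc a b ×ˢ A).indicator fun _ => c • h := by
      ext p
      by_cases h1 : p.1 ∈ Set.Ioc a b <;> by_cases h2 : p.2 ∈ A <;> 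
        simp only [Set.indicator, Set.mem_prod, h1, h2, if_true, if_false, and_true, and_false]
    rw [e]
    exact stronglyMeasurable_const.indicator (measurableSet_Ioc.prod (𝔽.le a A hA))
  | add _ _ h1 h2 => exact h1.add h2

/-- This is progressive measurability, needed so that the energy up to `T` is known at time `T`. -/
lemma stronglyMeasurable_min (h : IsElementary 𝔽 w ψ J) (T : ℝ≥0) :
    @StronglyMeasurable (ℝ≥0 × Ω) H _ (@Prod.instMeasurableSpace _ _ _ (𝔽 T))
      fun p => ψ (min p.1 T) p.2 := by
  induction h with
  | piece c a b hab A hA h =>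
    rcases le_total T a with hTa | haT
    · have e : (fun p : ℝ≥0 × Ω => (Set.Ioc a b).indicator
          (fun _ => A.indicator (fun _ => c • h) p.2) (min p.1 T)) = fun _ => 0 := by
        ext p
        rw [Set.indicator_of_notMem]
        exact fun hm => absurd hm.1 (not_lt.2 ((min_le_right _ _).trans hTa))
      rw [e]
      exact @stronglyMeasurable_const _ _ (@Prod.instMeasurableSpace _ _ _ (𝔽 T)) _ _
    · have e : (fun p : ℝ≥0 × Ω => (Set.Ioc a b).indicator
          (fun _ => A.indicator (fun _ => c • h) p.2) (min p.1 T)) =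
          (((fun s => min s T) ⁻¹' Set.Ioc a b) ×ˢ A).indicator fun _ => c • h := by
        ext p
        by_cases h1 : min p.1 T ∈ Set.Ioc a b <;> by_cases h2 : p.2 ∈ A <;>
          simp only [Set.indicator, Set.mem_prod, Set.mem_preimage, h1, h2, if_true, if_false,
            and_true, and_false]
      rw [e]
      refine StronglyMeasurable.indicator
        (@stronglyMeasurable_const _ _ (@Prod.instMeasurableSpace _ _ _ (𝔽 T)) _ _) ?_
      have hm : Measurable fun s : ℝ≥0 => min s T := by fun_prop
      exact @MeasurableSet.prod _ _ _ (𝔽 T) _ _ (hm measurableSet_Ioc) (𝔽.mono haT A hA)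
  | add _ _ h1 h2 => exact h1.add h2

lemma measurable_integral (h : IsElementary 𝔽 w ψ J) (hw : IsWienerVersion 𝔽 P w) (t : ℝ≥0) :
    Measurable (J t) := by
  induction h with
  | piece c a b hab A hA h =>
    exact ((((hw.measurable _ h).mono (𝔽.le _) le_rfl).sub
      ((hw.measurable _ h).mono (𝔽.le _) le_rfl)).const_mul c).indicator (𝔽.le a A hA)
  | add _ _ h1 h2 => exact h1.add h2

lemma memLp_integral (h : IsElementary 𝔽 w ψ J) (hw : IsWienerVersion 𝔽 P w) (t : ℝ≥0) :
    MemLp (J t) 2 P := by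
  induction h with
  | piece c a b hab A hA h =>
    exact (((hw.memLp _ h).sub (hw.memLp _ h)).const_mul c).indicator (𝔽.le a A hA)
  | add _ _ h1 h2 => exact h1.add h2

lemma integral_eq_zero [IsProbabilityMeasure P] (h : IsElementary 𝔽 w ψ J)
    (hw : IsWienerVersion 𝔽 P w) (t : ℝ≥0) : ∫ ω, J t ω ∂P = 0 := by
  induction h with
  | piece c a b hab A hA h =>
    rw [integral_indicator (𝔽.le a A hA), integral_const_mul]
    rcases le_total t a with hta | hat
    · rw [min_eq_right hta, min_eq_right (hta.trans hab)]
      simp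
    · rw [min_eq_left hat, hw.centered a (min b t) h (le_min hab hat) A hA, mul_zero]
  | add h1 h2 ih1 ih2 =>
    rw [integral_add ((h1.memLp_integral hw t).integrable one_le_two)
      ((h2.memLp_integral hw t).integrable one_le_two), ih1, ih2, add_zero]

end IsElementary

end Elementary


/-! ### The Itô isometry for elementary integrands -/

section Isometry

variable {H : Type*} [NormedAddCommGroup H] [InnerProductSpace ℝ H]
variable {Ω : Type*} {mΩ : MeasurableSpace Ω} {P : Measure Ω}
variable {𝔽 : Filtration ℝ≥0 mΩ} {w : ℝ≥0 → H → Ω → ℝ}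

namespace IsWienerVersion

variable (hw : IsWienerVersion 𝔽 P w)
include hw

lemma integrable_mul_sub (D : Set Ω) (s t s' t' : ℝ≥0) (h h' : H) :
    Integrable (fun ω => (w t h ω - w s h ω) * (w t' h' ω - w s' h' ω)) (P.restrict D) :=
  (((hw.memLp t h).sub (hw.memLp s h)).integrable_mul
    ((hw.memLp t' h').sub (hw.memLp s' h'))).integrableOn

lemma setIntegral_mul_eq_zero [IsProbabilityMeasure P] {s t : ℝ≥0} (hst : s ≤ t) {D : Set Ω}
    (hD : MeasurableSet[𝔽 s] D) {a b : ℝ≥0} (ha : a ≤ s) (hb : b ≤ s) (h h' : H) :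
    ∫ ω in D, (w b h ω - w a h ω) * (w t h' ω - w s h' ω) ∂P = 0 := by
  have hDm := 𝔽.le s D hD
  rw [← integral_indicator hDm]
  have e : (D.indicator fun ω => (w b h ω - w a h ω) * (w t h' ω - w s h' ω)) =
      fun ω => (D.indicator (fun ω => w b h ω - w a h ω)) ω * (w t h' ω - w s h' ω) := by
    ext ω; by_cases hω : ω ∈ D <;> simp [hω]
  rw [e]
  refine integral_mul_eq_zero_of_setIntegral (𝔽.le s)
    (((hw.memLp t h').sub (hw.memLp s h')).integrable one_le_two)
    (fun B hB => hw.centered s t h' hst B hB)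
    ((((hw.measurable b h).mono (𝔽.mono hb) le_rfl).sub
      ((hw.measurable a h).mono (𝔽.mono ha) le_rfl)).indicator hD) ?_
  rw [← e]
  exact (integrable_indicator_iff hDm).2 (hw.integrable_mul_sub D a b s t h h')

/-- Covariance of increments over overlapping intervals. -/
lemma setIntegral_mul [IsProbabilityMeasure P] {a b a' b' : ℝ≥0} (hab' : a' ≤ b')
    (haa' : a ≤ a') {D : Set Ω} (hD : MeasurableSet[𝔽 a'] D) (h h' : H) :
    ∫ ω in D, (w b h ω - w a h ω) * (w b' h' ω - w a' h' ω) ∂P =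
      P.real D * (max 0 ((min b b' : ℝ) - a') * inner ℝ h h') := by
  rcases le_total b a' with hba | hab2
  · rw [hw.setIntegral_mul_eq_zero hab' hD haa' hba, max_eq_left, zero_mul, mul_zero]
    have : (b : ℝ) ≤ a' := hba
    linarith [min_le_left (b : ℝ) b']
  · set m : ℝ≥0 := min b b' with hm
    have ham : a' ≤ m := le_min hab2 hab'
    have I := hw.integrable_mul_sub D
    have z1 := hw.setIntegral_mul_eq_zero hab' hD haa' le_rfl h h'
    have z2 := hw.setIntegral_mul_eq_zero (min_le_right b b') (𝔽.mono ham D hD) ham le_rfl h h'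
    have z3 : ∫ ω in D, (w b h ω - w m h ω) * (w b' h' ω - w a' h' ω) ∂P = 0 := by
      rcases le_total b b' with hbb | hbb
      · rw [hm, min_eq_left hbb]; simp
      · have e : m = b' := min_eq_right hbb
        rw [e]
        simp_rw [mul_comm (w b h _ - w b' h _)]
        exact hw.setIntegral_mul_eq_zero hbb (𝔽.mono hab' D hD) hab' le_rfl h' h
    have z4 := hw.covariance a' m h h' ham D hD
    -- Splitting at a' and m leaves one product over the common interval from a' to m; the other
    -- products involve disjoint intervals and have mean zero.
    have e : ∀ ω, (w b h ω - w a h ω) * (w b' h' ω - w a' h' ω) =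
        ((w a' h ω - w a h ω) * (w b' h' ω - w a' h' ω) +
        (w m h ω - w a' h ω) * (w b' h' ω - w m h' ω)) +
        ((w b h ω - w m h ω) * (w b' h' ω - w a' h' ω) +
        (w m h ω - w a' h ω) * (w m h' ω - w a' h' ω)) := fun ω => by ring
    simp_rw [e]
    have i1 : Integrable (fun ω => (w a' h ω - w a h ω) * (w b' h' ω - w a' h' ω) +
        (w m h ω - w a' h ω) * (w b' h' ω - w m h' ω)) (P.restrict D) :=
      (I a a' a' b' h h').add (I a' m m b' h h')
    have i2 : Integrable (fun ω => (w b h ω - w m h ω) * (w b' h' ω - w a' h' ω) +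
        (w m h ω - w a' h ω) * (w m h' ω - w a' h' ω)) (P.restrict D) :=
      (I m b a' b' h h').add (I a' m a' m h h')
    rw [integral_add i1 i2, integral_add (I a a' a' b' h h') (I a' m m b' h h'),
      integral_add (I m b a' b' h h') (I a' m a' m h h'), z1, z2, z3, z4]
    have e2 : max 0 ((min b b' : ℝ) - a') = (m : ℝ) - a' := by
      rw [hm, NNReal.coe_min]
      refine max_eq_right (sub_nonneg.2 ?_)
      have : (a' : ℝ) ≤ m := ham
      rwa [hm, NNReal.coe_min] at this
    rw [e2]; ring

end IsWienerVersion

lemma setIntegral_indicator_Ioc_toNNReal (a b a' b' T : ℝ≥0) (k : ℝ) :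
    ∫ s in Set.Ioc (0 : ℝ) T, (Set.Ioc a b ∩ Set.Ioc a' b').indicator (fun _ => k) s.toNNReal =
      max 0 ((min (min b T) (min b' T) : ℝ) - max (a : ℝ) a') * k := by
  have e : ∀ s ∈ Set.Ioc (0 : ℝ) T,
      (Set.Ioc a b ∩ Set.Ioc a' b').indicator (fun _ => k) s.toNNReal =
      (Set.Ioc (max a a' : ℝ) (min (min b T) (min b' T))).indicator (fun _ => k) s := by
    intro s hs
    have hiff : s.toNNReal ∈ Set.Ioc a b ∩ Set.Ioc a' b' ↔
        s ∈ Set.Ioc (max a a' : ℝ) (min (min b T) (min b' T)) := by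
      simp only [Set.mem_inter_iff, Set.mem_Ioc, max_lt_iff, le_min_iff,
        Real.lt_toNNReal_iff_coe_lt, Real.toNNReal_le_iff_le_coe]
      have := hs.2
      tauto
    by_cases h : s ∈ Set.Ioc (max a a' : ℝ) (min (min b T) (min b' T))
    · rw [Set.indicator_of_mem h, Set.indicator_of_mem (hiff.2 h)]
    · rw [Set.indicator_of_notMem h, Set.indicator_of_notMem fun h' => h (hiff.1 h')]
  rw [setIntegral_congr_fun measurableSet_Ioc e, integral_indicator_const _ measurableSet_Ioc,
    measureReal_restrict_apply measurableSet_Ioc, Set.inter_eq_left.2, smul_eq_mul,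
    measureReal_def, Real.volume_Ioc, ENNReal.toReal_ofReal', max_comm]
  intro s hs
  exact ⟨lt_of_le_of_lt (le_max_of_le_left a.2) hs.1,
    hs.2.trans ((min_le_left _ _).trans (min_le_right _ _))⟩

namespace IsElementary

variable {ψ ψ' : ℝ≥0 → Ω → H} {J J' : ℝ≥0 → Ω → ℝ}

lemma stronglyMeasurable_inner (h : IsElementary 𝔽 w ψ J) (h' : IsElementary 𝔽 w ψ' J') :
    StronglyMeasurable fun p : Ω × ℝ =>
      (inner ℝ (ψ p.2.toNNReal p.1) (ψ' p.2.toNNReal p.1) : ℝ) := by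
  have hm : Measurable fun p : Ω × ℝ => (p.2.toNNReal, p.1) := by fun_prop
  exact (h.stronglyMeasurable.comp_measurable hm).inner (h'.stronglyMeasurable.comp_measurable hm)

lemma exists_bound_inner (h : IsElementary 𝔽 w ψ J) (h' : IsElementary 𝔽 w ψ' J') :
    ∃ M : ℝ, ∀ s ω, |(inner ℝ (ψ s ω) (ψ' s ω) : ℝ)| ≤ M := by
  obtain ⟨M, hM⟩ := h.exists_bound
  obtain ⟨M', hM'⟩ := h'.exists_bound
  exact ⟨M * M', fun s ω => (abs_real_inner_le_norm _ _).trans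
    (mul_le_mul (hM s ω) (hM' s ω) (norm_nonneg _) ((norm_nonneg _).trans (hM s ω)))⟩

lemma integrable_inner (h : IsElementary 𝔽 w ψ J) (h' : IsElementary 𝔽 w ψ' J') (T : ℝ≥0)
    (ω : Ω) : IntegrableOn (fun s : ℝ =>
      (inner ℝ (ψ s.toNNReal ω) (ψ' s.toNNReal ω) : ℝ)) (Set.Ioc 0 T) := by
  obtain ⟨M, hM⟩ := h.exists_bound_inner h'
  refine Integrable.mono' (g := fun _ => M) (integrable_const M) ?_
    (Eventually.of_forall fun s => hM _ ω)
  exact ((h.stronglyMeasurable_inner h').comp_measurable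
    (measurable_const.prodMk measurable_id : Measurable fun s : ℝ => (ω, s))).aestronglyMeasurable

lemma integrable_integral_inner [IsProbabilityMeasure P] (h : IsElementary 𝔽 w ψ J)
    (h' : IsElementary 𝔽 w ψ' J') (T : ℝ≥0) :
    Integrable (fun ω => ∫ s in Set.Ioc (0 : ℝ) T,
      (inner ℝ (ψ s.toNNReal ω) (ψ' s.toNNReal ω) : ℝ)) P := by
  obtain ⟨M, hM⟩ := h.exists_bound_inner h'
  refine Integrable.mono' (g := fun _ => M * T) (integrable_const _) ?_
    (Eventually.of_forall fun ω => ?_)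
  · exact (h.stronglyMeasurable_inner h').integral_prod_right.aestronglyMeasurable
  · have := norm_setIntegral_le_of_norm_le_const (μ := volume) (s := Set.Ioc (0 : ℝ) T)
      (f := fun s : ℝ => (inner ℝ (ψ s.toNNReal ω) (ψ' s.toNNReal ω) : ℝ)) (C := M)
      measure_Ioc_lt_top (fun s _ => hM _ ω)
    simpa [measureReal_def] using this

/-- Since a ≤ a', the event A ∩ A' is known at time a', and the covariance over the overlap applies.
If T ≤ a' this event need not be known at T, but then both sides vanish. -/
lemma integral_mul_piece [IsProbabilityMeasure P] (hw : IsWienerVersion 𝔽 P w) (T : ℝ≥0)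
    (c : ℝ) (a b : ℝ≥0) (A : Set Ω) (hA : MeasurableSet[𝔽 a] A) (h : H)
    (c' : ℝ) (a' b' : ℝ≥0) (hab' : a' ≤ b') (A' : Set Ω) (hA' : MeasurableSet[𝔽 a'] A') (h' : H)
    (haa' : a ≤ a') :
    ∫ ω, A.indicator (fun ω => c * (w (min b T) h ω - w (min a T) h ω)) ω *
      A'.indicator (fun ω => c' * (w (min b' T) h' ω - w (min a' T) h' ω)) ω ∂P =
    ∫ ω, (∫ s in Set.Ioc (0 : ℝ) T, (inner ℝ
      ((Set.Ioc a b).indicator (fun _ => A.indicator (fun _ => c • h) ω) s.toNNReal)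
      ((Set.Ioc a' b').indicator (fun _ => A'.indicator (fun _ => c' • h') ω) s.toNNReal) : ℝ))
      ∂P := by
  have hD : MeasurableSet[𝔽 a'] (A ∩ A') := (𝔽.mono haa' A hA).inter hA'
  have hDm := 𝔽.le _ _ hD
  have e1 : ∀ ω, A.indicator (fun ω => c * (w (min b T) h ω - w (min a T) h ω)) ω *
      A'.indicator (fun ω => c' * (w (min b' T) h' ω - w (min a' T) h' ω)) ω =
      (A ∩ A').indicator (fun ω => (c * c') * ((w (min b T) h ω - w (min a T) h ω) *
        (w (min b' T) h' ω - w (min a' T) h' ω))) ω := by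
    intro ω
    by_cases h1 : ω ∈ A <;> by_cases h2 : ω ∈ A' <;> simp [h1, h2]
    ring
  have e2 : ∀ ω, ∫ s in Set.Ioc (0 : ℝ) T, (inner ℝ
      ((Set.Ioc a b).indicator (fun _ => A.indicator (fun _ => c • h) ω) s.toNNReal)
      ((Set.Ioc a' b').indicator (fun _ => A'.indicator (fun _ => c' • h') ω) s.toNNReal) : ℝ) =
      (A ∩ A').indicator (fun _ => max 0 ((min (min b T) (min b' T) : ℝ) - max (a : ℝ) a') *
        (c * c' * inner ℝ h h')) ω := by
    intro ω
    by_cases hω : ω ∈ A ∩ A'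
    · rw [Set.indicator_of_mem hω, ← setIntegral_indicator_Ioc_toNNReal]
      congr 1; ext s
      by_cases h1 : s.toNNReal ∈ Set.Ioc a b <;> by_cases h2 : s.toNNReal ∈ Set.Ioc a' b' <;>
        simp only [Set.indicator, Set.mem_inter_iff, h1, h2, hω.1, hω.2, if_true, if_false,
          inner_zero_left, inner_zero_right, and_true, and_false, real_inner_smul_left,
          real_inner_smul_right]
      ring
    · rw [Set.indicator_of_notMem hω]
      have : ∀ s : ℝ, (inner ℝ
        ((Set.Ioc a b).indicator (fun _ => A.indicator (fun _ => c • h) ω) s.toNNReal)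
        ((Set.Ioc a' b').indicator (fun _ => A'.indicator (fun _ => c' • h') ω) s.toNNReal) : ℝ)
          = 0 := by
        intro s
        by_cases h1 : ω ∈ A
        · have h2 : ω ∉ A' := fun h2 => hω ⟨h1, h2⟩
          simp [h2]
        · simp [h1]
      simp [this]
  simp_rw [e1, e2]
  rw [integral_indicator hDm, integral_indicator_const _ hDm, integral_const_mul]
  rcases le_total T a' with hTa | haT
  · rw [min_eq_right hTa, min_eq_right (hTa.trans hab'), max_eq_left]
    · simp
    · have h1 : (T : ℝ) ≤ a' := hTa
      have h2 := min_le_right (min (b : ℝ) T) (min (b' : ℝ) T)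
      have h3 := min_le_right (b' : ℝ) T
      have h4 := le_max_right (a : ℝ) a'
      linarith
  · have h1 := hw.setIntegral_mul (a := min a T) (b := min b T) (a' := min a' T)
      (b' := min b' T) (min_le_min_right _ hab')
      (min_le_min_right _ haa') (by rwa [min_eq_left haT]) h h'
    rw [h1, min_eq_left haT, max_eq_right (show (a : ℝ) ≤ a' from haa'), smul_eq_mul]
    simp only [NNReal.coe_min]
    ring

/-- The Itô isometry, polarized. -/
lemma integral_mul [IsProbabilityMeasure P] (hw : IsWienerVersion 𝔽 P w)
    (h : IsElementary 𝔽 w ψ J) (h' : IsElementary 𝔽 w ψ' J') (T : ℝ≥0) :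
    ∫ ω, J T ω * J' T ω ∂P = ∫ ω, (∫ s in Set.Ioc (0 : ℝ) T,
      (inner ℝ (ψ s.toNNReal ω) (ψ' s.toNNReal ω) : ℝ)) ∂P := by
  have I : ∀ {ψ ψ' : ℝ≥0 → Ω → H} {J J' : ℝ≥0 → Ω → ℝ}, IsElementary 𝔽 w ψ J →
      IsElementary 𝔽 w ψ' J' → Integrable (fun ω => J T ω * J' T ω) P := fun h h' =>
    (h.memLp_integral hw T).integrable_mul (h'.memLp_integral hw T)
  induction h with
  | piece c a b hab A hA k =>
    induction h' with
    | piece c' a' b' hab' A' hA' k' =>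
      rcases le_total a a' with haa' | haa'
      · exact integral_mul_piece hw T c a b A hA k c' a' b' hab' A' hA' k' haa'
      · have := integral_mul_piece hw T c' a' b' A' hA' k' c a b hab A hA k haa'
        simp_rw [mul_comm (A'.indicator _ _), real_inner_comm] at this
        exact this
    | @add ψ₁ ψ₂ J₁ J₂ h1 h2 ih1 ih2 =>
      have h0 := piece (𝔽 := 𝔽) (w := w) c a b hab A hA k
      simp_rw [mul_add, inner_add_right]
      rw [integral_add (I h0 h1) (I h0 h2), ih1, ih2, ← integral_add
        (h0.integrable_integral_inner h1 T) (h0.integrable_integral_inner h2 T)]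
      congr 1; ext ω
      exact (integral_add (h0.integrable_inner h1 T ω) (h0.integrable_inner h2 T ω)).symm
  | @add ψ₁ ψ₂ J₁ J₂ h1 h2 ih1 ih2 =>
      simp_rw [add_mul, inner_add_left]
      rw [integral_add (I h1 h') (I h2 h'), ih1, ih2, ← integral_add
        (h1.integrable_integral_inner h' T) (h2.integrable_integral_inner h' T)]
      congr 1; ext ω
      exact (integral_add (h1.integrable_inner h' T ω) (h2.integrable_inner h' T ω)).symm

end IsElementary

end Isometry


/-! ### Energies of integrands -/

section Energy

variable {H : Type*} [NormedAddCommGroup H] {Ω : Type*}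

/-- The energy `∫₀ᵀ ‖f(s)‖² ds`. -/
def energy (f : ℝ≥0 → Ω → H) (T : ℝ≥0) (ω : Ω) : ℝ≥0∞ :=
  ∫⁻ s in Set.Ioc (0 : ℝ) T, ‖f s.toNNReal ω‖ₑ ^ 2

lemma mem_Ioc_toNNReal {T : ℝ≥0} {s : ℝ} (hs : s ∈ Set.Ioc (0 : ℝ) T) :
    s.toNNReal ∈ Set.Ioc (0 : ℝ≥0) T :=
  ⟨Real.toNNReal_pos.2 hs.1, Real.toNNReal_le_iff_le_coe.2 hs.2⟩

lemma energy_mono {f g : ℝ≥0 → Ω → H} {T : ℝ≥0} {ω : Ω}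
    (h : ∀ s ∈ Set.Ioc 0 T, ‖f s ω‖ ≤ ‖g s ω‖) : energy f T ω ≤ energy g T ω := by
  refine setLIntegral_mono' measurableSet_Ioc fun s hs => ?_
  have := h _ (mem_Ioc_toNNReal hs)
  gcongr
  exact enorm_le_iff_norm_le.2 this

lemma energy_congr {f g : ℝ≥0 → Ω → H} {T : ℝ≥0} {ω : Ω}
    (h : ∀ s ∈ Set.Ioc 0 T, f s ω = g s ω) : energy f T ω = energy g T ω :=
  le_antisymm (energy_mono fun s hs => (congrArg norm (h s hs)).le)
    (energy_mono fun s hs => (congrArg norm (h s hs)).ge)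

lemma energy_mono_time (f : ℝ≥0 → Ω → H) {T T' : ℝ≥0} (hT : T ≤ T') (ω : Ω) :
    energy f T ω ≤ energy f T' ω :=
  lintegral_mono_set (Set.Ioc_subset_Ioc_right (by exact_mod_cast hT))

lemma enorm_add_sq_le (x y : H) : ‖x + y‖ₑ ^ 2 ≤ 2 * ‖x‖ₑ ^ 2 + 2 * ‖y‖ₑ ^ 2 := by
  have h : ‖x + y‖₊ ^ 2 ≤ 2 * ‖x‖₊ ^ 2 + 2 * ‖y‖₊ ^ 2 := by
    have h1 : ‖x + y‖ ≤ ‖x‖ + ‖y‖ := norm_add_le x y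
    have h2 : ‖x + y‖ ^ 2 ≤ (‖x‖ + ‖y‖) ^ 2 := by gcongr
    have h3 : ‖x + y‖ ^ 2 ≤ 2 * ‖x‖ ^ 2 + 2 * ‖y‖ ^ 2 := by nlinarith [sq_nonneg (‖x‖ - ‖y‖)]
    exact_mod_cast h3
  simp only [enorm_eq_nnnorm]
  exact_mod_cast h

lemma energy_add_le {f g k : ℝ≥0 → Ω → H} {T : ℝ≥0} {ω : Ω}
    (hf : StronglyMeasurable fun s => f s ω) (h : ∀ s ∈ Set.Ioc 0 T, k s ω = f s ω + g s ω) :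
    energy k T ω ≤ 2 * energy f T ω + 2 * energy g T ω := by
  have hm : Measurable fun s : ℝ => ‖f s.toNNReal ω‖ₑ ^ 2 :=
    ((hf.comp_measurable measurable_real_toNNReal).enorm).pow_const 2
  rw [energy_congr (g := fun s ω => f s ω + g s ω) h]
  unfold energy
  rw [← lintegral_const_mul _ hm, ← lintegral_const_mul' _ _ (by simp),
    ← lintegral_add_left (hm.const_mul 2)]
  exact lintegral_mono fun s => enorm_add_sq_le _ _

lemma energy_le_const {f : ℝ≥0 → Ω → H} {T : ℝ≥0} {ω : Ω} {M : ℝ≥0}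
    (h : ∀ s ∈ Set.Ioc 0 T, ‖f s ω‖ ≤ M) : energy f T ω ≤ (M ^ 2 * T : ℝ≥0) := by
  calc energy f T ω ≤ ∫⁻ _ in Set.Ioc (0 : ℝ) T, (M : ℝ≥0∞) ^ 2 := by
        refine setLIntegral_mono' measurableSet_Ioc fun s hs => ?_
        have h1 := h _ (mem_Ioc_toNNReal hs)
        have h2 : ‖f s.toNNReal ω‖₊ ≤ M := h1
        gcongr
        exact_mod_cast h2
    _ = (M ^ 2 * T : ℝ≥0) := by
        rw [setLIntegral_const, Real.volume_Ioc, sub_zero, ENNReal.ofReal_coe_nnreal]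
        push_cast; rfl

/-- The energy grows at most linearly for bounded integrands. -/
lemma energy_le_add {f : ℝ≥0 → Ω → H} {M : ℝ≥0} {ω : Ω} (h : ∀ s, ‖f s ω‖ ≤ M) {T T' : ℝ≥0}
    (hT : T ≤ T') : energy f T' ω ≤ energy f T ω + (M ^ 2 * (T' - T) : ℝ≥0) := by
  have hT' : (T : ℝ) ≤ T' := hT
  unfold energy
  rw [← Set.Ioc_union_Ioc_eq_Ioc T.coe_nonneg hT', lintegral_union measurableSet_Ioc
    (Set.Ioc_disjoint_Ioc_of_le le_rfl)]
  refine add_le_add le_rfl ?_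
  calc ∫⁻ s in Set.Ioc (T : ℝ) T', ‖f s.toNNReal ω‖ₑ ^ 2
      ≤ ∫⁻ _ in Set.Ioc (T : ℝ) T', (M : ℝ≥0∞) ^ 2 := by
        refine lintegral_mono fun s => ?_
        have h2 : ‖f s.toNNReal ω‖₊ ≤ M := h _
        gcongr
        exact_mod_cast h2
    _ = (M ^ 2 * (T' - T) : ℝ≥0) := by
        rw [setLIntegral_const, Real.volume_Ioc, ← NNReal.coe_sub hT, ENNReal.ofReal_coe_nnreal]
        push_cast; rfl

lemma energy_zero (f : ℝ≥0 → Ω → H) (ω : Ω) : energy f 0 ω = 0 := by simp [energy]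

/-- An integrand which vanishes after time `c`. -/
lemma energy_le_of_vanish {f g : ℝ≥0 → Ω → H} {c T : ℝ≥0} {ω : Ω}
    (h1 : ∀ s ∈ Set.Ioc 0 T, s ≤ c → ‖f s ω‖ ≤ ‖g s ω‖) (h2 : ∀ s ∈ Set.Ioc 0 T, c < s → f s ω = 0)
    (hcT : c ≤ T) : energy f T ω ≤ energy g c ω := by
  have hc' : (c : ℝ) ≤ T := hcT
  unfold energy
  rw [← Set.Ioc_union_Ioc_eq_Ioc c.coe_nonneg hc', lintegral_union measurableSet_Ioc
    (Set.Ioc_disjoint_Ioc_of_le le_rfl)]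
  have e : ∫⁻ s in Set.Ioc (c : ℝ) T, ‖f s.toNNReal ω‖ₑ ^ 2 = 0 := by
    rw [← lintegral_zero]
    refine setLIntegral_congr_fun measurableSet_Ioc fun s hs => ?_
    have hs' : s ∈ Set.Ioc (0 : ℝ) T := ⟨lt_of_le_of_lt c.2 hs.1, hs.2⟩
    simp [h2 _ (mem_Ioc_toNNReal hs') (Real.lt_toNNReal_iff_coe_lt.2 hs.1)]
  rw [e, add_zero]
  exact energy_mono fun s hs => h1 s ⟨hs.1, hs.2.trans hcT⟩ hs.2

lemma measurable_energy [MeasurableSpace Ω] {f : ℝ≥0 → Ω → H}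
    (hf : StronglyMeasurable fun p : ℝ≥0 × Ω => f p.1 p.2) (T : ℝ≥0) :
    Measurable (energy f T) := by
  have hm : Measurable fun p : ℝ × Ω => ‖f p.1.toNNReal p.2‖ₑ ^ 2 :=
    ((hf.comp_measurable (by fun_prop : Measurable fun p : ℝ × Ω => (p.1.toNNReal, p.2))).enorm
      ).pow_const 2
  exact hm.lintegral_prod_left'

end Energy

/-! ### Grid restrictions -/

section Grid

lemma exists_cell {d : ℕ → ℝ≥0} {n : ℕ} {s : ℝ≥0} (h0 : d 0 < s) (hn : s ≤ d n) :
    ∃ k < n, s ∈ Set.Ioc (d k) (d (k + 1)) := by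
  induction n with
  | zero => exact absurd h0 (not_lt.2 hn)
  | succ n ih =>
    by_cases h : s ≤ d n
    · obtain ⟨k, hk, hs⟩ := ih h
      exact ⟨k, hk.trans n.lt_succ_self, hs⟩
    · exact ⟨n, n.lt_succ_self, not_le.1 h, hn⟩

variable {H : Type*} [NormedAddCommGroup H] {Ω : Type*}

/-- The integrand `ψ` restricted to the event `B k` on the cell `(d k, d (k + 1)]`. -/
def gridRestrict (d : ℕ → ℝ≥0) (B : ℕ → Set Ω) (n : ℕ) (ψ : ℝ≥0 → Ω → H) (s : ℝ≥0) (ω : Ω) : H :=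
  ∑ k ∈ Finset.range n,
    (Set.Ioc (d k) (d (k + 1))).indicator (fun _ => (B k).indicator (fun _ => ψ s ω) ω) s

/-- The stochastic integral of the restricted integrand. -/
def gridIntegral (d : ℕ → ℝ≥0) (B : ℕ → Set Ω) (n : ℕ) (J : ℝ≥0 → Ω → ℝ) (t : ℝ≥0) (ω : Ω) : ℝ :=
  ∑ k ∈ Finset.range n,
    (B k).indicator (fun ω => J (min (d (k + 1)) t) ω - J (min (d k) t) ω) ω

variable {d : ℕ → ℝ≥0} {B : ℕ → Set Ω} {n : ℕ} {ψ : ℝ≥0 → Ω → H} {J : ℝ≥0 → Ω → ℝ}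

lemma gridRestrict_of_mem (hd : Monotone d) {k : ℕ} (hk : k < n) {s : ℝ≥0}
    (hs : s ∈ Set.Ioc (d k) (d (k + 1))) (ω : Ω) :
    gridRestrict d B n ψ s ω = (B k).indicator (fun _ => ψ s ω) ω := by
  unfold gridRestrict
  rw [Finset.sum_eq_single k]
  · rw [Set.indicator_of_mem hs]
  · intro i _ hik
    refine Set.indicator_of_notMem (fun hi => ?_) _
    rcases lt_or_gt_of_ne hik with h | h
    · exact absurd hs.1 (not_lt.2 (hi.2.trans (hd h)))
    · exact absurd hi.1 (not_lt.2 (hs.2.trans (hd h)))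
  · intro h; exact absurd (Finset.mem_range.2 hk) h

lemma gridRestrict_of_le (hd : Monotone d) {s : ℝ≥0} (hs : s ≤ d 0) (ω : Ω) :
    gridRestrict d B n ψ s ω = 0 :=
  Finset.sum_eq_zero fun k _ => Set.indicator_of_notMem
    (fun hk => absurd hk.1 (not_lt.2 (hs.trans (hd (Nat.zero_le k))))) _

end Grid

/-! ### Isometry, truncation and Lenglart's inequality for elementary integrands. -/

namespace IsElementary

variable {H : Type*} [NormedAddCommGroup H] [InnerProductSpace ℝ H]
variable {Ω : Type*} {mΩ : MeasurableSpace Ω} {P : Measure Ω}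
variable {𝔽 : Filtration ℝ≥0 mΩ} {w : ℝ≥0 → H → Ω → ℝ} {ψ ψ' : ℝ≥0 → Ω → H}
  {J J' : ℝ≥0 → Ω → ℝ}

lemma grid (h : IsElementary 𝔽 w ψ J) {d : ℕ → ℝ≥0} (hd : Monotone d) {B : ℕ → Set Ω}
    (hB : ∀ k, MeasurableSet[𝔽 (d k)] (B k)) (n : ℕ) :
    IsElementary 𝔽 w (gridRestrict d B n ψ) (gridIntegral d B n J) :=
  IsElementary.sum _ fun k _ => h.restrict (hd k.le_succ) (hB k)

lemma integral_zero (h : IsElementary 𝔽 w ψ J) (ω : Ω) : J 0 ω = 0 := by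
  induction h with
  | piece c a b hab A hA h => by_cases hω : ω ∈ A <;> simp [hω]
  | add _ _ h1 h2 => simp [h1, h2]

lemma measurable_energy_adapted (h : IsElementary 𝔽 w ψ J) (T : ℝ≥0) :
    Measurable[𝔽 T] (energy ψ T) := by
  have e : energy ψ T = energy (fun s ω => ψ (min s T) ω) T := by
    ext ω
    exact energy_congr fun s hs => by rw [min_eq_left hs.2]
  rw [e]
  exact @measurable_energy H _ Ω (𝔽 T) _ (h.stronglyMeasurable_min T) T

lemma measurable_energy (h : IsElementary 𝔽 w ψ J) (T : ℝ≥0) : Measurable (energy ψ T) :=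
  (h.measurable_energy_adapted T).mono (𝔽.le T) le_rfl

/-- The Itô isometry. -/
lemma lintegral_sq [IsProbabilityMeasure P] (h : IsElementary 𝔽 w ψ J)
    (hw : IsWienerVersion 𝔽 P w) (T : ℝ≥0) :
    ∫⁻ ω, ‖J T ω‖ₑ ^ 2 ∂P = ∫⁻ ω, energy ψ T ω ∂P := by
  have h1 := h.integral_mul hw h T
  have e1 : ∀ ω, ‖J T ω‖ₑ ^ 2 = ENNReal.ofReal (J T ω * J T ω) := fun ω => by
    rw [← sq, Real.enorm_eq_ofReal_abs, ← ENNReal.ofReal_pow (abs_nonneg _), sq_abs]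
  have e2 : ∀ ω, energy ψ T ω = ENNReal.ofReal (∫ s in Set.Ioc (0 : ℝ) T,
      (inner ℝ (ψ s.toNNReal ω) (ψ s.toNNReal ω) : ℝ)) := fun ω => by
    rw [ofReal_integral_eq_lintegral_ofReal (h.integrable_inner h T ω)
      (Eventually.of_forall fun s => real_inner_self_nonneg)]
    refine lintegral_congr fun s => ?_
    rw [real_inner_self_eq_norm_sq, ENNReal.ofReal_pow (norm_nonneg _), ofReal_norm]
  simp_rw [e1, e2]
  have i1 : Integrable (fun ω => J T ω * J T ω) P :=
    (h.memLp_integral hw T).integrable_mul (h.memLp_integral hw T)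
  rw [← ofReal_integral_eq_lintegral_ofReal i1
      (Eventually.of_forall fun ω => mul_self_nonneg _), h1,
    ofReal_integral_eq_lintegral_ofReal (h.integrable_integral_inner h T)
      (Eventually.of_forall fun ω => integral_nonneg fun s => real_inner_self_nonneg)]

/-- Truncation of the energy. -/
lemma exists_truncation (h : IsElementary 𝔽 w ψ J) (T : ℝ≥0) {K : ℝ≥0} (hK : 0 < K) :
    ∃ (Ψ : ℝ≥0 → Ω → H) (J' : ℝ≥0 → Ω → ℝ), IsElementary 𝔽 w Ψ J' ∧
      (∀ ω, energy Ψ T ω ≤ (2 * K : ℝ≥0)) ∧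
      ∀ ω, energy ψ T ω ≤ K → (∀ s ∈ Set.Ioc 0 T, Ψ s ω = ψ s ω) ∧ J' T ω = J T ω := by
  obtain ⟨M₀, hM₀⟩ := h.exists_bound
  set M : ℝ≥0 := M₀.toNNReal with hMdef
  have hM : ∀ s ω, ‖ψ s ω‖ ≤ M := fun s ω => (hM₀ s ω).trans (Real.le_coe_toNNReal M₀)
  -- The cells are so short that at most `K` of energy is gained over one of them; n = N + 1 is
  -- never 0.
  obtain ⟨N, hN⟩ := exists_nat_gt (M ^ 2 * T / K)
  set n : ℕ := N + 1 with hn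
  have hn0 : (0 : ℝ≥0) < n := by positivity
  set c : ℕ → ℝ≥0 := fun i => i * T / n with hc
  have hcm : Monotone c := fun a b hab => by
    simp only [hc]
    gcongr
  have hc0 : c 0 = 0 := by simp [hc]
  have hcn : c n = T := by
    simp only [hc]
    field_simp
  have hmesh : ∀ k, M ^ 2 * (c (k + 1) - c k) ≤ K := by
    intro k
    have e : c (k + 1) - c k = T / n := by
      have : c (k + 1) = T / n + c k := by
        simp only [hc]; push_cast; ring
      rw [this, add_tsub_cancel_right]
    rw [e, ← mul_div_assoc, div_le_iff₀ hn0]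
    have h2 : M ^ 2 * T < N * K := (div_lt_iff₀ hK).1 hN
    refine h2.le.trans ?_
    rw [mul_comm K, hn]
    gcongr
    exact le_self_add
  -- A cell is kept if the energy up to its left end is at most `K`. This is decided at the left
  -- end, so the restricted integrand remains elementary.
  set A : ℕ → Set Ω := fun k => {ω | energy ψ (c k) ω ≤ K} with hA
  have hAm : ∀ k, MeasurableSet[𝔽 (c k)] (A k) := fun k =>
    (h.measurable_energy_adapted (c k)) measurableSet_Iic
  refine ⟨gridRestrict c A n ψ, gridIntegral c A n J, h.grid hcm hAm n, ?_, ?_⟩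
  · intro ω
    by_cases hall : energy ψ T ω ≤ K
    · refine le_trans (energy_mono fun s hs => ?_) (hall.trans ?_)
      · obtain ⟨k, hk, hsk⟩ := exists_cell (d := c) (n := n) (s := s)
          (by rw [hc0]; exact hs.1) (by rw [hcn]; exact hs.2)
        rw [gridRestrict_of_mem hcm hk hsk]
        by_cases hω : ω ∈ A k <;> simp [hω]
      · push_cast
        exact le_mul_of_one_le_left (zero_le) one_le_two
    · have hex : ∃ k, ω ∉ A k := ⟨n, by simp only [hA, Set.mem_ofPred_eq, hcn]; exact hall⟩
      classical
      -- The last cell that is kept starts with energy at most `K` and adds at most `K`, which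
      -- explains the bound 2K.
      set k := Nat.find hex with hk
      have hk1 : ω ∉ A k := Nat.find_spec hex
      have hkn : k ≤ n := Nat.find_min' hex
        (by simp only [hA, Set.mem_ofPred_eq, hcn]; exact hall)
      have hk0 : k ≠ 0 := by
        intro h0
        rw [h0] at hk1
        exact hk1 (by simp only [hA, Set.mem_ofPred_eq, hc0, energy_zero]; exact zero_le)
      obtain ⟨l, hl⟩ := Nat.exists_eq_succ_of_ne_zero hk0
      have hlA : ω ∈ A l := not_not.1 (Nat.find_min hex (by rw [← hk, hl]; exact l.lt_succ_self))
      have hlater : ∀ i, k ≤ i → ω ∉ A i := fun i hi hAi => hk1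
        ((energy_mono_time ψ (hcm hi) ω).trans hAi)
      calc energy (gridRestrict c A n ψ) T ω ≤ energy ψ (c k) ω := by
            refine energy_le_of_vanish (fun s hs _ => ?_) (fun s hs hks => ?_)
              (by rw [← hcn]; exact hcm hkn)
            · obtain ⟨i, hi, hsi⟩ := exists_cell (d := c) (n := n) (s := s)
                (by rw [hc0]; exact hs.1) (by rw [hcn]; exact hs.2)
              rw [gridRestrict_of_mem hcm hi hsi]
              by_cases hω : ω ∈ A i <;> simp [hω]
            · obtain ⟨i, hi, hsi⟩ := exists_cell (d := c) (n := n) (s := s)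
                (by rw [hc0]; exact hs.1) (by rw [hcn]; exact hs.2)
              rw [gridRestrict_of_mem hcm hi hsi, Set.indicator_of_notMem]
              refine hlater i (not_lt.1 fun hik => ?_)
              exact absurd hks (not_lt.2 (hsi.2.trans (hcm hik)))
        _ ≤ energy ψ (c l) ω + (M ^ 2 * (c k - c l) : ℝ≥0) := by
            rw [hl]; exact energy_le_add (fun s => hM s ω) (hcm l.le_succ)
        _ ≤ K + K := by
            refine add_le_add hlA ?_
            rw [hl]
            exact_mod_cast hmesh l
        _ = (2 * K : ℝ≥0) := by push_cast; ring
  · intro ω hω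
    have hall : ∀ k, k ≤ n → ω ∈ A k := fun k hk =>
      (energy_mono_time ψ (by rw [← hcn]; exact hcm hk) ω).trans hω
    constructor
    · intro s hs
      obtain ⟨k, hk, hsk⟩ := exists_cell (d := c) (n := n) (s := s)
        (by rw [hc0]; exact hs.1) (by rw [hcn]; exact hs.2)
      rw [gridRestrict_of_mem hcm hk hsk, Set.indicator_of_mem (hall k hk.le)]
    · unfold gridIntegral
      rw [Finset.sum_congr rfl (g := fun k => J (c (k + 1)) ω - J (c k) ω)]
      · rw [Finset.sum_range_sub (fun k => J (c k) ω), hcn, hc0, h.integral_zero, sub_zero]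
      · intro k hk
        have hk := Finset.mem_range.1 hk
        rw [Set.indicator_of_mem (hall k hk.le),
          min_eq_left (by rw [← hcn]; exact hcm (Nat.succ_le_of_lt hk)),
          min_eq_left (by rw [← hcn]; exact hcm hk.le)]

/-- Lenglart's inequality for elementary integrands. -/
lemma measure_le [IsProbabilityMeasure P] (h : IsElementary 𝔽 w ψ J)
    (hw : IsWienerVersion 𝔽 P w) (T : ℝ≥0) {K : ℝ≥0} (hK : 0 < K) {ε : ℝ≥0∞} (hε : ε ≠ 0)
    (hε' : ε ≠ ∞) :
    P {ω | ε ≤ ‖J T ω‖ₑ} ≤ P {ω | K ≤ energy ψ T ω} + (2 * K : ℝ≥0) / ε ^ 2 := by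
  obtain ⟨Ψ, J', h', hbound, heq⟩ := h.exists_truncation T hK
  -- Either the energy reaches `K`, or the truncation changes nothing and Chebyshev's inequality
  -- with the isometry applies.
  have h1 : {ω | ε ≤ ‖J T ω‖ₑ} ⊆ {ω | K ≤ energy ψ T ω} ∪ {ω | ε ^ 2 ≤ ‖J' T ω‖ₑ ^ 2} := by
    intro ω hω
    by_cases hK' : (K : ℝ≥0∞) ≤ energy ψ T ω
    · exact Or.inl hK'
    · refine Or.inr ?_
      have e := (heq ω (not_le.1 hK').le).2
      simp only [Set.mem_ofPred_eq] at hω ⊢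
      rw [e]; gcongr
  refine (measure_mono h1).trans ((measure_union_le _ _).trans (add_le_add le_rfl ?_))
  rw [ENNReal.le_div_iff_mul_le (Or.inl (pow_ne_zero 2 hε)) (Or.inl (ENNReal.pow_ne_top hε')),
    mul_comm]
  have hm : Measurable fun ω => ‖J' T ω‖ₑ ^ 2 := (h'.measurable_integral hw T).enorm.pow_const 2
  refine (mul_meas_ge_le_lintegral hm (ε ^ 2)).trans ?_
  rw [h'.lintegral_sq hw T]
  calc ∫⁻ ω, energy Ψ T ω ∂P ≤ ∫⁻ _, ((2 * K : ℝ≥0) : ℝ≥0∞) ∂P := lintegral_mono hbound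
    _ = (2 * K : ℝ≥0) := by simp

end IsElementary


/-! ### Approximation of stochastic integrals by elementary ones -/

section Approximation

variable {H : Type*} [NormedAddCommGroup H] [InnerProductSpace ℝ H]
variable {Ω : Type*} {mΩ : MeasurableSpace Ω} {P : Measure Ω}
variable {𝔽 : Filtration ℝ≥0 mΩ} {w : ℝ≥0 → H → Ω → ℝ} {W : TimeL2 H →L[ℝ] Lp ℝ 2 P}

lemma ElementaryProcess.exists_isElementary (hwW : ∀ t h, w t h =ᵐ[P] wienerAt W t h)
    (Φ : ElementaryProcess H 𝔽) :
    ∃ J, IsElementary 𝔽 w Φ.val J ∧ ∀ t, J t =ᵐ[P] Φ.integral W t := by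
  refine ⟨fun t ω => ∑ i, (Φ.A i).indicator
      (fun ω => 1 * (w (min (Φ.b i) t) (Φ.h i) ω - w (min (Φ.a i) t) (Φ.h i) ω)) ω,
    (IsElementary.sum Finset.univ fun i _ => IsElementary.piece 1 (Φ.a i) (Φ.b i) (Φ.le i) (Φ.A i)
      (Φ.measurable i) (Φ.h i)).congr (fun s ω => by simp [ElementaryProcess.val])
      (fun t ω => rfl), fun t => ?_⟩
  have h1 : ∀ i, ∀ᵐ ω ∂P, w (min (Φ.b i) t) (Φ.h i) ω = wienerAt W (min (Φ.b i) t) (Φ.h i) ω :=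
    fun i => hwW _ _
  have h2 : ∀ i, ∀ᵐ ω ∂P, w (min (Φ.a i) t) (Φ.h i) ω = wienerAt W (min (Φ.a i) t) (Φ.h i) ω :=
    fun i => hwW _ _
  filter_upwards [ae_all_iff.2 h1, ae_all_iff.2 h2] with ω h1 h2
  simp only [ElementaryProcess.integral]
  refine Finset.sum_congr rfl fun i _ => ?_
  by_cases hω : ω ∈ Φ.A i <;> simp [hω, h1, h2]

lemma IsStochasticIntegral.exists_seq (hwW : ∀ t h, w t h =ᵐ[P] wienerAt W t h)
    {Φ : ℝ≥0 → Ω → H} {T : ℝ≥0} {ξ : Ω → ℝ} (h : IsStochasticIntegral 𝔽 W Φ T ξ) :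
    ∃ (ψ : ℕ → ℝ≥0 → Ω → H) (J : ℕ → ℝ≥0 → Ω → ℝ), (∀ m, IsElementary 𝔽 w (ψ m) (J m)) ∧
      (∀ ε : ℝ≥0∞, 0 < ε → Tendsto (fun m =>
        P {ω | ε ≤ energy (fun s ω => ψ m s ω - Φ s ω) T ω}) atTop (𝓝 0)) ∧
      ∀ ε : ℝ≥0∞, 0 < ε → Tendsto (fun m => P {ω | ε ≤ ‖J m T ω - ξ ω‖ₑ}) atTop (𝓝 0) := by
  obtain ⟨Φs, h1, h2⟩ := h
  choose J hJ hJW using fun m => (Φs m).exists_isElementary hwW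
  refine ⟨fun m => (Φs m).val, J, hJ, h1, fun ε hε => ?_⟩
  refine (h2 ε hε).congr fun m => measure_congr ?_
  filter_upwards [hJW m T] with ω hω
  simp only [eq_iff_iff, edist_eq_enorm_sub]
  change ε ≤ ‖(Φs m).integral W T ω - ξ ω‖ₑ ↔ ε ≤ ‖J m T ω - ξ ω‖ₑ
  rw [hω]

lemma tendsto_measure_of_subset {A B C : ℕ → Set Ω} (h : ∀ m, A m ⊆ B m ∪ C m)
    (hB : Tendsto (fun m => P (B m)) atTop (𝓝 0)) (hC : Tendsto (fun m => P (C m)) atTop (𝓝 0)) :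
    Tendsto (fun m => P (A m)) atTop (𝓝 0) := by
  have hBC : Tendsto (fun m => P (B m) + P (C m)) atTop (𝓝 0) := by simpa using hB.add hC
  exact tendsto_of_tendsto_of_tendsto_of_le_of_le tendsto_const_nhds hBC (fun _ => zero_le)
    fun m => (measure_mono (h m)).trans (measure_union_le _ _)

lemma le_or_le_of_le_two_mul_add {ε a b c : ℝ≥0∞} (h : ε ≤ a) (habc : a ≤ 2 * b + 2 * c) :
    ε / 4 ≤ b ∨ ε / 4 ≤ c := by
  by_contra hcon
  rw [not_or, not_le, not_le] at hcon
  have h1 : 2 * b + 2 * c < 2 * (ε / 4) + 2 * (ε / 4) :=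
    ENNReal.add_lt_add (by gcongr; simp; exact hcon.1) (by gcongr; simp; exact hcon.2)
  have h2 : 2 * (ε / 4) + 2 * (ε / 4) = ε := by
    rw [← add_mul, show (2 : ℝ≥0∞) + 2 = 4 by norm_num,
      ENNReal.mul_div_cancel (by norm_num) (by simp)]
  rw [h2] at h1
  exact absurd (h.trans habc) (not_le.2 h1)

/-- In Lenglart's inequality the level K is chosen so small that the Chebyshev term is below η/2;
the other term is then small for large m. -/
lemma tendsto_measure_integral [IsProbabilityMeasure P] (hw : IsWienerVersion 𝔽 P w)
    {ψ : ℕ → ℝ≥0 → Ω → H} {J : ℕ → ℝ≥0 → Ω → ℝ} (h : ∀ m, IsElementary 𝔽 w (ψ m) (J m)) {T : ℝ≥0}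
    (hψ : ∀ ε : ℝ≥0∞, 0 < ε → Tendsto (fun m => P {ω | ε ≤ energy (ψ m) T ω}) atTop (𝓝 0))
    {ε : ℝ≥0∞} (hε : 0 < ε) :
    Tendsto (fun m => P {ω | ε ≤ ‖J m T ω‖ₑ}) atTop (𝓝 0) := by
  wlog hε' : ε ≠ ∞ generalizing ε
  · have h1 := this one_pos ENNReal.one_ne_top
    refine tendsto_of_tendsto_of_tendsto_of_le_of_le tendsto_const_nhds h1 (fun _ => zero_le)
      fun m => measure_mono fun ω hω => ?_
    rw [not_not.1 hε'] at hω
    exact le_trans (b := ∞) le_top hω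
  rw [ENNReal.tendsto_nhds_zero]
  intro η hη
  obtain ⟨K, hK, hKη⟩ : ∃ K : ℝ≥0, 0 < K ∧ ((2 * K : ℝ≥0) : ℝ≥0∞) / ε ^ 2 ≤ η / 2 := by
    have hpos : 0 < min (η / 2 * ε ^ 2) 1 :=
      lt_min (ENNReal.mul_pos (ENNReal.half_pos hη.ne').ne' (pow_ne_zero 2 hε.ne')) one_pos
    obtain ⟨K, hK0, hK⟩ := ENNReal.lt_iff_exists_nnreal_btwn.1 hpos
    refine ⟨K / 2, by simpa using hK0, ENNReal.div_le_of_le_mul ?_⟩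
    rw [mul_div_cancel₀ K two_ne_zero]
    exact hK.le.trans (min_le_left _ _)
  have h1 := (ENNReal.tendsto_nhds_zero.1 (hψ K (by exact_mod_cast hK))) (η / 2)
    (ENNReal.half_pos hη.ne')
  filter_upwards [h1] with m hm
  calc P {ω | ε ≤ ‖J m T ω‖ₑ} ≤ _ := (h m).measure_le hw T hK hε.ne' hε'
    _ ≤ η / 2 + η / 2 := add_le_add hm hKη
    _ = η := ENNReal.add_halves η

/-- Approximation of a stochastic integral process by an elementary one, uniformly over a finite
set of times. -/
lemma exists_elementary_approx [IsProbabilityMeasure P] (hw : IsWienerVersion 𝔽 P w)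
    (hwW : ∀ t h, w t h =ᵐ[P] wienerAt W t h) {Φ : ℝ≥0 → Ω → H}
    (hΦ : StronglyMeasurable fun p : ℝ≥0 × Ω => Φ p.1 p.2) {N : ℝ≥0 → Ω → ℝ}
    (hN : ∀ t, IsStochasticIntegral 𝔽 W Φ t (N t)) (T : ℝ≥0) (S : Finset ℝ≥0)
    (hS : ∀ t ∈ S, t ≤ T) {ε δ : ℝ≥0∞} (hε : 0 < ε) (hδ : 0 < δ) :
    ∃ (ψ : ℝ≥0 → Ω → H) (J : ℝ≥0 → Ω → ℝ), IsElementary 𝔽 w ψ J ∧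
      P ({ω | ε ≤ energy (fun s ω => ψ s ω - Φ s ω) T ω} ∪
        ⋃ t ∈ S, {ω | ε ≤ ‖J t ω - N t ω‖ₑ}) ≤ δ := by
  -- Each time comes with its own approximating sequence. The one for `T` serves all earlier times:
  -- its difference to the sequence for `t` has energy tending to 0 on [0, t], hence so have the
  -- integrals.
  obtain ⟨ψ, J, hψ, hψT, -⟩ := (hN T).exists_seq hwW
  have hsec : ∀ ω, StronglyMeasurable fun s => Φ s ω := fun ω =>
    hΦ.comp_measurable (measurable_id.prodMk measurable_const)
  have hJ : ∀ t ∈ S, Tendsto (fun m => P {ω | ε ≤ ‖J m t ω - N t ω‖ₑ}) atTop (𝓝 0) := by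
    intro t ht
    obtain ⟨φ, I, hφ, hφt, hI⟩ := (hN t).exists_seq hwW
    have hdiff : ∀ η : ℝ≥0∞, 0 < η → Tendsto (fun m =>
        P {ω | η ≤ energy (fun s ω => ψ m s ω - φ m s ω) t ω}) atTop (𝓝 0) := by
      intro η hη
      have h4 : 0 < η / 4 := ENNReal.div_pos hη.ne' (by simp)
      refine tendsto_measure_of_subset (fun m ω hω => ?_) (hψT _ h4) (hφt _ h4)
      have h1 : energy (fun s ω => ψ m s ω - φ m s ω) t ω ≤
          2 * energy (fun s ω => ψ m s ω - Φ s ω) t ω +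
          2 * energy (fun s ω => φ m s ω - Φ s ω) t ω := by
        have e : energy (fun s ω => φ m s ω - Φ s ω) t ω =
            energy (fun s ω => Φ s ω - φ m s ω) t ω :=
          le_antisymm (energy_mono fun s _ => (norm_sub_rev _ _).le)
            (energy_mono fun s _ => (norm_sub_rev _ _).le)
        rw [e]
        refine energy_add_le (((hψ m).stronglyMeasurable.comp_measurable
          (measurable_id.prodMk measurable_const)).sub (hsec ω)) fun s _ => by abel
      rcases le_or_le_of_le_two_mul_add hω h1 with h2 | h2
      · exact Or.inl (h2.trans (energy_mono_time _ (hS t ht) ω))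
      · exact Or.inr h2
    have h2 : 0 < ε / 2 := ENNReal.half_pos hε.ne'
    have h3 := tendsto_measure_integral hw (fun m => (hψ m).sub (hφ m)) hdiff h2
    refine tendsto_measure_of_subset (fun m ω hω => ?_) h3 (hI _ h2)
    by_contra hcon
    rw [Set.mem_union, not_or] at hcon
    have h4 : ‖J m t ω - I m t ω‖ₑ < ε / 2 := not_le.1 hcon.1
    have h5 : ‖I m t ω - N t ω‖ₑ < ε / 2 := not_le.1 hcon.2
    have h6 : ‖J m t ω - N t ω‖ₑ ≤ ‖J m t ω - I m t ω‖ₑ + ‖I m t ω - N t ω‖ₑ := by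
      have : J m t ω - N t ω = (J m t ω - I m t ω) + (I m t ω - N t ω) := by ring
      rw [this]; exact enorm_add_le _ _
    have h7 := ENNReal.add_lt_add h4 h5
    rw [ENNReal.add_halves] at h7
    exact absurd (le_trans hω h6) (not_le.2 h7)
  have hsum : Tendsto (fun m => P {ω | ε ≤ energy (fun s ω => ψ m s ω - Φ s ω) T ω} +
      ∑ t ∈ S, P {ω | ε ≤ ‖J m t ω - N t ω‖ₑ}) atTop (𝓝 0) := by
    have := (hψT ε hε).add (tendsto_finsetSum S hJ)
    simpa using this
  obtain ⟨m, hm⟩ := ((ENNReal.tendsto_nhds_zero.1 hsum) δ hδ).exists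
  exact ⟨ψ m, J m, hψ m, (measure_union_le _ _).trans
    ((add_le_add le_rfl (measure_biUnion_finset_le _ _)).trans hm)⟩

end Approximation


/-! ### Square integrability of stopped stochastic integrals -/

section L2

lemma tendsto_of_le_add_of_le_add {a c : ℕ → ℝ≥0∞} {b : ℝ≥0∞} (h1 : ∀ n, a n ≤ c n + b)
    (h2 : ∀ n, b ≤ c n + a n) (hc : Tendsto c atTop (𝓝 0)) : Tendsto a atTop (𝓝 b) := by
  have hup : Tendsto (fun n => c n + b) atTop (𝓝 b) := by
    simpa using hc.add (tendsto_const_nhds (x := b))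
  have hlow : Tendsto (fun n => b - c n) atTop (𝓝 b) := by
    have := ENNReal.Tendsto.sub (tendsto_const_nhds (x := b)) hc (Or.inr ENNReal.zero_ne_top)
    simpa using this
  exact tendsto_of_tendsto_of_tendsto_of_le_of_le hlow hup
    (fun n => tsub_le_iff_left.2 (h2 n)) h1

lemma lintegral_enorm_sq_eq {α E : Type*} [MeasurableSpace α] {μ : Measure α}
    [NormedAddCommGroup E] (f : α → E) : ∫⁻ x, ‖f x‖ₑ ^ 2 ∂μ = eLpNorm f 2 μ ^ 2 := by
  have := eLpNorm_nnreal_pow_eq_lintegral (f := f) (μ := μ) (p := 2) two_ne_zero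
  simp only [NNReal.coe_ofNat, ENNReal.rpow_ofNat, ENNReal.coe_ofNat] at this
  exact this.symm

lemma tendsto_lintegral_enorm_sq {α E : Type*} [MeasurableSpace α] {μ : Measure α}
    [NormedAddCommGroup E] {f : ℕ → α → E} {g : α → E} (hf : ∀ n, AEStronglyMeasurable (f n) μ)
    (hg : AEStronglyMeasurable g μ)
    (h : Tendsto (fun n => ∫⁻ x, ‖f n x - g x‖ₑ ^ 2 ∂μ) atTop (𝓝 0)) :
    Tendsto (fun n => ∫⁻ x, ‖f n x‖ₑ ^ 2 ∂μ) atTop (𝓝 (∫⁻ x, ‖g x‖ₑ ^ 2 ∂μ)) := by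
  have e : ∀ n, ∫⁻ x, ‖f n x - g x‖ₑ ^ 2 ∂μ = eLpNorm (f n - g) 2 μ ^ 2 := fun n =>
    lintegral_enorm_sq_eq (f n - g)
  simp_rw [lintegral_enorm_sq_eq] at *
  have h0 : Tendsto (fun n => eLpNorm (f n - g) 2 μ) atTop (𝓝 0) := by
    have := (ENNReal.continuous_rpow_const (y := (1 / 2 : ℝ))).tendsto 0 |>.comp h
    rw [ENNReal.zero_rpow_of_pos (by norm_num)] at this
    refine this.congr fun n => ?_
    simp only [Function.comp]
    rw [← ENNReal.rpow_natCast, ← ENNReal.rpow_mul]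
    norm_num
    rfl
  have h1 : Tendsto (fun n => eLpNorm (f n) 2 μ) atTop (𝓝 (eLpNorm g 2 μ)) := by
    refine tendsto_of_le_add_of_le_add (fun n => ?_) (fun n => ?_) h0
    · calc eLpNorm (f n) 2 μ = eLpNorm ((f n - g) + g) 2 μ := by rw [sub_add_cancel]
        _ ≤ _ := eLpNorm_add_le ((hf n).sub hg) hg one_le_two
    · calc eLpNorm g 2 μ = eLpNorm ((g - f n) + f n) 2 μ := by rw [sub_add_cancel]
        _ ≤ _ := eLpNorm_add_le (hg.sub (hf n)) (hf n) one_le_two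
        _ = _ := by rw [eLpNorm_sub_comm]
  exact (ENNReal.continuous_pow 2).tendsto _ |>.comp h1

lemma integral_eq_zero_of_tendsto {Ω : Type*} [MeasurableSpace Ω] {P : Measure Ω}
    [IsProbabilityMeasure P] {f : ℕ → Ω → ℝ} {g : Ω → ℝ} (hf : ∀ n, MemLp (f n) 2 P)
    (hg : AEStronglyMeasurable g P) (h0 : ∀ n, ∫ ω, f n ω ∂P = 0)
    (h : Tendsto (fun n => ∫⁻ x, ‖f n x - g x‖ₑ ^ 2 ∂P) atTop (𝓝 0)) :
    MemLp g 2 P ∧ ∫ ω, g ω ∂P = 0 := by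
  have e : ∀ n, ∫⁻ x, ‖f n x - g x‖ₑ ^ 2 ∂P = eLpNorm (f n - g) 2 P ^ 2 := fun n =>
    lintegral_enorm_sq_eq (f n - g)
  simp_rw [e] at h
  have h1 : Tendsto (fun n => eLpNorm (f n - g) 2 P) atTop (𝓝 0) := by
    have := (ENNReal.continuous_rpow_const (y := (1 / 2 : ℝ))).tendsto 0 |>.comp h
    rw [ENNReal.zero_rpow_of_pos (by norm_num)] at this
    refine this.congr fun n => ?_
    simp only [Function.comp]
    rw [← ENNReal.rpow_natCast, ← ENNReal.rpow_mul]
    norm_num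
  obtain ⟨n, hn⟩ := ((ENNReal.tendsto_nhds_zero.1 h1) 1 one_pos).exists
  have hmem : MemLp g 2 P := by
    have h2 : MemLp (f n - g) 2 P :=
      ⟨(hf n).1.sub hg, hn.trans_lt ENNReal.one_lt_top⟩
    have := (hf n).sub h2
    rwa [sub_sub_cancel] at this
  refine ⟨hmem, ?_⟩
  have h3 : Tendsto (fun n => eLpNorm (f n - g) 1 P) atTop (𝓝 0) :=
    tendsto_of_tendsto_of_tendsto_of_le_of_le tendsto_const_nhds h1 (fun _ => zero_le)
      fun n => eLpNorm_le_eLpNorm_of_exponent_le one_le_two ((hf n).1.sub hg)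
  have h4 := tendsto_integral_of_L1' g hmem.1
    (Eventually.of_forall fun n => (hf n).integrable one_le_two) h3
  simp only [h0] at h4
  exact tendsto_nhds_unique h4 tendsto_const_nhds

end L2

/-! ### Sums over the cells that begin before a given time. -/

section Cells

/-- The cells starting before `ρ` form an initial segment, so the sum telescopes up to the first
grid point not before `ρ`, at most one cell later. -/
lemma sum_cells {d : ℕ → ℝ≥0} (hd : Monotone d) {n : ℕ} {ρ : ℝ≥0} (hρ : ρ ≤ d n) {η : ℝ≥0}
    (hη : ∀ k, d (k + 1) ≤ d k + η) (g : ℝ≥0 → ℝ) :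
    ∃ l, (∑ k ∈ Finset.range n, if d k < ρ then g (d (k + 1)) - g (d k) else 0) =
      g l - g (d 0) ∧ max ρ (d 0) ≤ l ∧ l ≤ max ρ (d 0) + η := by
  rcases le_or_gt ρ (d 0) with h0 | h0
  · refine ⟨d 0, ?_, by rw [max_eq_right h0], by rw [max_eq_right h0]; exact le_self_add⟩
    rw [sub_self]
    exact Finset.sum_eq_zero fun k _ => if_neg (not_lt.2 (h0.trans (hd (Nat.zero_le k))))
  · obtain ⟨k, hk, hs⟩ := exists_cell h0 hρ
    refine ⟨d (k + 1), ?_, by rw [max_eq_left h0.le]; exact hs.2, ?_⟩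
    · have e : ∀ i, d i < ρ ↔ i < k + 1 := fun i => by
        constructor
        · intro hi
          by_contra hcon
          exact absurd hi (not_lt.2 (hs.2.trans (hd (not_lt.1 hcon))))
        · intro hi
          exact (hd (Nat.lt_succ_iff.1 hi)).trans_lt hs.1
      simp_rw [e]
      rw [← Finset.sum_filter]
      have e2 : (Finset.range n).filter (fun i => i < k + 1) = Finset.range (k + 1) := by
        ext i; simp only [Finset.mem_filter, Finset.mem_range]; omega
      rw [e2, Finset.sum_range_sub fun i => g (d i)]
    · rw [max_eq_left h0.le]
      exact (hη k).trans (by gcongr; exact hs.1.le)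

variable {H : Type*} [NormedAddCommGroup H] {Ω : Type*}

lemma energy_le_support {f : ℝ≥0 → Ω → H} {T a η : ℝ≥0} {ω : Ω} {M : ℝ≥0}
    (h : ∀ s ∈ Set.Ioc 0 T, f s ω ≠ 0 → a ≤ s ∧ s ≤ a + η ∧ ‖f s ω‖ ≤ M) :
    energy f T ω ≤ (M ^ 2 * η : ℝ≥0) := by
  calc energy f T ω ≤ ∫⁻ s in Set.Ioc (0 : ℝ) T,
        (Set.Icc (a : ℝ) (a + η)).indicator (fun _ => (M : ℝ≥0∞) ^ 2) s := by
        refine setLIntegral_mono' measurableSet_Ioc fun s hs => ?_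
        by_cases h0 : f s.toNNReal ω = 0
        · simp [h0]
        · obtain ⟨h1, h2, h3⟩ := h _ (mem_Ioc_toNNReal hs) h0
          have h1' : (a : ℝ) ≤ s := (Real.le_toNNReal_iff_coe_le hs.1.le).1 h1
          have h2' : s ≤ (a : ℝ) + η := by
            have := Real.toNNReal_le_iff_le_coe.1 h2
            simpa using this
          rw [Set.indicator_of_mem (show s ∈ Set.Icc (a : ℝ) (a + η) from ⟨h1', h2'⟩)]
          have h4 : ‖f s.toNNReal ω‖₊ ≤ M := h3
          gcongr
          exact_mod_cast h4
    _ ≤ ∫⁻ s, (Set.Icc (a : ℝ) (a + η)).indicator (fun _ => (M : ℝ≥0∞) ^ 2) s :=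
        setLIntegral_le_lintegral _ _
    _ = (M ^ 2 * η : ℝ≥0) := by
        rw [lintegral_indicator_const measurableSet_Icc, Real.volume_Icc, add_sub_cancel_left,
          ENNReal.ofReal_coe_nnreal]
        push_cast; rfl

end Cells


/-! ### The Itô isometry for stopped stochastic integrals -/

section StoppedIntegral

variable {H : Type*} [NormedAddCommGroup H] [InnerProductSpace ℝ H]
variable {Ω : Type*} {mΩ : MeasurableSpace Ω} {P : Measure Ω}
variable {𝔽 : Filtration ℝ≥0 mΩ} {w : ℝ≥0 → H → Ω → ℝ} {W : TimeL2 H →L[ℝ] Lp ℝ 2 P}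

/-- The integrand `Φ` restricted to the stochastic interval `(u, ρ)` and the event `B`. -/
def stoppedIntegrand (Φ : ℝ≥0 → Ω → H) (u : ℝ≥0) (ρ : Ω → ℝ≥0) (B : Set Ω) (s : ℝ≥0) (ω : Ω) : H :=
  {ω | ω ∈ B ∧ u < s ∧ s < ρ ω}.indicator (fun ω => Φ s ω) ω

lemma stronglyMeasurable_stoppedIntegrand {Φ : ℝ≥0 → Ω → H}
    (hΦ : StronglyMeasurable fun p : ℝ≥0 × Ω => Φ p.1 p.2) (u : ℝ≥0) {ρ : Ω → ℝ≥0}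
    (hρ : Measurable ρ) {B : Set Ω} (hB : MeasurableSet B) :
    StronglyMeasurable fun p : ℝ≥0 × Ω => stoppedIntegrand Φ u ρ B p.1 p.2 := by
  have e : (fun p : ℝ≥0 × Ω => stoppedIntegrand Φ u ρ B p.1 p.2) =
      {p : ℝ≥0 × Ω | p.2 ∈ B ∧ u < p.1 ∧ p.1 < ρ p.2}.indicator fun p => Φ p.1 p.2 := by
    ext p
    by_cases h : p.2 ∈ B ∧ u < p.1 ∧ p.1 < ρ p.2 <;>
      simp only [stoppedIntegrand, Set.indicator, Set.mem_ofPred_eq, h]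
  rw [e]
  have h1 : MeasurableSet {p : ℝ≥0 × Ω | u < p.1} := measurableSet_lt measurable_const measurable_fst
  have h2 : MeasurableSet {p : ℝ≥0 × Ω | p.1 < ρ p.2} :=
    measurableSet_lt measurable_fst (hρ.comp measurable_snd)
  exact hΦ.indicator ((measurable_snd hB).inter (h1.inter h2))

lemma norm_stoppedIntegrand_le {Φ : ℝ≥0 → Ω → H} {u : ℝ≥0} {ρ : Ω → ℝ≥0} {B : Set Ω} {C : ℝ≥0}
    (hC : ∀ ω s, s < ρ ω → ‖Φ s ω‖ ≤ C) (s : ℝ≥0) (ω : Ω) :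
    ‖stoppedIntegrand Φ u ρ B s ω‖ ≤ C := by
  by_cases h : ω ∈ B ∧ u < s ∧ s < ρ ω
  · simp only [stoppedIntegrand, Set.indicator, Set.mem_ofPred_eq, h, and_self, if_true]
    exact hC ω s h.2.2
  · simp only [stoppedIntegrand, Set.indicator, Set.mem_ofPred_eq, h, if_false, norm_zero]
    exact C.coe_nonneg

/-- The uniform grid of `[u, v]` with `n + 1` cells. -/
def uniformGrid (u v : ℝ≥0) (n : ℕ) (k : ℕ) : ℝ≥0 := u + k * ((v - u) / (n + 1))

lemma uniformGrid_zero (u v : ℝ≥0) (n : ℕ) : uniformGrid u v n 0 = u := by simp [uniformGrid]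

lemma uniformGrid_last {u v : ℝ≥0} (huv : u ≤ v) (n : ℕ) : uniformGrid u v n (n + 1) = v := by
  simp only [uniformGrid]
  rw [show ((n + 1 : ℕ) : ℝ≥0) = n + 1 by push_cast; rfl, mul_div_cancel₀ _ (by positivity),
    add_tsub_cancel_of_le huv]

lemma uniformGrid_mono (u v : ℝ≥0) (n : ℕ) : Monotone (uniformGrid u v n) := fun a b hab => by
  simp only [uniformGrid]; gcongr

lemma uniformGrid_succ (u v : ℝ≥0) (n k : ℕ) :
    uniformGrid u v n (k + 1) = uniformGrid u v n k + (v - u) / (n + 1) := by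
  simp only [uniformGrid]; push_cast; ring

/-- There are two errors: replacing Φ by ψ, and the part of the last cell beyond `ρ`, whose length
is at most one mesh width. -/
lemma energy_gridRestrict_sub_le {Φ : ℝ≥0 → Ω → H} {ψ : ℝ≥0 → Ω → H} {u v : ℝ≥0} (huv : u ≤ v)
    {ρ : Ω → ℝ≥0} {B : Set Ω} (hΦ : StronglyMeasurable fun p : ℝ≥0 × Ω => Φ p.1 p.2)
    (hψ : StronglyMeasurable fun p : ℝ≥0 × Ω => ψ p.1 p.2) {ω : Ω} {M : ℝ≥0}
    (hM : ∀ s ≤ v, ‖Φ s ω‖ ≤ M) (n : ℕ) :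
    energy (fun s ω => gridRestrict (uniformGrid u v n)
        (fun k => B ∩ {ω | uniformGrid u v n k < ρ ω}) (n + 1) ψ s ω -
        stoppedIntegrand Φ u ρ B s ω) v ω ≤
      2 * energy (fun s ω => ψ s ω - Φ s ω) v ω +
        2 * (M ^ 2 * ((v - u) / (n + 1)) : ℝ≥0) := by
  have hsec : ∀ {f : ℝ≥0 → Ω → H}, (StronglyMeasurable fun p : ℝ≥0 × Ω => f p.1 p.2) →
      StronglyMeasurable fun s => f s ω := fun hf =>
    hf.comp_measurable (measurable_id.prodMk measurable_const)
  set d := uniformGrid u v n with hd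
  set E : ℕ → Set Ω := fun k => B ∩ {ω | d k < ρ ω} with hE
  have hdm : Monotone d := uniformGrid_mono u v n
  have hd0 : d 0 = u := uniformGrid_zero u v n
  have hdn : d (n + 1) = v := uniformGrid_last huv n
  have hS : MeasurableSet {s : ℝ≥0 | ∃ k < n + 1, s ∈ Set.Ioc (d k) (d (k + 1)) ∧ ω ∈ E k} := by
    have e : {s : ℝ≥0 | ∃ k < n + 1, s ∈ Set.Ioc (d k) (d (k + 1)) ∧ ω ∈ E k} =
        ⋃ k ∈ {k | k < n + 1 ∧ ω ∈ E k}, Set.Ioc (d k) (d (k + 1)) := by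
      ext s; simp only [Set.mem_ofPred_eq, Set.mem_iUnion, exists_prop]
      constructor
      · rintro ⟨k, h1, h2, h3⟩; exact ⟨k, ⟨h1, h3⟩, h2⟩
      · rintro ⟨k, ⟨h1, h3⟩, h2⟩; exact ⟨k, h1, h2, h3⟩
    rw [e]
    exact MeasurableSet.biUnion (Set.to_countable _) fun _ _ => measurableSet_Ioc
  set S := {s : ℝ≥0 | ∃ k < n + 1, s ∈ Set.Ioc (d k) (d (k + 1)) ∧ ω ∈ E k} with hSdef
  have hgrid : ∀ (f : ℝ≥0 → Ω → H) (s : ℝ≥0), s ≤ v →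
      gridRestrict d E (n + 1) f s ω = S.indicator (fun s => f s ω) s := by
    intro f s hs
    rcases le_or_gt s u with hsu | hsu
    · rw [gridRestrict_of_le hdm (by rwa [hd0]), Set.indicator_of_notMem]
      rintro ⟨k, -, hk, -⟩
      exact absurd hk.1 (not_lt.2 (hsu.trans (by rw [← hd0]; exact hdm (Nat.zero_le k))))
    · obtain ⟨k, hk, hsk⟩ := exists_cell (d := d) (n := n + 1) (s := s) (by rwa [hd0])
        (by rwa [hdn])
      rw [gridRestrict_of_mem hdm hk hsk]
      by_cases hω : ω ∈ E k
      · rw [Set.indicator_of_mem hω, Set.indicator_of_mem (show s ∈ S from ⟨k, hk, hsk, hω⟩)]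
      · rw [Set.indicator_of_notMem hω, Set.indicator_of_notMem]
        rintro ⟨i, hi, hsi, hωi⟩
        have : i = k := by
          by_contra hne
          rcases lt_or_gt_of_ne hne with h | h
          · exact absurd hsk.1 (not_lt.2 (hsi.2.trans (hdm h)))
          · exact absurd hsi.1 (not_lt.2 (hsk.2.trans (hdm h)))
        exact hω (this ▸ hωi)
  refine (energy_add_le (f := fun s _ => S.indicator (fun s => ψ s ω - Φ s ω) s)
    (g := fun s ω' => S.indicator (fun s => Φ s ω) s - stoppedIntegrand Φ u ρ B s ω)
    (((hsec hψ).sub (hsec hΦ)).indicator hS) fun s hs => ?_).trans (add_le_add ?_ ?_)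
  · rw [hgrid ψ s hs.2]
    by_cases h : s ∈ S <;> simp [h]
  · gcongr
    refine energy_mono fun s _ => ?_
    by_cases h : s ∈ S <;> simp [h]
  · gcongr
    refine energy_le_support (a := ρ ω) fun s hs hne => ?_
    by_cases h : s ∈ S
    · obtain ⟨k, hk, hsk, hωB, hωρ⟩ := h
      have hus : u < s := lt_of_le_of_lt (by rw [← hd0]; exact hdm (Nat.zero_le k)) hsk.1
      have hω : ¬(s < ρ ω) := by
        intro hlt
        refine hne ?_
        rw [Set.indicator_of_mem (show s ∈ S from ⟨k, hk, hsk, hωB, hωρ⟩), stoppedIntegrand,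
          Set.indicator_of_mem (show ω ∈ {ω | ω ∈ B ∧ u < s ∧ s < ρ ω} from ⟨hωB, hus, hlt⟩),
          sub_self]
      refine ⟨not_lt.1 hω, ?_, ?_⟩
      · refine hsk.2.trans ?_
        rw [hd, uniformGrid_succ]
        gcongr
        exact le_of_lt hωρ
      · rw [Set.indicator_of_mem (show s ∈ S from ⟨k, hk, hsk, hωB, hωρ⟩), stoppedIntegrand,
          Set.indicator_of_notMem, sub_zero]
        · exact hM s hs.2
        · rintro ⟨-, -, h3⟩; exact hω h3
    · exfalso
      refine hne ?_
      rw [Set.indicator_of_notMem h, stoppedIntegrand, Set.indicator_of_notMem, sub_zero]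
      rintro ⟨h1, h2, h3⟩
      obtain ⟨k, hk, hsk⟩ := exists_cell (d := d) (n := n + 1) (s := s) (by rwa [hd0])
        (by rw [hdn]; exact hs.2)
      exact h ⟨k, hk, hsk, h1, hsk.1.trans h3⟩

/-- The sum telescopes by `sum_cells`; each of the n + 1 cells contributes an error ε at either end.
-/
lemma gridIntegral_sub_le {J N : ℝ≥0 → Ω → ℝ} {u v : ℝ≥0} (huv : u ≤ v) {ρ : Ω → ℝ≥0} {B : Set Ω}
    {ω : Ω} (hρ : ρ ω ≤ v) (n : ℕ) {ε : ℝ} (hε : 0 ≤ ε)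
    (hJ : ∀ k ≤ n + 1, |J (uniformGrid u v n k) ω - N (uniformGrid u v n k) ω| ≤ ε) :
    ∃ l, max (ρ ω) u ≤ l ∧ l ≤ max (ρ ω) u + (v - u) / (n + 1) ∧
      |gridIntegral (uniformGrid u v n) (fun k => B ∩ {ω | uniformGrid u v n k < ρ ω}) (n + 1) J v ω
        - B.indicator (fun ω => N l ω - N u ω) ω| ≤ (n + 1) * (2 * ε) := by
  set d := uniformGrid u v n with hd
  have hdm : Monotone d := uniformGrid_mono u v n
  have hd0 : d 0 = u := uniformGrid_zero u v n
  have hdn : d (n + 1) = v := uniformGrid_last huv n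
  obtain ⟨l, hl1, hl2, hl3⟩ := sum_cells hdm (n := n + 1) (ρ := ρ ω) (by rwa [hdn])
    (η := (v - u) / (n + 1)) (fun k => (uniformGrid_succ u v n k).le) fun t => N t ω
  rw [hd0] at hl1 hl2 hl3
  refine ⟨l, hl2, hl3, ?_⟩
  by_cases hω : ω ∈ B
  · rw [Set.indicator_of_mem hω, ← hl1, gridIntegral, ← Finset.sum_sub_distrib]
    calc _ ≤ ∑ _k ∈ Finset.range (n + 1), 2 * ε := by
          refine (Finset.abs_sum_le_sum_abs _ _).trans (Finset.sum_le_sum fun k hk => ?_)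
          have hk := Finset.mem_range.1 hk
          by_cases hlt : d k < ρ ω
          · rw [Set.indicator_of_mem (show ω ∈ B ∩ {ω | d k < ρ ω} from ⟨hω, hlt⟩), if_pos hlt,
              min_eq_left (by rw [← hdn]; exact hdm hk), min_eq_left (by rw [← hdn]; exact hdm hk.le)]
            have h1 := hJ (k + 1) hk
            have h2 := hJ k hk.le
            rw [abs_le] at h1 h2 ⊢
            constructor <;> linarith [h1.1, h1.2, h2.1, h2.2]
          · rw [Set.indicator_of_notMem (fun h => hlt h.2), if_neg hlt]
            simpa using hε
      _ = (n + 1) * (2 * ε) := by simp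
  · rw [Set.indicator_of_notMem hω, gridIntegral, Finset.sum_eq_zero]
    · simp only [sub_zero, abs_zero]; positivity
    · exact fun k _ => Set.indicator_of_notMem (fun h => hω h.1) _

/-- The stopped stochastic integral is a square integrable martingale whose quadratic variation is
the energy of the integrand. -/
theorem stopped_integral_isometry [IsProbabilityMeasure P] (hw : IsWienerVersion 𝔽 P w)
    (hwW : ∀ t h, w t h =ᵐ[P] wienerAt W t h) {Φ : ℝ≥0 → Ω → H}
    (hΦ : StronglyMeasurable fun p : ℝ≥0 × Ω => Φ p.1 p.2) {N : ℝ≥0 → Ω → ℝ}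
    (hN : ∀ t, IsStochasticIntegral 𝔽 W Φ t (N t)) (hNc : ∀ ω, Continuous fun t => N t ω)
    {u v : ℝ≥0} (huv : u ≤ v) {ρ : Ω → ℝ≥0} (hρ : ∀ s, MeasurableSet[𝔽 s] {ω | s < ρ ω})
    (hρv : ∀ ω, ρ ω ≤ v) {C : ℝ≥0} (hC : ∀ ω s, s < ρ ω → ‖Φ s ω‖ ≤ C)
    (hM : ∀ ω, ∃ M : ℝ≥0, ∀ s ≤ v, ‖Φ s ω‖ ≤ M) {B : Set Ω} (hB : MeasurableSet[𝔽 u] B) :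
    MemLp (B.indicator fun ω => N (max (ρ ω) u) ω - N u ω) 2 P ∧
    ∫ ω in B, (N (max (ρ ω) u) ω - N u ω) ∂P = 0 ∧
    ∫⁻ ω, ‖B.indicator (fun ω => N (max (ρ ω) u) ω - N u ω) ω‖ₑ ^ 2 ∂P =
      ∫⁻ ω, energy (stoppedIntegrand Φ u ρ B) v ω ∂P := by
  have hBm := 𝔽.le u B hB
  have hρm : Measurable ρ := measurable_of_Ioi fun s => 𝔽.le s _ (hρ s)
  set Y : Ω → ℝ := B.indicator fun ω => N (max (ρ ω) u) ω - N u ω with hY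
  set Ψ := stoppedIntegrand Φ u ρ B with hΨ
  have hΨm : StronglyMeasurable fun p : ℝ≥0 × Ω => Ψ p.1 p.2 :=
    stronglyMeasurable_stoppedIntegrand hΦ u hρm hBm
  have hsec : ∀ {f : ℝ≥0 → Ω → H} (_ : StronglyMeasurable fun p : ℝ≥0 × Ω => f p.1 p.2) (ω : Ω),
      StronglyMeasurable fun s => f s ω := fun hf _ =>
    hf.comp_measurable (measurable_id.prodMk measurable_const)
  have hΨC : ∀ ω, energy Ψ v ω ≤ (C ^ 2 * v : ℝ≥0) := fun ω =>
    energy_le_const fun s _ => norm_stoppedIntegrand_le hC s ω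
  -- The factor 1/(n + 1) compensates for adding the errors of n + 1 cells. The exceptional
  -- probabilities 2⁻ⁿ are summable, so Borel–Cantelli gives good behaviour for all large n.
  set ε : ℕ → ℝ≥0 := fun n => (1 / 2) ^ n / (n + 1) with hε
  have hεpos : ∀ n, 0 < ε n := fun n => by simp only [hε]; positivity
  have hεle : ∀ n, ε n ≤ (1 / 2) ^ n := fun n => div_le_self (zero_le) (by simp)
  choose ψ J hψ hbad using fun n : ℕ => exists_elementary_approx hw hwW hΦ hN v
    ((Finset.range (n + 2)).image (uniformGrid u v n)) (fun t ht => by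
      obtain ⟨k, hk, rfl⟩ := Finset.mem_image.1 ht
      exact (uniformGrid_mono u v n (Nat.lt_succ_iff.1 (Finset.mem_range.1 hk))).trans
        (uniformGrid_last huv n).le)
    (ε := ε n) (by exact_mod_cast hεpos n) (δ := (1 / 2 : ℝ≥0∞) ^ n)
    (ENNReal.pow_pos (by simp) n)
  have hgood := ae_eventually_notMem (μ := P) (ne_top_of_le_ne_top
    (by rw [one_div, ENNReal.tsum_geometric]; simp) (ENNReal.tsum_le_tsum hbad))
  set d : ℕ → ℕ → ℝ≥0 := uniformGrid u v with hd
  set E : ℕ → ℕ → Set Ω := fun n k => B ∩ {ω | d n k < ρ ω} with hE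
  have hEm : ∀ n k, MeasurableSet[𝔽 (d n k)] (E n k) := fun n k =>
    (𝔽.mono (by rw [hd]; simp only [uniformGrid]; exact le_self_add) B hB).inter (hρ _)
  have hgr : ∀ n, IsElementary 𝔽 w (gridRestrict (d n) (E n) (n + 1) (ψ n))
      (gridIntegral (d n) (E n) (n + 1) (J n)) := fun n =>
    (hψ n).grid (uniformGrid_mono u v n) (hEm n) (n + 1)
  -- The limiting energy is at most C² v, so truncation at this level is eventually inactive for
  -- almost every ω. It still supplies the uniform bound needed for dominated convergence.
  set K : ℝ≥0 := 2 * (C ^ 2 * v) + 2 with hK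
  choose Ψs J' hel hbound heq using fun n => (hgr n).exists_truncation v (K := K) (by positivity)
  -- pointwise convergence
  have hpt : ∀ᵐ ω ∂P, Tendsto (fun n => energy (fun s ω => Ψs n s ω - Ψ s ω) v ω) atTop (𝓝 0) ∧
      Tendsto (fun n => J' n v ω) atTop (𝓝 (Y ω)) := by
    filter_upwards [hgood] with ω hω
    obtain ⟨M, hMω⟩ := hM ω
    have hgood1 : ∀ᶠ n in atTop, energy (fun s ω => ψ n s ω - Φ s ω) v ω ≤ ε n ∧
        ∀ k ≤ n + 1, |J n (d n k) ω - N (d n k) ω| ≤ ε n := by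
      filter_upwards [hω] with n hn
      rw [Set.mem_union, not_or] at hn
      refine ⟨(not_le.1 hn.1).le, fun k hk => ?_⟩
      have h2 := hn.2
      simp only [Set.mem_iUnion, not_exists] at h2
      have h3 : ‖J n (d n k) ω - N (d n k) ω‖ₑ < ε n := not_le.1 (h2 (d n k)
        (Finset.mem_image_of_mem _ (Finset.mem_range.2 (Nat.lt_succ_of_le hk))))
      rw [enorm_eq_nnnorm] at h3
      have h4 : ‖J n (d n k) ω - N (d n k) ω‖₊ < ε n := by exact_mod_cast h3
      exact (NNReal.coe_lt_coe.2 h4).le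
    have hmesh : Tendsto (fun n : ℕ => (v - u) / ((n : ℝ≥0) + 1)) atTop (𝓝 0) := by
      have := (NNReal.tendsto_coe).1
        ((tendsto_const_div_atTop_nhds_zero_nat ((v - u : ℝ≥0) : ℝ)).comp (tendsto_add_atTop_nat 1)
          |>.congr (fun n => by
            simp only [Function.comp]
            push_cast
            rfl) : Tendsto (fun n : ℕ => (((v - u) / ((n : ℝ≥0) + 1) : ℝ≥0) : ℝ)) atTop
              (𝓝 ((0 : ℝ≥0) : ℝ)))
      exact this
    have hpow : Tendsto (fun n : ℕ => ((1 / 2 : ℝ≥0)) ^ n) atTop (𝓝 0) :=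
      NNReal.tendsto_pow_atTop_nhds_zero_of_lt_one (by
        rw [div_lt_one two_pos]; exact one_lt_two)
    have hε0 : Tendsto ε atTop (𝓝 0) :=
      tendsto_of_tendsto_of_tendsto_of_le_of_le tendsto_const_nhds hpow (fun _ => zero_le) hεle
    set a : ℕ → ℝ≥0 := fun n => 2 * ε n + 2 * (M ^ 2 * ((v - u) / (n + 1))) with ha
    have ha0 : Tendsto a atTop (𝓝 0) := by
      simpa using (hε0.const_mul 2).add ((hmesh.const_mul (M ^ 2)).const_mul 2)
    have hgr0 : ∀ᶠ n in atTop, energy (fun s ω => gridRestrict (d n) (E n) (n + 1) (ψ n) s ω -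
        Ψ s ω) v ω ≤ a n := by
      filter_upwards [hgood1] with n hn
      refine (energy_gridRestrict_sub_le huv hΦ (hψ n).stronglyMeasurable hMω n).trans ?_
      rw [ha]
      push_cast
      gcongr
      exact hn.1
    have hactive : ∀ᶠ n in atTop, energy (gridRestrict (d n) (E n) (n + 1) (ψ n)) v ω ≤ K := by
      filter_upwards [hgr0, ha0.eventually (ge_mem_nhds one_pos)] with n h1 h2
      have h3 : energy (gridRestrict (d n) (E n) (n + 1) (ψ n)) v ω ≤
          2 * energy (fun s ω => gridRestrict (d n) (E n) (n + 1) (ψ n) s ω - Ψ s ω) v ω +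
          2 * energy Ψ v ω :=
        energy_add_le ((hsec (hgr n).stronglyMeasurable ω).sub (hsec hΨm ω)) fun s _ => by abel
      calc _ ≤ _ := h3
        _ ≤ 2 * (a n : ℝ≥0∞) + 2 * ((C ^ 2 * v : ℝ≥0) : ℝ≥0∞) := by
            gcongr
            exact hΨC ω
        _ ≤ K := by
            rw [hK]
            have : 2 * a n + 2 * (C ^ 2 * v) ≤ 2 * (C ^ 2 * v) + 2 := by
              rw [add_comm]; gcongr
              calc 2 * a n ≤ 2 * 1 := by gcongr
                _ = 2 := mul_one 2
            exact_mod_cast this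
    constructor
    · have ha0' : Tendsto (fun n => (a n : ℝ≥0∞)) atTop (𝓝 0) := by
        rw [← ENNReal.coe_zero]
        exact ENNReal.tendsto_coe.2 ha0
      refine tendsto_of_tendsto_of_tendsto_of_le_of_le' tendsto_const_nhds ha0'
        (Eventually.of_forall fun _ => zero_le) ?_
      filter_upwards [hgr0, hactive] with n h1 h2
      rw [energy_congr (g := fun s ω => gridRestrict (d n) (E n) (n + 1) (ψ n) s ω - Ψ s ω)
        fun s hs => by rw [(heq n ω h2).1 s hs]]
      exact h1
    · have hl : ∀ n, ∃ l, (∀ k ≤ n + 1, |J n (d n k) ω - N (d n k) ω| ≤ ε n) →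
          max (ρ ω) u ≤ l ∧ l ≤ max (ρ ω) u + (v - u) / (n + 1) ∧
          |gridIntegral (d n) (E n) (n + 1) (J n) v ω - B.indicator (fun ω => N l ω - N u ω) ω| ≤
            (n + 1) * (2 * ε n) := fun n => by
        by_cases hJ : ∀ k ≤ n + 1, |J n (d n k) ω - N (d n k) ω| ≤ ε n
        · obtain ⟨l, h⟩ := gridIntegral_sub_le (B := B) huv (hρv ω) n (ε n).coe_nonneg hJ
          exact ⟨l, fun _ => h⟩
        · exact ⟨0, fun h => absurd h hJ⟩
      choose l hl using hl
      have hl0 : Tendsto l atTop (𝓝 (max (ρ ω) u)) := by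
        have hup : Tendsto (fun n : ℕ => max (ρ ω) u + (v - u) / ((n : ℝ≥0) + 1)) atTop
            (𝓝 (max (ρ ω) u)) := by simpa using hmesh.const_add (max (ρ ω) u)
        refine tendsto_of_tendsto_of_tendsto_of_le_of_le' tendsto_const_nhds hup ?_ ?_
        · filter_upwards [hgood1] with n hn using (hl n hn.2).1
        · filter_upwards [hgood1] with n hn using (hl n hn.2).2.1
      have hY1 : Tendsto (fun n => B.indicator (fun ω => N (l n) ω - N u ω) ω) atTop
          (𝓝 (Y ω)) := by
        by_cases hωB : ω ∈ B
        · simp only [hY, Set.indicator_of_mem hωB]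
          exact (((hNc ω).tendsto _).comp hl0).sub_const _
        · simp only [hY, Set.indicator_of_notMem hωB]
          exact tendsto_const_nhds
      have herr : Tendsto (fun n => J' n v ω - B.indicator (fun ω => N (l n) ω - N u ω) ω) atTop
          (𝓝 0) := by
        have hpow2 : Tendsto (fun n : ℕ => 2 * (1 / 2 : ℝ) ^ n) atTop (𝓝 0) := by
          simpa using (tendsto_pow_atTop_nhds_zero_of_lt_one (r := (1 / 2 : ℝ)) (by norm_num)
            (by norm_num)).const_mul 2
        refine squeeze_zero_norm' ?_ hpow2
        filter_upwards [hgood1, hactive] with n h1 h2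
        rw [(heq n ω h2).2, Real.norm_eq_abs]
        refine (hl n h1.2).2.2.trans (le_of_eq ?_)
        simp only [hε]
        push_cast
        field_simp
      simpa using herr.add hY1
  -- square integrable limits
  set D : ℕ → ℝ≥0∞ := fun n => ∫⁻ ω, energy (fun s ω => Ψs n s ω - Ψ s ω) v ω ∂P with hD
  have hD0 : Tendsto D atTop (𝓝 0) := by
    have := tendsto_lintegral_of_dominated_convergence
      (F := fun n ω => energy (fun s ω => Ψs n s ω - Ψ s ω) v ω) (f := fun _ => 0) (μ := P)
      (fun _ => ((2 * (2 * K) + 2 * (C ^ 2 * v) : ℝ≥0) : ℝ≥0∞))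
      (fun n => measurable_energy ((hel n).stronglyMeasurable.sub hΨm) v)
      (fun n => Eventually.of_forall fun ω => ?_)
      (by rw [lintegral_const, measure_univ, mul_one]; exact ENNReal.coe_ne_top) (hpt.mono fun ω h => h.1)
    · simpa using this
    · refine (energy_add_le (f := Ψs n) (g := fun s ω => - Ψ s ω)
        (hsec (hel n).stronglyMeasurable ω) fun s _ => sub_eq_add_neg _ _).trans ?_
      have e : energy (fun s ω => - Ψ s ω) v ω ≤ (C ^ 2 * v : ℝ≥0) :=
        (energy_mono fun s _ => (norm_neg _).le).trans (hΨC ω)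
      have e2 := hbound n ω
      push_cast at e e2 ⊢
      gcongr
  have hJm : ∀ n, Measurable (J' n v) := fun n => (hel n).measurable_integral hw v
  have hYm : AEStronglyMeasurable Y P := aestronglyMeasurable_of_tendsto_ae atTop
    (fun n => (hJm n).aestronglyMeasurable) (hpt.mono fun ω h => h.2)
  have hdiff : ∀ n, ∫⁻ ω, ‖J' n v ω - Y ω‖ₑ ^ 2 ∂P ≤ 2 * D n := by
    intro n
    have h1 : ∀ k, ∫⁻ ω, ‖J' n v ω - J' k v ω‖ₑ ^ 2 ∂P ≤ 2 * D n + 2 * D k := by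
      intro k
      have e1 := ((hel n).sub (hel k)).lintegral_sq hw v
      rw [e1, hD, ← lintegral_const_mul _ (measurable_energy ((hel n).stronglyMeasurable.sub hΨm) v),
        ← lintegral_const_mul _ (measurable_energy ((hel k).stronglyMeasurable.sub hΨm) v),
        ← lintegral_add_left ((measurable_energy
          ((hel n).stronglyMeasurable.sub hΨm) v).const_mul 2)]
      refine lintegral_mono fun ω => ?_
      have e2 : energy (fun s ω => Ψs k s ω - Ψ s ω) v ω =
          energy (fun s ω => Ψ s ω - Ψs k s ω) v ω :=
        le_antisymm (energy_mono fun s _ => (norm_sub_rev _ _).le)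
          (energy_mono fun s _ => (norm_sub_rev _ _).le)
      rw [e2]
      exact energy_add_le ((hsec (hel n).stronglyMeasurable ω).sub (hsec hΨm ω))
        fun s _ => by abel
    have h2 : Tendsto (fun k => 2 * D n + 2 * D k) atTop (𝓝 (2 * D n)) := by
      have := (ENNReal.Tendsto.const_mul (a := 2) hD0 (Or.inr (by simp))).const_add (2 * D n)
      simpa using this
    -- The isometry for differences shows that the truncated integrals are Cauchy in mean square;
    -- Fatou's lemma passes to their pointwise limit.
    calc ∫⁻ ω, ‖J' n v ω - Y ω‖ₑ ^ 2 ∂P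
        ≤ ∫⁻ ω, liminf (fun k => ‖J' n v ω - J' k v ω‖ₑ ^ 2) atTop ∂P := by
          refine lintegral_mono_ae ?_
          filter_upwards [hpt] with ω h
          refine le_of_eq (Tendsto.liminf_eq ?_).symm
          have h3 : Tendsto (fun k => J' n v ω - J' k v ω) atTop (𝓝 (J' n v ω - Y ω)) :=
            h.2.const_sub _
          exact (ENNReal.continuous_pow 2).tendsto _ |>.comp h3.enorm
      _ ≤ liminf (fun k => ∫⁻ ω, ‖J' n v ω - J' k v ω‖ₑ ^ 2 ∂P) atTop :=
          lintegral_liminf_le fun k => ((hJm n).sub (hJm k)).enorm.pow_const 2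
      _ ≤ liminf (fun k => 2 * D n + 2 * D k) atTop :=
          liminf_le_liminf (Eventually.of_forall h1)
      _ = 2 * D n := h2.liminf_eq
  have hconv : Tendsto (fun n => ∫⁻ ω, ‖J' n v ω - Y ω‖ₑ ^ 2 ∂P) atTop (𝓝 0) := by
    have h2 : Tendsto (fun n => 2 * D n) atTop (𝓝 0) := by
      simpa using ENNReal.Tendsto.const_mul (a := 2) hD0 (Or.inr (by simp))
    exact tendsto_of_tendsto_of_tendsto_of_le_of_le tendsto_const_nhds h2 (fun _ => zero_le) hdiff
  obtain ⟨hYL, hY0⟩ := integral_eq_zero_of_tendsto (fun n => (hel n).memLp_integral hw v) hYm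
    (fun n => (hel n).integral_eq_zero hw v) hconv
  refine ⟨hYL, by rw [← integral_indicator hBm]; exact hY0, ?_⟩
  have h1 := tendsto_lintegral_enorm_sq (fun n => (hJm n).aestronglyMeasurable) hYm hconv
  have h2 : Tendsto (fun n => ∫⁻ ω, energy (Ψs n) v ω ∂P) atTop
      (𝓝 (∫⁻ ω, energy Ψ v ω ∂P)) := by
    refine tendsto_lintegral_of_dominated_convergence (fun _ => ((2 * K : ℝ≥0) : ℝ≥0∞))
      (fun n => (hel n).measurable_energy v) (fun n => Eventually.of_forall (hbound n))
      (by rw [lintegral_const, measure_univ, mul_one]; exact ENNReal.coe_ne_top) ?_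
    filter_upwards [hpt] with ω h
    exact tendsto_lintegral_enorm_sq
      (fun n => ((hsec (hel n).stronglyMeasurable ω).comp_measurable
        measurable_real_toNNReal).aestronglyMeasurable)
      ((hsec hΨm ω).comp_measurable measurable_real_toNNReal).aestronglyMeasurable h.1
  simp_rw [fun n => (hel n).lintegral_sq hw v] at h1
  exact tendsto_nhds_unique h1 h2

end StoppedIntegral


/-! ### Laws of weak solutions solve the local martingale problem -/

section WeakSolution

variable {E V H : Type*}
  [NormedAddCommGroup E] [NormedSpace ℝ E] [CompleteSpace E]
  [TopologicalSpace.SeparableSpace E] [MeasurableSpace E] [BorelSpace E]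
  [NormedAddCommGroup V] [NormedSpace ℝ V]
  [NormedAddCommGroup H] [InnerProductSpace ℝ H] [CompleteSpace H]
  [TopologicalSpace.SeparableSpace H]
  {j : E →L[ℝ] V} {A : V →ₗ.[ℝ] V} {F : E → V} {G : E → H →L[ℝ] V}
  {Ω : Type*} {mΩ : MeasurableSpace Ω} {P : Measure Ω} {𝔽 : Filtration ℝ≥0 mΩ}
  {W : TimeL2 H →L[ℝ] Lp ℝ 2 P} {X : Ω → C(ℝ≥0, E)}

lemma IsStochasticIntegral.congr {Φ : ℝ≥0 → Ω → H} {t : ℝ≥0} {ξ ξ' : Ω → ℝ}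
    (h : IsStochasticIntegral 𝔽 W Φ t ξ) (he : ξ =ᵐ[P] ξ') : IsStochasticIntegral 𝔽 W Φ t ξ' := by
  obtain ⟨Φs, h1, h2⟩ := h
  exact ⟨Φs, h1, h2.congr_right he⟩

/-- For s strictly between u and v, being before the exit means that the running norm is below `r`.
Only the end point v may differ, and it is a null set. -/
lemma energy_stoppedIntegrand (hyp : StandingAssumptions j A F G) (v' : V →L[ℝ] ℝ) (r : ℝ)
    {u v : ℝ≥0} (huv : u ≤ v) (B : Set Ω) (ω : Ω) :
    energy (stoppedIntegrand (fun s ω => hilbertAdjoint (G (X ω s)) v') u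
      (fun ω => exitMin r v (X ω)) B) v ω =
    ENNReal.ofReal (B.indicator
      (fun ω => ∫ w in (u : ℝ)..v, killedFun r (covFun G v' v') w (X ω)) ω) := by
  have huv' : (u : ℝ) ≤ v := huv
  by_cases hω : ω ∈ B
  · rw [Set.indicator_of_mem hω, intervalIntegral.integral_of_le huv',
      ofReal_integral_eq_lintegral_ofReal]
    · unfold energy
      rw [← Set.Ioc_union_Ioc_eq_Ioc u.coe_nonneg huv', lintegral_union measurableSet_Ioc
        (Set.Ioc_disjoint_Ioc_of_le le_rfl)]
      have e0 : ∀ s ∈ Set.Ioc (0 : ℝ) u, ‖stoppedIntegrand (fun s ω => hilbertAdjoint (G (X ω s)) v')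
          u (fun ω => exitMin r v (X ω)) B s.toNNReal ω‖ₑ ^ 2 = 0 := by
        intro s hs
        rw [stoppedIntegrand, Set.indicator_of_notMem]
        · simp
        · rintro ⟨-, h, -⟩
          exact absurd (mem_Ioc_toNNReal hs).2 (not_le.2 h)
      rw [setLIntegral_congr_fun measurableSet_Ioc e0, lintegral_zero, zero_add]
      refine lintegral_congr_ae ?_
      have hne : ∀ᵐ s : ℝ ∂(volume.restrict (Set.Ioc (u : ℝ) v)), s ≠ v :=
        ae_restrict_of_ae (by simp [ae_iff, measure_singleton])
      filter_upwards [ae_restrict_mem measurableSet_Ioc, hne] with s hs hsv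
      have hs0 : 0 ≤ s := u.coe_nonneg.trans hs.1.le
      have hus : u < s.toNNReal := Real.lt_toNNReal_iff_coe_lt.2 hs.1
      have hsv' : s.toNNReal < v := by
        rw [Real.toNNReal_lt_iff_lt_coe hs0]
        exact lt_of_le_of_ne hs.2 hsv
      by_cases hr : runNorm s.toNNReal (X ω) < r
      · rw [stoppedIntegrand, Set.indicator_of_mem
          (show ω ∈ {ω | ω ∈ B ∧ u < s.toNNReal ∧ s.toNNReal < exitMin r v (X ω)} from
            ⟨hω, hus, lt_exitMin_iff.2 ⟨hsv', hr⟩⟩), killedFun, if_pos hr, covFun_self,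
          ENNReal.ofReal_pow (norm_nonneg _), ofReal_norm]
      · rw [stoppedIntegrand, Set.indicator_of_notMem, killedFun, if_neg hr]
        · simp
        · rintro ⟨-, -, h⟩
          exact hr (lt_exitMin_iff.1 h).2
    · exact (intervalIntegrable_iff_integrableOn_Ioc_of_le huv').1
        (hyp.intervalIntegrable_killed_cov r v' v' (X ω) u v)
    · refine Eventually.of_forall fun s => ?_
      simp only [killedFun, Pi.zero_apply]
      split_ifs
      · rw [covFun_self]; positivity
      · exact le_rfl
  · rw [Set.indicator_of_notMem hω, ENNReal.ofReal_zero]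
    unfold energy
    rw [← lintegral_zero]
    refine lintegral_congr fun s => ?_
    rw [stoppedIntegrand, Set.indicator_of_notMem fun h => hω h.1]
    simp

namespace IsWeakSolution

variable (hX : IsWeakSolution j A F G P 𝔽 W X)
include hX

lemma measurable_adapted (t : ℝ≥0) : Measurable[𝔽 t] fun ω => X ω t :=
  (hX.progressive.stronglyAdapted t).measurable

lemma measurable : Measurable X :=
  measurable_path_iff.2 fun t => (hX.measurable_adapted t).mono (𝔽.le t) le_rfl

lemma measurableSet_preimage {t : ℝ≥0} {B : Set C(ℝ≥0, E)}
    (hB : MeasurableSet[pathFiltration E t] B) : MeasurableSet[𝔽 t] (X ⁻¹' B) := by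
  have h : pathFiltration E t ≤ MeasurableSpace.map X (𝔽 t) := by
    refine iSup_le fun s => ?_
    rintro _ ⟨D, hD, rfl⟩
    exact ((hX.measurable_adapted s).mono (𝔽.mono s.2) le_rfl) hD
  exact h B hB

/-- The martingale part of a weak solution is a stochastic integral. -/
lemma isStochasticIntegral_process (hyp : StandingAssumptions j A F G) {v' w' : V →L[ℝ] ℝ}
    (hv : IsAdjointValue A v' w') (t : ℝ≥0) :
    IsStochasticIntegral 𝔽 W (fun s ω => hilbertAdjoint (G (X ω s)) v') t fun ω =>
      martingaleProcess (fun x => v' (j x)) (driftFun j F v' w') t (X ω) - v' (j (X ω 0)) := by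
  obtain ⟨I, hI, hIe⟩ := hX.equation v' w' hv t
  refine hI.congr ?_
  filter_upwards [hIe] with ω hω
  have b1 : ∀ r : ℝ, ∃ C, ∀ x : E, ‖x‖ ≤ r → |w' (j x)| ≤ C := fun r => by
    obtain ⟨C, -, h⟩ := hyp.exists_bound_self r w' w' w'
    exact ⟨C, fun x hx => (h x hx).1⟩
  have m1 : Measurable fun x : E => w' (j x) := (w'.continuous.comp j.continuous).measurable
  have m2 := hyp.measurable_drift v' w'
  have i1 := intervalIntegrable_of_bounded_on_bounded m1 b1 (X ω) 0 t
  have i2 := intervalIntegrable_of_bounded_on_bounded m2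
    (hyp.tamePair_lin v' w').bounded_right (X ω) 0 t
  have e : ∫ s in (0 : ℝ)..t, v' (F (X ω s.toNNReal)) =
      (∫ s in (0 : ℝ)..t, driftFun j F v' w' (X ω s.toNNReal)) -
        ∫ s in (0 : ℝ)..t, w' (j (X ω s.toNNReal)) := by
    rw [← intervalIntegral.integral_sub i2 i1]
    exact intervalIntegral.integral_congr fun s _ => by simp [driftFun]
  rw [e] at hω
  simp only [martingaleProcess]
  linarith

/-- The first two moments of the stopped increments of the martingale part. -/
lemma stopped_moments (hyp : StandingAssumptions j A F G) {v' w' : V →L[ℝ] ℝ}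
    (hv : IsAdjointValue A v' w') (r : ℕ) {u v : ℝ≥0} (huv : u ≤ v) {B : Set C(ℝ≥0, E)}
    (hB : MeasurableSet[pathFiltration E u] B) :
    ∫ ω in X ⁻¹' B, (martingaleProcess (fun x => v' (j x)) (driftFun j F v' w')
        (exitMin r v (X ω)) (X ω) - martingaleProcess (fun x => v' (j x)) (driftFun j F v' w')
        (exitMin r u (X ω)) (X ω)) ∂P = 0 ∧
    ∫ ω in X ⁻¹' B, (martingaleProcess (fun x => v' (j x)) (driftFun j F v' w')
        (exitMin r v (X ω)) (X ω) - martingaleProcess (fun x => v' (j x)) (driftFun j F v' w')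
        (exitMin r u (X ω)) (X ω)) ^ 2 ∂P =
      ∫ ω in X ⁻¹' B, (∫ w in (u : ℝ)..v, killedFun r (covFun G v' v') w (X ω)) ∂P := by
  have := hX.probability
  obtain ⟨w, hw, hwW⟩ := hX.wiener.exists_version
  have t1 := hyp.tamePair_lin v' w'
  set f : E → ℝ := fun x => v' (j x) with hf
  set M := martingaleProcess f (driftFun j F v' w') with hM
  set N : ℝ≥0 → Ω → ℝ := fun t ω => M t (X ω) - f (X ω 0) with hN
  set Φ : ℝ≥0 → Ω → H := fun s ω => hilbertAdjoint (G (X ω s)) v' with hΦ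
  have hXm := hX.measurable
  have hBm := hX.measurableSet_preimage hB
  have hBm' := 𝔽.le u _ hBm
  have hΦm : StronglyMeasurable fun p : ℝ≥0 × Ω => Φ p.1 p.2 :=
    (hyp.stronglyMeasurable_hilbertAdjoint v').comp_measurable
      (measurable_path_eval.comp (measurable_fst.prodMk (hXm.comp measurable_snd)))
  have hbound : ∀ R : ℝ, ∃ C : ℝ≥0, ∀ x : E, ‖x‖ ≤ R → ‖hilbertAdjoint (G x) v'‖ ≤ C := by
    intro R
    obtain ⟨C, hC0, hC⟩ := hyp.exists_bound_self R v' v' v'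
    -- A nonnegative number whose square is at most C is at most 1 + C.
    refine ⟨⟨1 + C, by positivity⟩, fun x hx => ?_⟩
    have h1 := (hC x hx).2.2
    rw [covFun_self, abs_of_nonneg (by positivity)] at h1
    change _ ≤ 1 + C
    nlinarith [norm_nonneg (hilbertAdjoint (G x) v')]
  obtain ⟨C, hC⟩ := hbound r
  have key := stopped_integral_isometry (N := N) hw hwW hΦm
    (fun t => hX.isStochasticIntegral_process hyp hv t)
    (fun ω => (t1.continuous_process (X ω)).sub continuous_const) huv
    (ρ := fun ω => exitMin r v (X ω)) (fun s => ?_) (fun ω => exitMin_le _ _ _) (C := C)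
    (fun ω s hs => hC _ (runNorm_lt_iff.1 (lt_exitMin_iff.1 hs).2 s le_rfl).le) (fun ω => ?_) hBm
  rotate_left
  · have e : {ω | s < exitMin r v (X ω)} = X ⁻¹' {x | s < v ∧ runNorm s x < r} := by
      ext ω; exact lt_exitMin_iff
    rw [e]
    refine hX.measurableSet_preimage ?_
    by_cases hsv : s < v
    · simpa only [hsv, true_and] using measurableSet_runNorm_lt (E := E) (r : ℝ) s
    · simp [hsv]
  · obtain ⟨R, hR⟩ := exists_norm_le_on_Icc (X ω) v
    obtain ⟨C', hC'⟩ := hbound R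
    exact ⟨C', fun s hs => hC' _ (hR s hs)⟩
  -- If the exit occurs by time `u`, both increments are 0; otherwise both run from `u` to the exit
  -- or to `v`.
  have eN : ∀ ω, N (max (exitMin r v (X ω)) u) ω - N u ω =
      M (exitMin r v (X ω)) (X ω) - M (exitMin r u (X ω)) (X ω) := by
    intro ω
    simp only [hN]
    rw [exitMin_of_le huv]
    rcases le_total (exitMin r v (X ω)) u with h | h
    · rw [max_eq_right h, min_eq_right h]; ring
    · rw [max_eq_left h, min_eq_left h]; ring
  simp only [eN] at key
  obtain ⟨k1, k2, k3⟩ := key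
  refine ⟨k2, ?_⟩
  simp_rw [hΦ, energy_stoppedIntegrand hyp v' r huv] at k3
  set Z : Ω → ℝ := fun ω => M (exitMin r v (X ω)) (X ω) - M (exitMin r u (X ω)) (X ω) with hZ
  set Q : Ω → ℝ := fun ω => ∫ w in (u : ℝ)..v, killedFun r (covFun G v' v') w (X ω) with hQ
  have hQm : Measurable Q := (measurable_timeIntegral
    (measurable_killedFun r (hyp.measurable_cov v' v')) u v).comp hXm
  have hQ0 : ∀ ω, 0 ≤ Q ω := fun ω => by
    refine intervalIntegral.integral_nonneg huv fun s _ => ?_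
    simp only [killedFun]
    split_ifs
    · rw [covFun_self]; positivity
    · exact le_rfl
  have hQi : Integrable Q P := by
    obtain ⟨c, hc0, hc⟩ := hyp.exists_bound_self r v' w' v'
    exact integrable_of_abs_le (M := c * ((v : ℝ) - u)) hQm fun ω => abs_interval_integral_le huv
      fun s _ _ => abs_killedFun_le hc0 (fun y hy => (hc y hy).2.2) s (X ω)
  have e1 : ∀ ω, ‖(X ⁻¹' B).indicator Z ω‖ₑ ^ 2 =
      ENNReal.ofReal ((X ⁻¹' B).indicator (fun ω => Z ω ^ 2) ω) := fun ω => by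
    by_cases h : ω ∈ X ⁻¹' B
    · rw [Set.indicator_of_mem h, Set.indicator_of_mem h, Real.enorm_eq_ofReal_abs,
        ← ENNReal.ofReal_pow (abs_nonneg _), sq_abs]
    · rw [Set.indicator_of_notMem h, Set.indicator_of_notMem h]; simp
  have hZi : Integrable ((X ⁻¹' B).indicator fun ω => Z ω ^ 2) P := by
    have h := k1.integrable_sq
    refine h.congr (ae_of_all _ fun ω => ?_)
    by_cases h : ω ∈ X ⁻¹' B <;> simp only [Set.indicator, h, if_true, if_false]
    simp
  simp_rw [e1] at k3
  rw [← ofReal_integral_eq_lintegral_ofReal hZi (ae_of_all _ fun ω =>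
      Set.indicator_nonneg (fun ω _ => sq_nonneg (Z ω)) ω),
    ← ofReal_integral_eq_lintegral_ofReal (hQi.indicator hBm') (ae_of_all _ fun ω =>
      Set.indicator_nonneg (fun ω _ => hQ0 ω) ω),
    ENNReal.ofReal_eq_ofReal_iff (integral_nonneg fun ω =>
      Set.indicator_nonneg (fun ω _ => sq_nonneg (Z ω)) ω) (integral_nonneg fun ω =>
      Set.indicator_nonneg (fun ω _ => hQ0 ω) ω), integral_indicator hBm',
    integral_indicator hBm'] at k3
  exact k3

/-- The square of a stopped martingale increment minus the energy has conditional mean zero by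
`stopped_moments` and serves as the main part. With a the increment of ⟨X, v'⟩ and b the integrated
drift, a² and (a - b)² differ by 2ab - b², which lies within the error allowed in
`HasQuadraticVariation`. -/
theorem solvesLMP_map (hyp : StandingAssumptions j A F G) :
    SolvesLMP (operatorGraph j A F G) (P.map X) := by
  have := hX.probability
  have hXm := hX.measurable
  have hprob : IsProbabilityMeasure (P.map X) := Measure.isProbabilityMeasure_map hXm.aemeasurable
  refine solvesLMP_of_quadraticVariation hyp (fun v' w' hv => ?_) fun v' w' hv r => ?_
  · intro r u v huv B hB
    have t1 := hyp.tamePair_lin v' w'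
    have hm : Measurable fun x => martingaleProcess (fun x => v' (j x)) (driftFun j F v' w')
        (exitMin r v x) x - martingaleProcess (fun x => v' (j x)) (driftFun j F v' w')
        (exitMin r u x) x := (t1.measurable_stopped r v).sub (t1.measurable_stopped r u)
    rw [setIntegral_map ((pathFiltration E).le u B hB) hm.aestronglyMeasurable hXm.aemeasurable]
    exact (hX.stopped_moments hyp hv r huv hB).1
  · have t1 := hyp.tamePair_lin v' w'
    obtain ⟨C, hC0, hC⟩ := hyp.exists_bound_self r v' w' v'
    set M := martingaleProcess (fun x => v' (j x)) (driftFun j F v' w') with hM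
    have hm1 : ∀ u v, Measurable fun x => (M (exitMin r v x) x - M (exitMin r u x) x) ^ 2 :=
      fun u v => ((t1.measurable_stopped r v).sub (t1.measurable_stopped r u)).pow_const 2
    have hm2 : ∀ u v : ℝ≥0, Measurable fun x : C(ℝ≥0, E) =>
        ∫ w in (u : ℝ)..v, killedFun r (covFun G v' v') w x := fun u v =>
      measurable_timeIntegral (measurable_killedFun r (hyp.measurable_cov v' v')) u v
    have i1 : ∀ u v, u ≤ v → Integrable
        (fun x => (M (exitMin r v x) x - M (exitMin r u x) x) ^ 2) (P.map X) := by
      intro u v huv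
      obtain ⟨c, -, hc⟩ := t1.abs_stopped_sub_le r v
      refine integrable_of_abs_le (M := c ^ 2) (hm1 u v) fun x => ?_
      rw [abs_pow]
      exact pow_le_pow_left₀ (abs_nonneg _) (hc x _ _ (exitMin_mono huv x) le_rfl) 2
    have i2 : ∀ u v : ℝ≥0, u ≤ v → Integrable (fun x : C(ℝ≥0, E) =>
        ∫ w in (u : ℝ)..v, killedFun r (covFun G v' v') w x) (P.map X) := fun u v huv =>
      integrable_of_abs_le (M := C * ((v : ℝ) - u)) (hm2 u v) fun x => abs_interval_integral_le huv
        fun s _ _ => abs_killedFun_le hC0 (fun y hy => (hC y hy).2.2) s x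
    refine ⟨fun (u v : ℝ≥0) x => (M (exitMin r v x) x - M (exitMin r u x) x) ^ 2 -
      ∫ w in (u : ℝ)..v, killedFun r (covFun G v' v') w x, 2 * C + C ^ 2, by positivity,
      fun u v => (hm1 u v).sub (hm2 u v), fun u v huv B hB => ?_,
      fun u v huv => (i1 u v huv).sub (i2 u v huv), fun u v x δ huv hδ => ?_⟩
    · have hBm := (pathFiltration E).le u B hB
      rw [integral_sub (i1 u v huv).integrableOn (i2 u v huv).integrableOn,
        setIntegral_map hBm (hm1 u v).aestronglyMeasurable hXm.aemeasurable,
        setIntegral_map hBm (hm2 u v).aestronglyMeasurable hXm.aemeasurable, sub_eq_zero]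
      exact (hX.stopped_moments hyp hv r huv hB).2
    · simp only
      rw [hM, t1.stopped_sub huv]
      have huv' : (u : ℝ) ≤ v := huv
      have h1 : |∫ w in (u : ℝ)..v, killedFun r (driftFun j F v' w') w x| ≤ C * ((v : ℝ) - u) :=
        abs_interval_integral_le huv'
          fun s _ _ => abs_killedFun_le hC0 (fun y hy => (hC y hy).2.1) s x
      have h2 := hδ v huv le_rfl
      set a := stoppedFun r (fun y => v' (j y)) v x - stoppedFun r (fun y => v' (j y)) u x
      set b := ∫ w in (u : ℝ)..v, killedFun r (driftFun j F v' w') w x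
      set q := ∫ w in (u : ℝ)..v, killedFun r (covFun G v' v') w x
      have e : a ^ 2 - q - ((a - b) ^ 2 - q) = 2 * a * b - b ^ 2 := by ring
      rw [e]
      have hl : 0 ≤ (v : ℝ) - u := sub_nonneg.2 huv'
      have hδ0 : 0 ≤ δ := (abs_nonneg _).trans h2
      calc |2 * a * b - b ^ 2| ≤ |2 * a * b| + |b ^ 2| := abs_sub _ _
        _ = 2 * |a| * |b| + |b| ^ 2 := by rw [abs_mul, abs_mul, abs_two, abs_pow]
        _ ≤ 2 * δ * (C * ((v : ℝ) - u)) + (C * ((v : ℝ) - u)) ^ 2 := by gcongr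
        _ ≤ (2 * C + C ^ 2) * ((v : ℝ) - u) * (δ + ((v : ℝ) - u)) := by
          have : 0 ≤ C ^ 2 * ((v : ℝ) - u) * δ + 2 * C * ((v : ℝ) - u) * ((v : ℝ) - u) := by
            positivity
          nlinarith

end IsWeakSolution

end WeakSolution

end SVP

end

/-! ### Conclusion. -/

theorem theorem3p5 {E V H : Type*}
    [NormedAddCommGroup E] [NormedSpace ℝ E] [CompleteSpace E]
    [TopologicalSpace.SeparableSpace E] [MeasurableSpace E] [BorelSpace E]
    [NormedAddCommGroup V] [NormedSpace ℝ V] [CompleteSpace V]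
    [TopologicalSpace.SeparableSpace V]
    [NormedAddCommGroup H] [InnerProductSpace ℝ H] [CompleteSpace H]
    [TopologicalSpace.SeparableSpace H]
    (j : E →L[ℝ] V) (A : V →ₗ.[ℝ] V) (F : E → V) (G : E → H →L[ℝ] V)
    (hyp : SVP.StandingAssumptions j A F G)
    (hwell : SVP.WellPosed (SVP.operatorGraph j A F G)) :
    SVP.CompletelyWellPosed (SVP.operatorGraph j A F G) ∧
    ∃ T : SVP.TransitionSemigroup E,
      (∀ P : Measure C(ℝ≥0, E), SVP.SolvesLMP (SVP.operatorGraph j A F G) P →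
        SVP.IsStrongMarkovMeasure T P) ∧
      (∀ (Ω : Type*) (mΩ : MeasurableSpace Ω) (P : Measure Ω) (𝔽 : Filtration ℝ≥0 mΩ)
        (W : SVP.TimeL2 H →L[ℝ] Lp ℝ 2 P) (X : Ω → C(ℝ≥0, E)),
        SVP.IsWeakSolution j A F G P 𝔽 W X → SVP.IsStrongMarkovMeasure T (P.map X)) := by
  obtain ⟨Ξ, hΞc, hΞf, hΞs⟩ := hyp.exists_countable_tests
  have hΞ : SVP.IsTestFamily (SVP.operatorGraph j A F G) Ξ := ⟨hΞc, hΞf, hΞs⟩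
  choose Q hQ hQu using hwell
  obtain ⟨T, hT⟩ := SVP.exists_transitionSemigroup hΞ hQ hQu
  have hsolves : ∀ P : Measure C(ℝ≥0, E), SVP.SolvesLMP (SVP.operatorGraph j A F G) P →
      SVP.IsStrongMarkovMeasure T P := fun P hP =>
    SVP.isStrongMarkovMeasure_of_solves hΞ hQ hQu hT hP
  exact ⟨SVP.completelyWellPosed_of_testFamily hΞ hQ hQu, T, hsolves,
    fun Ω mΩ P 𝔽 W X hX => hsolves _ (hX.solvesLMP_map hyp)⟩
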